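/- **Conventions.** All graphs are connected. Fix $g\ge 0$, partitions $\lambda,\mu$ of $d\geq 1$ with $r=l(\lambda)+l(\mu)+2g-2>0$, and real points $\underline x=\{x_1<\dots<x_r\}$. *Partitions.* Every partition is uniquely $\lambda=(\lambda_e,\lambda_{o,o}^2,\lambda_o)$, where $\lambda_e$ consists of the even parts, $\lambda_{o,o}$ and $\lambda_o$ of odd integers, $\lambda_o$ has no repeated entry, and in $\lambda_{o,o}^2$ every entry of $\lambda_{o,o}$ is listed twice. If $l(\lambda_o)=1$, the single entry is also denoted $\lambda_o$. *Tropical covers.* A tropical cover $\varphi:C\to\mathbb R\cup\{\pm\infty\}$ of type $(g,\lambda,\mu,\underline x)$ is a map from a genus $g$ metric graph without 2-valent vertices, linear with positive integer slope (weight) on every edge, with leaves mapped to $\pm\infty$, inner vertices mapped onto $\underline x$, such that at each inner vertex the weights to the left and to the right have equal sums, and such that the ends over $-\infty$ (in-ends) have weights $\lambda$ and those over $+\infty$ (out-ends) weights $\mu$; $d$ is its degree. (All inner vertices are then trivalent, one over each $x_i$.) Covers are considered up to isomorphism. A symmetric cycle is a pair of edges of equal weight with the same two endpoints; a symmetric fork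 is a pair of ends of equal weight, on the same side of a common inner vertex. *Zigzag covers.* A string is a connected subgraph $S$ of $C$ whose part without leaves is a closed 1-dimensional submanifold. $\varphi$ is a zigzag cover if there is $S\subset C$, either a string of odd edges or a single inner vertex, disjoint from the symmetric cycles and odd symmetric forks, such that every component of $C\setminus S$ is a tail: starting at $S$, a chain of even edges separated by any number $\ge 0$ of symmetric cycles of odd weight, ending in an end of even weight or in a symmetric fork of odd weight. It is an in-tail or an out-tail according to whether its ends are in-ends or out-ends; its weight is the weight of its edge at $S$. A vertex of $S$ is bent if both its edges in $S$ lie on the same side of it; tails at bent (unbent) vertices are called bent (unbent). *Monotone covers.* Let $S$ be a string with two ends, cut at its bent vertices into consecutive pieces $S_1,\dots,S_n$. If $S_1$ contains an in-end (out-end) of $S$ the pieces of odd index are the in-pieces (out-pieces) and the others the out-pieces (in-pieces). An in-component is an in-piece (with its bent vertices) with all tails attached to it; an out-component is an out-piece without its bent vertices, with its unbent tails. A zigzag cover with string $S$ is monotone if for some arrangement of the pieces: (1) unbent tails on in-pieces are out-tails, unbent tails on out-pieces are in-tails, no unbent tail contains a symmetric cycle and no unbent out-tail a symmetric fork; (2)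 bent tails containing a symmetric cycle or fork have weight $2$; (3) the smallest intervals containing the images of the inner vertices of the various tails (each with its attaching vertex) are pairwise disjoint, and so are those for the various components. It is universally monotone if moreover every in-piece carries at most one unbent out-tail. *$k$-mixed covers.* A zigzag cover $\varphi$ is $k$-mixed if for some string $S$ as above the restriction of $\varphi$ to the minimal subgraph $C'$ having the vertices over $x_1,\dots,x_k$ as inner vertices (with edges leaving $C'$ prolonged to ends) is a universally monotone zigzag cover with string $S\cap C'$, and $S\setminus C'$ is connected if $S\not\subset C'$. *Real factorizations.* Let $\varepsilon\in\{\pm1\}^r$. A real $k$-mixed factorization of type $(g,\lambda,\mu;\varepsilon)$ is a tuple $(\gamma,\sigma_1,\tau_1,\dots,\tau_r,\sigma_2)$ in $\mathcal S_d$ such that $\sigma_1,\sigma_2$ have cycle types $\lambda,\mu$, the $\tau_i=(a_i\,b_i)$, $a_i<b_i$, are transpositions, $\sigma_2\tau_r\cdots\tau_1\sigma_1=1$, the group generated by $\sigma_1,\sigma_2,\tau_1,\dots,\tau_r$ is transitive, $\gamma^2=1$, $b_1\le\dots\le b_k$, and $\gamma_i\rho_i\gamma_i=\rho_i^{-1}$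 for $0\le i\le r$, where $\rho_i=\tau_i\cdots\tau_1\sigma_1$, $\varepsilon_0=1$, $\gamma_0=\gamma$, and $\gamma_{i+1}=\gamma_i$ if $\varepsilon_{i+1}=\varepsilon_i$, $\gamma_{i+1}=\gamma_i\rho_i$ otherwise. Such a tuple produces a coloured tropical cover: its edges are the cycles of $\rho_0,\dots,\rho_r$, weighted by their length, which are cut or joined by $\tau_i$ at a trivalent vertex over $x_i$. Edges of a pair of cycles exchanged under conjugation by $\gamma_i$ are dotted; an even edge inverted by $\gamma_i$ is red if $\varepsilon_i=1$ and its cycle has fixed points of $\gamma_i$, or $\varepsilon_i=-1$ and it has none, and blue otherwise; other edges are plain. A colouring of a cover $\varphi$ is a choice of symmetric cycles and forks (dotted) and of red or blue for each component of the subgraph of remaining even edges, odd remaining edges being plain; a vertex is positive if, writing the edge alone on its side first, its edges are coloured (plain; plain, blue), (blue; blue, blue), (red; plain, plain) or (blue; dotted, dotted), and negative if this holds with red and blue exchanged. For a zigzag cover $\varphi$, let $\vec N_k(\varphi)$ be the minimum over $\varepsilon\in\{\pm1\}^r$ of the number of real $k$-mixed factorizations of type $(g,\lambda,\mu;\varepsilon)$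 producing $\varphi$ with the (unique) colouring for which the vertex over $x_i$ has sign $\varepsilon_i$ for all $i$. The $k$-mixed zigzag number $\vec{\mathcal Z}_g(\lambda,\mu;k)$ is the sum of $\vec N_k(\varphi)$ over all $k$-mixed zigzag covers $\varphi$ of type $(g,\lambda,\mu,\underline x)$. **Theorem.** Let $g\ge0$ and let $\lambda,\mu$ be partitions of $d$ with $l(\lambda_o)=l(\mu_o)=1$. Suppose that there are two partitions $\lambda',\mu'$ with $|\lambda'|=|\mu'|\le d$ such that - $\lambda'_o=\lambda_o$, $\lambda'\setminus\lambda'_o\subset\lambda_e$ and $\mu'\setminus\mu'_o\subset\mu_e$ (as multisets); - $\lambda'_{o,o}=\mu'_{o,o}=\emptyset$, $l(\lambda'_o)=l(\mu'_o)=1$ and $l(\lambda')+l(\mu')=k+2$; - $\mu'_i+\mu'_j>\max(\lambda_o,\lambda'_{\max})$ for any two entries $\mu'_i,\mu'_j$ of $\mu'_e$, and $\lambda'_{\max}>\mu'_o$, where $\lambda'_{\max}$ is the maximal entry of $\lambda'_e$ (in particular $\lambda'_e\neq\emptyset$). Then for every $m\ge1$ there is at least one $k$-mixed zigzag cover of type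 $(g,(\lambda,1^{2m}),(\mu,1^{2m}),\underline x)$. Moreover, there is an integer $m_0\ge 0$ such that for all $m\ge m_0$ $$\vec{\mathcal Z}_g\big((\lambda,1^{2m}),(\mu,1^{2m});k\big)\ \ge\ \big((m-m_0)!\big)^4\cdot(2m)!.$$ -/

import Mathlib

namespace MixedZigzag

/-! ### Partitions and their tail decomposition -/

/-- The even parts of a partition. -/
def evenParts (p : Multiset ℕ) : Multiset ℕ := p.filter Even

/-- The multiset of odd parts without repetition in the tail decomposition: every odd integer
occurring an odd number of times, listed once. -/
def singleOddParts (p : Multiset ℕ) : Multiset ℕ :=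
  p.dedup.filter fun a => Odd a ∧ Odd (p.count a)

/-- The multiset of odd parts that occur doubled in the tail decomposition. -/
def pairedOddParts (p : Multiset ℕ) : Multiset ℕ :=
  ∑ a ∈ p.toFinset.filter Odd, Multiset.replicate (p.count a / 2) a

/-- The partition `(p, 1 ^ (2 * m))`. -/
def addOnes {d : ℕ} (p : Nat.Partition d) (m : ℕ) : Nat.Partition (d + 2 * m) where
  parts := p.parts + Multiset.replicate (2 * m) 1
  parts_pos := by
    intro i hi
    rcases Multiset.mem_add.1 hi with h | h
    · exact p.parts_pos h
    · rw [Multiset.eq_of_mem_replicate h]; exact Nat.one_pos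
  parts_sum := by simp [p.parts_sum]

/-- The number `r = l(λ) + l(μ) + 2 g - 2` of simple branch points. -/
def numBranch {d : ℕ} (g : ℕ) (lam mu : Nat.Partition d) : ℕ :=
  lam.parts.card + mu.parts.card + 2 * g - 2

/-! ### Tropical covers -/

/-- The combinatorial data of a map from a graph to the tropical projective line with branch points
`x 0 < ... < x (r - 1)`. There is one inner vertex over every branch point, so inner vertices
are elements of `Fin r`; the edge `e` runs from left to right from `src e` to `tgt e`, where
`src e = none` means a leaf over `-∞` and `tgt e = none` a leaf over `+∞`; `wt e` is its weight.
The length of an inner edge is forced to be the difference of the two branch points divided by the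
weight, so these data determine the metric graph and the map. -/
structure Cover (r : ℕ) (E : Type) where
  src : E → Option (Fin r)
  tgt : E → Option (Fin r)
  wt : E → ℕ

namespace Cover

/-- The edge `e` is incident to the inner vertex `v`. -/
def Inc {r : ℕ} {E : Type} (φ : Cover r E) (e : E) (v : Fin r) : Prop :=
  φ.src e = some v ∨ φ.tgt e = some v

/-- `e` and `f` are joined by a chain of edges of `A`, consecutive ones sharing an inner vertex. -/
def ConnIn {r : ℕ} {E : Type} (φ : Cover r E) (A : Set E) (e f : E) : Prop :=
  Relation.ReflTransGen (fun a b => a ∈ A ∧ b ∈ A ∧ ∃ v, φ.Inc a v ∧ φ.Inc b v) e f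

/-- `φ` is a (simply branched) tropical cover by a connected graph. For a graph of genus `g` without
two-valent vertices having `r = l(λ) + l(μ) + 2 g - 2` branch points, an Euler characteristic count
shows that all inner vertices are trivalent and lie over different branch points. -/
structure IsTropical {r : ℕ} {E : Type} [Fintype E] (φ : Cover r E) : Prop where
  wt_pos : ∀ e, 0 < φ.wt e
  src_lt_tgt : ∀ e u v, φ.src e = some u → φ.tgt e = some v → u < v
  trivalent : ∀ v, {e | φ.Inc e v}.ncard = 3
  balanced : ∀ v, ∑ e with φ.tgt e = some v, φ.wt e = ∑ e with φ.src e = some v, φ.wt e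
  nonempty : Nonempty E
  connected : ∀ e f, φ.ConnIn Set.univ e f

/-- The weights of the ends over `-∞`. -/
def inProfile {r : ℕ} {E : Type} [Fintype E] (φ : Cover r E) : Multiset ℕ :=
  (Finset.univ.filter fun e => φ.src e = none).val.map φ.wt

/-- The weights of the ends over `+∞`. -/
def outProfile {r : ℕ} {E : Type} [Fintype E] (φ : Cover r E) : Multiset ℕ :=
  (Finset.univ.filter fun e => φ.tgt e = none).val.map φ.wt

/-- `φ` is a tropical cover of type `(g, λ, μ, x)`. The first Betti number is
`#edges - #vertices + 1`, where the vertices are the `r` inner ones and the leaves. -/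
structure HasType {r : ℕ} {E : Type} [Fintype E] (φ : Cover r E) (g : ℕ)
    (lam mu : Multiset ℕ) : Prop where
  tropical : φ.IsTropical
  genus : Fintype.card E + 1 = r + φ.inProfile.card + φ.outProfile.card + g
  inProfile_eq : φ.inProfile = lam
  outProfile_eq : φ.outProfile = mu

/-- `e` and `f` form a symmetric cycle. -/
def SymCycle {r : ℕ} {E : Type} (φ : Cover r E) (e f : E) : Prop :=
  e ≠ f ∧ φ.wt e = φ.wt f ∧ ∃ u v,
    φ.src e = some u ∧ φ.src f = some u ∧ φ.tgt e = some v ∧ φ.tgt f = some v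

/-- `e` and `f` form a symmetric fork: two ends of equal weight on the same side of a common inner
vertex. -/
def SymFork {r : ℕ} {E : Type} (φ : Cover r E) (e f : E) : Prop :=
  e ≠ f ∧ φ.wt e = φ.wt f ∧ ∃ v,
    (φ.src e = none ∧ φ.src f = none ∧ φ.tgt e = some v ∧ φ.tgt f = some v) ∨
    (φ.src e = some v ∧ φ.src f = some v ∧ φ.tgt e = none ∧ φ.tgt f = none)

/-! ### Zigzag covers -/

/-- A string, given by its set of edges: a nonempty connected subgraph in which every inner vertex
has valency two. -/
structure IsString {r : ℕ} {E : Type} (φ : Cover r E) (S : Set E) : Prop where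
  nonempty : S.Nonempty
  connected : ∀ e ∈ S, ∀ f ∈ S, φ.ConnIn S e f
  two : ∀ v, (∃ e ∈ S, φ.Inc e v) → {e | e ∈ S ∧ φ.Inc e v}.ncard = 2

/-- `Side.left` is used for in-tails (ends over `-∞`), `Side.right` for out-tails. -/
inductive Side where
  | left
  | right

/-- The endpoint of an edge of a tail that is nearer to the string. -/
def near {r : ℕ} {E : Type} (φ : Cover r E) : Side → E → Option (Fin r)
  | Side.left => φ.tgt
  | Side.right => φ.src

/-- The endpoint of an edge of a tail that is farther from the string. -/
def far {r : ℕ} {E : Type} (φ : Cover r E) : Side → E → Option (Fin r)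
  | Side.left => φ.src
  | Side.right => φ.tgt

/-- `T` is the set of edges of a tail whose edge next to the string is `e`: starting from the string
one meets even edges separated by symmetric cycles of odd weight (any number of them, possibly
none), and finally an even end or a symmetric fork of odd weight. -/
inductive IsTail {r : ℕ} {E : Type} (φ : Cover r E) (s : Side) : E → Set E → Prop
  | single (e : E) : φ.far s e = none → Even (φ.wt e) → IsTail φ s e {e}
  | fork (e f f' : E) (v : Fin r) : φ.far s e = some v →
      φ.SymFork f f' → Odd (φ.wt f) → φ.near s f = some v → IsTail φ s e {e, f, f'}
  | cycle (e f f' e' : E) (u v : Fin r) (T : Set E) : φ.far s e = some v →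
      φ.SymCycle f f' → Odd (φ.wt f) → φ.near s f = some v → φ.far s f = some u →
      φ.near s e' = some u → IsTail φ s e' T → IsTail φ s e ({e, f, f'} ∪ T)

/-- `T` is (the edge set of) a tail with first edge `e`, attached at the vertex `a`, and disjoint from
the edge set `S`. -/
structure IsTailAt {r : ℕ} {E : Type} (φ : Cover r E) (S : Set E) (s : Side) (a : Fin r)
    (e : E) (T : Set E) : Prop where
  attached : φ.near s e = some a
  isTail : φ.IsTail s e T
  disjoint : Disjoint T S

/-- The inner vertices lying on the edges of `S`. -/
def verts {r : ℕ} {E : Type} (φ : Cover r E) (S : Set E) : Set (Fin r) :=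
  {v | ∃ e ∈ S, φ.Inc e v}

/-- `S` is a string of odd edges outside the symmetric cycles and symmetric odd forks, and the
components of its complement are tails attached to it. -/
structure IsZigzagAlong {r : ℕ} {E : Type} (φ : Cover r E) (S : Set E) : Prop where
  isString : φ.IsString S
  odd : ∀ e ∈ S, Odd (φ.wt e)
  not_sym : ∀ e ∈ S, ∀ f, ¬ φ.SymCycle e f ∧ ¬ (φ.SymFork e f ∧ Odd (φ.wt e))
  tails : ∀ e, e ∉ S → ∃ s, ∃ a ∈ φ.verts S, ∃ e₀ T, φ.IsTailAt S s a e₀ T ∧ e ∈ T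

/-- `φ` is a zigzag cover: along a string or at a single inner vertex. -/
def IsZigzag {r : ℕ} {E : Type} [Fintype E] (φ : Cover r E) : Prop :=
  φ.IsTropical ∧
    ((∃ S, φ.IsZigzagAlong S) ∨ ∃ v, ∀ e, ∃ s e₀ T, φ.IsTailAt ∅ s v e₀ T ∧ e ∈ T)

/-! ### Monotone and universally monotone zigzag covers -/

/-- The string `S` bends at `v`: both its edges at `v` lie on the same side of `v`. -/
def Bent {r : ℕ} {E : Type} (φ : Cover r E) (S : Set E) (v : Fin r) : Prop :=
  ∃ e ∈ S, ∃ f ∈ S, e ≠ f ∧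
    ((φ.src e = some v ∧ φ.src f = some v) ∨ (φ.tgt e = some v ∧ φ.tgt f = some v))

/-- The edges `e`, `f` of the string lie in the same piece, the pieces being obtained by cutting `S`
at its bent vertices. -/
def SamePiece {r : ℕ} {E : Type} (φ : Cover r E) (S : Set E) (e f : E) : Prop :=
  Relation.ReflTransGen
    (fun a b => a ∈ S ∧ b ∈ S ∧ ∃ v, φ.Inc a v ∧ φ.Inc b v ∧ ¬ φ.Bent S v) e f

/-- `I` is the union of the in-pieces for one of the two arrangements `S₁, ..., Sₙ` of the pieces
along a string `S` with two ends (the out-pieces being the rest of `S`). In such an arrangement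
in-pieces and out-pieces alternate, and the two possible alternating choices belong to the two
arrangements: the in-pieces are those traversed from left to right when one walks along the string
from `S₁` to `Sₙ`. -/
structure IsInPieces {r : ℕ} {E : Type} (φ : Cover r E) (S I : Set E) : Prop where
  has_end : ∃ e ∈ S, φ.src e = none ∨ φ.tgt e = none
  subset : I ⊆ S
  alternate : ∀ v, ∀ e ∈ S, ∀ f ∈ S, e ≠ f → φ.Inc e v → φ.Inc f v →
    ((e ∈ I ↔ f ∈ I) ↔ ¬ φ.Bent S v)

/-- The vertex `a` of the string together with the inner vertices of the tail attached at `a`. -/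
def tailVerts {r : ℕ} {E : Type} (φ : Cover r E) (S : Set E) (a : Fin r) : Set (Fin r) :=
  {w | w = a ∨ ∃ s e T, φ.IsTailAt S s a e T ∧ w ∈ φ.verts T}

/-- The inner vertices of the component of the piece containing the string edge `e`. Bent vertices,
and the tails attached to them, belong to the in-components only. -/
def compVerts {r : ℕ} {E : Type} (φ : Cover r E) (S I : Set E) (e : E) : Set (Fin r) :=
  {w | ∃ f ∈ S, φ.SamePiece S e f ∧ ∃ a, φ.Inc f a ∧ (φ.Bent S a → f ∈ I) ∧ w ∈ φ.tailVerts S a}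

/-- The interval from the smallest to the largest element of `W`. -/
def hull {r : ℕ} (W : Set (Fin r)) : Set (Fin r) := {x | ∃ a ∈ W, ∃ b ∈ W, a ≤ x ∧ x ≤ b}

/-- `φ` is a monotone zigzag cover with string `S` and in-pieces `I`. -/
structure IsMonotoneAlong {r : ℕ} {E : Type} [Fintype E] (φ : Cover r E) (S I : Set E) :
    Prop where
  tropical : φ.IsTropical
  zigzag : φ.IsZigzagAlong S
  pieces : φ.IsInPieces S I
  unbent_side : ∀ s a e T, φ.IsTailAt S s a e T → ¬ φ.Bent S a →
    ∀ f ∈ S, φ.Inc f a → (f ∈ I → s = Side.right) ∧ (f ∉ I → s = Side.left)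
  unbent_cycle : ∀ s, ∀ a ∈ φ.verts S, ∀ e T, φ.IsTailAt S s a e T → ¬ φ.Bent S a →
    ¬ ∃ f ∈ T, ∃ f' ∈ T, φ.SymCycle f f'
  unbent_fork : ∀ a ∈ φ.verts S, ∀ e T, φ.IsTailAt S Side.right a e T → ¬ φ.Bent S a →
    ¬ ∃ f ∈ T, ∃ f' ∈ T, φ.SymFork f f'
  bent_weight : ∀ s a e T, φ.IsTailAt S s a e T → φ.Bent S a →
    (∃ f ∈ T, ∃ f' ∈ T, φ.SymCycle f f' ∨ φ.SymFork f f') → φ.wt e = 2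
  tails_disjoint : ∀ a ∈ φ.verts S, ∀ b ∈ φ.verts S, a ≠ b →
    Disjoint (hull (φ.tailVerts S a)) (hull (φ.tailVerts S b))
  comps_disjoint : ∀ e ∈ S, ∀ f ∈ S, ¬ φ.SamePiece S e f →
    Disjoint (hull (φ.compVerts S I e)) (hull (φ.compVerts S I f))

/-- `φ` is a universally monotone zigzag cover with string `S` and in-pieces `I`: to every in-piece at
most one unbent out-tail is attached. -/
structure IsUniversallyMonotoneAlong {r : ℕ} {E : Type} [Fintype E] (φ : Cover r E)
    (S I : Set E) : Prop where
  monotone : φ.IsMonotoneAlong S I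
  at_most_one : ∀ f ∈ I, ∀ f' ∈ I, φ.SamePiece S f f' → ∀ a b, φ.Inc f a → φ.Inc f' b →
    ¬ φ.Bent S a → ¬ φ.Bent S b → ∀ e e' T T', φ.IsTailAt S Side.right a e T →
    φ.IsTailAt S Side.right b e' T' → a = b

/-! ### Mixed zigzag covers -/

/-- The edges of the minimal subgraph having the first `k` vertices among its inner vertices. -/
def firstEdges {r : ℕ} {E : Type} (φ : Cover r E) (k : ℕ) : Set E :=
  {e | ∃ v : Fin r, v.val < k ∧ φ.Inc e v}

/-- The vertex `v` as one of the first `k` vertices, if it is one. -/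
def cut {r : ℕ} (k : ℕ) (v : Fin r) : Option (Fin k) :=
  if h : v.val < k then some ⟨v.val, h⟩ else none

/-- The restriction of `φ` to the minimal subgraph containing the first `k` vertices; the edges
leaving this subgraph are prolonged to ends. -/
def restrict {r : ℕ} {E : Type} (φ : Cover r E) (k : ℕ) : Cover k (φ.firstEdges k) where
  src e := (φ.src e.1).bind (cut k)
  tgt e := (φ.tgt e.1).bind (cut k)
  wt e := φ.wt e.1

open scoped Classical in
/-- `φ` is a `k`-mixed zigzag cover. The condition `separate` says that the subgraph spanned by the
first `k` vertices has no further inner (two-valent) vertex, so that the restriction of `φ` to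
it makes sense as a tropical cover. -/
structure IsMixedAlong {r : ℕ} {E : Type} [Fintype E] (φ : Cover r E) (k : ℕ) (S : Set E) :
    Prop where
  zigzag : φ.IsZigzagAlong S
  separate : ∀ e ∈ φ.firstEdges k, ∀ f ∈ φ.firstEdges k, ∀ v : Fin r, k ≤ v.val →
    φ.Inc e v → φ.Inc f v → e = f
  first : ∃ I, (φ.restrict k).IsUniversallyMonotoneAlong {e | e.1 ∈ S} I
  rest : ¬ S ⊆ φ.firstEdges k →
    ∀ e ∈ S \ φ.firstEdges k, ∀ f ∈ S \ φ.firstEdges k, φ.ConnIn (S \ φ.firstEdges k) e f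

/-- `φ` is a `k`-mixed zigzag cover. -/
def IsMixedZigzag {r : ℕ} {E : Type} [Fintype E] (φ : Cover r E) (k : ℕ) : Prop :=
  φ.IsZigzag ∧ ∃ S, φ.IsMixedAlong k S

/-! ### Colourings -/

/-- The four ways of drawing an edge of a coloured cover: odd edges are plain, the edges of the chosen
symmetric cycles and forks are dotted, the other even edges are red or blue. -/
inductive Colour where
  | plain
  | dotted
  | red
  | blue

/-- `c` is a colouring of `φ`: a set of symmetric cycles and symmetric forks is chosen (the dotted
ones), and every component of the subgraph of the remaining even edges is red or blue. -/
structure IsColouring {r : ℕ} {E : Type} (φ : Cover r E) (c : E → Colour) : Prop where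
  dotted_mem : ∀ e, c e = Colour.dotted → ∃ f, φ.SymCycle e f ∨ φ.SymFork e f
  dotted_pair : ∀ e f, φ.SymCycle e f ∨ φ.SymFork e f →
    (c e = Colour.dotted ↔ c f = Colour.dotted)
  odd : ∀ e, c e ≠ Colour.dotted → Odd (φ.wt e) → c e = Colour.plain
  even : ∀ e, c e ≠ Colour.dotted → Even (φ.wt e) → c e = Colour.red ∨ c e = Colour.blue
  comp : ∀ e f v, φ.Inc e v → φ.Inc f v → Even (φ.wt e) → Even (φ.wt f) →
    c e ≠ Colour.dotted → c f ≠ Colour.dotted → c e = c f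

/-- The local pictures of a positive vertex, with `p` blue and `n` red, in terms of the colour of the
edge alone on its side and of those of the two other edges; exchanging the colours gives the
pictures of a negative vertex. -/
def SignPattern (p n : Colour) (a b b' : Colour) : Prop :=
  (a = Colour.plain ∧ b = Colour.plain ∧ b' = p) ∨
  (a = p ∧ b = p ∧ b' = p) ∨
  (a = n ∧ b = Colour.plain ∧ b' = Colour.plain) ∨
  (a = p ∧ b = Colour.dotted ∧ b' = Colour.dotted)

/-- The vertex `v` of the coloured cover has sign `ε`. -/
def HasSign {r : ℕ} {E : Type} (φ : Cover r E) (c : E → Colour) (v : Fin r) (ε : ℤˣ) : Prop :=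
  ∃ e f f', f ≠ f' ∧
    ((φ.src e = some v ∧ φ.tgt f = some v ∧ φ.tgt f' = some v) ∨
      (φ.tgt e = some v ∧ φ.src f = some v ∧ φ.src f' = some v)) ∧
    (if ε = 1 then SignPattern Colour.blue Colour.red (c e) (c f) (c f')
      else SignPattern Colour.red Colour.blue (c e) (c f) (c f'))

end Cover

/-! ### Isomorphism classes of covers -/

/-- Isomorphism classes of covers with `r` branch points. An isomorphism fixes the inner vertices
(their images in the line are different) and permutes edges with the same source, target and
weight, so that an isomorphism class is the multiset of the triples (source, target, weight). -/
abbrev CoverClass (r : ℕ) : Type := Multiset (Option (Fin r) × Option (Fin r) × ℕ)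

/-- A representative of an isomorphism class. -/
def CoverClass.cover {r : ℕ} (M : CoverClass r) : Cover r (Multiset.ToType M) where
  src e := e.1.1
  tgt e := e.1.2.1
  wt e := e.1.2.2

/-! ### Real factorizations -/

/-- A tuple `(γ, σ₁, τ₁, ..., τᵣ, σ₂)` in the symmetric group on `d` letters. -/
structure Tuple (d r : ℕ) where
  γ : Equiv.Perm (Fin d)
  σ₁ : Equiv.Perm (Fin d)
  τ : Fin r → Equiv.Perm (Fin d)
  σ₂ : Equiv.Perm (Fin d)

namespace Tuple

/-- The product `τᵢ ∘ ... ∘ τ₁ ∘ σ₁` (the transposition `τᵢ` is `F.τ (i - 1)`). -/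
def prod {d r : ℕ} (F : Tuple d r) : ℕ → Equiv.Perm (Fin d)
  | 0 => F.σ₁
  | i + 1 => if h : i < r then F.τ ⟨i, h⟩ * prod F i else prod F i

/-- The sign of index `i`, with sign `+1` in front of the sequence. -/
def signAt {r : ℕ} (ε : Fin r → ℤˣ) : ℕ → ℤˣ
  | 0 => 1
  | i + 1 => if h : i < r then ε ⟨i, h⟩ else 1

/-- The involutions `γᵢ`, with `γ₀ = γ`: one has `γᵢ₊₁ = γᵢ` if the sign does not change and
`γᵢ₊₁ = γᵢ ∘ τᵢ ∘ ... ∘ τ₁ ∘ σ₁` if it does. -/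
def gammaAt {d r : ℕ} (F : Tuple d r) (ε : Fin r → ℤˣ) : ℕ → Equiv.Perm (Fin d)
  | 0 => F.γ
  | i + 1 => if signAt ε (i + 1) = signAt ε i then gammaAt F ε i else gammaAt F ε i * F.prod i

/-- Real factorizations of type `(g, λ, μ; ε)`, where `r = l(λ) + l(μ) + 2 g - 2`. -/
structure IsRealFactorization {d : ℕ} (g : ℕ) (lam mu : Nat.Partition d)
    (ε : Fin (numBranch g lam mu) → ℤˣ) (F : Tuple d (numBranch g lam mu)) : Prop where
  prod_eq : F.σ₂ * F.prod (numBranch g lam mu) = 1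
  type₁ : F.σ₁.partition.parts = lam.parts
  type₂ : F.σ₂.partition.parts = mu.parts
  isSwap : ∀ i, (F.τ i).IsSwap
  transitive : MulAction.IsPretransitive
    (Subgroup.closure ({F.σ₁, F.σ₂} ∪ Set.range F.τ)) (Fin d)
  involution : F.γ * F.γ = 1
  real : ∀ i ≤ numBranch g lam mu,
    F.gammaAt ε i * F.prod i * F.gammaAt ε i = (F.prod i)⁻¹

/-- The larger entries of the first `k` transpositions are weakly increasing. -/
def IsMixed {d r : ℕ} (F : Tuple d r) (k : ℕ) : Prop :=
  ∀ i j : Fin r, j.val = i.val + 1 → j.val < k → ∀ a b a' b' : Fin d, a < b → a' < b' →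
    F.τ i = Equiv.swap a b → F.τ j = Equiv.swap a' b' → b ≤ b'

/-- The transposition of index `i` moves an element of `B`. -/
def Meets {d r : ℕ} (F : Tuple d r) (i : Fin r) (B : Finset (Fin d)) : Prop :=
  ∃ x ∈ B, F.τ i x ≠ x

instance {d r : ℕ} (F : Tuple d r) (i : Fin r) (B : Finset (Fin d)) : Decidable (F.Meets i B) := by
  unfold Meets; infer_instance

/-- `B` is the set of elements of one of the disjoint cycles (possibly of length one) of `ρ`. -/
def IsCycleOf {d : ℕ} (ρ : Equiv.Perm (Fin d)) (B : Finset (Fin d)) : Prop :=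
  ∃ x, ∀ y, y ∈ B ↔ ρ.SameCycle x y

/-- The index of the first product after the vertex `s`. -/
def birth {r : ℕ} : Option (Fin r) → ℕ
  | none => 0
  | some i => i.val + 1

/-- The edges of the cover produced by a factorization: the left ends are the cycles of `σ₁`, and the
edges starting at the vertex `i` are the cycles created by the transposition of index `i`. -/
def IsEdge {d r : ℕ} (F : Tuple d r) (p : Option (Fin r) × Finset (Fin d)) : Prop :=
  IsCycleOf (F.prod (birth p.1)) p.2 ∧ ∀ i, p.1 = some i → F.Meets i p.2

/-- The vertices at which a cycle created at `s` is cut or joined. -/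
def deaths {d r : ℕ} (F : Tuple d r) (s : Option (Fin r)) (B : Finset (Fin d)) : Finset (Fin r) :=
  Finset.univ.filter fun j => birth s ≤ j.val ∧ F.Meets j B

/-- The cover produced by a factorization: every transposition gives an inner vertex, where cycles are
cut or joined, and an edge is weighted by the length of its cycle. -/
def cover {d r : ℕ} (F : Tuple d r) : Cover r {p // F.IsEdge p} where
  src p := p.1.1
  tgt p := if h : (F.deaths p.1.1 p.1.2).Nonempty then some ((F.deaths p.1.1 p.1.2).min' h) else none
  wt p := p.1.2.card

/-- The colours of the edges of the cover produced by a factorization. With sign `+1` at the time of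
creation an inverted even cycle is red if it has fixed points of the involution and blue if not;
with sign `-1` the rule is reversed. Exchanged cycles are dotted. -/
def colour {d r : ℕ} (F : Tuple d r) (ε : Fin r → ℤˣ)
    (p : Option (Fin r) × Finset (Fin d)) : Cover.Colour :=
  if p.2.image (F.gammaAt ε (birth p.1)) ≠ p.2 then Cover.Colour.dotted
  else if Odd p.2.card then Cover.Colour.plain
  else if (∃ x ∈ p.2, F.gammaAt ε (birth p.1) x = x) ↔ signAt ε (birth p.1) = 1 then
    Cover.Colour.red
  else Cover.Colour.blue

/-- `F` produces the real tropical cover `(φ, c)` up to isomorphism. -/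
def Produces {d r : ℕ} {E : Type} (F : Tuple d r) (ε : Fin r → ℤˣ) (φ : Cover r E)
    (c : E → Cover.Colour) : Prop :=
  ∃ θ : {p // F.IsEdge p} ≃ E, ∀ p, φ.src (θ p) = F.cover.src p ∧ φ.tgt (θ p) = F.cover.tgt p ∧
    φ.wt (θ p) = F.cover.wt p ∧ c (θ p) = F.colour ε p.1

end Tuple

/-! ### Mixed zigzag numbers -/

/-- The set of (isomorphism classes of) `k`-mixed zigzag covers of type `(g, λ, μ, x)`. -/
def mixedZigzagCovers {d : ℕ} (g k : ℕ) (lam mu : Nat.Partition d) :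
    Set (CoverClass (numBranch g lam mu)) :=
  {M | M.cover.HasType g lam.parts mu.parts ∧ M.cover.IsMixedZigzag k}

/-- The number of real `k`-mixed factorizations of type `(g, λ, μ; ε, k)` that produce the cover `φ`
with the colouring whose positive and negative vertices are given by `ε`. -/
noncomputable def mixedCount {d : ℕ} (g k : ℕ) (lam mu : Nat.Partition d) {E : Type}
    (φ : Cover (numBranch g lam mu) E) (ε : Fin (numBranch g lam mu) → ℤˣ) : ℕ :=
  {F : Tuple d (numBranch g lam mu) |
    F.IsRealFactorization g lam mu ε ∧ F.IsMixed k ∧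
      ∃ c, φ.IsColouring c ∧ (∀ v, φ.HasSign c v (ε v)) ∧ F.Produces ε φ c}.ncard

/-- The `k`-mixed zigzag number: the sum over all `k`-mixed zigzag covers of type `(g, λ, μ, x)` of the
minimum over all sequences of signs of the number of associated factorizations. -/
noncomputable def mixedZigzagNumber {d : ℕ} (g k : ℕ) (lam mu : Nat.Partition d) : ℕ :=
  ∑ᶠ M ∈ mixedZigzagCovers g k lam mu, ⨅ ε, mixedCount g k lam mu M.cover ε

end MixedZigzag

/-! The relevant zigzag covers are encoded by walks of integers. Along the string one records the
weights, positive where the string runs to the right. At each vertex this signed weight changes by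
the even signed weight of the tail attached there. Tropicality, ends, genus, monotonicity and
mixedness all become conditions on this sequence and on the order of the vertices.

For one cover and one sequence of signs, a colouring is forced outward from the string, and a real
factorization is built by passing the vertices from left to right (`Tuple.exists_realizes`). Two
facts about reflections of a cycle `ρ` carry this. On an odd cycle a reflection fixes exactly one
point. On an even cycle exactly one of `κ` and `ρ⁻¹ * κ` has fixed points. They always provide a
transposition that commutes with the relevant reflection and makes the prescribed cut or join with
the prescribed colours.

Such a factorization becomes mixed after relabelling the sheets (`IsModel.exists_isMixed_conj`).
Each of the first `k` transpositions moves a distinguished point, its centre. Universal monotonicity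
implies that equal centres occur consecutively and that the other moved point is never a current or
later centre, so the centres can be made the largest labels, in order of appearance. The sheets over
in-ends that avoid the first `k` vertices can still be permuted freely. Different permutations give
different factorizations, because a permutation that fixes a point and commutes with a transitive
group is trivial. This gives the factor `(2m)!` for all signs, hence for the minimum.

For the number of covers, the first `k` steps lead from the odd part of `λ` to the odd part of `μ'`,
upwards by the even parts of `λ'` and downwards by those of `μ'` (`Walk.exists_descends`). Two
downward steps always bring a positive weight to a nonpositive one, so no left-to-right piece gets
two unbent tails. Keeping the largest even part of `λ'` for the last upward step guarantees that a
downward step is available whenever the weight is positive.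

After these vertices comes one in-tail of weight two carrying the whole genus. Out-tails of weight
two with forks bring the string down to weight one, provided `m` is large. There follow `N = m - m₀`
pairs of such tails, an out-tail and an in-tail, between which the weight swings from 1 to -1 and
back. All remaining parts are placed at the end.

The vertices of the `N` pairs are of four types: attaching vertices and fork vertices, of out-tails
and of in-tails. The order among vertices of one type is unconstrained, and the cover together with
the first vertex of its string determines the numbering of all of them (`IsModel.pt_unique`). This
yields `(N!) ^ 4` different covers. -/

open Equiv Equiv.Perm
namespace MixedZigzag

namespace Tuple

/-! ### Cycles of a permutation: reflections, cuts and joins -/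

section Cycles

variable {D : ℕ} {ρ κ : Perm (Fin D)} {B : Finset (Fin D)} {x y : Fin D}

/-- An injective self-map of a finite set is onto, so the inverse preserves `S` as well. -/
theorem zpow_apply_mem_of_forall {f : Perm (Fin D)} {S : Finset (Fin D)} (h : ∀ x ∈ S, f x ∈ S)
    (n : ℤ) (hx : x ∈ S) : (f ^ n) x ∈ S := by
  have h1 : Set.MapsTo f (S : Set (Fin D)) S := fun y hy => h y hy
  have h2 : Set.MapsTo (f⁻¹ : Perm (Fin D)) (S : Set (Fin D)) S := perm_symm_mapsTo_of_mapsTo f h1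
  rcases n with n | n
  · simpa using h1.perm_pow n hx
  · have := h2.perm_pow (n + 1) hx
    rw [zpow_negSucc, ← inv_pow]
    exact this

theorem IsCycleOf.sameCycle (h : IsCycleOf ρ B) (hx : x ∈ B) (hy : y ∈ B) : ρ.SameCycle x y := by
  obtain ⟨z, hz⟩ := h
  exact ((hz x).1 hx).symm.trans ((hz y).1 hy)

theorem IsCycleOf.mem_iff (h : IsCycleOf ρ B) (hx : x ∈ B) : y ∈ B ↔ ρ.SameCycle x y := by
  obtain ⟨z, hz⟩ := h
  rw [hz]
  exact ⟨fun hy => ((hz x).1 hx).symm.trans hy, fun hy => ((hz x).1 hx).trans hy⟩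

theorem IsCycleOf.nonempty (h : IsCycleOf ρ B) : B.Nonempty :=
  let ⟨z, hz⟩ := h
  ⟨z, (hz z).2 (SameCycle.refl _ _)⟩

theorem isCycleOf_of_forall (hx : x ∈ B) (h₁ : ∀ y ∈ B, ρ y ∈ B)
    (h₂ : ∀ y ∈ B, ρ.SameCycle x y) : IsCycleOf ρ B := by
  refine ⟨x, fun y => ⟨h₂ y, ?_⟩⟩
  rintro ⟨n, rfl⟩
  exact zpow_apply_mem_of_forall h₁ n hx

theorem IsCycleOf.zpow_mem (h : IsCycleOf ρ B) (hx : x ∈ B) (n : ℤ) : (ρ ^ n) x ∈ B :=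
  (h.mem_iff hx).2 ⟨n, rfl⟩

theorem IsCycleOf.pow_mem (h : IsCycleOf ρ B) (hx : x ∈ B) (n : ℕ) : (ρ ^ n) x ∈ B :=
  h.zpow_mem hx n

theorem IsCycleOf.apply_mem (h : IsCycleOf ρ B) (hx : x ∈ B) : ρ x ∈ B := by
  simpa using h.zpow_mem hx 1

theorem IsCycleOf.inv_apply_mem (h : IsCycleOf ρ B) (hx : x ∈ B) : ρ⁻¹ x ∈ B := by
  simpa using h.zpow_mem hx (-1)

theorem IsCycleOf.exists_zpow (h : IsCycleOf ρ B) (hx : x ∈ B) (hy : y ∈ B) :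
    ∃ n : ℤ, (ρ ^ n) x = y :=
  h.sameCycle hx hy

theorem IsCycleOf.eq_of_mem {B' : Finset (Fin D)} (h : IsCycleOf ρ B) (h' : IsCycleOf ρ B')
    (hx : x ∈ B) (hx' : x ∈ B') : B = B' := by
  ext y
  rw [h.mem_iff hx, h'.mem_iff hx']

/-- A cycle is an orbit of the cyclic group generated by `ρ`. Through the minimal period, all
computations inside a cycle become divisibility by its cardinality. -/
theorem IsCycleOf.card_eq (h : IsCycleOf ρ B) (hx : x ∈ B) :
    B.card = Function.minimalPeriod (ρ • ·) x := by
  classical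
  have : Fintype (MulAction.orbit (Subgroup.zpowers ρ) x) := Fintype.ofFinite _
  rw [MulAction.minimalPeriod_eq_card (a := ρ) (b := x), ← Set.toFinset_card]
  congr 1
  ext y
  rw [h.mem_iff hx, Set.mem_toFinset]
  constructor
  · rintro ⟨n, rfl⟩
    exact ⟨⟨ρ ^ n, n, rfl⟩, rfl⟩
  · rintro ⟨⟨_, n, rfl⟩, rfl⟩
    exact ⟨n, rfl⟩

theorem IsCycleOf.zpow_apply_eq_self_iff (h : IsCycleOf ρ B) (hx : x ∈ B) (n : ℤ) :
    (ρ ^ n) x = x ↔ (B.card : ℤ) ∣ n := by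
  rw [h.card_eq hx]
  exact MulAction.zpow_smul_eq_iff_minimalPeriod_dvd (a := ρ) (b := x)

theorem IsCycleOf.zpow_apply_eq_iff (h : IsCycleOf ρ B) (hx : x ∈ B) (n k : ℤ) :
    (ρ ^ n) x = (ρ ^ k) x ↔ (B.card : ℤ) ∣ n - k := by
  rw [← h.zpow_apply_eq_self_iff hx, sub_eq_neg_add, zpow_add, Perm.mul_apply, zpow_neg,
    Perm.inv_eq_iff_eq, eq_comm, eq_comm (a := (ρ ^ k) x)]

/-! Reflections of a cycle. -/

theorem reflect_zpow (h : κ * ρ * κ = ρ⁻¹) (hκ : κ * κ = 1) (n : ℤ) (x : Fin D) :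
    κ ((ρ ^ n) x) = (ρ ^ (-n)) (κ x) := by
  have h1 : κ * ρ * κ⁻¹ = ρ⁻¹ := by rwa [inv_eq_of_mul_eq_one_right hκ]
  have h2 : κ * ρ ^ n * κ⁻¹ = ρ ^ (-n) := by rw [← conj_zpow, h1, inv_zpow, zpow_neg]
  have h3 := congrArg (fun f : Perm (Fin D) => f (κ x)) h2
  simpa using h3

/-- In the coordinate `j ↦ ρ ^ j x` the reflection is `j ↦ t - j`, so the equation to solve is `2 j
= t - p` modulo the length. For odd length 2 is invertible. For even length without fixed points `t`
is odd, and then so is `p`. -/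
theorem exists_apply_eq_zpow (hB : IsCycleOf ρ B) (h : κ * ρ * κ = ρ⁻¹) (hκ : κ * κ = 1)
    (hpres : ∀ x ∈ B, κ x ∈ B) (p : ℤ)
    (hp : Odd B.card ∨ (Odd p ∧ Even B.card ∧ ¬ ∃ x ∈ B, κ x = x)) :
    ∃ a ∈ B, κ a = (ρ ^ p) a := by
  obtain ⟨x, hx⟩ := hB.nonempty
  obtain ⟨t, ht⟩ := hB.exists_zpow hx (hpres x hx)
  have key : ∀ j : ℤ, (B.card : ℤ) ∣ t - p - 2 * j → κ ((ρ ^ j) x) = (ρ ^ p) ((ρ ^ j) x) := by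
    intro j hj
    rw [reflect_zpow h hκ, ← ht, ← Perm.mul_apply, ← Perm.mul_apply, ← zpow_add, ← zpow_add,
      hB.zpow_apply_eq_iff hx]
    convert hj using 1
    ring
  have key0 : ∀ j : ℤ, (B.card : ℤ) ∣ t - 2 * j → κ ((ρ ^ j) x) = (ρ ^ j) x := by
    intro j hj
    rw [reflect_zpow h hκ, ← ht, ← Perm.mul_apply, ← zpow_add, hB.zpow_apply_eq_iff hx]
    convert hj using 1
    ring
  rcases hp with ⟨l, hl⟩ | ⟨hp, -, hn⟩
  -- The length is `2 * l + 1`, and `l + 1` is the inverse of 2 modulo it.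
  · refine ⟨(ρ ^ ((t - p) * (l + 1))) x, hB.zpow_mem hx _, key _ ⟨-(t - p), ?_⟩⟩
    rw [hl]; push_cast; ring
  · rcases Int.even_or_odd t with ⟨u, hu⟩ | ht'
    · exact absurd ⟨_, hB.zpow_mem hx u, key0 u ⟨0, by rw [hu]; ring⟩⟩ hn
    · obtain ⟨u, hu⟩ := ht'.sub_odd hp
      exact ⟨(ρ ^ u) x, hB.zpow_mem hx u, key u ⟨0, by rw [hu]; ring⟩⟩

theorem exists_fixed_of_odd (hB : IsCycleOf ρ B) (h : κ * ρ * κ = ρ⁻¹) (hκ : κ * κ = 1)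
    (hpres : ∀ x ∈ B, κ x ∈ B) (ho : Odd B.card) : ∃ a ∈ B, κ a = a := by
  simpa using exists_apply_eq_zpow hB h hκ hpres 0 (Or.inl ho)

/-- Two fixed points at distance `j` give a length dividing `2 * j`, hence dividing `j` when it is
odd. -/
theorem fixed_unique_of_odd (hB : IsCycleOf ρ B) (h : κ * ρ * κ = ρ⁻¹) (hκ : κ * κ = 1)
    (ho : Odd B.card) (hx : x ∈ B) (hy : y ∈ B) (hfx : κ x = x) (hfy : κ y = y) : x = y := by
  obtain ⟨j, rfl⟩ := hB.exists_zpow hx hy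
  rw [reflect_zpow h hκ, hfx, hB.zpow_apply_eq_iff hx] at hfy
  have h2 : (B.card : ℤ) ∣ 2 * j := by
    have : -j - j = -(2 * j) := by ring
    rwa [this, dvd_neg] at hfy
  have hc : IsCoprime (B.card : ℤ) 2 := by
    rw [Int.isCoprime_iff_gcd_eq_one]
    exact Nat.coprime_two_right.2 ho
  exact ((hB.zpow_apply_eq_self_iff hx j).2 (hc.dvd_of_dvd_mul_left h2)).symm

/-- On an even cycle `j ↦ t - j` has a fixed point exactly when `t` is even, and multiplication by
`ρ⁻¹` replaces `t` by `t - 1`. This is the reason why a change of sign exchanges the two colours. -/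
theorem exists_fixed_iff_of_even (hB : IsCycleOf ρ B) (h : κ * ρ * κ = ρ⁻¹) (hκ : κ * κ = 1)
    (hpres : ∀ x ∈ B, κ x ∈ B) (he : Even B.card) :
    (∃ a ∈ B, (ρ⁻¹ * κ) a = a) ↔ ¬ ∃ a ∈ B, κ a = a := by
  constructor
  · rintro ⟨b, hb, hfb⟩ ⟨a, ha, hfa⟩
    obtain ⟨j, rfl⟩ := hB.exists_zpow ha hb
    rw [Perm.mul_apply, reflect_zpow h hκ, hfa, ← Perm.mul_apply, ← zpow_neg_one, ← zpow_add,
      hB.zpow_apply_eq_iff ha] at hfb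
    have h2 : (2 : ℤ) ∣ B.card := by exact_mod_cast he.two_dvd
    have := h2.trans hfb
    omega
  · intro hn
    obtain ⟨a, ha, h1⟩ := exists_apply_eq_zpow hB h hκ hpres 1 (Or.inr ⟨odd_one, he, hn⟩)
    refine ⟨a, ha, ?_⟩
    rw [Perm.mul_apply, h1]
    simp

/-! Cutting and joining cycles. -/

theorem isCycleOf_image_range {f : Perm (Fin D)} {a : Fin D} {p : ℕ} (hp : 0 < p)
    (h : (f ^ p) a = a) : IsCycleOf f ((Finset.range p).image fun j => (f ^ j) a) := by
  refine isCycleOf_of_forall (x := a) ?_ ?_ ?_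
  · exact Finset.mem_image.2 ⟨0, Finset.mem_range.2 hp, by simp⟩
  · intro y hy
    obtain ⟨j, hj, rfl⟩ := Finset.mem_image.1 hy
    have hj := Finset.mem_range.1 hj
    rcases Nat.lt_or_ge (j + 1) p with hlt | hge
    · exact Finset.mem_image.2 ⟨j + 1, Finset.mem_range.2 hlt, by rw [pow_succ', Perm.mul_apply]⟩
    · refine Finset.mem_image.2 ⟨0, Finset.mem_range.2 hp, ?_⟩
      have : j + 1 = p := by omega
      rw [← Perm.mul_apply, ← pow_succ', this, h]
      simp
  · intro y hy
    obtain ⟨j, -, rfl⟩ := Finset.mem_image.1 hy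
    exact ⟨j, by simp⟩

/-- The part of length `p` of the cycle of `a` that starts at `a`. -/
def arc (ρ : Perm (Fin D)) (a : Fin D) (p : ℕ) : Finset (Fin D) :=
  (Finset.range p).image fun j => (ρ ^ j) a

theorem IsCycleOf.pow_apply_eq_iff (h : IsCycleOf ρ B) (hx : x ∈ B) (n k : ℕ) :
    (ρ ^ n) x = (ρ ^ k) x ↔ (B.card : ℤ) ∣ (n : ℤ) - k := by
  rw [← h.zpow_apply_eq_iff hx]; simp

theorem IsCycleOf.pow_injOn (h : IsCycleOf ρ B) (hx : x ∈ B) {n k : ℕ} (hn : n < B.card)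
    (hk : k < B.card) (he : (ρ ^ n) x = (ρ ^ k) x) : n = k := by
  rw [h.pow_apply_eq_iff hx] at he
  have := Int.eq_zero_of_abs_lt_dvd he (by rw [abs_lt]; constructor <;> omega)
  omega

theorem card_arc (h : IsCycleOf ρ B) (hx : x ∈ B) {p : ℕ} (hp : p ≤ B.card) :
    (arc ρ x p).card = p := by
  rw [arc, Finset.card_image_of_injOn, Finset.card_range]
  intro n hn k hk he
  have hn := Finset.mem_range.1 (Finset.mem_coe.1 hn)
  have hk := Finset.mem_range.1 (Finset.mem_coe.1 hk)
  exact h.pow_injOn hx (by omega) (by omega) he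

/-- The transposition only matters when `ρ` arrives at `a` or `b`, which does not happen between the
start at `a` and the step `p`. -/
theorem swap_mul_pow_apply (h : IsCycleOf ρ B) {a b : Fin D} (ha : a ∈ B) {p : ℕ} (hp : p < B.card)
    (hb : (ρ ^ p) a = b) {j : ℕ} (hj : j < p) : ((swap a b * ρ) ^ j) a = (ρ ^ j) a := by
  induction j with
  | zero => simp
  | succ j ih =>
    rw [pow_succ', Perm.mul_apply, ih (by omega), Perm.mul_apply, ← Perm.mul_apply ρ, ← pow_succ']
    apply swap_apply_of_ne_of_ne
    · intro he
      have := h.pow_injOn ha (n := j + 1) (k := 0) (by omega) (by omega) (by rw [he, pow_zero, Perm.one_apply])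
      omega
    · rw [← hb]
      intro he
      have := h.pow_injOn ha (by omega) (by omega) he
      omega

theorem isCycleOf_arc (h : IsCycleOf ρ B) {a b : Fin D} (ha : a ∈ B) {p : ℕ} (hp : p < B.card)
    (hp0 : 0 < p) (hb : (ρ ^ p) a = b) : IsCycleOf (swap a b * ρ) (arc ρ a p) := by
  have h1 : ((swap a b * ρ) ^ p) a = a := by
    obtain ⟨q, rfl⟩ : ∃ q, p = q + 1 := ⟨p - 1, by omega⟩
    rw [pow_succ', Perm.mul_apply, swap_mul_pow_apply h ha hp hb (by omega), Perm.mul_apply,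
      ← Perm.mul_apply ρ, ← pow_succ', hb, swap_apply_right]
  have h2 : arc ρ a p = (Finset.range p).image fun j => ((swap a b * ρ) ^ j) a := by
    refine Finset.image_congr fun j hj => ?_
    exact (swap_mul_pow_apply h ha hp hb (Finset.mem_range.1 (Finset.mem_coe.1 hj))).symm
  rw [h2]
  exact isCycleOf_image_range hp0 h1

/-- Starting from `a`, the new permutation follows `ρ` and returns to `a` at the moment when `ρ`
would reach `b`. Exchanging the roles of `a` and `b` gives the complementary arc. -/
theorem cut_cycle (h : IsCycleOf ρ B) {a b : Fin D} (ha : a ∈ B) {p q : ℕ} (hpq : p + q = B.card)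
    (hp : 0 < p) (hq : 0 < q) (hb : (ρ ^ p) a = b) :
    IsCycleOf (swap a b * ρ) (arc ρ a p) ∧ IsCycleOf (swap a b * ρ) (arc ρ b q) ∧
    (arc ρ a p).card = p ∧ (arc ρ b q).card = q ∧ a ∈ arc ρ a p ∧ b ∈ arc ρ b q ∧
    Disjoint (arc ρ a p) (arc ρ b q) ∧ arc ρ a p ∪ arc ρ b q = B ∧ a ≠ b := by
  have hbB : b ∈ B := by rw [← hb]; simpa using h.zpow_mem ha p
  have hba : (ρ ^ q) b = a := by
    rw [← hb, ← Perm.mul_apply, ← pow_add, Nat.add_comm q p, hpq]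
    have := (h.pow_apply_eq_iff ha B.card 0).2 (by simp)
    simpa using this
  have hdis : Disjoint (arc ρ a p) (arc ρ b q) := by
    rw [Finset.disjoint_left]
    intro z hz hz'
    obtain ⟨j, hj, rfl⟩ := Finset.mem_image.1 hz
    obtain ⟨l, hl, hjl⟩ := Finset.mem_image.1 hz'
    rw [← hb, ← Perm.mul_apply, ← pow_add] at hjl
    have hj := Finset.mem_range.1 hj
    have hl := Finset.mem_range.1 hl
    have := h.pow_injOn ha (by omega) (by omega) hjl
    omega
  have hab : a ∈ arc ρ a p := Finset.mem_image.2 ⟨0, Finset.mem_range.2 hp, by simp⟩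
  have hbb : b ∈ arc ρ b q := Finset.mem_image.2 ⟨0, Finset.mem_range.2 hq, by simp⟩
  refine ⟨isCycleOf_arc h ha (by omega) hp hb, ?_, card_arc h ha (by omega),
    card_arc h hbB (by omega), hab, hbb, hdis, ?_, ?_⟩
  · rw [swap_comm]
    exact isCycleOf_arc h hbB (by omega) hq hba
  · apply Finset.eq_of_subset_of_card_le
    · intro z hz
      rcases Finset.mem_union.1 hz with hz | hz
      · obtain ⟨j, -, rfl⟩ := Finset.mem_image.1 hz
        simpa using h.zpow_mem ha j
      · obtain ⟨j, -, rfl⟩ := Finset.mem_image.1 hz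
        simpa using h.zpow_mem hbB j
    · rw [Finset.card_union_of_disjoint hdis, card_arc h ha (by omega), card_arc h hbB (by omega)]
      omega
  · rintro rfl
    exact Finset.disjoint_left.1 hdis hab hbb

theorem join_cycle {A : Finset (Fin D)} (hA : IsCycleOf ρ A) (hB : IsCycleOf ρ B)
    (hd : Disjoint A B) {a b : Fin D} (ha : a ∈ A) (hb : b ∈ B) :
    IsCycleOf (swap a b * ρ) (A ∪ B) := by
  have hne : ∀ {x}, x ∈ A → x ∉ B := fun hx => Finset.disjoint_left.1 hd hx
  have aux : ∀ {A B : Finset (Fin D)} {a b : Fin D}, IsCycleOf ρ A → IsCycleOf ρ B → Disjoint A B →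
      a ∈ A → b ∈ B → ∀ j : ℕ, j < A.card → ((swap a b * ρ) ^ j) a = (ρ ^ j) a := by
    intro A B a b hA hB hd ha hb j
    induction j with
    | zero => intro; simp
    | succ j ih =>
      intro hj
      rw [pow_succ', Perm.mul_apply, ih (by omega), Perm.mul_apply, ← Perm.mul_apply ρ, ← pow_succ']
      apply swap_apply_of_ne_of_ne
      · intro he
        have := hA.pow_injOn ha (k := 0) (by omega) (by omega) (by simpa using he)
        omega
      · intro he
        refine Finset.disjoint_left.1 hd ?_ hb
        rw [← he]
        exact hA.pow_mem ha (j + 1)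
  have aux2 : ∀ {A B : Finset (Fin D)} {a b : Fin D}, IsCycleOf ρ A → IsCycleOf ρ B → Disjoint A B →
      a ∈ A → b ∈ B → ∀ y ∈ A, (swap a b * ρ).SameCycle a y := by
    intro A B a b hA hB hd ha hb y hy
    have hpos : 0 < A.card := Finset.card_pos.2 ⟨a, ha⟩
    obtain ⟨n, rfl⟩ := hA.exists_zpow ha hy
    obtain ⟨j, hj⟩ : ∃ j : ℕ, n % (A.card : ℤ) = j :=
      ⟨(n % (A.card : ℤ)).toNat, (Int.toNat_of_nonneg (Int.emod_nonneg _ (by omega))).symm⟩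
    have hlt : j < A.card := by
      have := Int.emod_lt_of_pos n (b := (A.card : ℤ)) (by omega)
      omega
    have : (ρ ^ n) a = (ρ ^ j) a := by
      rw [← zpow_natCast, hA.zpow_apply_eq_iff ha, ← hj]
      exact Int.dvd_self_sub_emod
    rw [this, ← aux hA hB hd ha hb j hlt]
    exact ⟨j, by simp⟩
  -- The predecessor of `a` is now sent to `b`, which links the two old cycles.
  have hbA : (swap a b * ρ).SameCycle a b := by
    have h1 : (swap a b * ρ) (ρ⁻¹ a) = b := by simp
    have h2 := aux2 hA hB hd ha hb _ (hA.inv_apply_mem ha)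
    have h3 := sameCycle_apply_right.2 h2
    rwa [h1] at h3
  refine isCycleOf_of_forall (x := a) (Finset.mem_union_left _ ha) ?_ ?_
  · intro y hy
    have h1 : ρ y ∈ A ∪ B := by
      rcases Finset.mem_union.1 hy with hy | hy
      · exact Finset.mem_union_left _ (hA.apply_mem hy)
      · exact Finset.mem_union_right _ (hB.apply_mem hy)
    rw [Perm.mul_apply]
    rcases eq_or_ne (ρ y) a with h | h
    · rw [h, swap_apply_left]; exact Finset.mem_union_right _ hb
    rcases eq_or_ne (ρ y) b with h' | h'
    · rw [h', swap_apply_right]; exact Finset.mem_union_left _ ha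
    rwa [swap_apply_of_ne_of_ne h h']
  · intro y hy
    rcases Finset.mem_union.1 hy with hy | hy
    · exact aux2 hA hB hd ha hb y hy
    · have := aux2 hB hA hd.symm hb ha y hy
      rw [swap_comm] at this
      exact hbA.trans this

theorem isCycleOf_mul_of_fixed {τ : Perm (Fin D)} (hB : IsCycleOf ρ B) (hτ : ∀ x ∈ B, τ x = x) :
    IsCycleOf (τ * ρ) B := by
  obtain ⟨x, hx⟩ := hB.nonempty
  have key : ∀ n : ℕ, ((τ * ρ) ^ n) x = (ρ ^ n) x := by
    intro n
    induction n with
    | zero => simp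
    | succ n ih =>
      rw [pow_succ', Perm.mul_apply, ih, Perm.mul_apply, ← Perm.mul_apply ρ, ← pow_succ']
      exact hτ _ (hB.pow_mem hx (n + 1))
  refine isCycleOf_of_forall hx (fun y hy => ?_) (fun y hy => ?_)
  · rw [Perm.mul_apply, hτ _ (hB.apply_mem hy)]
    exact hB.apply_mem hy
  · obtain ⟨n, -, hn⟩ := (hB.sameCycle hx hy).exists_pow_eq'
    exact ⟨n, by rw [zpow_natCast, key, hn]⟩

/-- The cycle type (with fixed points) of a permutation whose cycles are listed by `B`. -/
theorem partition_parts_eq {ι : Type*} [Fintype ι] (B : ι → Finset (Fin D))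
    (hc : ∀ i, IsCycleOf ρ (B i)) (hcov : ∀ x, ∃ i, x ∈ B i)
    (hdis : ∀ i j x, x ∈ B i → x ∈ B j → i = j) :
    ρ.partition.parts = Finset.univ.val.map fun i => (B i).card := by
  classical
  choose rep hrep using fun i => (hc i).nonempty
  have hsupp : ∀ i, ∀ y, y ∈ B i → (ρ y = y ↔ (B i).card = 1) := by
    intro i y hy
    have := (hc i).zpow_apply_eq_self_iff hy 1
    rw [zpow_one] at this
    rw [this]
    constructor
    · intro h
      have := Int.eq_one_of_dvd_one (by omega) h
      omega
    · intro h; rw [h]; simp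
  have hpos : ∀ i, 0 < (B i).card := fun i => Finset.card_pos.2 (hc i).nonempty
  have hcyc : ∀ i, (B i).card ≠ 1 → (ρ.cycleOf (rep i)).support = B i := by
    intro i hi
    ext y
    rw [mem_support_cycleOf_iff, (hc i).mem_iff (hrep i), mem_support]
    refine ⟨fun h => h.1, fun h => ⟨h, fun h' => hi ((hsupp i _ (hrep i)).1 h')⟩⟩
  -- `cycleType` ignores fixed points, which `partition` adds as parts equal to 1. Cycles of length
  -- one are therefore treated separately.
  set S : Finset ι := Finset.univ.filter fun i => (B i).card ≠ 1 with hS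
  have h1 : ρ.cycleFactorsFinset = S.image fun i => ρ.cycleOf (rep i) := by
    ext f
    rw [Finset.mem_image]
    constructor
    · intro hf
      obtain ⟨hf1, hf2⟩ := mem_cycleFactorsFinset_iff.1 hf
      obtain ⟨x, hx⟩ := hf1.nonempty_support
      obtain ⟨i, hi⟩ := hcov x
      have hfx := (cycle_is_cycleOf hx hf)
      have hxs : ρ x ≠ x := by
        rw [← hf2 x hx]; exact mem_support.1 hx
      refine ⟨i, ?_, ?_⟩
      · simp only [hS, Finset.mem_filter, Finset.mem_univ, true_and]
        exact fun h => hxs ((hsupp i x hi).2 h)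
      · rw [hfx]
        exact ((hc i).sameCycle (hrep i) hi).cycleOf_eq
    · rintro ⟨i, hi, rfl⟩
      rw [cycleOf_mem_cycleFactorsFinset_iff, mem_support]
      simp only [hS, Finset.mem_filter, Finset.mem_univ, true_and] at hi
      exact fun h => hi ((hsupp i _ (hrep i)).1 h)
  have hinj : Set.InjOn (fun i => ρ.cycleOf (rep i)) (S : Set ι) := by
    intro i hi j hj hij
    have hi : (B i).card ≠ 1 := by simpa [hS] using hi
    have hj : (B j).card ≠ 1 := by simpa [hS] using hj
    have h2 := congrArg Perm.support hij
    simp only [hcyc i hi, hcyc j hj] at h2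
    exact hdis i j (rep i) (hrep i) (h2 ▸ hrep i)
  have h2 : ρ.cycleType = S.val.map fun i => (B i).card := by
    rw [cycleType_def, h1, Finset.image_val_of_injOn hinj, Multiset.map_map]
    refine Multiset.map_congr rfl fun i hi => ?_
    have hi : (B i).card ≠ 1 := by simpa [hS] using hi
    simp [hcyc i hi]
  have h3 : Fintype.card (Fin D) - ρ.support.card =
      (Finset.univ.filter fun i => (B i).card = 1).card := by
    rw [← Finset.card_compl]
    symm
    refine Finset.card_bij (fun i _ => rep i) ?_ ?_ ?_
    · intro i hi
      rw [Finset.mem_compl, notMem_support]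
      exact (hsupp i _ (hrep i)).2 (by simpa using hi)
    · intro i _ j _ hij
      exact hdis i j (rep i) (hrep i) (hij ▸ hrep j)
    · intro x hx
      rw [Finset.mem_compl, notMem_support] at hx
      obtain ⟨i, hi⟩ := hcov x
      have h1 := (hsupp i x hi).1 hx
      refine ⟨i, by simpa using h1, ?_⟩
      exact Finset.card_le_one.1 h1.le _ (hrep i) _ hi
  rw [parts_partition, h2, h3]
  have h4 : (Finset.univ : Finset ι) = S ∪ Finset.univ.filter fun i => (B i).card = 1 := by
    ext i; simp only [hS, Finset.mem_union, Finset.mem_filter, Finset.mem_univ, true_and]; tauto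
  have h5 : Disjoint S (Finset.univ.filter fun i => (B i).card = 1) := by
    rw [Finset.disjoint_left]; intro i; simp [hS]
  have h6 : (Finset.univ : Finset ι).val =
      S.val + (Finset.univ.filter fun i => (B i).card = 1).val := by
    have h7 := congrArg Finset.val (h4.trans (Finset.disjUnion_eq_union _ _ h5).symm)
    exact h7
  rw [h6, Multiset.map_add]
  congr 1
  symm
  rw [Multiset.eq_replicate]
  refine ⟨Multiset.card_map _ _, fun n hn => ?_⟩
  obtain ⟨i, hi, rfl⟩ := Multiset.mem_map.1 hn
  simpa using hi

end Cycles

end Tuple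


/-! ### Tropical covers across a branch point -/

namespace Cover

variable {r : ℕ} {E : Type} (φ : Cover r E)

/-- The edge `e` crosses the region between the branch points `i - 1` and `i`. -/
def Alive (i : ℕ) (e : E) : Prop :=
  Tuple.birth (φ.src e) ≤ i ∧ ∀ j, φ.tgt e = some j → i ≤ j.val

/-- `e` and `f` form a symmetric cycle or a symmetric fork. -/
def SymPair (e f : E) : Prop := φ.SymCycle e f ∨ φ.SymFork e f

variable {φ}

theorem SymPair.ne {e f : E} (h : φ.SymPair e f) : e ≠ f := by
  rcases h with h | h <;> exact h.1

theorem SymPair.wt {e f : E} (h : φ.SymPair e f) : φ.wt e = φ.wt f := by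
  rcases h with h | h <;> exact h.2.1

theorem SymPair.src {e f : E} (h : φ.SymPair e f) : φ.src e = φ.src f := by
  rcases h with ⟨-, -, u, v, h1, h2, h3, h4⟩ | ⟨-, -, v, ⟨h1, h2, h3, h4⟩ | ⟨h1, h2, h3, h4⟩⟩ <;>
    rw [h1, h2]

theorem SymPair.tgt {e f : E} (h : φ.SymPair e f) : φ.tgt e = φ.tgt f := by
  rcases h with ⟨-, -, u, v, h1, h2, h3, h4⟩ | ⟨-, -, v, ⟨h1, h2, h3, h4⟩ | ⟨h1, h2, h3, h4⟩⟩ <;>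
    rw [h3, h4]

theorem SymPair.symm {e f : E} (h : φ.SymPair e f) : φ.SymPair f e := by
  rcases h with ⟨h0, h, u, v, h1, h2, h3, h4⟩ | ⟨h0, h, v, ⟨h1, h2, h3, h4⟩ | ⟨h1, h2, h3, h4⟩⟩
  · exact Or.inl ⟨h0.symm, h.symm, u, v, h2, h1, h4, h3⟩
  · exact Or.inr ⟨h0.symm, h.symm, v, Or.inl ⟨h2, h1, h4, h3⟩⟩
  · exact Or.inr ⟨h0.symm, h.symm, v, Or.inr ⟨h2, h1, h4, h3⟩⟩

theorem SymPair.exists_inc {e f : E} (h : φ.SymPair e f) :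
    (∃ v, φ.tgt e = some v) ∨ ∃ v, φ.src e = some v := by
  rcases h with ⟨-, -, u, v, h1, h2, h3, h4⟩ | ⟨-, -, v, ⟨h1, h2, h3, h4⟩ | ⟨h1, h2, h3, h4⟩⟩
  · exact Or.inl ⟨v, h3⟩
  · exact Or.inl ⟨v, h3⟩
  · exact Or.inr ⟨v, h1⟩

section Tropical

variable [Fintype E] (ht : φ.IsTropical)
include ht

theorem IsTropical.alive_of_tgt {e : E} {v : Fin r} (h : φ.tgt e = some v) :
    φ.Alive v.val e := by
  refine ⟨?_, fun j hj => ?_⟩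
  · cases hs : φ.src e with
    | none => exact Nat.zero_le _
    | some u => exact ht.src_lt_tgt e u v hs h
  · rw [h] at hj
    cases hj; exact le_rfl

theorem IsTropical.tgt_ne_of_src {e : E} {v : Fin r} (h : φ.src e = some v) :
    φ.tgt e ≠ some v := fun h' => lt_irrefl _ (ht.src_lt_tgt e v v h h')

theorem IsTropical.alive_succ_of_src {e : E} {v : Fin r} (h : φ.src e = some v) :
    φ.Alive (v.val + 1) e := by
  refine ⟨by rw [h]; exact le_rfl, fun j hj => ht.src_lt_tgt e v j h hj⟩

theorem IsTropical.alive_birth (e : E) : φ.Alive (Tuple.birth (φ.src e)) e := by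
  refine ⟨le_rfl, fun j hj => ?_⟩
  exact (ht.alive_of_tgt hj).1

/-- This drives every induction over the branch points: crossing `v` replaces the edges that end
there by those that start there, and nothing else happens. -/
theorem IsTropical.alive_succ_iff {e : E} {v : Fin r} :
    φ.Alive (v.val + 1) e ↔
      φ.src e = some v ∨ φ.src e ≠ some v ∧ φ.Alive v.val e ∧ φ.tgt e ≠ some v := by
  constructor
  · intro h
    by_cases hs : φ.src e = some v
    · exact Or.inl hs
    refine Or.inr ⟨hs, ⟨?_, fun j hj => (Nat.le_succ _).trans (h.2 j hj)⟩, fun h' => ?_⟩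
    · rcases Nat.lt_or_ge v.val (Tuple.birth (φ.src e)) with h1 | h1
      · exfalso
        apply hs
        have h2 : Tuple.birth (φ.src e) = v.val + 1 := le_antisymm h.1 h1
        cases hs' : φ.src e with
        | none => rw [hs'] at h2; simp [Tuple.birth] at h2
        | some u =>
          rw [hs'] at h2
          congr 1
          ext
          simpa [Tuple.birth] using h2
      · exact h1
    · have := h.2 v h'
      omega
  · rintro (h | ⟨-, h, h'⟩)
    · exact ht.alive_succ_of_src h
    · refine ⟨h.1.trans (Nat.le_succ _), fun j hj => ?_⟩
      rcases (h.2 j hj).lt_or_eq with h1 | h1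
      · exact h1
      · exact absurd (hj.trans (congrArg some (Fin.ext h1.symm))) h'

theorem IsTropical.inc_iff {e f g : E} {v : Fin r} (he : φ.Inc e v) (hf : φ.Inc f v)
    (hg : φ.Inc g v) (hef : e ≠ f) (heg : e ≠ g) (hfg : f ≠ g) (x : E) :
    φ.Inc x v ↔ x = e ∨ x = f ∨ x = g := by
  classical
  have h1 : ({e, f, g} : Set E) ⊆ {x | φ.Inc x v} := by
    rintro x (rfl | rfl | rfl) <;> assumption
  have h3 : ({e, f, g} : Set E).ncard = 3 := Set.ncard_eq_three.2 ⟨e, f, g, hef, heg, hfg, rfl⟩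
  have h2 := Set.eq_of_subset_of_ncard_le h1 (by rw [ht.trivalent v, h3]) (Set.toFinite _)
  have := Set.ext_iff.1 h2 x
  simpa using this.symm

/-- Trivalence leaves no room for a further edge at `v`, and balancing then gives the relation
between the weights. -/
theorem IsTropical.join_data {e f f' : E} {v : Fin r} (he : φ.src e = some v)
    (hf : φ.tgt f = some v) (hf' : φ.tgt f' = some v) (hff : f ≠ f') :
    (∀ g, φ.tgt g = some v ↔ g = f ∨ g = f') ∧ (∀ g, φ.src g = some v ↔ g = e) ∧
      φ.wt f + φ.wt f' = φ.wt e := by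
  classical
  have hef : e ≠ f := by rintro rfl; exact ht.tgt_ne_of_src he hf
  have hef' : e ≠ f' := by rintro rfl; exact ht.tgt_ne_of_src he hf'
  have hi := ht.inc_iff (Or.inl he) (Or.inr hf) (Or.inr hf') hef hef' hff
  have h1 : ∀ g, φ.tgt g = some v ↔ g = f ∨ g = f' := by
    intro g
    constructor
    · intro hg
      rcases (hi g).1 (Or.inr hg) with rfl | h
      · exact absurd hg (ht.tgt_ne_of_src he)
      · exact h
    · rintro (rfl | rfl) <;> assumption
  have h2 : ∀ g, φ.src g = some v ↔ g = e := by
    intro g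
    constructor
    · intro hg
      rcases (hi g).1 (Or.inl hg) with h | rfl | rfl
      · exact h
      · exact absurd hf (ht.tgt_ne_of_src hg)
      · exact absurd hf' (ht.tgt_ne_of_src hg)
    · rintro rfl; assumption
  refine ⟨h1, h2, ?_⟩
  have hb := ht.balanced v
  have e1 : (Finset.univ.filter fun g => φ.tgt g = some v) = {f, f'} := by ext g; simp [h1]
  have e2 : (Finset.univ.filter fun g => φ.src g = some v) = {e} := by ext g; simp [h2]
  rw [e1, e2, Finset.sum_pair hff, Finset.sum_singleton] at hb
  exact hb

theorem IsTropical.cut_data {e f f' : E} {v : Fin r} (he : φ.tgt e = some v)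
    (hf : φ.src f = some v) (hf' : φ.src f' = some v) (hff : f ≠ f') :
    (∀ g, φ.src g = some v ↔ g = f ∨ g = f') ∧ (∀ g, φ.tgt g = some v ↔ g = e) ∧
      φ.wt f + φ.wt f' = φ.wt e := by
  classical
  have hef : e ≠ f := by rintro rfl; exact ht.tgt_ne_of_src hf he
  have hef' : e ≠ f' := by rintro rfl; exact ht.tgt_ne_of_src hf' he
  have hi := ht.inc_iff (Or.inr he) (Or.inl hf) (Or.inl hf') hef hef' hff
  have h1 : ∀ g, φ.src g = some v ↔ g = f ∨ g = f' := by
    intro g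
    constructor
    · intro hg
      rcases (hi g).1 (Or.inl hg) with rfl | h
      · exact absurd he (ht.tgt_ne_of_src hg)
      · exact h
    · rintro (rfl | rfl) <;> assumption
  have h2 : ∀ g, φ.tgt g = some v ↔ g = e := by
    intro g
    constructor
    · intro hg
      rcases (hi g).1 (Or.inr hg) with h | rfl | rfl
      · exact h
      · exact absurd hg (ht.tgt_ne_of_src hf)
      · exact absurd hg (ht.tgt_ne_of_src hf')
    · rintro rfl; assumption
  refine ⟨h1, h2, ?_⟩
  have hb := ht.balanced v
  have e1 : (Finset.univ.filter fun g => φ.src g = some v) = {f, f'} := by ext g; simp [h1]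
  have e2 : (Finset.univ.filter fun g => φ.tgt g = some v) = {e} := by ext g; simp [h2]
  rw [e1, e2, Finset.sum_pair hff, Finset.sum_singleton] at hb
  exact hb.symm

/-- Two partners of `e` would occupy, together with `e`, all three places at a vertex on one side of
it. The other side would have weight zero, against balancing. -/
theorem IsTropical.symPair_unique {e f f' : E} (h : φ.SymPair e f) (h' : φ.SymPair e f') :
    f = f' := by
  classical
  by_contra hff
  rcases h.exists_inc with ⟨v, hv⟩ | ⟨v, hv⟩
  · have hf : φ.tgt f = some v := h.tgt ▸ hv
    have hf' : φ.tgt f' = some v := h'.tgt ▸ hv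
    have hi := ht.inc_iff (Or.inr hv) (Or.inr hf) (Or.inr hf') h.ne h'.ne hff
    have hb := ht.balanced v
    have e1 : (Finset.univ.filter fun g => φ.src g = some v) = ∅ := by
      rw [Finset.filter_eq_empty_iff]
      intro g _ hg
      rcases (hi g).1 (Or.inl hg) with rfl | rfl | rfl <;>
        exact ht.tgt_ne_of_src hg (by assumption)
    rw [e1, Finset.sum_empty, Finset.sum_eq_zero_iff] at hb
    exact (ht.wt_pos e).ne' (hb e (by simpa using hv))
  · have hf : φ.src f = some v := h.src ▸ hv
    have hf' : φ.src f' = some v := h'.src ▸ hv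
    have hi := ht.inc_iff (Or.inl hv) (Or.inl hf) (Or.inl hf') h.ne h'.ne hff
    have hb := ht.balanced v
    have e1 : (Finset.univ.filter fun g => φ.tgt g = some v) = ∅ := by
      rw [Finset.filter_eq_empty_iff]
      intro g _ hg
      rcases (hi g).1 (Or.inr hg) with rfl | rfl | rfl <;>
        exact ht.tgt_ne_of_src (by assumption) hg
    rw [e1, Finset.sum_empty, eq_comm, Finset.sum_eq_zero_iff] at hb
    exact (ht.wt_pos e).ne' (hb e (by simpa using hv))

end Tropical

end Cover

/-! ### Passing a vertex of a coloured cover -/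

namespace Tuple

open Cover

/-- The colour of the even edges on which the involution used at a vertex of sign `s` has
fixed points. -/
def signColour (s : ℤˣ) : Colour := if s = 1 then Colour.blue else Colour.red

/-- The cycles at a regular point: a permutation `ρ`, an involution `lam` inverting it, and the sets of
elements of the edges. -/
structure State (D : ℕ) (E : Type) where
  ρ : Perm (Fin D)
  lam : Perm (Fin D)
  B : E → Finset (Fin D)

/-- The state describes the coloured cover between the branch points `i - 1` and `i`. -/
structure Inv {D r : ℕ} {E : Type} (φ : Cover r E) (c : E → Colour) (s : ℤˣ) (i : ℕ)
    (σ : State D E) : Prop where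
  invol : σ.lam * σ.lam = 1
  real : σ.lam * σ.ρ * σ.lam = σ.ρ⁻¹
  cyc : ∀ e, φ.Alive i e → IsCycleOf σ.ρ (σ.B e)
  card : ∀ e, φ.Alive i e → (σ.B e).card = φ.wt e
  cover : ∀ x, ∃ e, φ.Alive i e ∧ x ∈ σ.B e
  disj : ∀ e f x, φ.Alive i e → φ.Alive i f → x ∈ σ.B e → x ∈ σ.B f → e = f
  pres : ∀ e, φ.Alive i e → c e ≠ Colour.dotted → ∀ x ∈ σ.B e, σ.lam x ∈ σ.B e
  exch : ∀ e f, φ.Alive i e → c e = Colour.dotted → φ.SymPair e f →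
    ∀ x ∈ σ.B e, σ.lam x ∈ σ.B f
  colr : ∀ e, φ.Alive i e → c e ≠ Colour.dotted → Even (φ.wt e) →
    ((∃ x ∈ σ.B e, σ.lam x = x) ↔ c e = signColour s)

/-- The involution commuting with the transposition at the next vertex, if the latter has sign
`s'`. -/
def State.kappa {D : ℕ} {E : Type} (σ : State D E) (s s' : ℤˣ) : Perm (Fin D) :=
  if s' = s then σ.lam else σ.ρ⁻¹ * σ.lam

/-- The state `σ'` arises from `σ` by passing the vertex `v` of sign `s'`. -/
structure Rel {D r : ℕ} {E : Type} (φ : Cover r E) (s s' : ℤˣ) (v : Fin r)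
    (σ σ' : State D E) : Prop where
  isSwap : (σ'.ρ * σ.ρ⁻¹).IsSwap
  lam_eq : σ'.lam = σ'.ρ * σ.ρ⁻¹ * σ.kappa s s'
  B_eq : ∀ e, φ.src e ≠ some v → σ'.B e = σ.B e
  meets_old : ∀ e, φ.Alive v.val e → ((∃ x ∈ σ.B e, (σ'.ρ * σ.ρ⁻¹) x ≠ x) ↔ φ.tgt e = some v)
  meets_new : ∀ e, φ.Alive (v.val + 1) e →
    ((∃ x ∈ σ'.B e, (σ'.ρ * σ.ρ⁻¹) x ≠ x) ↔ φ.src e = some v)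

/-- A reflection maps cycles to cycles, so the image of a single point decides which cycle is the
target. -/
theorem map_cycle_mem {D : ℕ} {ρ κ : Perm (Fin D)} {A A' : Finset (Fin D)} (hA : IsCycleOf ρ A)
    (hA' : IsCycleOf ρ A') (h : κ * ρ * κ = ρ⁻¹) (hκ : κ * κ = 1) {x : Fin D} (hx : x ∈ A)
    (hx' : κ x ∈ A') : ∀ y ∈ A, κ y ∈ A' := by
  intro y hy
  obtain ⟨n, rfl⟩ := hA.exists_zpow hx hy
  rw [reflect_zpow h hκ]
  exact hA'.zpow_mem hx' _

theorem swap_comm_of_fixed {D : ℕ} {κ : Perm (Fin D)} {a b : Fin D} (ha : κ a = a) (hb : κ b = b) :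
    swap a b * κ = κ * swap a b := by
  rw [mul_swap_eq_swap_mul, ha, hb]

theorem swap_comm_of_exchanged {D : ℕ} {κ : Perm (Fin D)} {a b : Fin D} (ha : κ a = b)
    (hb : κ b = a) : swap a b * κ = κ * swap a b := by
  rw [mul_swap_eq_swap_mul, ha, hb, swap_comm]

theorem signColour_ne_iff {s s' : ℤˣ} (h : s' ≠ s) {x : Colour}
    (hx : x = Colour.red ∨ x = Colour.blue) : ¬ x = signColour s ↔ x = signColour s' := by
  rcases Int.units_eq_one_or s with rfl | rfl <;> rcases Int.units_eq_one_or s' with rfl | rfl <;>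
    rcases hx with rfl | rfl <;> simp_all [signColour]

section Step

variable {D r : ℕ} {E : Type} [Fintype E] {φ : Cover r E} {c : E → Colour} {s s' : ℤˣ}

/-- `σ.ρ⁻¹ * σ.lam` is again a reflection of the same cycles. On even cycles it has fixed points
exactly where `σ.lam` has none, and `signColour` changes with the sign, so the invariant holds for
`kappa` with `s'` in place of `s`. -/
theorem Inv.kappa_facts {i : ℕ} {σ : State D E} (hc : φ.IsColouring c) (h : Inv φ c s i σ)
    (s' : ℤˣ) :
    σ.kappa s s' * σ.kappa s s' = 1 ∧ σ.kappa s s' * σ.ρ * σ.kappa s s' = σ.ρ⁻¹ ∧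
    (∀ e, φ.Alive i e → c e ≠ Colour.dotted → ∀ x ∈ σ.B e, σ.kappa s s' x ∈ σ.B e) ∧
    (∀ e f, φ.Alive i e → c e = Colour.dotted → φ.SymPair e f →
      ∀ x ∈ σ.B e, σ.kappa s s' x ∈ σ.B f) ∧
    (∀ e, φ.Alive i e → c e ≠ Colour.dotted → Even (φ.wt e) →
      ((∃ x ∈ σ.B e, σ.kappa s s' x = x) ↔ c e = signColour s')) := by
  have e1 : σ.lam * σ.ρ⁻¹ * σ.lam = σ.ρ := by
    rw [← h.real]
    simp only [mul_assoc, h.invol, mul_one]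
    rw [← mul_assoc, h.invol, one_mul]
  by_cases hs : s' = s
  · have hk : σ.kappa s s' = σ.lam := by simp [State.kappa, hs]
    rw [hk, hs]
    exact ⟨h.invol, h.real, h.pres, h.exch, h.colr⟩
  · have hk : σ.kappa s s' = σ.ρ⁻¹ * σ.lam := by simp [State.kappa, hs]
    rw [hk]
    refine ⟨?_, ?_, ?_, ?_, ?_⟩
    · calc σ.ρ⁻¹ * σ.lam * (σ.ρ⁻¹ * σ.lam) = σ.ρ⁻¹ * (σ.lam * σ.ρ⁻¹ * σ.lam) := by
            simp only [mul_assoc]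
        _ = 1 := by rw [e1]; simp
    · calc σ.ρ⁻¹ * σ.lam * σ.ρ * (σ.ρ⁻¹ * σ.lam) = σ.ρ⁻¹ * (σ.lam * σ.lam) := by group
        _ = σ.ρ⁻¹ := by rw [h.invol, mul_one]
    · intro e he hce x hx
      exact (h.cyc e he).inv_apply_mem (h.pres e he hce x hx)
    · intro e f he hce hef x hx
      have hf : φ.Alive i f := by
        unfold Cover.Alive at he ⊢
        rwa [← hef.src, ← hef.tgt]
      exact (h.cyc f hf).inv_apply_mem (h.exch e f he hce hef x hx)
    · intro e he hce hev
      rw [exists_fixed_iff_of_even (h.cyc e he) h.real h.invol (h.pres e he hce)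
        (by rwa [h.card e he]), h.colr e he hce hev]
      exact signColour_ne_iff hs (hc.even e hce hev)

/-- Passing a vertex: the verification common to cuts and joins. -/
theorem Inv.step {v : Fin r} {σ : State D E} (ht : φ.IsTropical) (hc : φ.IsColouring c)
    (h : Inv φ c s v.val σ) {a b : Fin D} (hab : a ≠ b)
    (hcomm : swap a b * σ.kappa s s' = σ.kappa s s' * swap a b) (B' : E → Finset (Fin D))
    (hB' : ∀ e, φ.src e ≠ some v → B' e = σ.B e)
    (hin : ∀ e, φ.tgt e = some v → a ∈ σ.B e ∨ b ∈ σ.B e)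
    (ha : ∃ f, φ.tgt f = some v ∧ a ∈ σ.B f) (hb : ∃ f, φ.tgt f = some v ∧ b ∈ σ.B f)
    (ncyc : ∀ e, φ.src e = some v → IsCycleOf (swap a b * σ.ρ) (B' e))
    (ncard : ∀ e, φ.src e = some v → (B' e).card = φ.wt e)
    (nout : ∀ e, φ.src e = some v → a ∈ B' e ∨ b ∈ B' e)
    (nsub : ∀ e, φ.src e = some v → ∀ x ∈ B' e, ∃ f, φ.tgt f = some v ∧ x ∈ σ.B f)
    (ncov : ∀ f, φ.tgt f = some v → ∀ x ∈ σ.B f, ∃ e, φ.src e = some v ∧ x ∈ B' e)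
    (ndis : ∀ e f x, φ.src e = some v → φ.src f = some v → x ∈ B' e → x ∈ B' f → e = f)
    (npres : ∀ e, φ.src e = some v → c e ≠ Colour.dotted →
      ∀ x ∈ B' e, (swap a b * σ.kappa s s') x ∈ B' e)
    (nexch : ∀ e f, φ.src e = some v → c e = Colour.dotted → φ.SymPair e f →
      ∀ x ∈ B' e, (swap a b * σ.kappa s s') x ∈ B' f)
    (ncolr : ∀ e, φ.src e = some v → c e ≠ Colour.dotted → Even (φ.wt e) →
      ((∃ x ∈ B' e, (swap a b * σ.kappa s s') x = x) ↔ c e = signColour s')) :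
    Inv φ c s' (v.val + 1) ⟨swap a b * σ.ρ, swap a b * σ.kappa s s', B'⟩ ∧
      Rel φ s s' v σ ⟨swap a b * σ.ρ, swap a b * σ.kappa s s', B'⟩ := by
  obtain ⟨k1, k2, k3, k4, k5⟩ := h.kappa_facts hc s'
  have hold : ∀ e, φ.Alive v.val e → φ.tgt e ≠ some v → ∀ x ∈ σ.B e, swap a b x = x := by
    intro e he hte x hx
    apply swap_apply_of_ne_of_ne
    · rintro rfl
      obtain ⟨f, hf, haf⟩ := ha
      exact hte (h.disj e f _ he (ht.alive_of_tgt hf) hx haf ▸ hf)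
    · rintro rfl
      obtain ⟨f, hf, hbf⟩ := hb
      exact hte (h.disj e f _ he (ht.alive_of_tgt hf) hx hbf ▸ hf)
  have hmeet : ∀ S : Finset (Fin D), a ∈ S ∨ b ∈ S → ∃ x ∈ S, swap a b x ≠ x := by
    rintro S (hS | hS)
    · exact ⟨a, hS, by rw [swap_apply_left]; exact hab.symm⟩
    · exact ⟨b, hS, by rw [swap_apply_right]; exact hab⟩
  have hss : swap a b * swap a b = 1 := swap_mul_self a b
  refine ⟨⟨?_, ?_, ?_, ?_, ?_, ?_, ?_, ?_, ?_⟩, ⟨?_, ?_, hB', ?_, ?_⟩⟩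
  -- Write `τ` for the transposition. As it commutes with `κ`, the product `τ * κ` is an involution,
  -- and it conjugates `τ * ρ` to `κ * ρ * κ * τ = ρ⁻¹ * τ`.
  · calc swap a b * σ.kappa s s' * (swap a b * σ.kappa s s')
        = swap a b * (σ.kappa s s' * swap a b) * σ.kappa s s' := by simp only [mul_assoc]
      _ = (swap a b * swap a b) * (σ.kappa s s' * σ.kappa s s') := by
          rw [← hcomm]; simp only [mul_assoc]
      _ = 1 := by rw [hss, k1, one_mul]
  · calc swap a b * σ.kappa s s' * (swap a b * σ.ρ) * (swap a b * σ.kappa s s')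
        = (swap a b * σ.kappa s s') * swap a b * σ.ρ * (swap a b * σ.kappa s s') := by
          simp only [mul_assoc]
      _ = σ.kappa s s' * (swap a b * swap a b) * σ.ρ * (σ.kappa s s' * swap a b) := by
          rw [hcomm]; simp only [mul_assoc]
      _ = (σ.kappa s s' * σ.ρ * σ.kappa s s') * swap a b := by
          rw [hss]; simp only [mul_assoc, one_mul]
      _ = (swap a b * σ.ρ)⁻¹ := by rw [k2, mul_inv_rev, swap_inv]
  · intro e he
    rcases ht.alive_succ_iff.1 he with hn | ⟨hn, hal, hte⟩
    · exact ncyc e hn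
    · simp only [hB' e hn]
      exact isCycleOf_mul_of_fixed (h.cyc e hal) (hold e hal hte)
  · intro e he
    rcases ht.alive_succ_iff.1 he with hn | ⟨hn, hal, hte⟩
    · exact ncard e hn
    · simp only [hB' e hn]
      exact h.card e hal
  · intro x
    obtain ⟨e, he, hx⟩ := h.cover x
    by_cases hte : φ.tgt e = some v
    · obtain ⟨f, hf, hxf⟩ := ncov e hte x hx
      exact ⟨f, ht.alive_succ_of_src hf, hxf⟩
    · have hn : φ.src e ≠ some v := by
        intro hn
        have := he.1
        rw [hn] at this
        simp [birth] at this
      exact ⟨e, ht.alive_succ_iff.2 (Or.inr ⟨hn, he, hte⟩), by simpa only [hB' e hn] using hx⟩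
  · intro e f x he hf hxe hxf
    simp only at hxe hxf
    rcases ht.alive_succ_iff.1 he with hn | ⟨hn, hal, hte⟩ <;>
      rcases ht.alive_succ_iff.1 hf with hn' | ⟨hn', hal', hte'⟩
    · exact ndis e f x hn hn' hxe hxf
    · rw [hB' f hn'] at hxf
      obtain ⟨g, hg, hxg⟩ := nsub e hn x hxe
      exact absurd (h.disj f g x hal' (ht.alive_of_tgt hg) hxf hxg ▸ hg) hte'
    · rw [hB' e hn] at hxe
      obtain ⟨g, hg, hxg⟩ := nsub f hn' x hxf
      exact absurd (h.disj e g x hal (ht.alive_of_tgt hg) hxe hxg ▸ hg) hte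
    · rw [hB' f hn'] at hxf
      rw [hB' e hn] at hxe
      exact h.disj e f x hal hal' hxe hxf
  · intro e he hce x hx
    simp only at hx ⊢
    rcases ht.alive_succ_iff.1 he with hn | ⟨hn, hal, hte⟩
    · exact npres e hn hce x hx
    · rw [hB' e hn] at hx ⊢
      have := k3 e hal hce x hx
      rwa [Perm.mul_apply, hold e hal hte _ this]
  · intro e f he hce hef x hx
    simp only at hx ⊢
    rcases ht.alive_succ_iff.1 he with hn | ⟨hn, hal, hte⟩
    · exact nexch e f hn hce hef x hx
    · rw [hB' e hn] at hx
      rw [hB' f (by rwa [← hef.src])]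
      have hf : φ.Alive v.val f := by
        unfold Cover.Alive at hal ⊢
        rwa [← hef.src, ← hef.tgt]
      have := k4 e f hal hce hef x hx
      rwa [Perm.mul_apply, hold f hf (by rwa [← hef.tgt]) _ this]
  · intro e he hce hev
    simp only
    rcases ht.alive_succ_iff.1 he with hn | ⟨hn, hal, hte⟩
    · exact ncolr e hn hce hev
    · rw [hB' e hn, ← k5 e hal hce hev]
      refine exists_congr fun x => and_congr_right fun hx => ?_
      rw [Perm.mul_apply, hold e hal hte _ (k3 e hal hce x hx)]
  · rw [mul_inv_cancel_right]
    exact ⟨a, b, hab, rfl⟩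
  · simp only [mul_inv_cancel_right]
  · intro e he
    simp only [mul_inv_cancel_right]
    refine ⟨?_, fun hte => hmeet _ (hin e hte)⟩
    rintro ⟨x, hx, hne⟩
    by_contra hte
    exact hne (hold e he hte x hx)
  · intro e he
    simp only [mul_inv_cancel_right]
    rcases ht.alive_succ_iff.1 he with hn | ⟨hn, hal, hte⟩
    · exact ⟨fun _ => hn, fun _ => hmeet _ (nout e hn)⟩
    · refine ⟨?_, fun h' => absurd h' hn⟩
      rintro ⟨x, hx, hne⟩
      rw [hB' e hn] at hx
      exact absurd (hold e hal hte x hx) hne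

/-- The work at a joining vertex is thereby reduced to finding one point in each old cycle such that
their transposition commutes with `kappa`, and to checking the colour of the union. -/
theorem Inv.join {v : Fin r} {σ : State D E} (ht : φ.IsTropical) (hc : φ.IsColouring c)
    (h : Inv φ c s v.val σ) {e f f' : E} (he : φ.src e = some v)
    (hf : φ.tgt f = some v) (hf' : φ.tgt f' = some v) (hff : f ≠ f') {a b : Fin D}
    (ha : a ∈ σ.B f) (hb : b ∈ σ.B f')
    (hcomm : swap a b * σ.kappa s s' = σ.kappa s s' * swap a b) (hce : c e ≠ Colour.dotted)
    (hpres : ∀ x ∈ σ.B f ∪ σ.B f', σ.kappa s s' x ∈ σ.B f ∪ σ.B f')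
    (hcol : Even (φ.wt e) → ((∃ x ∈ σ.B f ∪ σ.B f', (swap a b * σ.kappa s s') x = x) ↔
      c e = signColour s')) :
    ∃ σ', Inv φ c s' (v.val + 1) σ' ∧ Rel φ s s' v σ σ' := by
  classical
  obtain ⟨d1, d2, d3⟩ := ht.join_data he hf hf' hff
  have alf := ht.alive_of_tgt hf
  have alf' := ht.alive_of_tgt hf'
  have hdis : Disjoint (σ.B f) (σ.B f') := by
    rw [Finset.disjoint_left]
    exact fun x hx hx' => hff (h.disj f f' x alf alf' hx hx')
  have hab : a ≠ b := by rintro rfl; exact Finset.disjoint_left.1 hdis ha hb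
  set B' : E → Finset (Fin D) := fun g => if g = e then σ.B f ∪ σ.B f' else σ.B g with hB'
  have hBe : B' e = σ.B f ∪ σ.B f' := by simp [hB']
  refine ⟨_, h.step ht hc hab hcomm B' ?_ ?_ ⟨f, hf, ha⟩ ⟨f', hf', hb⟩ ?_ ?_ ?_ ?_ ?_ ?_ ?_ ?_ ?_⟩
  · intro g hg
    have : g ≠ e := by rintro rfl; exact hg he
    simp [hB', this]
  · intro g hg
    rcases (d1 g).1 hg with rfl | rfl
    · exact Or.inl ha
    · exact Or.inr hb
  · intro g hg
    rw [(d2 g).1 hg, hBe]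
    exact join_cycle (h.cyc f alf) (h.cyc f' alf') hdis ha hb
  · intro g hg
    rw [(d2 g).1 hg, hBe, Finset.card_union_of_disjoint hdis, h.card f alf, h.card f' alf', d3]
  · intro g hg
    rw [(d2 g).1 hg, hBe]
    exact Or.inl (Finset.mem_union_left _ ha)
  · intro g hg x hx
    rw [(d2 g).1 hg, hBe] at hx
    rcases Finset.mem_union.1 hx with hx | hx
    · exact ⟨f, hf, hx⟩
    · exact ⟨f', hf', hx⟩
  · intro g hg x hx
    refine ⟨e, he, ?_⟩
    rw [hBe]
    rcases (d1 g).1 hg with rfl | rfl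
    · exact Finset.mem_union_left _ hx
    · exact Finset.mem_union_right _ hx
  · intro g g' x hg hg' _ _
    rw [(d2 g).1 hg, (d2 g').1 hg']
  · intro g hg _ x hx
    rw [(d2 g).1 hg, hBe] at hx ⊢
    have h1 := hpres x hx
    rw [Perm.mul_apply]
    rcases eq_or_ne (σ.kappa s s' x) a with h2 | h2
    · rw [h2, swap_apply_left]; exact Finset.mem_union_right _ hb
    rcases eq_or_ne (σ.kappa s s' x) b with h3 | h3
    · rw [h3, swap_apply_right]; exact Finset.mem_union_left _ ha
    rwa [swap_apply_of_ne_of_ne h2 h3]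
  · intro g g' hg hcg
    rw [(d2 g).1 hg] at hcg
    exact absurd hcg hce
  · intro g hg _ hev
    have := (d2 g).1 hg
    subst this
    rw [hBe]
    exact hcol hev

/-- The two ways in which `swap a b` commutes with `kappa` are the two kinds of cuts. If `a` and `b`
are exchanged, then `a` and `b` become fixed points of the new reflection and both arcs are
inverted. If both are fixed, the new reflection exchanges the arcs, which are dotted. -/
theorem Inv.cut {v : Fin r} {σ : State D E} (ht : φ.IsTropical) (hc : φ.IsColouring c)
    (h : Inv φ c s v.val σ) {e f f' : E} (he : φ.tgt e = some v)
    (hf : φ.src f = some v) (hf' : φ.src f' = some v) (hff : f ≠ f') {a b : Fin D}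
    (ha : a ∈ σ.B e) (hb : (σ.ρ ^ φ.wt f) a = b)
    (hcol :
      (σ.kappa s s' a = b ∧ σ.kappa s s' b = a ∧ c f ≠ Colour.dotted ∧ c f' ≠ Colour.dotted ∧
        (Even (φ.wt f) → c f = signColour s') ∧ (Even (φ.wt f') → c f' = signColour s')) ∨
      (σ.kappa s s' a = a ∧ σ.kappa s s' b = b ∧ c f = Colour.dotted ∧ c f' = Colour.dotted)) :
    ∃ σ', Inv φ c s' (v.val + 1) σ' ∧ Rel φ s s' v σ σ' := by
  classical
  obtain ⟨d1, d2, d3⟩ := ht.cut_data he hf hf' hff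
  have ale := ht.alive_of_tgt he
  obtain ⟨k1, k2, k3, k4, k5⟩ := h.kappa_facts hc s'
  obtain ⟨c1, c2, c3, c4, c5, c6, c7, c8, c9⟩ := cut_cycle (h.cyc e ale) ha
    (p := φ.wt f) (q := φ.wt f') (by rw [d3, h.card e ale]) (ht.wt_pos f) (ht.wt_pos f') hb
  have hcomm : swap a b * σ.kappa s s' = σ.kappa s s' * swap a b := by
    rcases hcol with ⟨h1, h2, -⟩ | ⟨h1, h2, -⟩
    · exact swap_comm_of_exchanged h1 h2
    · exact swap_comm_of_fixed h1 h2
  set A := arc σ.ρ a (φ.wt f)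
  set A' := arc σ.ρ b (φ.wt f')
  set B' : E → Finset (Fin D) := fun g => if g = f then A else if g = f' then A' else σ.B g with hB'
  have hBf : B' f = A := by simp [hB']
  have hBf' : B' f' = A' := by simp [hB', hff.symm]
  have hss : swap a b * swap a b = 1 := swap_mul_self a b
  have linv : (swap a b * σ.kappa s s') * (swap a b * σ.kappa s s') = 1 := by
    calc swap a b * σ.kappa s s' * (swap a b * σ.kappa s s')
          = swap a b * (σ.kappa s s' * swap a b) * σ.kappa s s' := by simp only [mul_assoc]
      _ = (swap a b * swap a b) * (σ.kappa s s' * σ.kappa s s') := by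
          rw [← hcomm]; simp only [mul_assoc]
      _ = 1 := by rw [hss, k1, one_mul]
  have lreal : (swap a b * σ.kappa s s') * (swap a b * σ.ρ) * (swap a b * σ.kappa s s') =
      (swap a b * σ.ρ)⁻¹ := by
    calc swap a b * σ.kappa s s' * (swap a b * σ.ρ) * (swap a b * σ.kappa s s')
        = (swap a b * σ.kappa s s') * swap a b * σ.ρ * (swap a b * σ.kappa s s') := by
          simp only [mul_assoc]
      _ = σ.kappa s s' * (swap a b * swap a b) * σ.ρ * (σ.kappa s s' * swap a b) := by
          rw [hcomm]; simp only [mul_assoc]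
      _ = (σ.kappa s s' * σ.ρ * σ.kappa s s') * swap a b := by
          rw [hss]; simp only [mul_assoc, one_mul]
      _ = (swap a b * σ.ρ)⁻¹ := by rw [k2, mul_inv_rev, swap_inv]
  refine ⟨_, h.step ht hc c9 hcomm B' ?_ ?_ ⟨e, he, ha⟩
    ⟨e, he, by rw [← c8]; exact Finset.mem_union_right _ c6⟩ ?_ ?_ ?_ ?_ ?_ ?_ ?_ ?_ ?_⟩
  · intro g hg
    have h1 : g ≠ f := by rintro rfl; exact hg hf
    have h2 : g ≠ f' := by rintro rfl; exact hg hf'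
    simp [hB', h1, h2]
  · intro g hg
    rw [(d2 g).1 hg]
    exact Or.inl ha
  · intro g hg
    rcases (d1 g).1 hg with rfl | rfl
    · rwa [hBf]
    · rwa [hBf']
  · intro g hg
    rcases (d1 g).1 hg with rfl | rfl
    · rwa [hBf]
    · rwa [hBf']
  · intro g hg
    rcases (d1 g).1 hg with rfl | rfl
    · rw [hBf]; exact Or.inl c5
    · rw [hBf']; exact Or.inr c6
  · intro g hg x hx
    refine ⟨e, he, ?_⟩
    rw [← c8]
    rcases (d1 g).1 hg with rfl | rfl
    · rw [hBf] at hx; exact Finset.mem_union_left _ hx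
    · rw [hBf'] at hx; exact Finset.mem_union_right _ hx
  · intro g hg x hx
    rw [(d2 g).1 hg, ← c8] at hx
    rcases Finset.mem_union.1 hx with hx | hx
    · exact ⟨f, hf, by rwa [hBf]⟩
    · exact ⟨f', hf', by rwa [hBf']⟩
  · intro g g' x hg hg' hx hx'
    rcases (d1 g).1 hg with rfl | rfl <;> rcases (d1 g').1 hg' with rfl | rfl
    · rfl
    · rw [hBf] at hx; rw [hBf'] at hx'
      exact absurd hx' (Finset.disjoint_left.1 c7 hx)
    · rw [hBf'] at hx; rw [hBf] at hx'
      exact absurd hx (Finset.disjoint_left.1 c7 hx')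
    · rfl
  · intro g hg hcg
    rcases hcol with ⟨h1, h2, h3, h4, -⟩ | ⟨h1, h2, h3, h4⟩
    · rcases (d1 g).1 hg with rfl | rfl
      · rw [hBf]
        exact map_cycle_mem c1 c1 lreal linv c5 (by rw [Perm.mul_apply, h1, swap_apply_right]; exact c5)
      · rw [hBf']
        exact map_cycle_mem c2 c2 lreal linv c6 (by rw [Perm.mul_apply, h2, swap_apply_left]; exact c6)
    · rcases (d1 g).1 hg with rfl | rfl
      · exact absurd h3 hcg
      · exact absurd h4 hcg
  · intro g g' hg hcg hgg
    have hg' : φ.src g' = some v := hgg.src ▸ hg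
    rcases hcol with ⟨h1, h2, h3, h4, -⟩ | ⟨h1, h2, h3, h4⟩
    · rcases (d1 g).1 hg with rfl | rfl
      · exact absurd hcg h3
      · exact absurd hcg h4
    · rcases (d1 g).1 hg with rfl | rfl <;> rcases (d1 g').1 hg' with rfl | rfl
      · exact absurd rfl hgg.ne
      · rw [hBf, hBf']
        exact map_cycle_mem c1 c2 lreal linv c5 (by rw [Perm.mul_apply, h1, swap_apply_left]; exact c6)
      · rw [hBf, hBf']
        exact map_cycle_mem c2 c1 lreal linv c6 (by rw [Perm.mul_apply, h2, swap_apply_right]; exact c5)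
      · exact absurd rfl hgg.ne
  · intro g hg hcg hev
    rcases hcol with ⟨h1, h2, h3, h4, h5, h6⟩ | ⟨h1, h2, h3, h4⟩
    · rcases (d1 g).1 hg with rfl | rfl
      · rw [hBf]
        exact ⟨fun _ => h5 hev, fun _ => ⟨a, c5, by rw [Perm.mul_apply, h1, swap_apply_right]⟩⟩
      · rw [hBf']
        exact ⟨fun _ => h6 hev, fun _ => ⟨b, c6, by rw [Perm.mul_apply, h2, swap_apply_left]⟩⟩
    · rcases (d1 g).1 hg with rfl | rfl
      · exact absurd h3 hcg
      · exact absurd h4 hcg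

theorem hasSign_iff {v : Fin r} :
    φ.HasSign c v s' ↔ ∃ e f f', f ≠ f' ∧
    ((φ.src e = some v ∧ φ.tgt f = some v ∧ φ.tgt f' = some v) ∨
      (φ.tgt e = some v ∧ φ.src f = some v ∧ φ.src f' = some v)) ∧
    SignPattern (signColour s') (signColour (-s')) (c e) (c f) (c f') := by
  rcases Int.units_eq_one_or s' with rfl | rfl <;> simp [HasSign, signColour]

theorem signColour_ne (s : ℤˣ) : signColour s ≠ Colour.dotted ∧ signColour s ≠ Colour.plain := by
  unfold signColour
  split_ifs <;> simp

theorem odd_of_plain (hc : φ.IsColouring c) {e : E} (h : c e = Colour.plain) : Odd (φ.wt e) := by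
  rw [← Nat.not_even_iff_odd]
  intro hev
  have h' : c e ≠ Colour.dotted := by rw [h]; simp
  rcases hc.even e h' hev with h'' | h'' <;> rw [h] at h'' <;> simp at h''

theorem even_of_signColour (hc : φ.IsColouring c) {e : E} {s : ℤˣ} (h : c e = signColour s) :
    Even (φ.wt e) := by
  rw [← Nat.not_odd_iff_even]
  intro ho
  have h' : c e ≠ Colour.dotted := by rw [h]; exact (signColour_ne s).1
  have := hc.odd e h' ho
  rw [h] at this
  exact (signColour_ne s).2 this

theorem signColour_neg_ne (s : ℤˣ) : signColour (-s) ≠ signColour s := by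
  rcases Int.units_eq_one_or s with rfl | rfl <;> simp [signColour]

/-- A vertex of any sign can be passed. -/
theorem Inv.exists_step {v : Fin r} {σ : State D E} (ht : φ.IsTropical) (hc : φ.IsColouring c)
    (h : Inv φ c s v.val σ) (hs : φ.HasSign c v s') (hodd : ∃ e, φ.Inc e v ∧ Odd (φ.wt e)) :
    ∃ σ', Inv φ c s' (v.val + 1) σ' ∧ Rel φ s s' v σ σ' := by
  obtain ⟨k1, k2, k3, k4, k5⟩ := h.kappa_facts hc s'
  obtain ⟨e, f, f', hff, hdir, hpat⟩ := hasSign_iff.1 hs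
  have nd : ∀ {g : E} {t : ℤˣ}, c g = signColour t → c g ≠ Colour.dotted := by
    intro g t hg; rw [hg]; exact (signColour_ne t).1
  have np : ∀ {g : E}, c g = Colour.plain → c g ≠ Colour.dotted := by
    intro g hg; rw [hg]; simp
  -- The incoming edges of these colours are those on which `kappa` has a fixed point: odd ones
  -- always, even ones of the colour belonging to the sign of the vertex.
  have exfix : ∀ g, φ.Alive v.val g → c g = Colour.plain ∨ c g = signColour s' →
      ∃ a ∈ σ.B g, σ.kappa s s' a = a := by
    intro g hg hcg
    rcases hcg with hcg | hcg
    · exact exists_fixed_of_odd (h.cyc g hg) k2 k1 (k3 g hg (np hcg))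
        (by rw [h.card g hg]; exact odd_of_plain hc hcg)
    · exact (k5 g hg (nd hcg) (even_of_signColour hc hcg)).2 hcg
  rcases hdir with ⟨he, hf, hf'⟩ | ⟨he, hf, hf'⟩
  · -- joining two cycles
    have alf := ht.alive_of_tgt hf
    have alf' := ht.alive_of_tgt hf'
    obtain ⟨d1, d2, d3⟩ := ht.join_data he hf hf' hff
    have mk : ∀ (_ : c f ≠ Colour.dotted) (_ : c f' ≠ Colour.dotted),
        ∀ x ∈ σ.B f ∪ σ.B f', σ.kappa s s' x ∈ σ.B f ∪ σ.B f' := by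
      intro n1 n2 x hx
      rcases Finset.mem_union.1 hx with hx | hx
      · exact Finset.mem_union_left _ (k3 f alf n1 x hx)
      · exact Finset.mem_union_right _ (k3 f' alf' n2 x hx)
    rcases hpat with ⟨p1, p2, p3⟩ | ⟨p1, p2, p3⟩ | ⟨p1, p2, p3⟩ | ⟨p1, p2, p3⟩
    · obtain ⟨a, ha, hka⟩ := exfix f alf (Or.inl p2)
      obtain ⟨b, hb, hkb⟩ := exfix f' alf' (Or.inr p3)
      refine h.join ht hc he hf hf' hff ha hb (swap_comm_of_fixed hka hkb) (np p1)
        (mk (np p2) (nd p3)) fun hev => ?_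
      exact absurd (odd_of_plain hc p1) (Nat.not_odd_iff_even.2 hev)
    -- The picture with three even edges cannot occur, since some edge at `v` is odd.
    · exfalso
      obtain ⟨g, hg, hgo⟩ := hodd
      have : g = e ∨ g = f ∨ g = f' := by
        rcases hg with hg | hg
        · exact Or.inl ((d2 g).1 hg)
        · exact Or.inr ((d1 g).1 hg)
      rcases this with rfl | rfl | rfl
      · exact Nat.not_even_iff_odd.2 hgo (even_of_signColour hc p1)
      · exact Nat.not_even_iff_odd.2 hgo (even_of_signColour hc p2)
      · exact Nat.not_even_iff_odd.2 hgo (even_of_signColour hc p3)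
    -- Each odd cycle contains only one fixed point of `kappa`. The transposition exchanges these
    -- two, so the joined cycle has no fixed point, as the opposite colour requires.
    · obtain ⟨a, ha, hka⟩ := exfix f alf (Or.inl p2)
      obtain ⟨b, hb, hkb⟩ := exfix f' alf' (Or.inl p3)
      have hab : a ≠ b := by
        rintro rfl; exact hff (h.disj f f' a alf alf' ha hb)
      refine h.join ht hc he hf hf' hff ha hb (swap_comm_of_fixed hka hkb) (nd p1)
        (mk (np p2) (np p3)) fun _ => ?_
      rw [p1]
      refine ⟨?_, fun h' => absurd h' (signColour_neg_ne s')⟩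
      rintro ⟨x, hx, hfx⟩
      exfalso
      rw [Perm.mul_apply] at hfx
      have hfx' : σ.kappa s s' x = swap a b x := by
        rw [← hfx, swap_apply_self, hfx]
      rcases eq_or_ne x a with rfl | hxa
      · rw [swap_apply_left, hka] at hfx'; exact hab hfx'
      rcases eq_or_ne x b with rfl | hxb
      · rw [swap_apply_right, hkb] at hfx'; exact hab hfx'.symm
      rw [swap_apply_of_ne_of_ne hxa hxb] at hfx'
      rcases Finset.mem_union.1 hx with hx | hx
      · exact hxa (fixed_unique_of_odd (h.cyc f alf) k2 k1
          (by rw [h.card f alf]; exact odd_of_plain hc p2) hx ha hfx' hka)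
      · exact hxb (fixed_unique_of_odd (h.cyc f' alf') k2 k1
          (by rw [h.card f' alf']; exact odd_of_plain hc p3) hx hb hfx' hkb)
    · obtain ⟨g, hg⟩ := hc.dotted_mem f p2
      have hg : φ.SymPair f g := hg
      have hgf : g = f' := by
        rcases (d1 g).1 (hg.tgt ▸ hf) with h' | h'
        · exact absurd h'.symm hg.ne
        · exact h'
      subst hgf
      -- The two cycles are exchanged by `kappa`, so any point and its image have a transposition
      -- commuting with it.
      obtain ⟨a, ha⟩ := (h.cyc f alf).nonempty
      have hb := k4 f g alf p2 hg a ha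
      have hkk : σ.kappa s s' (σ.kappa s s' a) = a := by
        rw [← Perm.mul_apply, k1]; rfl
      refine h.join ht hc he hf hf' hff ha hb (swap_comm_of_exchanged rfl hkk) (nd p1) ?_ fun _ => ?_
      · intro x hx
        rcases Finset.mem_union.1 hx with hx | hx
        · exact Finset.mem_union_right _ (k4 f g alf p2 hg x hx)
        · exact Finset.mem_union_left _ (k4 g f alf' p3 hg.symm x hx)
      · refine ⟨fun _ => p1, fun _ => ⟨a, Finset.mem_union_left _ ha, ?_⟩⟩
        rw [Perm.mul_apply, swap_apply_right]
  · -- cutting a cycle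
    have ale := ht.alive_of_tgt he
    obtain ⟨d1, d2, d3⟩ := ht.cut_data he hf hf' hff
    have hkk : ∀ a, σ.kappa s s' (σ.kappa s s' a) = a := by
      intro a; rw [← Perm.mul_apply, k1]; rfl
    rcases hpat with ⟨p1, p2, p3⟩ | ⟨p1, p2, p3⟩ | ⟨p1, p2, p3⟩ | ⟨p1, p2, p3⟩
    -- On an odd cycle the reflection exchanges two points at any prescribed distance, here the
    -- weight of one of the new edges.
    · obtain ⟨a, ha, hka⟩ := exists_apply_eq_zpow (h.cyc e ale) k2 k1 (k3 e ale (np p1)) (φ.wt f)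
        (Or.inl (by rw [h.card e ale]; exact odd_of_plain hc p1))
      refine h.cut ht hc he hf hf' hff ha rfl (Or.inl ⟨?_, ?_, np p2, nd p3, ?_, fun _ => p3⟩)
      · simpa using hka
      · have h1 : (σ.ρ ^ φ.wt f) a = σ.kappa s s' a := by rw [hka, zpow_natCast]
        rw [h1, hkk]
      · intro hev
        exact absurd (odd_of_plain hc p2) (Nat.not_odd_iff_even.2 hev)
    · exfalso
      obtain ⟨g, hg, hgo⟩ := hodd
      have : g = e ∨ g = f ∨ g = f' := by
        rcases hg with hg | hg
        · exact Or.inr ((d1 g).1 hg)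
        · exact Or.inl ((d2 g).1 hg)
      rcases this with rfl | rfl | rfl
      · exact Nat.not_even_iff_odd.2 hgo (even_of_signColour hc p1)
      · exact Nat.not_even_iff_odd.2 hgo (even_of_signColour hc p2)
      · exact Nat.not_even_iff_odd.2 hgo (even_of_signColour hc p3)
    -- The edge to be cut has the opposite colour, so `kappa` has no fixed point on it and exchanges
    -- two points at any prescribed odd distance.
    · have hev := even_of_signColour hc p1
      have hno : ¬ ∃ x ∈ σ.B e, σ.kappa s s' x = x := by
        rw [k5 e ale (nd p1) hev, p1]
        exact signColour_neg_ne s'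
      obtain ⟨a, ha, hka⟩ := exists_apply_eq_zpow (h.cyc e ale) k2 k1 (k3 e ale (nd p1)) (φ.wt f)
        (Or.inr ⟨by exact_mod_cast odd_of_plain hc p2, by rwa [h.card e ale], hno⟩)
      refine h.cut ht hc he hf hf' hff ha rfl (Or.inl ⟨?_, ?_, np p2, np p3, ?_, ?_⟩)
      · simpa using hka
      · have h1 : (σ.ρ ^ φ.wt f) a = σ.kappa s s' a := by rw [hka, zpow_natCast]
        rw [h1, hkk]
      · intro hev
        exact absurd (odd_of_plain hc p2) (Nat.not_odd_iff_even.2 hev)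
      · intro hev
        exact absurd (odd_of_plain hc p3) (Nat.not_odd_iff_even.2 hev)
    · obtain ⟨g, hg⟩ := hc.dotted_mem f p2
      have hg : φ.SymPair f g := hg
      have hgf : g = f' := by
        rcases (d1 g).1 (hg.src ▸ hf) with h' | h'
        · exact absurd h'.symm hg.ne
        · exact h'
      subst hgf
      have hev := even_of_signColour hc p1
      -- The new edges have equal weights, so the second point of the transposition is antipodal to
      -- the fixed point `a`, and is fixed as well.
      obtain ⟨a, ha, hka⟩ := exfix e ale (Or.inr p1)
      refine h.cut ht hc he hf hf' hff ha rfl (Or.inr ⟨hka, ?_, p2, p3⟩)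
      rw [← zpow_natCast, reflect_zpow k2 k1, hka, (h.cyc e ale).zpow_apply_eq_iff ha, h.card e ale,
        ← d3, ← hg.wt]
      refine ⟨-1, ?_⟩
      push_cast
      ring

end Step

end Tuple


/-! ### The cycles to the left of all branch points -/

namespace Tuple

open Cover

section Init

variable {D r : ℕ} {E : Type} [Fintype E] {φ : Cover r E} {c : E → Colour}

/-- The sheets are identified with the residues modulo the weights of the in-ends. Integer
coordinates instead of residues allow a change of end without a change of type. -/
theorem exists_coordinates (hpos : ∀ e, 0 < φ.wt e) (hD : φ.inProfile.sum = D) :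
    ∃ P : {e // φ.src e = none} → ℤ → Fin D,
      (∀ e n e' n', P e n = P e' n' ↔ e = e' ∧ (φ.wt e.1 : ℤ) ∣ n - n') ∧
      ∀ x, ∃ e n, P e n = x := by
  classical
  have inst : ∀ e : {e // φ.src e = none}, NeZero (φ.wt e.1) := fun e => ⟨(hpos e.1).ne'⟩
  have hcard : Fintype.card (Σ e : {e // φ.src e = none}, ZMod (φ.wt e.1)) = Fintype.card (Fin D) := by
    rw [Fintype.card_sigma, Fintype.card_fin, ← hD, inProfile]
    have h1 : ∀ e : {e // φ.src e = none}, Fintype.card (ZMod (φ.wt e.1)) = φ.wt e.1 :=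
      fun e => ZMod.card _
    simp only [h1]
    symm
    exact Finset.sum_subtype (Finset.univ.filter fun e => φ.src e = none) (by simp) φ.wt
  let q := Fintype.equivOfCardEq hcard
  refine ⟨fun e n => q ⟨e, (n : ZMod (φ.wt e.1))⟩, ?_, ?_⟩
  · intro e n e' n'
    rw [q.injective.eq_iff]
    constructor
    · intro h
      have h1 : e = e' := congrArg Sigma.fst h
      subst h1
      refine ⟨rfl, ?_⟩
      have h2 := eq_of_heq (Sigma.mk.inj h).2
      have h3 := (ZMod.intCast_eq_intCast_iff_dvd_sub _ _ _).1 h2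
      rw [← dvd_neg, neg_sub] at h3
      exact h3
    · rintro ⟨rfl, h⟩
      congr 1
      rw [ZMod.intCast_eq_intCast_iff_dvd_sub, ← dvd_neg, neg_sub]
      exact h
  · intro x
    obtain ⟨⟨e, z⟩, rfl⟩ := q.surjective x
    exact ⟨e, z.cast, by simp⟩

/-- The rotation is `n ↦ n + 1`. The reflection is `n ↦ t - n` followed by the exchange of the two
ends of each dotted fork. On an even inverted end it has a fixed point exactly when `t` is even, so
`t` is 1 on red ends and 0 on all others. -/
theorem exists_inv_zero (ht : φ.IsTropical) (hc : φ.IsColouring c) (hD : φ.inProfile.sum = D) :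
    ∃ σ : State D E, Inv φ c 1 0 σ := by
  classical
  obtain ⟨P, hP, hsurj⟩ := exists_coordinates (φ := φ) ht.wt_pos hD
  have alive_iff : ∀ e, φ.Alive 0 e ↔ φ.src e = none := by
    intro e
    constructor
    · intro h
      cases hs : φ.src e with
      | none => rfl
      | some u => have := h.1; rw [hs] at this; simp [birth] at this
    · intro h
      exact ⟨by rw [h]; exact le_rfl, fun _ _ => Nat.zero_le _⟩
  choose re rn hre using hsurj
  have hP' : ∀ e n, P (re (P e n)) (rn (P e n)) = P e n := fun e n => hre _
  -- the rotation
  obtain ⟨ρ, hρ⟩ : ∃ ρ : Perm (Fin D), ∀ e n, ρ (P e n) = P e (n + 1) := by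
    -- The chosen coordinates of a point are only determined modulo the weight, and the formulas
    -- must not depend on the choice.
    have key : ∀ (k : ℤ) e n, P (re (P e n)) (rn (P e n) + k) = P e (n + k) := by
      intro k e n
      obtain ⟨h1, h2⟩ := (hP _ _ _ _).1 (hP' e n)
      exact (hP _ _ _ _).2 ⟨h1, by simpa using h2⟩
    refine ⟨⟨fun x => P (re x) (rn x + 1), fun x => P (re x) (rn x + -1), ?_, ?_⟩, ?_⟩
    · intro x
      simp only [key, add_assoc]
      simpa using hre x
    · intro x
      simp only [key, add_assoc]
      simpa using hre x
    · intro e n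
      exact key 1 e n
  -- the partner of a dotted end
  have hpart : ∀ e : {e // φ.src e = none}, ∃ f : {e // φ.src e = none},
      φ.wt f.1 = φ.wt e.1 ∧ c f.1 = c e.1 ∧ (c e.1 = Colour.dotted → φ.SymPair e.1 f.1) ∧
      (c e.1 ≠ Colour.dotted → f = e) := by
    intro e
    by_cases hd : c e.1 = Colour.dotted
    · obtain ⟨f, hf⟩ := hc.dotted_mem e.1 hd
      have hf' : φ.SymPair e.1 f := hf
      exact ⟨⟨f, hf'.src ▸ e.2⟩, hf'.wt.symm, by rw [hd, (hc.dotted_pair _ _ hf).1 hd],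
        fun _ => hf', fun h => absurd hd h⟩
    · exact ⟨e, rfl, rfl, fun h => absurd h hd, fun _ => rfl⟩
  choose π hπw hπc hπ1 hπ2 using hpart
  have hππ : ∀ e, π (π e) = e := by
    intro e
    by_cases hd : c e.1 = Colour.dotted
    · have h1 := hπ1 e hd
      have h2 := hπ1 (π e) (by rw [hπc, hd])
      exact Subtype.ext (ht.symPair_unique h2 h1.symm)
    · rw [hπ2 e hd, hπ2 e hd]
  let t : {e // φ.src e = none} → ℤ := fun e => if c e.1 = Colour.red then 1 else 0
  have htπ : ∀ e, t (π e) = t e := fun e => by simp only [t, hπc]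
  obtain ⟨lam, hlam⟩ : ∃ lam : Perm (Fin D), ∀ e n, lam (P e n) = P (π e) (t e - n) := by
    have key : ∀ e n, P (π (re (P e n))) (t (re (P e n)) - rn (P e n)) = P (π e) (t e - n) := by
      intro e n
      obtain ⟨h1, h2⟩ := (hP _ _ _ _).1 (hP' e n)
      rw [hP]
      refine ⟨by rw [h1], ?_⟩
      rw [hπw]
      have : t (re (P e n)) - rn (P e n) - (t e - n) = -(rn (P e n) - n) := by rw [h1]; ring
      rwa [this, dvd_neg]
    have hinv : Function.Involutive fun x => P (π (re x)) (t (re x) - rn x) := by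
      intro x
      simp only
      rw [key, hππ, htπ]
      simpa using hre x
    exact ⟨hinv.toPerm, fun e n => key e n⟩
  let B : E → Finset (Fin D) := fun e =>
    if h : φ.src e = none then Finset.univ.filter fun x => ∃ n, P ⟨e, h⟩ n = x else ∅
  have hB : ∀ e (h : φ.src e = none) x, x ∈ B e ↔ ∃ n, P ⟨e, h⟩ n = x := by
    intro e h x; simp [B, h]
  have hzpow : ∀ e (n : ℤ), (ρ ^ n) (P e 0) = P e n := by
    intro e n
    induction n using Int.induction_on with
    | zero => simp
    | succ i ih => rw [add_comm, zpow_add, Perm.mul_apply, ih, zpow_one, hρ, add_comm]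
    | pred i ih =>
      rw [sub_eq_neg_add, zpow_add, Perm.mul_apply, ih, zpow_neg_one, Perm.inv_eq_iff_eq, hρ]
      congr 1; ring
  refine ⟨⟨ρ, lam, B⟩, ?_, ?_, ?_, ?_, ?_, ?_, ?_, ?_, ?_⟩
  · ext x
    obtain ⟨e, n, rfl⟩ : ∃ e n, P e n = x := ⟨_, _, hre x⟩
    rw [Perm.mul_apply, hlam, hlam, hππ, htπ]
    simp
  · refine eq_inv_of_mul_eq_one_left ?_
    ext x
    obtain ⟨e, n, rfl⟩ : ∃ e n, P e n = x := ⟨_, _, hre x⟩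
    simp only [Perm.mul_apply]
    rw [hρ, hlam, hρ, hlam, hππ, htπ, Perm.one_apply]
    congr 2; ring
  · intro e he
    have hs := (alive_iff e).1 he
    refine ⟨P ⟨e, hs⟩ 0, fun y => ?_⟩
    rw [hB e hs]
    simp only [SameCycle, hzpow]
  · intro e he
    have hs := (alive_iff e).1 he
    have h1 : B e = (Finset.range (φ.wt e)).image fun j : ℕ => P ⟨e, hs⟩ j := by
      ext x
      rw [hB e hs, Finset.mem_image]
      constructor
      · rintro ⟨n, rfl⟩
        have hw : (0 : ℤ) < φ.wt e := by exact_mod_cast ht.wt_pos e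
        refine ⟨(n % φ.wt e).toNat, ?_, ?_⟩
        · rw [Finset.mem_range]
          have := Int.emod_lt_of_pos n hw
          have := Int.emod_nonneg n hw.ne'
          omega
        · rw [hP]
          refine ⟨rfl, ?_⟩
          rw [Int.toNat_of_nonneg (Int.emod_nonneg n hw.ne')]
          have := Int.dvd_self_sub_emod (x := n) (m := φ.wt e)
          rwa [← dvd_neg, neg_sub] at this
      · rintro ⟨j, -, rfl⟩
        exact ⟨j, rfl⟩
    simp only
    rw [h1, Finset.card_image_of_injOn, Finset.card_range]
    intro j hj l hl hjl
    have hj := Finset.mem_range.1 (Finset.mem_coe.1 hj)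
    have hl := Finset.mem_range.1 (Finset.mem_coe.1 hl)
    have h3 : (φ.wt e : ℤ) ∣ (j : ℤ) - l := ((hP _ _ _ _).1 hjl).2
    have := Int.eq_zero_of_abs_lt_dvd h3 (by rw [abs_lt]; constructor <;> omega)
    omega
  · intro x
    refine ⟨(re x).1, (alive_iff _).2 (re x).2, ?_⟩
    exact (hB _ (re x).2 x).2 ⟨rn x, hre x⟩
  · intro e f x he hf hxe hxf
    have hs := (alive_iff e).1 he
    have hs' := (alive_iff f).1 hf
    obtain ⟨n, hn⟩ := (hB e hs x).1 hxe
    obtain ⟨n', hn'⟩ := (hB f hs' x).1 hxf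
    have := ((hP _ _ _ _).1 (hn.trans hn'.symm)).1
    exact congrArg Subtype.val this
  · intro e he hce x hx
    have hs := (alive_iff e).1 he
    obtain ⟨n, rfl⟩ := (hB e hs x).1 hx
    refine (hB e hs _).2 ⟨t ⟨e, hs⟩ - n, ?_⟩
    rw [hlam, hπ2 _ hce]
  · intro e f he hce hef x hx
    have hs := (alive_iff e).1 he
    have hs' : φ.src f = none := hef.src ▸ hs
    obtain ⟨n, rfl⟩ := (hB e hs x).1 hx
    refine (hB f hs' _).2 ⟨t ⟨e, hs⟩ - n, ?_⟩
    have : π ⟨e, hs⟩ = ⟨f, hs'⟩ := Subtype.ext (ht.symPair_unique (hπ1 ⟨e, hs⟩ hce) hef)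
    rw [hlam, this]
  · intro e he hce hev
    have hs := (alive_iff e).1 he
    have h2 : (2 : ℤ) ∣ φ.wt e := by exact_mod_cast hev.two_dvd
    have ht' : t ⟨e, hs⟩ = if c e = Colour.red then 1 else 0 := rfl
    have hsc : signColour 1 = Colour.blue := by simp [signColour]
    rw [hsc]
    constructor
    · rintro ⟨x, hx, hfx⟩
      obtain ⟨n, rfl⟩ := (hB e hs x).1 hx
      rw [hlam, hP] at hfx
      rcases hc.even e hce hev with h | h
      · exfalso
        have h3 := hfx.2
        rw [hπw] at h3
        have h4 := h2.trans h3
        rw [ht', if_pos h] at h4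
        omega
      · exact h
    · intro h
      refine ⟨P ⟨e, hs⟩ 0, (hB e hs _).2 ⟨0, rfl⟩, ?_⟩
      rw [hlam, hπ2 _ hce, ht', if_neg (by rw [h]; simp)]
      simp

end Init

/-- `F` is a real factorization producing the coloured cover `(φ, c)`, where `B e` is the set of
elements of the cycle that gives the edge `e`. -/
structure Realizes {D r : ℕ} {E : Type} (F : Tuple D r) (ε : Fin r → ℤˣ) (φ : Cover r E)
    (c : E → Colour) (B : E → Finset (Fin D)) : Prop where
  prod_eq : F.σ₂ * F.prod r = 1
  isSwap : ∀ i, (F.τ i).IsSwap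
  involution : F.γ * F.γ = 1
  real : ∀ i ≤ r, F.gammaAt ε i * F.prod i * F.gammaAt ε i = (F.prod i)⁻¹
  cyc : ∀ i ≤ r, ∀ e, φ.Alive i e → IsCycleOf (F.prod i) (B e)
  card : ∀ e, (B e).card = φ.wt e
  cover : ∀ i ≤ r, ∀ x, ∃ e, φ.Alive i e ∧ x ∈ B e
  disj : ∀ i ≤ r, ∀ e f x, φ.Alive i e → φ.Alive i f → x ∈ B e → x ∈ B f → e = f
  pres : ∀ i ≤ r, ∀ e, φ.Alive i e → c e ≠ Colour.dotted → ∀ x ∈ B e, F.gammaAt ε i x ∈ B e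
  exch : ∀ i ≤ r, ∀ e f, φ.Alive i e → c e = Colour.dotted → φ.SymPair e f →
    ∀ x ∈ B e, F.gammaAt ε i x ∈ B f
  colr : ∀ i ≤ r, ∀ e, φ.Alive i e → c e ≠ Colour.dotted → Even (φ.wt e) →
    ((∃ x ∈ B e, F.gammaAt ε i x = x) ↔ (c e = Colour.red ↔ signAt ε i = 1))
  meets_old : ∀ v e, φ.Alive v.val e → (F.Meets v (B e) ↔ φ.tgt e = some v)
  meets_new : ∀ v e, φ.Alive (v.val + 1) e → (F.Meets v (B e) ↔ φ.src e = some v)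

/-! ### Existence of real factorizations -/

section Existence

variable {D r : ℕ} {E : Type} [Fintype E] {φ : Cover r E} {c : E → Colour} {ε : Fin r → ℤˣ}

theorem signAt_succ (v : Fin r) : signAt ε (v.val + 1) = ε v := by
  simp [signAt]

theorem exists_states (ht : φ.IsTropical) (hc : φ.IsColouring c) (hD : φ.inProfile.sum = D)
    (hs : ∀ v, φ.HasSign c v (ε v)) (hodd : ∀ v, ∃ e, φ.Inc e v ∧ Odd (φ.wt e)) :
    ∃ st : ℕ → State D E, (∀ i ≤ r, Inv φ c (signAt ε i) i (st i)) ∧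
      ∀ v : Fin r, Rel φ (signAt ε v.val) (ε v) v (st v.val) (st (v.val + 1)) := by
  obtain ⟨σ₀, h₀⟩ := exists_inv_zero ht hc hD
  -- Beyond the last vertex, or where the invariant fails, any state will do. This makes the
  -- successor function total and allows plain recursion.
  have hstep : ∀ (i : ℕ) (σ : State D E), ∃ σ' : State D E, ∀ h : i < r,
      Inv φ c (signAt ε i) i σ → Inv φ c (ε ⟨i, h⟩) (i + 1) σ' ∧
        Rel φ (signAt ε i) (ε ⟨i, h⟩) ⟨i, h⟩ σ σ' := by
    intro i σ
    by_cases h : i < r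
    · by_cases hi : Inv φ c (signAt ε i) i σ
      · obtain ⟨σ', h1, h2⟩ := Inv.exists_step (v := ⟨i, h⟩) ht hc hi (hs ⟨i, h⟩) (hodd ⟨i, h⟩)
        exact ⟨σ', fun _ _ => ⟨h1, h2⟩⟩
      · exact ⟨σ, fun _ h' => absurd h' hi⟩
    · exact ⟨σ, fun h' => absurd h' h⟩
  choose next hnext using hstep
  let st : ℕ → State D E := fun i => Nat.rec σ₀ (fun i σ => next i σ) i
  have hinv : ∀ i ≤ r, Inv φ c (signAt ε i) i (st i) := by
    intro i
    induction i with
    | zero => intro _; exact h₀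
    | succ i ih =>
      intro hi
      have h1 := (hnext i (st i) hi (ih (by omega))).1
      have h2 := signAt_succ (ε := ε) ⟨i, hi⟩
      rw [h2]
      exact h1
  exact ⟨st, hinv, fun v => (hnext v.val (st v.val) v.2 (hinv v.val v.2.le)).2⟩

/-- Every coloured cover all of whose vertices have an odd edge is produced by a real factorization. -/
theorem exists_realizes (ht : φ.IsTropical) (hc : φ.IsColouring c) (hD : φ.inProfile.sum = D)
    (hs : ∀ v, φ.HasSign c v (ε v)) (hodd : ∀ v, ∃ e, φ.Inc e v ∧ Odd (φ.wt e)) :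
    ∃ (F : Tuple D r) (B : E → Finset (Fin D)), F.Realizes ε φ c B := by
  obtain ⟨st, hinv, hrel⟩ := exists_states ht hc hD hs hodd
  -- The involution in the definition of real factorizations is `ρ⁻¹ * lam`. With `lam' = τ * κ` one
  -- gets `ρ'⁻¹ * lam' = ρ⁻¹ * κ`, which is `γ` for equal signs and `γ * ρ` otherwise, as prescribed
  -- by `gammaAt`.
  let F : Tuple D r := ⟨(st 0).ρ⁻¹ * (st 0).lam, (st 0).ρ,
    fun v => (st (v.val + 1)).ρ * (st v.val).ρ⁻¹, (st r).ρ⁻¹⟩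
  have hprod : ∀ i ≤ r, F.prod i = (st i).ρ := by
    intro i
    induction i with
    | zero => intro _; rfl
    | succ i ih =>
      intro hi
      have hlt : i < r := hi
      simp only [prod, hlt, dif_pos, ih hlt.le]
      simp [F]
  have hlamrho : ∀ i ≤ r, (st i).lam * (st i).ρ = (st i).ρ⁻¹ * (st i).lam := by
    intro i hi
    rw [← (hinv i hi).real, mul_assoc, (hinv i hi).invol, mul_one]
  have hgam : ∀ i ≤ r, F.gammaAt ε i = (st i).ρ⁻¹ * (st i).lam := by
    intro i
    induction i with
    | zero => intro _; rfl
    | succ i ih =>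
      intro hi
      have hlt : i < r := hi
      have h1 := (hrel ⟨i, hlt⟩).lam_eq
      have h2 := signAt_succ (ε := ε) ⟨i, hlt⟩
      simp only at h1 h2
      have h3 : (st (i + 1)).ρ⁻¹ * (st (i + 1)).lam =
          (st i).ρ⁻¹ * (st i).kappa (signAt ε i) (ε ⟨i, hlt⟩) := by
        rw [h1]; group
      rw [h3]
      simp only [gammaAt, h2, State.kappa, ih hlt.le, hprod i hlt.le]
      split_ifs
      · rfl
      · rw [mul_assoc, hlamrho i hlt.le]
  -- The set of an edge is not touched after the edge has appeared, so the family of the last state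
  -- serves for all times.
  have hB : ∀ i ≤ r, ∀ e, φ.Alive i e → (st r).B e = (st i).B e := by
    intro i hi e he
    have : ∀ k, i + k ≤ r → (st (i + k)).B e = (st i).B e := by
      intro k
      induction k with
      | zero => intro _; rfl
      | succ k ih =>
        intro hk
        rw [← ih (by omega)]
        refine (hrel ⟨i + k, by omega⟩).B_eq e fun hse => ?_
        have := he.1
        rw [hse] at this
        simp only [birth] at this
        omega
    have h := this (r - i) (by omega)
    rwa [Nat.add_sub_cancel' hi] at h
  have hbirth : ∀ e, birth (φ.src e) ≤ r := by
    intro e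
    cases φ.src e with
    | none => exact Nat.zero_le _
    | some u => exact u.2
  refine ⟨F, (st r).B, ⟨?_, ?_, ?_, ?_, ?_, ?_, ?_, ?_, ?_, ?_, ?_, ?_, ?_⟩⟩
  · rw [hprod r le_rfl]; simp [F]
  · exact fun v => (hrel v).isSwap
  · have h := hinv 0 (Nat.zero_le _)
    change (st 0).ρ⁻¹ * (st 0).lam * ((st 0).ρ⁻¹ * (st 0).lam) = 1
    rw [← h.real]
    calc _ = (st 0).lam * (st 0).ρ * ((st 0).lam * (st 0).lam) * (st 0).lam * (st 0).ρ *
          ((st 0).lam * (st 0).lam) := by simp only [mul_assoc]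
      _ = (st 0).lam * (st 0).ρ * (st 0).lam * (st 0).ρ := by rw [h.invol]; simp
      _ = 1 := by rw [h.real]; simp
  · intro i hi
    rw [hgam i hi, hprod i hi]
    have h := hinv i hi
    calc _ = (st i).ρ⁻¹ * (st i).lam * (st i).lam := by group
      _ = _ := by rw [mul_assoc, h.invol, mul_one]
  · intro i hi e he
    rw [hprod i hi, hB i hi e he]
    exact (hinv i hi).cyc e he
  · intro e
    have he := ht.alive_birth e
    rw [hB _ (hbirth e) e he]
    exact (hinv _ (hbirth e)).card e he
  · intro i hi x
    obtain ⟨e, he, hx⟩ := (hinv i hi).cover x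
    exact ⟨e, he, by rwa [hB i hi e he]⟩
  · intro i hi e f x he hf hxe hxf
    rw [hB i hi e he] at hxe
    rw [hB i hi f hf] at hxf
    exact (hinv i hi).disj e f x he hf hxe hxf
  · intro i hi e he hce x hx
    rw [hB i hi e he] at hx ⊢
    rw [hgam i hi]
    exact ((hinv i hi).cyc e he).inv_apply_mem ((hinv i hi).pres e he hce x hx)
  · intro i hi e f he hce hef x hx
    have hf : φ.Alive i f := by
      unfold Cover.Alive at he ⊢
      rwa [← hef.src, ← hef.tgt]
    rw [hB i hi e he] at hx
    rw [hB i hi f hf, hgam i hi]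
    exact ((hinv i hi).cyc f hf).inv_apply_mem ((hinv i hi).exch e f he hce hef x hx)
  · intro i hi e he hce hev
    have h := hinv i hi
    rw [hB i hi e he, hgam i hi, exists_fixed_iff_of_even (h.cyc e he) h.real h.invol
      (h.pres e he hce) (by rwa [h.card e he]), h.colr e he hce hev]
    rcases Int.units_eq_one_or (signAt ε i) with h1 | h1 <;> rw [h1] <;>
      rcases hc.even e hce hev with h2 | h2 <;> rw [h2] <;> simp [signColour]
  · intro v e he
    rw [hB v.val v.2.le e he]
    exact (hrel v).meets_old e he
  · intro v e he
    rw [hB (v.val + 1) v.2 e he]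
    exact (hrel v).meets_new e he

end Existence

/-! ### The cover and the cycle types of a realization -/

section Consequences

variable {D r : ℕ} {E : Type} [Fintype E] {φ : Cover r E} {c : E → Colour} {ε : Fin r → ℤˣ}
  {F : Tuple D r} {B : E → Finset (Fin D)}

theorem birth_le (s : Option (Fin r)) : birth s ≤ r := by
  cases s with
  | none => exact Nat.zero_le _
  | some u => exact u.2

/-- The sets of the edges alive at a given time are all the cycles at that time, and those moved by
the last transposition belong to the edges that start at its vertex. -/
theorem Realizes.isEdge_iff (ht : φ.IsTropical) (h : F.Realizes ε φ c B)
    (p : Option (Fin r) × Finset (Fin D)) : F.IsEdge p ↔ ∃ e, φ.src e = p.1 ∧ B e = p.2 := by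
  obtain ⟨s, A⟩ := p
  constructor
  · rintro ⟨h1, h2⟩
    simp only at h1 h2 ⊢
    cases s with
    | none =>
      obtain ⟨x, hx⟩ := h1.nonempty
      obtain ⟨e, he, hxe⟩ := h.cover 0 (Nat.zero_le _) x
      refine ⟨e, ?_, (h.cyc 0 (Nat.zero_le _) e he).eq_of_mem h1 hxe hx⟩
      cases hs : φ.src e with
      | none => rfl
      | some u => have := he.1; rw [hs] at this; simp [birth] at this
    | some u =>
      obtain ⟨x, hx, hxu⟩ := h2 u rfl
      obtain ⟨e, he, hxe⟩ := h.cover (u.val + 1) u.2 x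
      exact ⟨e, (h.meets_new u e he).1 ⟨x, hxe, hxu⟩, (h.cyc _ u.2 e he).eq_of_mem h1 hxe hx⟩
  · rintro ⟨e, he, hA⟩
    simp only at he hA
    subst he hA
    have ha := ht.alive_birth e
    refine ⟨h.cyc _ (birth_le _) e ha, fun i hi => ?_⟩
    simp only at hi
    rw [hi] at ha
    exact (h.meets_new i e ha).2 hi

/-- An edge is recovered from its source and its set of sheets, since distinct edges alive at the
same time have disjoint sets. Its target is the first later vertex whose transposition meets this
set. -/
theorem Realizes.produces (ht : φ.IsTropical) (hc : φ.IsColouring c) (h : F.Realizes ε φ c B) :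
    F.Produces ε φ c := by
  classical
  have hedge : ∀ e, F.IsEdge (φ.src e, B e) := fun e => (h.isEdge_iff ht _).2 ⟨e, rfl, rfl⟩
  let θ : E → {p // F.IsEdge p} := fun e => ⟨(φ.src e, B e), hedge e⟩
  have hbij : Function.Bijective θ := by
    constructor
    · intro e f hef
      have h1 : (φ.src e, B e) = (φ.src f, B f) := congrArg Subtype.val hef
      have hs : φ.src e = φ.src f := congrArg Prod.fst h1
      have hB : B e = B f := congrArg Prod.snd h1
      have he := ht.alive_birth e
      have hf := ht.alive_birth f
      rw [← hs] at hf
      obtain ⟨x, hx⟩ := (h.cyc _ (birth_le _) e he).nonempty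
      exact h.disj _ (birth_le _) e f x he hf hx (hB ▸ hx)
    · rintro ⟨p, hp⟩
      obtain ⟨e, he, hA⟩ := (h.isEdge_iff ht _).1 hp
      exact ⟨e, Subtype.ext (Prod.ext he hA)⟩
  have htgt : ∀ e, F.cover.tgt (θ e) = φ.tgt e := by
    intro e
    have hnot : ∀ j : Fin r, birth (φ.src e) ≤ j.val → (∀ k, φ.tgt e = some k → j ≤ k) →
        (F.Meets j (B e) ↔ φ.tgt e = some j) := by
      intro j hj hk
      exact h.meets_old j e ⟨hj, fun k hk' => hk k hk'⟩
    change (if h : (F.deaths (φ.src e) (B e)).Nonempty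
      then some ((F.deaths (φ.src e) (B e)).min' h) else none) = φ.tgt e
    cases hte : φ.tgt e with
    | none =>
      rw [dif_neg]
      rintro ⟨j, hj⟩
      simp only [deaths, Finset.mem_filter, Finset.mem_univ, true_and] at hj
      have := (hnot j hj.1 (by intro k hk; rw [hte] at hk; cases hk)).1 hj.2
      rw [hte] at this; cases this
    | some v =>
      have hal := ht.alive_of_tgt hte
      have hv : v ∈ F.deaths (φ.src e) (B e) := by
        simp only [deaths, Finset.mem_filter, Finset.mem_univ, true_and]
        exact ⟨hal.1, (h.meets_old v e hal).2 hte⟩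
      rw [dif_pos ⟨v, hv⟩]
      congr 1
      refine le_antisymm (Finset.min'_le _ _ hv) (Finset.le_min' _ _ _ fun j hj => ?_)
      simp only [deaths, Finset.mem_filter, Finset.mem_univ, true_and] at hj
      by_contra hlt
      have hlt := not_le.1 hlt
      have := (hnot j hj.1 (by intro k hk; rw [hte] at hk; cases hk; exact hlt.le)).1 hj.2
      rw [hte] at this
      cases this
      exact lt_irrefl _ hlt
  let Θ := Equiv.ofBijective θ hbij
  refine ⟨Θ.symm, fun p => ?_⟩
  obtain ⟨e, rfl⟩ := Θ.surjective p
  rw [Equiv.symm_apply_apply]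
  refine ⟨rfl, (htgt e).symm, (h.card e).symm, ?_⟩
  change c e = F.colour ε (φ.src e, B e)
  have he := ht.alive_birth e
  have hbl := birth_le (φ.src e)
  unfold colour
  simp only
  by_cases hd : c e = Colour.dotted
  · rw [if_pos, hd]
    obtain ⟨f, hf⟩ := hc.dotted_mem e hd
    have hf : φ.SymPair e f := hf
    intro himg
    obtain ⟨x, hx⟩ := (h.cyc _ hbl e he).nonempty
    have h1 := h.exch _ hbl e f he hd hf x hx
    have h2 : F.gammaAt ε (birth (φ.src e)) x ∈ B e := by
      rw [← himg]; exact Finset.mem_image_of_mem _ hx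
    refine hf.ne (h.disj _ hbl e f _ he ?_ h2 h1)
    unfold Cover.Alive at he ⊢
    rwa [← hf.src, ← hf.tgt]
  · have himg : (B e).image (F.gammaAt ε (birth (φ.src e))) = B e := by
      apply Finset.eq_of_subset_of_card_le
      · intro y hy
        obtain ⟨x, hx, rfl⟩ := Finset.mem_image.1 hy
        exact h.pres _ hbl e he hd x hx
      · rw [Finset.card_image_of_injective _ (Equiv.injective _)]
    rw [if_neg (not_not.2 himg), h.card e]
    by_cases ho : Odd (φ.wt e)
    · rw [if_pos ho]; exact hc.odd e hd ho
    · rw [if_neg ho]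
      have hev := Nat.not_odd_iff_even.1 ho
      have hcol := h.colr _ hbl e he hd hev
      rcases hc.even e hd hev with h1 | h1
      · rw [if_pos]
        · exact h1
        · rw [hcol, h1]; simp
      · rw [if_neg]
        · exact h1
        · rw [hcol, h1]
          simp

theorem prod_mem_closure {i : ℕ} :
    F.prod i ∈ Subgroup.closure ({F.σ₁, F.σ₂} ∪ Set.range F.τ) := by
  induction i with
  | zero => exact Subgroup.subset_closure (Or.inl (Or.inl rfl))
  | succ i ih =>
    simp only [prod]
    split_ifs with h
    · exact mul_mem (Subgroup.subset_closure (Or.inr ⟨_, rfl⟩)) ih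
    · exact ih

/-- The sheets on one edge form a cycle of some partial product. Two edges with a common vertex both
contain a point moved by its transposition, and the moved points lie in one orbit. Connectedness of
the graph does the rest. -/
theorem Realizes.transitive (ht : φ.IsTropical) (h : F.Realizes ε φ c B) :
    MulAction.IsPretransitive (Subgroup.closure ({F.σ₁, F.σ₂} ∪ Set.range F.τ)) (Fin D) := by
  set G := Subgroup.closure ({F.σ₁, F.σ₂} ∪ Set.range F.τ) with hG
  have hcyc : ∀ e, ∀ x ∈ B e, ∀ y ∈ B e, MulAction.orbitRel G (Fin D) x y := by
    intro e x hx y hy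
    obtain ⟨n, hn⟩ := (h.cyc _ (birth_le _) e (ht.alive_birth e)).exists_zpow hy hx
    exact ⟨⟨F.prod _ ^ n, zpow_mem prod_mem_closure n⟩, hn⟩
  have hvert : ∀ (v : Fin r) (e : E), φ.Inc e v → ∃ x ∈ B e, F.τ v x ≠ x := by
    intro v e he
    rcases he with he | he
    · exact (h.meets_new v e (ht.alive_succ_of_src he)).2 he
    · exact (h.meets_old v e (ht.alive_of_tgt he)).2 he
  have hshare : ∀ e f, (∃ v, φ.Inc e v ∧ φ.Inc f v) → ∃ x ∈ B e, ∃ y ∈ B f,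
      MulAction.orbitRel G (Fin D) x y := by
    rintro e f ⟨v, he, hf⟩
    obtain ⟨x, hx, hxv⟩ := hvert v e he
    obtain ⟨y, hy, hyv⟩ := hvert v f hf
    refine ⟨x, hx, y, hy, ?_⟩
    obtain ⟨a, b, hab, hsw⟩ := h.isSwap v
    have hmem : F.τ v ∈ G := Subgroup.subset_closure (Or.inr ⟨v, rfl⟩)
    have key : ∀ z, F.τ v z ≠ z → z = a ∨ z = b := by
      intro z hz
      by_contra hcon
      push Not at hcon
      exact hz (by rw [hsw, swap_apply_of_ne_of_ne hcon.1 hcon.2])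
    rcases key x hxv with rfl | rfl <;> rcases key y hyv with rfl | rfl
    · exact ⟨1, one_smul _ _⟩
    · exact ⟨⟨F.τ v, hmem⟩, by change F.τ v _ = _; rw [hsw, swap_apply_right]⟩
    · exact ⟨⟨F.τ v, hmem⟩, by change F.τ v _ = _; rw [hsw, swap_apply_left]⟩
    · exact ⟨1, one_smul _ _⟩
  have hconn : ∀ e f, φ.ConnIn Set.univ e f → ∀ x ∈ B e, ∀ y ∈ B f,
      MulAction.orbitRel G (Fin D) x y := by
    intro e f hef
    induction hef with
    | refl => exact hcyc e
    | tail _ hstep ih =>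
      intro x hx y hy
      obtain ⟨-, -, hv⟩ := hstep
      obtain ⟨z, hz, w, hw, hzw⟩ := hshare _ _ hv
      exact Setoid.trans' _ (ih x hx z hz) (Setoid.trans' _ hzw (hcyc _ w hw y hy))
  refine ⟨fun x y => ?_⟩
  obtain ⟨e, -, he⟩ := h.cover 0 (Nat.zero_le _) x
  obtain ⟨f, -, hf⟩ := h.cover 0 (Nat.zero_le _) y
  obtain ⟨g, hg⟩ := hconn f e (ht.connected f e) y hf x he
  exact ⟨g, hg⟩

theorem Realizes.parts_prod (h : F.Realizes ε φ c B) {i : ℕ} (hi : i ≤ r) {p : E → Prop}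
    [DecidablePred p] (hp : ∀ e, φ.Alive i e ↔ p e) :
    (F.prod i).partition.parts = (Finset.univ.filter p).val.map φ.wt := by
  have h1 := partition_parts_eq (ρ := F.prod i) (fun e : {e // p e} => B e.1)
    (fun e => h.cyc i hi e.1 ((hp _).2 e.2))
    (fun x => by
      obtain ⟨e, he, hx⟩ := h.cover i hi x
      exact ⟨⟨e, (hp e).1 he⟩, hx⟩)
    (fun e f x hx hx' => Subtype.ext
      (h.disj i hi e.1 f.1 x ((hp _).2 e.2) ((hp _).2 f.2) hx hx'))
  rw [h1]
  simp only [h.card]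
  have h2 : (Finset.univ.filter p).val = (Finset.univ : Finset {e // p e}).val.map Subtype.val := by
    have : Finset.univ.filter p = (Finset.univ : Finset {e // p e}).map
        (Function.Embedding.subtype p) := by
      ext e; simp
    rw [this]; rfl
  rw [h2, Multiset.map_map]
  rfl

theorem Realizes.parts_first (h : F.Realizes ε φ c B) :
    F.σ₁.partition.parts = φ.inProfile := by
  refine h.parts_prod (Nat.zero_le _) fun e => ?_
  unfold Cover.Alive
  cases φ.src e <;> simp [birth]

theorem Realizes.parts_last (h : F.Realizes ε φ c B) :
    F.σ₂.partition.parts = φ.outProfile := by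
  have h1 : F.σ₂ = (F.prod r)⁻¹ := eq_inv_of_mul_eq_one_left h.prod_eq
  have h2 : F.σ₂.partition.parts = (F.prod r).partition.parts := by
    rw [h1, parts_partition, parts_partition, cycleType_inv, support_inv]
  rw [h2]
  refine h.parts_prod le_rfl fun e => ?_
  unfold Cover.Alive
  constructor
  · intro h'
    cases hs : φ.tgt e with
    | none => rfl
    | some v => have := h'.2 v hs; omega
  · intro h'
    exact ⟨birth_le _, fun j hj => by rw [h'] at hj; cases hj⟩

end Consequences

end Tuple


/-! ### Relabelling the sheets -/

namespace Tuple

open Cover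

section Conj

variable {D r : ℕ}

/-- Relabelling the sheets of a factorization. -/
def conj (π : Perm (Fin D)) (F : Tuple D r) : Tuple D r where
  γ := π * F.γ * π⁻¹
  σ₁ := π * F.σ₁ * π⁻¹
  τ i := π * F.τ i * π⁻¹
  σ₂ := π * F.σ₂ * π⁻¹

theorem prod_conj (π : Perm (Fin D)) (F : Tuple D r) (i : ℕ) :
    (conj π F).prod i = π * F.prod i * π⁻¹ := by
  induction i with
  | zero => rfl
  | succ i ih =>
    simp only [prod]
    split_ifs
    · rw [ih]; simp only [conj]; group
    · exact ih

theorem gammaAt_conj (π : Perm (Fin D)) (F : Tuple D r) (ε : Fin r → ℤˣ) (i : ℕ) :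
    (conj π F).gammaAt ε i = π * F.gammaAt ε i * π⁻¹ := by
  induction i with
  | zero => rfl
  | succ i ih =>
    simp only [gammaAt]
    split_ifs
    · exact ih
    · rw [ih, prod_conj]; group

theorem isCycleOf_conj {π ρ : Perm (Fin D)} {B : Finset (Fin D)} (h : IsCycleOf ρ B) :
    IsCycleOf (π * ρ * π⁻¹) (B.map π.toEmbedding) := by
  obtain ⟨x, hx⟩ := h
  refine ⟨π x, fun y => ?_⟩
  rw [sameCycle_conj, Finset.mem_map_equiv, hx]
  have : π⁻¹ (π x) = x := by simp
  rw [this]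
  rfl

theorem meets_conj (π : Perm (Fin D)) (F : Tuple D r) (i : Fin r) (B : Finset (Fin D)) :
    (conj π F).Meets i (B.map π.toEmbedding) ↔ F.Meets i B := by
  constructor
  · rintro ⟨x, hx, h⟩
    obtain ⟨y, hy, rfl⟩ := Finset.mem_map.1 hx
    refine ⟨y, hy, fun h' => h ?_⟩
    simp [conj, h']
  · rintro ⟨x, hx, h⟩
    refine ⟨π x, Finset.mem_map_of_mem _ hx, fun h' => h ?_⟩
    simpa [conj] using h'

theorem Realizes.conj {E : Type} {φ : Cover r E} {c : E → Colour} {ε : Fin r → ℤˣ} {F : Tuple D r}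
    {B : E → Finset (Fin D)} (h : F.Realizes ε φ c B) (π : Perm (Fin D)) :
    (conj π F).Realizes ε φ c fun e => (B e).map π.toEmbedding := by
  have mem : ∀ {x : Fin D} {S : Finset (Fin D)}, x ∈ S.map π.toEmbedding ↔ ∃ y ∈ S, π y = x := by
    intro x S; rw [Finset.mem_map]; rfl
  have happ : ∀ {f : Perm (Fin D)} {y : Fin D}, (π * f * π⁻¹) (π y) = π (f y) := by
    intro f y; simp
  refine ⟨?_, ?_, ?_, ?_, ?_, ?_, ?_, ?_, ?_, ?_, ?_, ?_, ?_⟩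
  · rw [prod_conj]
    calc _ = π * (F.σ₂ * F.prod r) * π⁻¹ := by simp only [Tuple.conj]; group
      _ = 1 := by rw [h.prod_eq]; simp
  · intro i
    obtain ⟨a, b, hab, hs⟩ := h.isSwap i
    refine ⟨π a, π b, π.injective.ne hab, ?_⟩
    simp only [Tuple.conj]
    rw [hs, mul_swap_eq_swap_mul, mul_inv_cancel_right]
  · calc _ = π * (F.γ * F.γ) * π⁻¹ := by simp only [Tuple.conj]; group
      _ = 1 := by rw [h.involution]; simp
  · intro i hi
    rw [prod_conj, gammaAt_conj]
    calc _ = π * (F.gammaAt ε i * F.prod i * F.gammaAt ε i) * π⁻¹ := by group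
      _ = _ := by rw [h.real i hi]; group
  · intro i hi e he
    rw [prod_conj]
    exact isCycleOf_conj (h.cyc i hi e he)
  · intro e
    rw [Finset.card_map, h.card e]
  · intro i hi x
    obtain ⟨e, he, hx⟩ := h.cover i hi (π⁻¹ x)
    exact ⟨e, he, mem.2 ⟨_, hx, by simp⟩⟩
  · intro i hi e f x he hf hx hx'
    obtain ⟨y, hy, rfl⟩ := mem.1 hx
    obtain ⟨y', hy', h'⟩ := mem.1 hx'
    rw [π.injective h'] at hy'
    exact h.disj i hi e f y he hf hy hy'
  · intro i hi e he hce x hx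
    obtain ⟨y, hy, rfl⟩ := mem.1 hx
    rw [gammaAt_conj, happ]
    exact mem.2 ⟨_, h.pres i hi e he hce y hy, rfl⟩
  · intro i hi e f he hce hef x hx
    obtain ⟨y, hy, rfl⟩ := mem.1 hx
    rw [gammaAt_conj, happ]
    exact mem.2 ⟨_, h.exch i hi e f he hce hef y hy, rfl⟩
  · intro i hi e he hce hev
    rw [← h.colr i hi e he hce hev, gammaAt_conj]
    constructor
    · rintro ⟨x, hx, hfx⟩
      obtain ⟨y, hy, rfl⟩ := mem.1 hx
      rw [happ] at hfx
      exact ⟨y, hy, π.injective hfx⟩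
    · rintro ⟨y, hy, hfy⟩
      exact ⟨π y, mem.2 ⟨y, hy, rfl⟩, by rw [happ, hfy]⟩
  · intro v e he
    rw [meets_conj]
    exact h.meets_old v e he
  · intro v e he
    rw [meets_conj]
    exact h.meets_new v e he

instance : Finite (Tuple D r) := by
  let f : Tuple D r → Perm (Fin D) × Perm (Fin D) × (Fin r → Perm (Fin D)) × Perm (Fin D) :=
    fun F => (F.γ, F.σ₁, F.τ, F.σ₂)
  refine Finite.of_injective f ?_
  rintro ⟨a, b, c, d⟩ ⟨a', b', c', d'⟩ h
  simp only [f, Prod.mk.injEq] at h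
  obtain ⟨rfl, rfl, rfl, rfl⟩ := h
  rfl

/-- A permutation fixing a point and commuting with a transitive group is trivial. -/
theorem conj_injective {F : Tuple D r}
    (ht : MulAction.IsPretransitive (Subgroup.closure ({F.σ₁, F.σ₂} ∪ Set.range F.τ)) (Fin D))
    {π π' : Perm (Fin D)} {x : Fin D} (hx : π x = x) (hx' : π' x = x)
    (h : conj π F = conj π' F) : π = π' := by
  have key : ∀ f ∈ ({F.σ₁, F.σ₂} ∪ Set.range F.τ : Set (Perm (Fin D))),
      (π'⁻¹ * π) * f = f * (π'⁻¹ * π) := by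
    have aux : ∀ f : Perm (Fin D), π * f * π⁻¹ = π' * f * π'⁻¹ →
        (π'⁻¹ * π) * f = f * (π'⁻¹ * π) := by
      intro f hf
      calc (π'⁻¹ * π) * f = π'⁻¹ * (π * f * π⁻¹) * π := by group
        _ = f * (π'⁻¹ * π) := by rw [hf]; group
    rintro f ((rfl | rfl) | ⟨i, rfl⟩)
    · exact aux _ (congrArg Tuple.σ₁ h)
    · exact aux _ (congrArg Tuple.σ₂ h)
    · exact aux _ (congrFun (congrArg Tuple.τ h) i)
  have key2 : ∀ f ∈ Subgroup.closure ({F.σ₁, F.σ₂} ∪ Set.range F.τ),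
      f ∈ Subgroup.centralizer {π'⁻¹ * π} := by
    rw [← SetLike.le_def, Subgroup.closure_le]
    intro f hf
    rw [SetLike.mem_coe, Subgroup.mem_centralizer_iff]
    intro g hg
    rw [Set.mem_singleton_iff.1 hg]
    exact key f hf
  have hfix : (π'⁻¹ * π) x = x := by
    rw [Perm.mul_apply, hx, Perm.inv_eq_iff_eq, hx']
  have : π'⁻¹ * π = 1 := by
    ext y
    obtain ⟨⟨g, hg⟩, rfl⟩ := ht.exists_smul_eq x y
    have h1 := Subgroup.mem_centralizer_iff.1 (key2 g hg) _ rfl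
    have h2 := congrArg (fun f : Perm (Fin D) => f x) h1
    simp only [Perm.mul_apply] at h2
    change ((π'⁻¹ * π) (g x)).val = (g x).val
    rw [Perm.mul_apply, h2, ← Perm.mul_apply π'⁻¹, hfix]
  rw [inv_mul_eq_one] at this
  exact this.symm

/-- All permutations of `S` fix the point `x` outside `S`, so by transitivity the conjugated tuples
are pairwise different. -/
theorem factorial_card_le_ncard {F : Tuple D r} (X : Set (Tuple D r)) (S : Finset (Fin D))
    (ht : MulAction.IsPretransitive (Subgroup.closure ({F.σ₁, F.σ₂} ∪ Set.range F.τ)) (Fin D))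
    {x : Fin D} (hx : x ∉ S)
    (hX : ∀ π : Perm (Fin D), (∀ y, y ∉ S → π y = y) → conj π F ∈ X) :
    S.card.factorial ≤ X.ncard := by
  classical
  let f : Perm {y // y ∈ S} → Tuple D r := fun p => conj (ofSubtype p) F
  have hfix : ∀ (p : Perm {y // y ∈ S}) (y : Fin D), y ∉ S → ofSubtype p y = y :=
    fun p y hy => ofSubtype_apply_of_not_mem p hy
  have hinj : Function.Injective f := fun p q hpq =>
    ofSubtype_injective (conj_injective ht (hfix p x hx) (hfix q x hx) hpq)
  have hsub : Set.range f ⊆ X := by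
    rintro _ ⟨p, rfl⟩
    exact hX _ (hfix p)
  calc S.card.factorial = Fintype.card (Perm {y // y ∈ S}) := by
        rw [Fintype.card_perm, Fintype.card_coe]
    _ = (Set.range f).ncard := by
        rw [← Nat.card_eq_fintype_card, ← Nat.card_range_of_injective hinj,
          Nat.card_coe_set_eq]
    _ ≤ X.ncard := Set.ncard_le_ncard hsub (Set.toFinite _)

/-- The labels are given in the order of first appearance as a value of `b`, points that never
appear coming before all others. By `h₁`, if `a i` appears at all, it does so before the index `i`.
By `h₂` equal values of `b` are consecutive, so that this is even before the first appearance of `b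
i`. -/
theorem exists_label {k : ℕ} (a b : Fin k → Fin D) (h₁ : ∀ i j, i ≤ j → b j ≠ a i)
    (h₂ : ∀ i l j, i < l → l < j → b i = b j → b l = b i) :
    ∃ π : Perm (Fin D), (∀ i, π (a i) < π (b i)) ∧ ∀ i j, i ≤ j → π (b i) ≤ π (b j) := by
  classical
  let C : Fin D → Finset (Fin k) := fun x => Finset.univ.filter fun i => b i = x
  let key : Fin D → ℕ := fun x => if h : (C x).Nonempty then ((C x).min' h).val + 1 else 0
  have hC : ∀ {x i}, i ∈ C x ↔ b i = x := by intro x i; simp [C]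
  have hne : ∀ i, (C (b i)).Nonempty := fun i => ⟨i, hC.2 rfl⟩
  have hkb : ∀ i, key (b i) = ((C (b i)).min' (hne i)).val + 1 := fun i => dif_pos (hne i)
  have hmin : ∀ i, b ((C (b i)).min' (hne i)) = b i := fun i => hC.1 (Finset.min'_mem _ _)
  have hle : ∀ i j, b j = b i → (C (b i)).min' (hne i) ≤ j :=
    fun i j h => Finset.min'_le _ _ (hC.2 h)
  -- `key ∘ π` is monotone, so the relabelling that increases with `key` is the inverse of `π`.
  let π := _root_.Tuple.sort key
  have hmono : Monotone (key ∘ π) := _root_.Tuple.monotone_sort key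
  have hlt : ∀ x y, key x < key y → π⁻¹ x < π⁻¹ y := by
    intro x y h
    by_contra hcon
    have := hmono (not_lt.1 hcon)
    have e1 : ∀ z, (key ∘ π) (π⁻¹ z) = key z := fun z => by simp
    rw [e1, e1] at this
    omega
  refine ⟨π⁻¹, fun i => hlt _ _ ?_, fun i j hij => ?_⟩
  · rw [hkb]
    by_cases hn : (C (a i)).Nonempty
    · have h3 : key (a i) = ((C (a i)).min' hn).val + 1 := dif_pos hn
      rw [h3]
      set l := (C (a i)).min' hn with hl
      have hbl : b l = a i := hC.1 (Finset.min'_mem _ hn)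
      set f := (C (b i)).min' (hne i) with hf
      have hbf : b f = b i := hmin i
      have hfi : f ≤ i := hle i i rfl
      have hli : l < i := by
        by_contra hcon
        exact h₁ i l (not_lt.1 hcon) hbl
      have : l < f := by
        by_contra hcon
        rcases (not_lt.1 hcon).lt_or_eq with h4 | h4
        · have := h₂ f l i h4 hli hbf
          rw [hbl, hbf] at this
          exact h₁ i i le_rfl this.symm
        · rw [h4] at hbf
          rw [hbl] at hbf
          exact h₁ i i le_rfl hbf.symm
      have : l.val < f.val := this
      omega
    · have h3 : key (a i) = 0 := dif_neg hn
      omega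
  · by_cases hb : b i = b j
    · rw [hb]
    · refine (hlt _ _ ?_).le
      rw [hkb, hkb]
      set f := (C (b i)).min' (hne i) with hf
      set f' := (C (b j)).min' (hne j) with hf'
      have hbf : b f = b i := hmin i
      have hbf' : b f' = b j := hmin j
      have hfi : f ≤ i := hle i i rfl
      have hne' : i ≠ j := fun h => hb (congrArg b h)
      have : f < f' := by
        by_contra hcon
        rcases (not_lt.1 hcon).lt_or_eq with h4 | h4
        · have := h₂ f' i j (h4.trans_le hfi) (lt_of_le_of_ne hij hne') hbf'
          rw [hbf'] at this
          exact hb this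
        · rw [h4, hbf] at hbf'
          exact hb hbf'
      have : f.val < f'.val := this
      omega

theorem swap_eq_swap_right {a b a' b' : Fin D} (h : swap a b = swap a' b') (hab : a < b)
    (hab' : a' < b') : b = b' := by
  have h1 : swap a' b' a = b := by rw [← h, swap_apply_left]
  have h2 : swap a' b' b = a := by rw [← h, swap_apply_right]
  rcases eq_or_ne a a' with rfl | hne
  · rw [← h1, swap_apply_left]
  rcases eq_or_ne a b' with rfl | hne'
  · rw [swap_apply_right] at h1
    subst h1
    exact absurd hab hab'.asymm
  · rw [swap_apply_of_ne_of_ne hne hne'] at h1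
    exact absurd h1 hab.ne

theorem isMixed_conj {F : Tuple D r} {k : ℕ} (hk : k ≤ r) (a b : Fin k → Fin D)
    (hτ : ∀ i, F.τ (Fin.castLE hk i) = swap (a i) (b i)) {π : Perm (Fin D)}
    (h₁ : ∀ i, π (a i) < π (b i)) (h₂ : ∀ i j, i ≤ j → π (b i) ≤ π (b j)) :
    (conj π F).IsMixed k := by
  have key : ∀ (i : Fin k) (x y : Fin D), x < y → (conj π F).τ (Fin.castLE hk i) = swap x y →
      y = π (b i) := by
    intro i x y hxy h
    simp only [conj, hτ, mul_swap_eq_swap_mul, mul_inv_cancel_right] at h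
    exact swap_eq_swap_right h.symm hxy (h₁ i)
  intro i j hij hj x y x' y' hxy hxy' hi hj'
  have e1 : i = Fin.castLE hk ⟨i.val, by omega⟩ := rfl
  have e2 : j = Fin.castLE hk ⟨j.val, hj⟩ := rfl
  rw [e1] at hi
  rw [e2] at hj'
  rw [key _ _ _ hxy hi, key _ _ _ hxy' hj']
  exact h₂ _ _ (by change i.val ≤ j.val; omega)

/-- A relabelling that fixes the points moved by the first `k` transpositions commutes with them and
leaves them unchanged. -/
theorem IsMixed.conj {F : Tuple D r} {k : ℕ} (h : F.IsMixed k) {π : Perm (Fin D)}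
    (hπ : ∀ i : Fin r, i.val < k → ∀ x, F.τ i x ≠ x → π x = x) : (conj π F).IsMixed k := by
  have key : ∀ i : Fin r, i.val < k → (Tuple.conj π F).τ i = F.τ i := by
    intro i hi
    ext x
    have hd : Disjoint π (F.τ i) := by
      intro y
      by_cases hy : F.τ i y = y
      · exact Or.inr hy
      · exact Or.inl (hπ i hi y hy)
    simp only [Tuple.conj]
    rw [hd.commute.eq, mul_inv_cancel_right]
  intro i j hij hj a b a' b' hab hab' hi hj'
  rw [key i (by omega)] at hi
  rw [key j hj] at hj'
  exact h i j hij hj a b a' b' hab hab' hi hj'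

end Conj

end Tuple


/-! ### Strings with tails -/

/-- Names for the edges of a cover along a string: `str i` is the `i`-th edge of the string, and
`tl i j b` are the edges (one or two) of the `j`-th segment of the tail at the `i`-th vertex. -/
inductive Edg where
  | str (i : ℕ)
  | tl (i j : ℕ) (b : Bool)

/-- A string with tails: `s i` is the weight of the `i`-th edge of the string, positive if it is
traversed from left to right; `δ i` is the weight of the tail at the `i`-th vertex, positive for
in-tails; `len i` is the number of inner vertices of this tail off the string. -/
structure Walk where
  n : ℕ
  s : ℕ → ℤ
  δ : ℕ → ℤ
  len : ℕ → ℕ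

namespace Walk

/-- The compatibilities between the weights of a string and its tails. -/
structure Valid (W : Walk) : Prop where
  step : ∀ i < W.n, W.s (i + 1) = W.s i + W.δ (i + 1)
  odd : ∀ i ≤ W.n, Odd (W.s i)
  even : ∀ i, 1 ≤ i → i ≤ W.n → Even (W.δ i)
  ne_zero : ∀ i, 1 ≤ i → i ≤ W.n → W.δ i ≠ 0
  half : ∀ i, 1 ≤ i → i ≤ W.n → 0 < W.len i → Odd ((W.δ i).natAbs / 2)
  pos_zero : 0 < W.s 0
  pos_last : 0 < W.s W.n

/-- The names that belong to an edge. -/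
def IsName (W : Walk) : Edg → Prop
  | Edg.str i => i ≤ W.n
  | Edg.tl i j b => 1 ≤ i ∧ i ≤ W.n ∧ j ≤ W.len i ∧ (b = true → Odd j)

/-- The weights of the ends of a tail. -/
def tailEnds (d : ℤ) (l : ℕ) : Multiset ℕ :=
  if Even l then {d.natAbs} else {d.natAbs / 2, d.natAbs / 2}

end Walk

/-- `φ` is the cover given by the string with tails `W`, where `pt i j` is the `j`-th vertex of the
tail at the `i`-th vertex `pt i 0` of the string, and `ed` names the edges. -/
structure IsModel {r : ℕ} {E : Type} (φ : Cover r E) (W : Walk) (pt : ℕ → ℕ → Option (Fin r))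
    (ed : Edg → E) : Prop where
  valid : W.Valid
  pt_iff : ∀ i j, (∃ v, pt i j = some v) ↔ 1 ≤ i ∧ i ≤ W.n ∧ j ≤ W.len i
  pt_inj : ∀ i j i' j' v, pt i j = some v → pt i' j' = some v → i = i' ∧ j = j'
  pt_surj : ∀ v, ∃ i j, pt i j = some v
  ed_inj : ∀ x y, W.IsName x → W.IsName y → ed x = ed y → x = y
  ed_surj : ∀ e, ∃ x, W.IsName x ∧ ed x = e
  src_str : ∀ i ≤ W.n, φ.src (ed (Edg.str i)) = if 0 < W.s i then pt i 0 else pt (i + 1) 0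
  tgt_str : ∀ i ≤ W.n, φ.tgt (ed (Edg.str i)) = if 0 < W.s i then pt (i + 1) 0 else pt i 0
  src_tl : ∀ i j b, W.IsName (Edg.tl i j b) →
    φ.src (ed (Edg.tl i j b)) = if 0 < W.δ i then pt i (j + 1) else pt i j
  tgt_tl : ∀ i j b, W.IsName (Edg.tl i j b) →
    φ.tgt (ed (Edg.tl i j b)) = if 0 < W.δ i then pt i j else pt i (j + 1)
  wt_str : ∀ i ≤ W.n, φ.wt (ed (Edg.str i)) = (W.s i).natAbs
  wt_tl : ∀ i j b, W.IsName (Edg.tl i j b) →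
    φ.wt (ed (Edg.tl i j b)) = if Even j then (W.δ i).natAbs else (W.δ i).natAbs / 2
  lt : ∀ e u v, φ.src e = some u → φ.tgt e = some v → u < v

namespace Cover

theorem ConnIn.symm {r : ℕ} {E : Type} {φ : Cover r E} {A : Set E} {e f : E}
    (h : φ.ConnIn A e f) : φ.ConnIn A f e := by
  induction h with
  | refl => exact Relation.ReflTransGen.refl
  | tail _ hs ih =>
    obtain ⟨h1, h2, v, h3, h4⟩ := hs
    exact Relation.ReflTransGen.head ⟨h2, h1, v, h4, h3⟩ ih

theorem ConnIn.trans {r : ℕ} {E : Type} {φ : Cover r E} {A : Set E} {e f g : E}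
    (h : φ.ConnIn A e f) (h' : φ.ConnIn A f g) : φ.ConnIn A e g :=
  Relation.ReflTransGen.trans h h'

theorem ConnIn.of_inc {r : ℕ} {E : Type} {φ : Cover r E} {A : Set E} {e f : E} (he : e ∈ A)
    (hf : f ∈ A) {v : Fin r} (hv : φ.Inc e v) (hv' : φ.Inc f v) : φ.ConnIn A e f :=
  Relation.ReflTransGen.single ⟨he, hf, v, hv, hv'⟩

end Cover

namespace IsModel

open Edg

variable {r : ℕ} {E : Type} {φ : Cover r E} {W : Walk} {pt : ℕ → ℕ → Option (Fin r)} {ed : Edg → E}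
  (M : IsModel φ W pt ed)
include M

theorem s_ne {i : ℕ} (hi : i ≤ W.n) : W.s i ≠ 0 := by
  obtain ⟨k, hk⟩ := M.valid.odd i hi
  omega

theorem pt_some {i j : ℕ} (h1 : 1 ≤ i) (h2 : i ≤ W.n) (h3 : j ≤ W.len i) : ∃ v, pt i j = some v :=
  (M.pt_iff i j).2 ⟨h1, h2, h3⟩

/-- The value `none` outside the range is what turns the first and last edge of the string and the
last segment of each tail into ends, without separate clauses. -/
theorem pt_none {i j : ℕ} (h : ¬ (1 ≤ i ∧ i ≤ W.n ∧ j ≤ W.len i)) : pt i j = none := by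
  rw [← M.pt_iff] at h
  cases hp : pt i j with
  | none => rfl
  | some v => exact absurd ⟨v, hp⟩ h

theorem inc_str {i : ℕ} (hi : i ≤ W.n) (v : Fin r) :
    φ.Inc (ed (str i)) v ↔ pt i 0 = some v ∨ pt (i + 1) 0 = some v := by
  unfold Cover.Inc
  rw [M.src_str i hi, M.tgt_str i hi]
  split_ifs
  · rfl
  · exact or_comm

theorem inc_tl {i j : ℕ} {b : Bool} (h : W.IsName (tl i j b)) (v : Fin r) :
    φ.Inc (ed (tl i j b)) v ↔ pt i j = some v ∨ pt i (j + 1) = some v := by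
  unfold Cover.Inc
  rw [M.src_tl i j b h, M.tgt_tl i j b h]
  split_ifs
  · exact or_comm
  · rfl

theorem inc_str_iff {i i' j' : ℕ} (hi : i ≤ W.n) {v : Fin r} (hv : pt i' j' = some v) :
    φ.Inc (ed (str i)) v ↔ j' = 0 ∧ (i = i' ∨ i + 1 = i') := by
  rw [M.inc_str hi]
  constructor
  · rintro (h | h)
    · obtain ⟨rfl, rfl⟩ := M.pt_inj _ _ _ _ v hv h
      exact ⟨rfl, Or.inl rfl⟩
    · obtain ⟨rfl, rfl⟩ := M.pt_inj _ _ _ _ v hv h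
      exact ⟨rfl, Or.inr rfl⟩
  · rintro ⟨rfl, rfl | rfl⟩
    · exact Or.inl hv
    · exact Or.inr hv

theorem inc_tl_iff {i j i' j' : ℕ} {b : Bool} (h : W.IsName (tl i j b)) {v : Fin r}
    (hv : pt i' j' = some v) :
    φ.Inc (ed (tl i j b)) v ↔ i = i' ∧ (j = j' ∨ j + 1 = j') := by
  rw [M.inc_tl h]
  constructor
  · rintro (h | h)
    · obtain ⟨rfl, rfl⟩ := M.pt_inj _ _ _ _ v hv h
      exact ⟨rfl, Or.inl rfl⟩
    · obtain ⟨rfl, rfl⟩ := M.pt_inj _ _ _ _ v hv h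
      exact ⟨rfl, Or.inr rfl⟩
  · rintro ⟨rfl, rfl | rfl⟩
    · exact Or.inl hv
    · exact Or.inr hv

theorem inc_string_vertex {i : ℕ} {v : Fin r} (hv : pt i 0 = some v) (e : E) :
    φ.Inc e v ↔ e = ed (str (i - 1)) ∨ e = ed (str i) ∨ e = ed (tl i 0 false) := by
  obtain ⟨h1, h2, h3⟩ := (M.pt_iff i 0).1 ⟨v, hv⟩
  have hn : W.IsName (tl i 0 false) := ⟨h1, h2, h3, by simp⟩
  constructor
  · intro h
    obtain ⟨x, hx, rfl⟩ := M.ed_surj e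
    cases x with
    | str l =>
      obtain ⟨-, rfl | rfl⟩ := (M.inc_str_iff hx hv).1 h
      · exact Or.inr (Or.inl rfl)
      · exact Or.inl rfl
    | tl l m b =>
      obtain ⟨rfl, hm⟩ := (M.inc_tl_iff hx hv).1 h
      have hm : m = 0 := by omega
      subst hm
      have hb : b = false := by
        cases b with
        | false => rfl
        | true => exact absurd (hx.2.2.2 rfl) (by simp)
      subst hb
      exact Or.inr (Or.inr rfl)
  · rintro (rfl | rfl | rfl)
    · exact (M.inc_str_iff (by omega) hv).2 ⟨rfl, Or.inr (by omega)⟩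
    · exact (M.inc_str_iff h2 hv).2 ⟨rfl, Or.inl rfl⟩
    · exact (M.inc_tl_iff hn hv).2 ⟨rfl, Or.inl rfl⟩

/-- The edges at a vertex of a tail off the string: the segment with one edge is `tl i p false`, the
other one `q`. -/
theorem inc_tail_vertex {i j p q : ℕ} {v : Fin r} (hv : pt i (j + 1) = some v) (hp : Even p)
    (hpq : p = j ∧ q = j + 1 ∨ p = j + 1 ∧ q = j) (e : E) :
    φ.Inc e v ↔ e = ed (tl i p false) ∨ e = ed (tl i q false) ∨ e = ed (tl i q true) := by
  obtain ⟨h1, h2, h3⟩ := (M.pt_iff i (j + 1)).1 ⟨v, hv⟩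
  have hq : Odd q := by
    rcases hpq with ⟨rfl, rfl⟩ | ⟨h, rfl⟩
    · exact hp.add_one
    · rw [h] at hp
      rw [← Nat.not_even_iff_odd]
      intro h'
      exact Nat.not_even_iff_odd.2 h'.add_one hp
  constructor
  · intro h
    obtain ⟨x, hx, rfl⟩ := M.ed_surj e
    cases x with
    | str l =>
      have := (M.inc_str_iff hx hv).1 h
      omega
    | tl l m b =>
      obtain ⟨rfl, hm⟩ := (M.inc_tl_iff hx hv).1 h
      have hm : m = p ∨ m = q := by omega
      rcases hm with rfl | rfl
      · have hb : b = false := by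
          cases b with
          | false => rfl
          | true => exact absurd hp (Nat.not_even_iff_odd.2 (hx.2.2.2 rfl))
        subst hb
        exact Or.inl rfl
      · cases b with
        | false => exact Or.inr (Or.inl rfl)
        | true => exact Or.inr (Or.inr rfl)
  · rintro (rfl | rfl | rfl)
    · exact (M.inc_tl_iff ⟨h1, h2, by omega, by simp⟩ hv).2 ⟨rfl, by omega⟩
    · exact (M.inc_tl_iff ⟨h1, h2, by omega, by simp⟩ hv).2 ⟨rfl, by omega⟩
    · exact (M.inc_tl_iff ⟨h1, h2, by omega, fun _ => hq⟩ hv).2 ⟨rfl, by omega⟩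

theorem connIn_str {a b : ℕ} (hab : a ≤ b) (hb : b ≤ W.n) {A : Set E}
    (hA : ∀ i, a ≤ i → i ≤ b → ed (str i) ∈ A) : φ.ConnIn A (ed (str a)) (ed (str b)) := by
  induction b, hab using Nat.le_induction with
  | base => exact Relation.ReflTransGen.refl
  | succ m hm ih =>
    refine (ih (by omega) fun i h1 h2 => hA i h1 (by omega)).trans ?_
    obtain ⟨v, hv⟩ := M.pt_some (i := m + 1) (j := 0) (by omega) hb (Nat.zero_le _)
    exact Cover.ConnIn.of_inc (hA m hm (by omega)) (hA (m + 1) (by omega) le_rfl)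
      ((M.inc_str (by omega) v).2 (Or.inr hv)) ((M.inc_str hb v).2 (Or.inl hv))

theorem connected (e f : E) : φ.ConnIn Set.univ e f := by
  have key : ∀ e, φ.ConnIn Set.univ (ed (str 0)) e := by
    intro e
    obtain ⟨x, hx, rfl⟩ := M.ed_surj e
    cases x with
    | str l => exact M.connIn_str (Nat.zero_le _) hx fun _ _ _ => Set.mem_univ _
    | tl i j b =>
      have hi : i ≤ W.n := hx.2.1
      refine (M.connIn_str (Nat.zero_le i) hi fun _ _ _ => Set.mem_univ _).trans ?_
      have h0 : ∀ m b, W.IsName (tl i m b) → φ.ConnIn Set.univ (ed (str i)) (ed (tl i m b)) := by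
        intro m
        induction m with
        | zero =>
          intro b hb
          obtain ⟨v, hv⟩ := M.pt_some (i := i) (j := 0) hx.1 hi (Nat.zero_le _)
          exact Cover.ConnIn.of_inc (Set.mem_univ _) (Set.mem_univ _)
            ((M.inc_str hi v).2 (Or.inl hv)) ((M.inc_tl hb v).2 (Or.inl hv))
        | succ m ih =>
          intro b hb
          have hm : W.IsName (tl i m false) := ⟨hb.1, hb.2.1, (Nat.le_succ m).trans hb.2.2.1, by simp⟩
          refine (ih false hm).trans ?_
          obtain ⟨v, hv⟩ := M.pt_some (i := i) (j := m + 1) hx.1 hi hb.2.2.1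
          exact Cover.ConnIn.of_inc (Set.mem_univ _) (Set.mem_univ _)
            ((M.inc_tl hm v).2 (Or.inr hv)) ((M.inc_tl hb v).2 (Or.inl hv))
      exact h0 j b hx
  exact (key e).symm.trans (key f)

theorem ed_ne {x y : Edg} (hx : W.IsName x) (hy : W.IsName y) (h : x ≠ y) : ed x ≠ ed y :=
  fun h' => h (M.ed_inj x y hx hy h')

theorem two_mul_half {i : ℕ} (h1 : 1 ≤ i) (h2 : i ≤ W.n) :
    (W.δ i).natAbs / 2 + (W.δ i).natAbs / 2 = (W.δ i).natAbs := by
  obtain ⟨k, hk⟩ := M.valid.even i h1 h2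
  omega

theorem isTropical [Fintype E] : φ.IsTropical := by
  classical
  have hbal : ∀ (v : Fin r) (a b c : E), a ≠ b → a ≠ c → b ≠ c →
      (∀ e, φ.Inc e v ↔ e = a ∨ e = b ∨ e = c) →
      ((if φ.tgt a = some v then φ.wt a else 0) + (if φ.tgt b = some v then φ.wt b else 0) +
        (if φ.tgt c = some v then φ.wt c else 0) =
      (if φ.src a = some v then φ.wt a else 0) + (if φ.src b = some v then φ.wt b else 0) +
        (if φ.src c = some v then φ.wt c else 0)) →
      ∑ e with φ.tgt e = some v, φ.wt e = ∑ e with φ.src e = some v, φ.wt e := by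
    intro v a b c hab hac hbc hinc h
    have key : ∀ (p : E → Prop) [DecidablePred p], (∀ e, p e → φ.Inc e v) → ∑ e with p e, φ.wt e =
        (if p a then φ.wt a else 0) + (if p b then φ.wt b else 0) +
          (if p c then φ.wt c else 0) := by
      intro p _ hp
      rw [Finset.sum_filter]
      have h3 : ∑ e ∈ ({a, b, c} : Finset E), (if p e then φ.wt e else 0) =
          ∑ e, if p e then φ.wt e else 0 := by
        refine Finset.sum_subset (Finset.subset_univ _) fun e _ he => if_neg fun hpe => he ?_
        have := (hinc e).1 (hp e hpe)
        simpa using this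
      rw [← h3, Finset.sum_insert (by simp [hab, hac]), Finset.sum_pair hbc, add_assoc]
    rw [key _ fun e he => Or.inr he, key _ fun e he => Or.inl he]
    exact h
  have hdata : ∀ v, ∃ a b c : E, (∀ e, φ.Inc e v ↔ e = a ∨ e = b ∨ e = c) ∧
      a ≠ b ∧ a ≠ c ∧ b ≠ c ∧
      ((if φ.tgt a = some v then φ.wt a else 0) + (if φ.tgt b = some v then φ.wt b else 0) +
        (if φ.tgt c = some v then φ.wt c else 0) =
      (if φ.src a = some v then φ.wt a else 0) + (if φ.src b = some v then φ.wt b else 0) +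
        (if φ.src c = some v then φ.wt c else 0)) := by
    intro v
    obtain ⟨i, j, hv⟩ := M.pt_surj v
    obtain ⟨h1, h2, h3⟩ := (M.pt_iff i j).1 ⟨v, hv⟩
    have ptne : ∀ {a b : ℕ}, (a ≠ i ∨ b ≠ j) → ¬ pt a b = some v := by
      intro a b hab h
      have := M.pt_inj _ _ _ _ v h hv
      omega
    cases j with
    | zero =>
      have hn : W.IsName (tl i 0 false) := ⟨h1, h2, h3, by simp⟩
      have hn1 : W.IsName (str (i - 1)) := by change i - 1 ≤ W.n; omega
      have hn2 : W.IsName (str i) := h2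
      refine ⟨_, _, _, M.inc_string_vertex hv, M.ed_ne hn1 hn2 (by simp; omega),
        M.ed_ne hn1 hn (by simp), M.ed_ne hn2 hn (by simp), ?_⟩
      rw [M.src_str _ hn1, M.tgt_str _ hn1, M.src_str _ hn2, M.tgt_str _ hn2, M.src_tl _ _ _ hn,
        M.tgt_tl _ _ _ hn, M.wt_str _ hn1, M.wt_str _ hn2, M.wt_tl _ _ _ hn]
      have e1 : i - 1 + 1 = i := by omega
      have n1 : ¬ pt (i - 1) 0 = some v := ptne (Or.inl (by omega))
      have n2 : ¬ pt (i + 1) 0 = some v := ptne (Or.inl (by omega))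
      have n3 : ¬ pt i (0 + 1) = some v := ptne (Or.inr (by omega))
      have hs := M.valid.step (i - 1) (by omega)
      rw [e1] at hs
      rw [e1]
      have z1 := M.s_ne hn1
      have z2 := M.s_ne hn2
      have z3 := M.valid.ne_zero i h1 h2
      -- In every sign pattern balancing is the equation `s i = s (i - 1) + δ i`: the signs decide
      -- on which side of the vertex each edge lies.
      rcases lt_or_gt_of_ne z1 with a1 | a1 <;> rcases lt_or_gt_of_ne z2 with a2 | a2 <;>
        rcases lt_or_gt_of_ne z3 with a3 | a3 <;>
        simp only [a1, a2, a3, if_true, not_lt.2 a1.le, not_lt.2 a2.le, not_lt.2 a3.le, if_false, hv,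
          n1, n2, n3, Even.zero] <;> omega
    | succ j =>
      obtain ⟨p, q, hp, hpq⟩ : ∃ p q, Even p ∧ (p = j ∧ q = j + 1 ∨ p = j + 1 ∧ q = j) := by
        rcases Nat.even_or_odd j with h | h
        · exact ⟨j, j + 1, h, Or.inl ⟨rfl, rfl⟩⟩
        · exact ⟨j + 1, j, h.add_one, Or.inr ⟨rfl, rfl⟩⟩
      have hq : ¬ Even q := by
        rcases hpq with ⟨rfl, rfl⟩ | ⟨rfl, rfl⟩
        · exact Nat.not_even_iff_odd.2 hp.add_one
        · intro h
          exact Nat.not_even_iff_odd.2 h.add_one hp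
      have hn1 : W.IsName (tl i p false) := ⟨h1, h2, by omega, by simp⟩
      have hn2 : W.IsName (tl i q false) := ⟨h1, h2, by omega, by simp⟩
      have hn3 : W.IsName (tl i q true) := ⟨h1, h2, by omega, fun _ => Nat.not_even_iff_odd.1 hq⟩
      have hpq' : p ≠ q := by omega
      refine ⟨_, _, _, M.inc_tail_vertex hv hp hpq, M.ed_ne hn1 hn2 (by simp; omega),
        M.ed_ne hn1 hn3 (by simp), M.ed_ne hn2 hn3 (by simp), ?_⟩
      rw [M.src_tl _ _ _ hn1, M.tgt_tl _ _ _ hn1, M.src_tl _ _ _ hn2, M.tgt_tl _ _ _ hn2,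
        M.src_tl _ _ _ hn3, M.tgt_tl _ _ _ hn3, M.wt_tl _ _ _ hn1, M.wt_tl _ _ _ hn2,
        M.wt_tl _ _ _ hn3]
      have n1 : ¬ pt i j = some v := ptne (Or.inr (by omega))
      have n3 : ¬ pt i (j + 1 + 1) = some v := ptne (Or.inr (by omega))
      have hh := M.two_mul_half h1 h2
      rcases hpq with ⟨rfl, rfl⟩ | ⟨rfl, rfl⟩ <;> by_cases a3 : 0 < W.δ i <;>
        simp only [a3, if_true, if_false, hv, n1, n3, hp, hq] <;> omega
  refine ⟨?_, M.lt, ?_, ?_, ⟨ed (str 0)⟩, M.connected⟩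
  · intro e
    obtain ⟨x, hx, rfl⟩ := M.ed_surj e
    cases x with
    | str i =>
      rw [M.wt_str i hx]
      have := M.s_ne hx
      omega
    | tl i j b =>
      rw [M.wt_tl i j b hx]
      have := M.valid.ne_zero i hx.1 hx.2.1
      have := M.two_mul_half hx.1 hx.2.1
      split_ifs <;> omega
  · intro v
    obtain ⟨a, b, c, hinc, hab, hac, hbc, -⟩ := hdata v
    rw [Set.ncard_eq_three]
    refine ⟨a, b, c, hab, hac, hbc, ?_⟩
    ext e
    simpa using hinc e
  · intro v
    obtain ⟨a, b, c, hinc, hab, hac, hbc, h⟩ := hdata v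
    exact hbal v a b c hab hac hbc hinc h

/-- The edges of the string. -/
theorem not_symPair_str {i : ℕ} (hi : i ≤ W.n) (f : E) : ¬ φ.SymPair (ed (str i)) f := by
  intro h
  obtain ⟨x, hx, rfl⟩ := M.ed_surj f
  have hinc : ∀ v, φ.Inc (ed (str i)) v ↔ φ.Inc (ed x) v := by
    intro v; unfold Cover.Inc; rw [h.src, h.tgt]
  cases x with
  | tl l m b =>
    obtain ⟨v, hv⟩ := M.pt_some hx.1 hx.2.1 hx.2.2.1
    have h1 := (hinc v).2 ((M.inc_tl hx v).2 (Or.inl hv))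
    have hm : m = 0 := ((M.inc_str_iff hi hv).1 h1).1
    have hw := h.wt
    rw [M.wt_str i hi, M.wt_tl l m b hx, hm, if_pos Even.zero] at hw
    have h2 := M.valid.odd i hi
    have h3 := M.valid.even l hx.1 hx.2.1
    rw [← Int.natAbs_odd, hw, Int.natAbs_odd] at h2
    exact Int.not_even_iff_odd.2 h2 h3
  | str l =>
    -- Edges of the string with the same endpoints can only be the first two, with `n = 1`. But then
    -- both run to the right, one into the vertex and the other out of it.
    have key : ∀ {i l : ℕ}, i ≤ W.n → l ≤ W.n → i < l → ¬ φ.SymPair (ed (str i)) (ed (str l)) := by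
      intro i l hi hl hil h
      have hinc : ∀ v, φ.Inc (ed (str i)) v ↔ φ.Inc (ed (str l)) v := by
        intro v; unfold Cover.Inc; rw [h.src, h.tgt]
      obtain ⟨v, hv⟩ := M.pt_some (i := l) (j := 0) (by omega) hl (Nat.zero_le _)
      have h1 := (hinc v).2 ((M.inc_str hl v).2 (Or.inl hv))
      have h2 := (M.inc_str_iff hi hv).1 h1
      have h0 : i = 0 := by
        by_contra h0
        obtain ⟨u, hu⟩ := M.pt_some (i := i) (j := 0) (by omega) hi (Nat.zero_le _)
        have h3 := (hinc u).1 ((M.inc_str hi u).2 (Or.inl hu))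
        have h4 := (M.inc_str_iff hl hu).1 h3
        omega
      have hl1 : l = 1 := by omega
      subst h0 hl1
      have hs := h.src
      rw [M.src_str 0 (by omega), M.src_str 1 hl, if_pos M.valid.pos_zero, M.pt_none (by omega)] at hs
      split_ifs at hs with h5
      · rw [hv] at hs; cases hs
      · by_cases hn : W.n = 1
        · have := M.valid.pos_last
          rw [hn] at this
          exact h5 this
        · obtain ⟨u, hu⟩ := M.pt_some (i := 1 + 1) (j := 0) (by omega) (by omega) (Nat.zero_le _)
          rw [hu] at hs; cases hs
    rcases lt_trichotomy i l with hlt | rfl | hlt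
    · exact key hi hx hlt h
    · exact h.ne rfl
    · exact key hx hi hlt h.symm

/-- Induction on the number `k` of vertices beyond the even segment `j`. None means an even end, one
means a fork, and otherwise a symmetric cycle is split off, which uses up two vertices. -/
theorem isTail {i : ℕ} (h1 : 1 ≤ i) (h2 : i ≤ W.n) {s : Cover.Side}
    (hs : s = if 0 < W.δ i then Cover.Side.left else Cover.Side.right) :
    ∀ k j, W.len i = j + k → Even j → φ.IsTail s (ed (tl i j false))
      {e | ∃ m b, j ≤ m ∧ W.IsName (tl i m b) ∧ ed (tl i m b) = e} := by
  have hnear : ∀ j b, W.IsName (tl i j b) → φ.near s (ed (tl i j b)) = pt i j := by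
    intro j b h
    rw [hs]
    split_ifs with h3
    · simp only [Cover.near]; rw [M.tgt_tl i j b h, if_pos h3]
    · simp only [Cover.near]; rw [M.src_tl i j b h, if_neg h3]
  have hfar : ∀ j b, W.IsName (tl i j b) → φ.far s (ed (tl i j b)) = pt i (j + 1) := by
    intro j b h
    rw [hs]
    split_ifs with h3
    · simp only [Cover.far]; rw [M.src_tl i j b h, if_pos h3]
    · simp only [Cover.far]; rw [M.tgt_tl i j b h, if_neg h3]
  intro k
  induction k using Nat.strong_induction_on with
  | _ k ih =>
  intro j hk hj
  have hn : W.IsName (tl i j false) := ⟨h1, h2, by omega, by simp⟩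
  have bfalse : ∀ {b}, W.IsName (tl i j b) → b = false := by
    intro b hb
    cases b with
    | false => rfl
    | true => exact absurd (hb.2.2.2 rfl) (Nat.not_odd_iff_even.2 hj)
  by_cases hk0 : k = 0
  · have : {e | ∃ m b, j ≤ m ∧ W.IsName (tl i m b) ∧ ed (tl i m b) = e} = {ed (tl i j false)} := by
      ext e
      constructor
      · rintro ⟨m, b, hm, hb, rfl⟩
        have hm' : m = j := by have := hb.2.2.1; omega
        subst hm'
        rw [bfalse hb]; rfl
      · rintro rfl
        exact ⟨j, false, le_rfl, hn, rfl⟩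
    rw [this]
    refine Cover.IsTail.single _ ?_ ?_
    · rw [hfar j false hn]
      exact M.pt_none (by omega)
    · rw [M.wt_tl _ _ _ hn, if_pos hj, Int.natAbs_even]
      exact M.valid.even i h1 h2
  · have hj1 : Odd (j + 1) := hj.add_one
    have hne : ¬ Even (j + 1) := Nat.not_even_iff_odd.2 hj1
    have hn1 : W.IsName (tl i (j + 1) false) := ⟨h1, h2, by omega, by simp⟩
    have hn2 : W.IsName (tl i (j + 1) true) := ⟨h1, h2, by omega, fun _ => hj1⟩
    obtain ⟨v, hv⟩ := M.pt_some (i := i) (j := j + 1) h1 h2 (by omega)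
    have hodd : Odd (φ.wt (ed (tl i (j + 1) false))) := by
      rw [M.wt_tl _ _ _ hn1, if_neg hne]
      exact M.valid.half i h1 h2 (by omega)
    have hwt : φ.wt (ed (tl i (j + 1) false)) = φ.wt (ed (tl i (j + 1) true)) := by
      rw [M.wt_tl _ _ _ hn1, M.wt_tl _ _ _ hn2]
    have hff : ed (tl i (j + 1) false) ≠ ed (tl i (j + 1) true) := M.ed_ne hn1 hn2 (by simp)
    by_cases hk1 : k = 1
    · have : {e | ∃ m b, j ≤ m ∧ W.IsName (tl i m b) ∧ ed (tl i m b) = e} =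
          {ed (tl i j false), ed (tl i (j + 1) false), ed (tl i (j + 1) true)} := by
        ext e
        constructor
        · rintro ⟨m, b, hm, hb, rfl⟩
          have hm' : m = j ∨ m = j + 1 := by have := hb.2.2.1; omega
          rcases hm' with rfl | rfl
          · rw [bfalse hb]; exact Or.inl rfl
          · cases b with
            | false => exact Or.inr (Or.inl rfl)
            | true => exact Or.inr (Or.inr rfl)
        · rintro (rfl | rfl | rfl)
          · exact ⟨j, false, le_rfl, hn, rfl⟩
          · exact ⟨j + 1, false, by omega, hn1, rfl⟩
          · exact ⟨j + 1, true, by omega, hn2, rfl⟩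
      rw [this]
      refine Cover.IsTail.fork _ _ _ v (by rw [hfar j false hn, hv]) ⟨hff, hwt, v, ?_⟩ hodd
        (by rw [hnear _ _ hn1, hv])
      rw [M.src_tl _ _ _ hn1, M.src_tl _ _ _ hn2, M.tgt_tl _ _ _ hn1, M.tgt_tl _ _ _ hn2, hv,
        M.pt_none (i := i) (j := j + 1 + 1) (by omega)]
      split_ifs
      · exact Or.inl ⟨rfl, rfl, rfl, rfl⟩
      · exact Or.inr ⟨rfl, rfl, rfl, rfl⟩
    · have hj2 : Even (j + 2) := hj.add even_two
      obtain ⟨u, hu⟩ := M.pt_some (i := i) (j := j + 2) h1 h2 (by omega)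
      have hn3 : W.IsName (tl i (j + 2) false) := ⟨h1, h2, by omega, by simp⟩
      have : {e | ∃ m b, j ≤ m ∧ W.IsName (tl i m b) ∧ ed (tl i m b) = e} =
          {ed (tl i j false), ed (tl i (j + 1) false), ed (tl i (j + 1) true)} ∪
          {e | ∃ m b, j + 2 ≤ m ∧ W.IsName (tl i m b) ∧ ed (tl i m b) = e} := by
        ext e
        constructor
        · rintro ⟨m, b, hm, hb, rfl⟩
          have hm' : m = j ∨ m = j + 1 ∨ j + 2 ≤ m := by omega
          rcases hm' with rfl | rfl | hm'
          · rw [bfalse hb]; exact Or.inl (Or.inl rfl)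
          · cases b with
            | false => exact Or.inl (Or.inr (Or.inl rfl))
            | true => exact Or.inl (Or.inr (Or.inr rfl))
          · exact Or.inr ⟨m, b, hm', hb, rfl⟩
        · rintro ((rfl | rfl | rfl) | ⟨m, b, hm, hb, rfl⟩)
          · exact ⟨j, false, le_rfl, hn, rfl⟩
          · exact ⟨j + 1, false, by omega, hn1, rfl⟩
          · exact ⟨j + 1, true, by omega, hn2, rfl⟩
          · exact ⟨m, b, by omega, hb, rfl⟩
      rw [this]
      refine Cover.IsTail.cycle _ _ _ (ed (tl i (j + 2) false)) u v _ (by rw [hfar j false hn, hv])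
        ⟨hff, hwt, ?_⟩ hodd (by rw [hnear _ _ hn1, hv]) (by rw [hfar _ _ hn1, hu])
        (by rw [hnear _ _ hn3, hu]) (ih (k - 2) (by omega) (j + 2) (by omega) hj2)
      rw [M.src_tl _ _ _ hn1, M.src_tl _ _ _ hn2, M.tgt_tl _ _ _ hn1, M.tgt_tl _ _ _ hn2, hv, hu]
      split_ifs
      · exact ⟨u, v, rfl, rfl, rfl, rfl⟩
      · exact ⟨v, u, rfl, rfl, rfl, rfl⟩

theorem mem_string_iff {x : Edg} (hx : W.IsName x) :
    ed x ∈ {e | ∃ i ≤ W.n, ed (str i) = e} ↔ ∃ i, x = str i := by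
  constructor
  · rintro ⟨i, hi, h⟩
    exact ⟨i, (M.ed_inj (str i) x hi hx h).symm⟩
  · rintro ⟨i, rfl⟩
    exact ⟨i, hx, rfl⟩

theorem isZigzagAlong : φ.IsZigzagAlong {e | ∃ i ≤ W.n, ed (str i) = e} := by
  have hvert : ∀ v, v ∈ φ.verts {e | ∃ i ≤ W.n, ed (str i) = e} → ∃ i, pt i 0 = some v := by
    rintro v ⟨_, ⟨i, hi, rfl⟩, hv⟩
    rcases (M.inc_str hi v).1 hv with h | h
    · exact ⟨i, h⟩
    · exact ⟨i + 1, h⟩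
  refine ⟨⟨⟨ed (str 0), 0, Nat.zero_le _, rfl⟩, ?_, ?_⟩, ?_, ?_, ?_⟩
  · have h0 : ∀ i ≤ W.n, φ.ConnIn {e | ∃ i ≤ W.n, ed (str i) = e} (ed (str 0)) (ed (str i)) :=
      fun i hi => M.connIn_str (Nat.zero_le _) hi fun j _ hj => ⟨j, hj.trans hi, rfl⟩
    rintro _ ⟨i, hi, rfl⟩ _ ⟨j, hj, rfl⟩
    exact (h0 i hi).symm.trans (h0 j hj)
  · intro v hv
    obtain ⟨i, hi⟩ := hvert v hv
    obtain ⟨h1, h2, h3⟩ := (M.pt_iff i 0).1 ⟨v, hi⟩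
    have hn1 : W.IsName (str (i - 1)) := by change i - 1 ≤ W.n; omega
    have hn2 : W.IsName (str i) := h2
    rw [Set.ncard_eq_two]
    refine ⟨ed (str (i - 1)), ed (str i), M.ed_ne hn1 hn2 (by simp; omega), ?_⟩
    ext e
    constructor
    · rintro ⟨⟨l, hl, rfl⟩, h⟩
      obtain ⟨-, rfl | rfl⟩ := (M.inc_str_iff hl hi).1 h
      · exact Or.inr rfl
      · exact Or.inl rfl
    · rintro (rfl | rfl)
      · exact ⟨⟨i - 1, hn1, rfl⟩, (M.inc_str_iff hn1 hi).2 ⟨rfl, Or.inr (by omega)⟩⟩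
      · exact ⟨⟨i, hn2, rfl⟩, (M.inc_str_iff hn2 hi).2 ⟨rfl, Or.inl rfl⟩⟩
  · rintro _ ⟨i, hi, rfl⟩
    rw [M.wt_str i hi, Int.natAbs_odd]
    exact M.valid.odd i hi
  · rintro _ ⟨i, hi, rfl⟩ f
    exact ⟨fun h => M.not_symPair_str hi f (Or.inl h), fun h => M.not_symPair_str hi f (Or.inr h.1)⟩
  · intro e he
    obtain ⟨x, hx, rfl⟩ := M.ed_surj e
    cases x with
    | str i => exact absurd ⟨i, hx, rfl⟩ he
    | tl i j b =>
      have h1 := hx.1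
      have h2 := hx.2.1
      obtain ⟨v, hv⟩ := M.pt_some (i := i) (j := 0) h1 h2 (Nat.zero_le _)
      have hn : W.IsName (tl i 0 false) := ⟨h1, h2, Nat.zero_le _, by simp⟩
      refine ⟨if 0 < W.δ i then Cover.Side.left else Cover.Side.right, v,
        ⟨ed (str i), ⟨i, h2, rfl⟩, (M.inc_str h2 v).2 (Or.inl hv)⟩, ed (tl i 0 false), _,
        ⟨?_, M.isTail h1 h2 rfl (W.len i) 0 (by omega) Even.zero, ?_⟩,
        ⟨j, b, Nat.zero_le _, hx, rfl⟩⟩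
      · split_ifs with h3
        · simp only [Cover.near]; rw [M.tgt_tl _ _ _ hn, if_pos h3, hv]
        · simp only [Cover.near]; rw [M.src_tl _ _ _ hn, if_neg h3, hv]
      · rw [Set.disjoint_left]
        rintro _ ⟨m, b', -, hm, rfl⟩ hmem
        obtain ⟨l, hl⟩ := (M.mem_string_iff hm).1 hmem
        cases hl

theorem isZigzag [Fintype E] : φ.IsZigzag := ⟨M.isTropical, Or.inl ⟨_, M.isZigzagAlong⟩⟩

end IsModel


/-! ### Ends and genus of a string with tails -/

namespace Walk

open Edg

open scoped Classical in
/-- The finite set of names of edges. -/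
noncomputable def names (W : Walk) : Finset Edg :=
  (Finset.range (W.n + 1)).image str ∪ (Finset.Icc 1 W.n).biUnion fun i =>
    (Finset.range (W.len i + 1)).biUnion fun j =>
      (if Odd j then {false, true} else {false} : Finset Bool).image (tl i j)

theorem mem_names {W : Walk} {x : Edg} : x ∈ W.names ↔ W.IsName x := by
  classical
  unfold names
  simp only [Finset.mem_union, Finset.mem_image, Finset.mem_biUnion, Finset.mem_range,
    Finset.mem_Icc]
  constructor
  · rintro (⟨i, hi, rfl⟩ | ⟨i, hi, j, hj, b, hb, rfl⟩)
    · exact Nat.lt_succ_iff.1 hi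
    · refine ⟨hi.1, hi.2, Nat.lt_succ_iff.1 hj, ?_⟩
      rintro rfl
      by_contra h
      rw [if_neg h] at hb
      simp at hb
  · cases x with
    | str i => exact fun h => Or.inl ⟨i, Nat.lt_succ_iff.2 h, rfl⟩
    | tl i j b =>
      rintro ⟨h1, h2, h3, h4⟩
      refine Or.inr ⟨i, ⟨h1, h2⟩, j, Nat.lt_succ_iff.2 h3, b, ?_, rfl⟩
      cases b with
      | false => split_ifs <;> simp
      | true => rw [if_pos (h4 rfl)]; simp

theorem sum_names {A : Type*} [AddCommMonoid A] (W : Walk) (f : Edg → A) :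
    ∑ x ∈ W.names, f x = ∑ i ∈ Finset.range (W.n + 1), f (str i) +
      ∑ i ∈ Finset.Icc 1 W.n, ∑ j ∈ Finset.range (W.len i + 1),
        (f (tl i j false) + if Odd j then f (tl i j true) else 0) := by
  classical
  unfold names
  rw [Finset.sum_union, Finset.sum_image, Finset.sum_biUnion]
  · congr 1
    refine Finset.sum_congr rfl fun i _ => ?_
    rw [Finset.sum_biUnion]
    · refine Finset.sum_congr rfl fun j _ => ?_
      rw [Finset.sum_image]
      · split_ifs
        · rw [Finset.sum_pair (by simp)]
        · rw [Finset.sum_singleton, add_zero]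
      · intro b _ b' _ h
        simpa using h
    · intro j _ j' _ hjj
      change _root_.Disjoint _ _
      rw [Finset.disjoint_left]
      intro x hx hx'
      obtain ⟨b, -, rfl⟩ := Finset.mem_image.1 hx
      obtain ⟨b', -, h⟩ := Finset.mem_image.1 hx'
      simp only [tl.injEq] at h
      exact hjj h.2.1.symm
  · intro i _ i' _ hii
    change _root_.Disjoint _ _
    rw [Finset.disjoint_left]
    intro x hx hx'
    obtain ⟨j, -, hx⟩ := Finset.mem_biUnion.1 hx
    obtain ⟨j', -, hx'⟩ := Finset.mem_biUnion.1 hx'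
    obtain ⟨b, -, rfl⟩ := Finset.mem_image.1 hx
    obtain ⟨b', -, h⟩ := Finset.mem_image.1 hx'
    simp only [tl.injEq] at h
    exact hii h.1.symm
  · intro i _ i' _ h
    simpa using h
  · rw [Finset.disjoint_left]
    intro x hx hx'
    obtain ⟨i, -, rfl⟩ := Finset.mem_image.1 hx
    obtain ⟨i, -, hx'⟩ := Finset.mem_biUnion.1 hx'
    obtain ⟨j', -, hx'⟩ := Finset.mem_biUnion.1 hx'
    obtain ⟨b', -, h⟩ := Finset.mem_image.1 hx'
    simp at h

theorem card_odd_range (l : ℕ) :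
    ∑ j ∈ Finset.range (l + 1), (1 + if Odd j then 1 else 0) = l + 1 + (l + 1) / 2 := by
  induction l with
  | zero => simp
  | succ l ih =>
    rw [Finset.sum_range_succ, ih]
    by_cases h : Odd (l + 1)
    · rw [if_pos h]
      obtain ⟨k, hk⟩ := h
      omega
    · rw [if_neg h]
      obtain ⟨k, hk⟩ := Nat.not_odd_iff_even.1 h
      omega

theorem card_tailEnds (d : ℤ) (l : ℕ) : (tailEnds d l).card = 1 + l % 2 := by
  unfold tailEnds
  split_ifs with h
  · rw [Nat.even_iff.1 h]; rfl
  · rw [Nat.odd_iff.1 (Nat.not_even_iff_odd.1 h)]; rfl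

/-- The weights of the ends of the tails over `-∞`. -/
def inTails (W : Walk) : Multiset ℕ :=
  ∑ i ∈ Finset.Icc 1 W.n, if 0 < W.δ i then tailEnds (W.δ i) (W.len i) else 0

/-- The weights of the ends of the tails over `+∞`. -/
def outTails (W : Walk) : Multiset ℕ :=
  ∑ i ∈ Finset.Icc 1 W.n, if 0 < W.δ i then 0 else tailEnds (W.δ i) (W.len i)

end Walk

theorem map_filter_eq_sum {E A : Type*} [Fintype E] (p : E → Prop) [DecidablePred p] (w : E → A) :
    (Finset.univ.filter p).val.map w = ∑ e, if p e then ({w e} : Multiset A) else 0 := by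
  rw [← Finset.sum_filter, ← Multiset.sum_map_singleton ((Finset.univ.filter p).val.map w),
    Multiset.map_map]
  rfl

namespace Walk

open Edg

/-- Only the last segment of a tail consists of ends: a single edge if its index is even, a fork if
it is odd. -/
theorem sum_tail {E : Type} {W : Walk} {ed : Edg → E} {i : ℕ} (h1 : 1 ≤ i) (h2 : i ≤ W.n) {A : Type*} (w : E → Multiset A) (x y : A)
    (h0 : ∀ j b, W.IsName (tl i j b) → w (ed (tl i j b)) = if j = W.len i then
      {if Even j then x else y} else 0) :
    ∑ j ∈ Finset.range (W.len i + 1), (w (ed (tl i j false)) + if Odd j then w (ed (tl i j true)) else 0) =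
      if Even (W.len i) then {x} else {y, y} := by
  rw [Finset.sum_eq_single (W.len i)]
  · have hn : W.IsName (tl i (W.len i) false) := ⟨h1, h2, le_rfl, by simp⟩
    rw [h0 _ _ hn, if_pos rfl]
    by_cases he : Even (W.len i)
    · rw [if_pos he, if_pos he, if_neg (Nat.not_odd_iff_even.2 he), add_zero]
    · have ho := Nat.not_even_iff_odd.1 he
      rw [if_neg he, if_neg he, if_pos ho, h0 _ _ ⟨h1, h2, le_rfl, fun _ => ho⟩, if_pos rfl,
        if_neg he]
      rfl
  · intro j hj hne
    have hj := Finset.mem_range.1 hj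
    rw [h0 _ _ ⟨h1, h2, by omega, by simp⟩, if_neg hne]
    split_ifs with ho
    · rw [h0 _ _ ⟨h1, h2, by omega, fun _ => ho⟩, if_neg hne]; rfl
    · rfl
  · intro h; exact absurd (Finset.mem_range.2 (Nat.lt_succ_self _)) h

end Walk

namespace IsModel

open Edg Walk

variable {r : ℕ} {E : Type} {φ : Cover r E} {W : Walk} {pt : ℕ → ℕ → Option (Fin r)} {ed : Edg → E}
  (M : IsModel φ W pt ed)
include M

theorem sum_edges [Fintype E] {A : Type*} [AddCommMonoid A] (f : E → A) :
    ∑ e, f e = ∑ x ∈ W.names, f (ed x) := by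
  symm
  refine Finset.sum_bij (fun x _ => ed x) (fun _ _ => Finset.mem_univ _) ?_ ?_ fun _ _ => rfl
  · intro x hx y hy h
    exact M.ed_inj x y (mem_names.1 hx) (mem_names.1 hy) h
  · intro e _
    obtain ⟨x, hx, rfl⟩ := M.ed_surj e
    exact ⟨x, mem_names.2 hx, rfl⟩

theorem pt_eq_none_iff {i j : ℕ} : pt i j = none ↔ ¬ (1 ≤ i ∧ i ≤ W.n ∧ j ≤ W.len i) := by
  refine ⟨fun h h' => ?_, M.pt_none⟩
  obtain ⟨v, hv⟩ := M.pt_some h'.1 h'.2.1 h'.2.2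
  rw [h] at hv; cases hv

theorem inProfile_eq [Fintype E] : φ.inProfile = {(W.s 0).natAbs} + W.inTails := by
  unfold Cover.inProfile inTails
  rw [map_filter_eq_sum, M.sum_edges, sum_names]
  congr 1
  · rw [Finset.sum_eq_single 0]
    · rw [if_pos, M.wt_str 0 (Nat.zero_le _)]
      rw [M.src_str 0 (Nat.zero_le _), if_pos M.valid.pos_zero]
      exact M.pt_none (by omega)
    · intro i hi hne
      have hi : i ≤ W.n := Nat.lt_succ_iff.1 (Finset.mem_range.1 hi)
      rw [if_neg]
      rw [M.src_str i hi]
      split_ifs with h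
      · rw [M.pt_eq_none_iff]; omega
      · rw [M.pt_eq_none_iff]
        -- The last edge of the string runs to the right, so an edge running to the left has a
        -- further vertex of the string at its left end.
        have : i ≠ W.n := by rintro rfl; exact h M.valid.pos_last
        omega
    · exact fun h => absurd (Finset.mem_range.2 (by omega)) h
  · refine Finset.sum_congr rfl fun i hi => ?_
    obtain ⟨h1, h2⟩ := Finset.mem_Icc.1 hi
    by_cases hδ : 0 < W.δ i
    · rw [if_pos hδ]
      refine sum_tail h1 h2 (fun e => if φ.src e = none then {φ.wt e} else 0) _ _ fun j b hn => ?_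
      rw [M.src_tl i j b hn, if_pos hδ, M.wt_tl i j b hn]
      refine if_congr ?_ rfl rfl
      rw [M.pt_eq_none_iff]
      have := hn.2.2.1
      omega
    · rw [if_neg hδ]
      refine Finset.sum_eq_zero fun j hj => ?_
      have hj : j ≤ W.len i := Nat.lt_succ_iff.1 (Finset.mem_range.1 hj)
      have key : ∀ b, W.IsName (tl i j b) → ¬ φ.src (ed (tl i j b)) = none := by
        intro b hb
        rw [M.src_tl i j b hb, if_neg hδ, M.pt_eq_none_iff]
        omega
      rw [if_neg (key false ⟨h1, h2, hj, by simp⟩)]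
      split_ifs with ho ho'
      · exact absurd ho' (key true ⟨h1, h2, hj, fun _ => ho⟩)
      · rfl
      · rfl

theorem outProfile_eq [Fintype E] : φ.outProfile = {(W.s W.n).natAbs} + W.outTails := by
  unfold Cover.outProfile outTails
  rw [map_filter_eq_sum, M.sum_edges, sum_names]
  congr 1
  · rw [Finset.sum_eq_single W.n]
    · rw [if_pos, M.wt_str _ le_rfl]
      rw [M.tgt_str _ le_rfl, if_pos M.valid.pos_last]
      exact M.pt_none (by omega)
    · intro i hi hne
      have hi : i ≤ W.n := Nat.lt_succ_iff.1 (Finset.mem_range.1 hi)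
      rw [if_neg]
      rw [M.tgt_str i hi]
      split_ifs with h
      · rw [M.pt_eq_none_iff]; omega
      · rw [M.pt_eq_none_iff]
        have : i ≠ 0 := by rintro rfl; exact h M.valid.pos_zero
        omega
    · exact fun h => absurd (Finset.mem_range.2 (by omega)) h
  · refine Finset.sum_congr rfl fun i hi => ?_
    obtain ⟨h1, h2⟩ := Finset.mem_Icc.1 hi
    by_cases hδ : 0 < W.δ i
    · rw [if_pos hδ]
      refine Finset.sum_eq_zero fun j hj => ?_
      have hj : j ≤ W.len i := Nat.lt_succ_iff.1 (Finset.mem_range.1 hj)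
      have key : ∀ b, W.IsName (tl i j b) → ¬ φ.tgt (ed (tl i j b)) = none := by
        intro b hb
        rw [M.tgt_tl i j b hb, if_pos hδ, M.pt_eq_none_iff]
        omega
      rw [if_neg (key false ⟨h1, h2, hj, by simp⟩)]
      split_ifs with ho ho'
      · exact absurd ho' (key true ⟨h1, h2, hj, fun _ => ho⟩)
      · rfl
      · rfl
    · rw [if_neg hδ]
      refine sum_tail h1 h2 (fun e => if φ.tgt e = none then {φ.wt e} else 0) _ _ fun j b hn => ?_
      rw [M.tgt_tl i j b hn, if_neg hδ, M.wt_tl i j b hn]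
      refine if_congr ?_ rfl rfl
      rw [M.pt_eq_none_iff]
      have := hn.2.2.1
      omega

/-- A tail with `l` vertices off the string has `l + 1` segments, `(l + 1) / 2` of them double, and
`1 + l % 2` ends. It therefore contributes `l / 2` independent cycles. -/
theorem genus_eq [Fintype E] (hr : r = ∑ i ∈ Finset.Icc 1 W.n, (W.len i + 1)) :
    Fintype.card E + 1 = r + φ.inProfile.card + φ.outProfile.card +
      ∑ i ∈ Finset.Icc 1 W.n, W.len i / 2 := by
  have hE : Fintype.card E = W.n + 1 + ∑ i ∈ Finset.Icc 1 W.n, (W.len i + 1 + (W.len i + 1) / 2) := by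
    rw [← Finset.card_univ, Finset.card_eq_sum_ones, M.sum_edges, sum_names]
    simp only [card_odd_range, Finset.sum_const, Finset.card_range, smul_eq_mul, mul_one]
  have h2 : (W.inTails + W.outTails).card = ∑ i ∈ Finset.Icc 1 W.n, (1 + W.len i % 2) := by
    unfold inTails outTails
    rw [← Finset.sum_add_distrib, Multiset.card_sum]
    refine Finset.sum_congr rfl fun i _ => ?_
    split_ifs <;> simp [card_tailEnds]
  rw [Multiset.card_add] at h2
  have h3 : W.n + 1 + ∑ i ∈ Finset.Icc 1 W.n, (W.len i + 1 + (W.len i + 1) / 2) + 1 =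
      ∑ i ∈ Finset.Icc 1 W.n, (W.len i + 1) + 1 + ∑ i ∈ Finset.Icc 1 W.n, (1 + W.len i % 2) + 1 +
      ∑ i ∈ Finset.Icc 1 W.n, W.len i / 2 := by
    have h4 : W.n = ∑ i ∈ Finset.Icc 1 W.n, 1 := by simp
    have h5 : ∑ i ∈ Finset.Icc 1 W.n, (W.len i + 1 + (W.len i + 1) / 2) + ∑ i ∈ Finset.Icc 1 W.n, 1 =
        ∑ i ∈ Finset.Icc 1 W.n, (W.len i + 1) + ∑ i ∈ Finset.Icc 1 W.n, (1 + W.len i % 2) +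
        ∑ i ∈ Finset.Icc 1 W.n, W.len i / 2 := by
      simp only [← Finset.sum_add_distrib]
      exact Finset.sum_congr rfl fun i _ => by omega
    omega
  rw [hE, M.inProfile_eq, M.outProfile_eq, Multiset.card_add, Multiset.card_add,
    Multiset.card_singleton, Multiset.card_singleton]
  omega

/-! Colourings. -/

end IsModel

namespace Walk

open Cover MixedZigzag.Tuple

/-- The colour of the `j`-th segment of the tail at the `i`-th vertex, if `η i j` is the sign of the
`j`-th vertex of this tail. -/
noncomputable def tailColour (W : Walk) (η : ℕ → ℕ → ℤˣ) (i : ℕ) : ℕ → Colour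
  | 0 => if 0 < W.s (i - 1) * W.s i then signColour (η i 0) else signColour (-(η i 0))
  | j + 1 => open scoped Classical in
    if Even j then
      if tailColour W η i j = signColour (η i (j + 1)) then Colour.dotted else Colour.plain
    else if tailColour W η i j = Colour.dotted then signColour (η i (j + 1))
      else signColour (-(η i (j + 1)))

/-- The colour of an edge. -/
noncomputable def colour (W : Walk) (η : ℕ → ℕ → ℤˣ) : Edg → Colour
  | Edg.str _ => Colour.plain
  | Edg.tl i j _ => W.tailColour η i j

theorem tailColour_even (W : Walk) (η : ℕ → ℕ → ℤˣ) (i : ℕ) {j : ℕ} (hj : Even j) :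
    ∃ t, W.tailColour η i j = signColour t := by
  cases j with
  | zero =>
    simp only [tailColour]
    split_ifs
    · exact ⟨_, rfl⟩
    · exact ⟨_, rfl⟩
  | succ j =>
    have : ¬ Even j := fun h => Nat.not_odd_iff_even.2 hj h.add_one
    simp only [tailColour, this, if_false]
    split_ifs
    · exact ⟨_, rfl⟩
    · exact ⟨_, rfl⟩

theorem tailColour_odd (W : Walk) (η : ℕ → ℕ → ℤˣ) (i : ℕ) {j : ℕ} (hj : Odd j) :
    W.tailColour η i j = Colour.dotted ∨ W.tailColour η i j = Colour.plain := by
  cases j with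
  | zero => simp at hj
  | succ j =>
    have : Even j := by
      rw [← Nat.not_odd_iff_even]
      intro h
      exact Nat.not_even_iff_odd.2 hj h.add_one
    simp only [tailColour, this, if_true]
    split_ifs <;> simp

theorem signColour_red_or_blue (t : ℤˣ) :
    signColour t = Colour.red ∨ signColour t = Colour.blue := by
  unfold signColour; split_ifs <;> simp

theorem signColour_eq_or (t s : ℤˣ) : signColour t = signColour s ∨ signColour t = signColour (-s) := by
  rcases Int.units_eq_one_or t with rfl | rfl <;> rcases Int.units_eq_one_or s with rfl | rfl <;>
    simp [signColour]

end Walk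

namespace IsModel

open Edg Walk Cover MixedZigzag.Tuple

variable {r : ℕ} {E : Type} {φ : Cover r E} {W : Walk} {pt : ℕ → ℕ → Option (Fin r)} {ed : Edg → E}
  (M : IsModel φ W pt ed)
include M

/-- A symmetric pair has the same vertices at both ends, and these vertices determine the tail and
the segment. -/
theorem symPair_tl {i j : ℕ} {b : Bool} (h : W.IsName (tl i j b)) {f : E}
    (hf : φ.SymPair (ed (tl i j b)) f) : Odd j ∧ ∃ b', W.IsName (tl i j b') ∧ f = ed (tl i j b') := by
  obtain ⟨x, hx, rfl⟩ := M.ed_surj f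
  cases x with
  | str l => exact absurd hf.symm (M.not_symPair_str hx _)
  | tl l m b' =>
    have hinc : ∀ v, φ.Inc (ed (tl i j b)) v ↔ φ.Inc (ed (tl l m b')) v := by
      intro v; unfold Cover.Inc; rw [hf.src, hf.tgt]
    obtain ⟨v, hv⟩ := M.pt_some h.1 h.2.1 h.2.2.1
    obtain ⟨u, hu⟩ := M.pt_some hx.1 hx.2.1 hx.2.2.1
    have h1 := (M.inc_tl_iff hx hv).1 ((hinc v).1 ((M.inc_tl h v).2 (Or.inl hv)))
    have h2 := (M.inc_tl_iff h hu).1 ((hinc u).2 ((M.inc_tl hx u).2 (Or.inl hu)))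
    have hij : l = i ∧ m = j := by omega
    obtain ⟨rfl, rfl⟩ := hij
    refine ⟨?_, b', hx, rfl⟩
    by_contra ho
    have hb : b = false := by
      cases b with
      | false => rfl
      | true => exact absurd (h.2.2.2 rfl) ho
    have hb' : b' = false := by
      cases b' with
      | false => rfl
      | true => exact absurd (hx.2.2.2 rfl) ho
    rw [hb, hb'] at hf
    exact hf.ne rfl

theorem symPair_of_odd {i j : ℕ} (hj : Odd j) (h : W.IsName (tl i j false)) :
    φ.SymPair (ed (tl i j false)) (ed (tl i j true)) := by
  have h' : W.IsName (tl i j true) := ⟨h.1, h.2.1, h.2.2.1, fun _ => hj⟩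
  have hne : ed (tl i j false) ≠ ed (tl i j true) := M.ed_ne h h' (by simp)
  have hwt : φ.wt (ed (tl i j false)) = φ.wt (ed (tl i j true)) := by
    rw [M.wt_tl _ _ _ h, M.wt_tl _ _ _ h']
  obtain ⟨v, hv⟩ := M.pt_some h.1 h.2.1 h.2.2.1
  by_cases hl : j = W.len i
  · refine Or.inr ⟨hne, hwt, v, ?_⟩
    rw [M.src_tl _ _ _ h, M.src_tl _ _ _ h', M.tgt_tl _ _ _ h, M.tgt_tl _ _ _ h', hv,
      M.pt_none (i := i) (j := j + 1) (by omega)]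
    split_ifs <;> simp
  · obtain ⟨u, hu⟩ := M.pt_some (i := i) (j := j + 1) h.1 h.2.1 (by have := h.2.2.1; omega)
    refine Or.inl ⟨hne, hwt, ?_⟩
    rw [M.src_tl _ _ _ h, M.src_tl _ _ _ h', M.tgt_tl _ _ _ h, M.tgt_tl _ _ _ h', hv, hu]
    split_ifs <;> simp

/-- Parity alone distinguishes the single segments of the tails from the string and the double
segments. This later allows the string to be recovered from the cover. -/
theorem wt_even_iff {x : Edg} (hx : W.IsName x) :
    Even (φ.wt (ed x)) ↔ ∃ i j b, x = tl i j b ∧ Even j := by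
  cases x with
  | str i =>
    rw [M.wt_str i hx, Int.natAbs_even]
    refine ⟨fun h => absurd (M.valid.odd i hx) (Int.not_odd_iff_even.2 h), ?_⟩
    rintro ⟨_, _, _, h, -⟩
    cases h
  | tl i j b =>
    rw [M.wt_tl i j b hx]
    by_cases hj : Even j
    · rw [if_pos hj, Int.natAbs_even]
      exact ⟨fun _ => ⟨i, j, b, rfl, hj⟩, fun _ => M.valid.even i hx.1 hx.2.1⟩
    · rw [if_neg hj]
      have h0 : 0 < W.len i := by
        have := hx.2.2.1
        rcases Nat.eq_zero_or_pos j with rfl | h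
        · exact absurd Even.zero hj
        · omega
      refine ⟨fun h => absurd (M.valid.half i hx.1 hx.2.1 h0) (Nat.not_odd_iff_even.2 h), ?_⟩
      rintro ⟨_, _, _, h, h'⟩
      cases h
      exact absurd h' hj

theorem exists_colour (η : ℕ → ℕ → ℤˣ) :
    ∃ c : E → Colour, ∀ x, W.IsName x → c (ed x) = W.colour η x := by
  choose nm hnm hed using M.ed_surj
  exact ⟨fun e => W.colour η (nm e), fun x hx => by
    simp only [M.ed_inj _ _ (hnm _) hx (hed (ed x))]⟩

/-- Distinct even edges never share a vertex, as single segments of a tail are separated by double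
ones of odd weight. So each even edge is a component by itself and its colour can be chosen
independently. -/
theorem isColouring {η : ℕ → ℕ → ℤˣ} {c : E → Colour}
    (hc : ∀ x, W.IsName x → c (ed x) = W.colour η x) : φ.IsColouring c := by
  refine ⟨?_, ?_, ?_, ?_, ?_⟩
  · intro e he
    obtain ⟨x, hx, rfl⟩ := M.ed_surj e
    rw [hc x hx] at he
    cases x with
    | str i => simp [Walk.colour] at he
    | tl i j b =>
      simp only [Walk.colour] at he
      have hj : Odd j := by
        rw [← Nat.not_even_iff_odd]
        intro h
        obtain ⟨t, ht⟩ := W.tailColour_even η i h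
        rw [ht] at he
        exact (signColour_ne t).1 he
      have h' := M.symPair_of_odd hj ⟨hx.1, hx.2.1, hx.2.2.1, by simp⟩
      cases b with
      | false => exact ⟨_, h'⟩
      | true => exact ⟨_, h'.symm⟩
  · intro e f hef
    have hef : φ.SymPair e f := hef
    obtain ⟨x, hx, rfl⟩ := M.ed_surj e
    cases x with
    | str i => exact absurd hef (M.not_symPair_str hx _)
    | tl i j b =>
      obtain ⟨-, b', hx', rfl⟩ := M.symPair_tl hx hef
      rw [hc _ hx, hc _ hx']
      rfl
  · intro e he ho
    obtain ⟨x, hx, rfl⟩ := M.ed_surj e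
    rw [hc x hx] at he ⊢
    cases x with
    | str i => rfl
    | tl i j b =>
      have hj : Odd j := by
        rw [← Nat.not_even_iff_odd]
        intro h
        exact Nat.not_even_iff_odd.2 ho ((M.wt_even_iff hx).2 ⟨i, j, b, rfl, h⟩)
      exact (W.tailColour_odd η i hj).resolve_left he
  · intro e he hev
    obtain ⟨x, hx, rfl⟩ := M.ed_surj e
    rw [hc x hx]
    obtain ⟨i, j, b, rfl, hj⟩ := (M.wt_even_iff hx).1 hev
    obtain ⟨t, ht⟩ := W.tailColour_even η i hj
    simp only [Walk.colour, ht]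
    exact signColour_red_or_blue t
  · intro e f v he hf hev hev' _ _
    obtain ⟨x, hx, rfl⟩ := M.ed_surj e
    obtain ⟨y, hy, rfl⟩ := M.ed_surj f
    obtain ⟨i, j, b, rfl, hj⟩ := (M.wt_even_iff hx).1 hev
    obtain ⟨l, m, b', rfl, hm⟩ := (M.wt_even_iff hy).1 hev'
    rw [hc _ hx, hc _ hy]
    obtain ⟨p, q, hpq⟩ := M.pt_surj v
    have h1 := (M.inc_tl_iff hx hpq).1 he
    have h2 := (M.inc_tl_iff hy hpq).1 hf
    obtain ⟨j', rfl⟩ := hj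
    obtain ⟨m', rfl⟩ := hm
    have h3 : i = l := by omega
    have h4 : j' = m' := by omega
    subst h3 h4
    rfl

/-- The admissible pictures at a vertex determine the colour farther from the string by the sign and
the nearer colour, so every choice of signs is realized by moving outward along the tails. -/
theorem hasSign [Fintype E] {ε : Fin r → ℤˣ} {η : ℕ → ℕ → ℤˣ} {c : E → Colour}
    (hη : ∀ i j v, pt i j = some v → η i j = ε v)
    (hc : ∀ x, W.IsName x → c (ed x) = W.colour η x) (v : Fin r) : φ.HasSign c v (ε v) := by
  classical
  rw [hasSign_iff]
  obtain ⟨i, j, hv⟩ := M.pt_surj v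
  obtain ⟨h1, h2, h3⟩ := (M.pt_iff i j).1 ⟨v, hv⟩
  rw [← hη i j v hv]
  cases j with
  | zero =>
    have hn : W.IsName (tl i 0 false) := ⟨h1, h2, h3, by simp⟩
    have hn1 : W.IsName (str (i - 1)) := by change i - 1 ≤ W.n; omega
    have hn2 : W.IsName (str i) := h2
    have e1 : i - 1 + 1 = i := by omega
    have hs := M.valid.step (i - 1) (by omega)
    rw [e1] at hs
    have d1 : ed (str (i - 1)) ≠ ed (str i) := M.ed_ne hn1 hn2 (by simp; omega)
    have d2 : ed (str (i - 1)) ≠ ed (tl i 0 false) := M.ed_ne hn1 hn (by simp)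
    have d3 : ed (str i) ≠ ed (tl i 0 false) := M.ed_ne hn2 hn (by simp)
    have c1 := hc _ hn
    have c2 : c (ed (str (i - 1))) = Colour.plain := hc _ hn1
    have c3 : c (ed (str i)) = Colour.plain := hc _ hn2
    simp only [Walk.colour, tailColour] at c1
    have s1 := M.src_str _ hn1
    have t1 := M.tgt_str _ hn1
    have s2 := M.src_str _ hn2
    have t2 := M.tgt_str _ hn2
    have s3 := M.src_tl _ _ _ hn
    have t3 := M.tgt_tl _ _ _ hn
    rw [e1] at s1 t1
    have z1 := M.s_ne hn1
    have z2 := M.s_ne hn2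
    have z3 := M.valid.ne_zero i h1 h2
    -- If the string passes straight through, the tail shares its side with an edge of the string
    -- and has the colour of the sign. If the string bends, the tail is alone on its side and has
    -- the opposite colour.
    rcases lt_or_gt_of_ne z1 with a1 | a1 <;> rcases lt_or_gt_of_ne z2 with a2 | a2
    · rw [if_pos (mul_pos_of_neg_of_neg a1 a2)] at c1
      simp only [if_neg (not_lt.2 a1.le), hv] at s1 t1
      simp only [if_neg (not_lt.2 a2.le), hv] at s2 t2
      rcases lt_or_gt_of_ne z3 with a3 | a3
      · simp only [if_neg (not_lt.2 a3.le), hv] at s3 t3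
        exact ⟨_, _, _, d2, Or.inr ⟨t2, s1, s3⟩, Or.inl ⟨c3, c2, c1⟩⟩
      · simp only [if_pos a3, hv] at s3 t3
        exact ⟨_, _, _, d3, Or.inl ⟨s1, t2, t3⟩, Or.inl ⟨c2, c3, c1⟩⟩
    · rw [if_neg (not_lt.2 (mul_neg_of_neg_of_pos a1 a2).le)] at c1
      simp only [if_neg (not_lt.2 a1.le), hv] at s1 t1
      simp only [if_pos a2, hv] at s2 t2
      have a3 : 0 < W.δ i := by omega
      simp only [if_pos a3, hv] at s3 t3
      exact ⟨_, _, _, d1, Or.inr ⟨t3, s1, s2⟩, Or.inr (Or.inr (Or.inl ⟨c1, c2, c3⟩))⟩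
    · rw [if_neg (not_lt.2 (mul_neg_of_pos_of_neg a1 a2).le)] at c1
      simp only [if_pos a1, hv] at s1 t1
      simp only [if_neg (not_lt.2 a2.le), hv] at s2 t2
      have a3 : ¬ 0 < W.δ i := by omega
      simp only [if_neg a3, hv] at s3 t3
      exact ⟨_, _, _, d1, Or.inl ⟨s3, t1, t2⟩, Or.inr (Or.inr (Or.inl ⟨c1, c2, c3⟩))⟩
    · rw [if_pos (mul_pos a1 a2)] at c1
      simp only [if_pos a1, hv] at s1 t1
      simp only [if_pos a2, hv] at s2 t2
      rcases lt_or_gt_of_ne z3 with a3 | a3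
      · simp only [if_neg (not_lt.2 a3.le), hv] at s3 t3
        exact ⟨_, _, _, d3, Or.inr ⟨t1, s2, s3⟩, Or.inl ⟨c2, c3, c1⟩⟩
      · simp only [if_pos a3, hv] at s3 t3
        exact ⟨_, _, _, d2, Or.inl ⟨s2, t1, t3⟩, Or.inl ⟨c3, c2, c1⟩⟩
  | succ j =>
    -- The picture is symmetric in the direction of travel: `p` denotes the single segment and `q`
    -- the double one, whichever of them is nearer to the string.
    have hpat : ∀ p q, Even p → (p = j ∧ q = j + 1 ∨ p = j + 1 ∧ q = j) →
        W.tailColour η i p = signColour (-(η i (j + 1))) ∧ W.tailColour η i q = Colour.plain ∨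
        W.tailColour η i p = signColour (η i (j + 1)) ∧ W.tailColour η i q = Colour.dotted := by
      intro p q hp hpq
      rcases hpq with ⟨rfl, rfl⟩ | ⟨rfl, rfl⟩
      · obtain ⟨t, ht⟩ := W.tailColour_even η i hp
        have hstep : W.tailColour η i (p + 1) =
          if W.tailColour η i p = signColour (η i (p + 1)) then Colour.dotted else Colour.plain := by
          simp only [tailColour, hp, if_true]
        rw [hstep]
        split_ifs with h
        · exact Or.inr ⟨h, rfl⟩
        · refine Or.inl ⟨?_, rfl⟩
          rw [ht] at h ⊢
          exact (signColour_eq_or t _).resolve_left h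
      · have hq : ¬ Even q := fun h => Nat.not_odd_iff_even.2 hp h.add_one
        have hstep : W.tailColour η i (q + 1) = if W.tailColour η i q = Colour.dotted
            then signColour (η i (q + 1)) else signColour (-(η i (q + 1))) := by
          simp only [tailColour, hq, if_false]
        rw [hstep]
        rcases W.tailColour_odd η i (Nat.not_even_iff_odd.1 hq) with h | h
        · rw [if_pos h]; exact Or.inr ⟨rfl, h⟩
        · rw [if_neg (by rw [h]; simp)]; exact Or.inl ⟨rfl, h⟩
    obtain ⟨p, q, hp, hpq⟩ : ∃ p q, Even p ∧ (p = j ∧ q = j + 1 ∨ p = j + 1 ∧ q = j) := by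
      rcases Nat.even_or_odd j with h | h
      · exact ⟨j, j + 1, h, Or.inl ⟨rfl, rfl⟩⟩
      · exact ⟨j + 1, j, h.add_one, Or.inr ⟨rfl, rfl⟩⟩
    have hq : Odd q := by
      rcases hpq with ⟨rfl, rfl⟩ | ⟨rfl, rfl⟩
      · exact hp.add_one
      · rw [← Nat.not_even_iff_odd]; intro h
        exact Nat.not_even_iff_odd.2 h.add_one hp
    have hn1 : W.IsName (tl i p false) := ⟨h1, h2, by omega, by simp⟩
    have hn2 : W.IsName (tl i q false) := ⟨h1, h2, by omega, by simp⟩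
    have hn3 : W.IsName (tl i q true) := ⟨h1, h2, by omega, fun _ => hq⟩
    refine ⟨ed (tl i p false), _, _, M.ed_ne hn2 hn3 (by simp), ?_, ?_⟩
    · rw [M.src_tl _ _ _ hn1, M.tgt_tl _ _ _ hn1, M.src_tl _ _ _ hn2, M.tgt_tl _ _ _ hn2,
        M.src_tl _ _ _ hn3, M.tgt_tl _ _ _ hn3]
      rcases hpq with ⟨rfl, rfl⟩ | ⟨rfl, rfl⟩ <;> by_cases a3 : 0 < W.δ i <;>
        simp only [a3, if_true, if_false, hv, and_self, true_or, or_true]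
    · rw [hc _ hn1, hc _ hn2, hc _ hn3]
      simp only [Walk.colour]
      rcases hpat p q hp hpq with ⟨h4, h5⟩ | ⟨h4, h5⟩
      · exact Or.inr (Or.inr (Or.inl ⟨h4, h5, h5⟩))
      · exact Or.inr (Or.inr (Or.inr ⟨h4, h5, h5⟩))

/-- This excludes the picture with three even edges when a vertex is passed. -/
theorem exists_odd (v : Fin r) : ∃ e, φ.Inc e v ∧ Odd (φ.wt e) := by
  have key : ∀ x, W.IsName x → (¬ ∃ i j b, x = tl i j b ∧ Even j) → Odd (φ.wt (ed x)) := by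
    intro x hx h
    rw [← Nat.not_even_iff_odd, M.wt_even_iff hx]
    exact h
  obtain ⟨i, j, hv⟩ := M.pt_surj v
  obtain ⟨h1, h2, h3⟩ := (M.pt_iff i j).1 ⟨v, hv⟩
  cases j with
  | zero =>
    refine ⟨ed (str i), (M.inc_str h2 v).2 (Or.inl hv), key _ h2 ?_⟩
    rintro ⟨_, _, _, h, -⟩
    cases h
  | succ j =>
    rcases Nat.even_or_odd j with h | h
    · have hn : W.IsName (tl i (j + 1) false) := ⟨h1, h2, h3, by simp⟩
      refine ⟨ed (tl i (j + 1) false), (M.inc_tl hn v).2 (Or.inl hv), key _ hn ?_⟩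
      rintro ⟨_, _, _, h', h''⟩
      cases h'
      exact Nat.not_odd_iff_even.2 h'' h.add_one
    · have hn : W.IsName (tl i j false) := ⟨h1, h2, by omega, by simp⟩
      refine ⟨ed (tl i j false), (M.inc_tl hn v).2 (Or.inr hv), key _ hn ?_⟩
      rintro ⟨_, _, _, h', h''⟩
      cases h'
      exact Nat.not_odd_iff_even.2 h'' h

end IsModel


/-! ### Universally monotone and mixed covers -/

namespace Walk

/-- The number of sign changes among the first `i` edges of the string. -/
def piece (W : Walk) : ℕ → ℕ
  | 0 => 0
  | i + 1 => W.piece i + if 0 < W.s i ↔ 0 < W.s (i + 1) then 0 else 1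

/-- The index of the component to which the `i`-th vertex of the string belongs. -/
def comp (W : Walk) (i : ℕ) : ℕ :=
  if 0 < W.s i then W.piece i else if 0 < W.s (i - 1) then W.piece (i - 1) else W.piece i

theorem piece_mono (W : Walk) : Monotone W.piece :=
  monotone_nat_of_le_succ fun _ => Nat.le_add_right _ _

theorem piece_succ_eq_iff (W : Walk) (i : ℕ) :
    W.piece (i + 1) = W.piece i ↔ (0 < W.s i ↔ 0 < W.s (i + 1)) := by
  simp only [piece]
  split_ifs with h <;> simp [h]

/-- The piece index never decreases, so equal values at `i` and `j` leave no sign change in between.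
-/
theorem pos_iff_of_piece_eq (W : Walk) {i j : ℕ} (h : W.piece i = W.piece j) :
    ∀ l, i ≤ l → l ≤ j → W.piece l = W.piece i ∧ (0 < W.s l ↔ 0 < W.s i) := by
  intro l hl
  induction l, hl using Nat.le_induction with
  | base => exact fun _ => ⟨rfl, Iff.rfl⟩
  | succ l hl ih =>
    intro hlj
    obtain ⟨h1, h2⟩ := ih (by omega)
    have h3 := W.piece_mono hlj
    have h4 := W.piece_mono (Nat.le_succ l)
    have h5 : W.piece (l + 1) = W.piece i := by
      change W.piece l ≤ W.piece (l + 1) at h4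
      omega
    exact ⟨h5, ((W.piece_succ_eq_iff l).1 (h5.trans h1.symm)).symm.trans h2⟩

theorem comp_of_unbent (W : Walk) {i : ℕ} (h1 : 1 ≤ i) (h : 0 < W.s (i - 1) ↔ 0 < W.s i) :
    W.piece (i - 1) = W.comp i ∧ W.piece i = W.comp i := by
  have h2 := (W.piece_succ_eq_iff (i - 1)).2 (by rwa [Nat.sub_add_cancel h1])
  rw [Nat.sub_add_cancel h1] at h2
  unfold comp
  by_cases h3 : 0 < W.s i
  · simp [h3, h2]
  · simp [h3, h.not.2 h3, h2]

/-- The weights of the string decrease along unbent tails, and no piece running from left to right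
has two unbent tails. -/
structure Alternating (W : Walk) : Prop where
  natAbs_lt : ∀ i < W.n, (0 < W.s i ↔ 0 < W.s (i + 1)) → (W.s (i + 1)).natAbs < (W.s i).natAbs
  not_three : ∀ i, i + 2 ≤ W.n → ¬ (0 < W.s i ∧ 0 < W.s (i + 1) ∧ 0 < W.s (i + 2))

/-- The first `k` vertices of the string, without chains. -/
def take (W : Walk) (k : ℕ) : Walk where
  n := k
  s := W.s
  δ := W.δ
  len _ := 0

theorem isName_of_take {W : Walk} {k : ℕ} (hkn : k ≤ W.n) {x : Edg} (hx : (W.take k).IsName x) : W.IsName x := by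
  cases x with
  | str i => exact le_trans (show i ≤ k from hx) hkn
  | tl i j b => exact ⟨hx.1, le_trans (show i ≤ k from hx.2.1) hkn,
      le_trans (show j ≤ 0 from hx.2.2.1) (Nat.zero_le _), hx.2.2.2⟩

end Walk

namespace IsModel

open Edg Cover

variable {r : ℕ} {E : Type} {φ : Cover r E} {W : Walk} {pt : ℕ → ℕ → Option (Fin r)} {ed : Edg → E}
  (M : IsModel φ W pt ed)
include M

theorem edges_str {i : ℕ} {v : Fin r} (hv : pt i 0 = some v) {e : E}
    (he : e ∈ {e | ∃ i ≤ W.n, ed (str i) = e}) (h : φ.Inc e v) :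
    e = ed (str (i - 1)) ∨ e = ed (str i) := by
  obtain ⟨l, hl, rfl⟩ := he
  obtain ⟨-, rfl | rfl⟩ := (M.inc_str_iff hl hv).1 h
  · exact Or.inr rfl
  · exact Or.inl rfl

section Ends

variable {i : ℕ} {v : Fin r} (hv : pt i 0 = some v)
include hv

theorem pt_ne {j l : ℕ} (h : j ≠ i ∨ l ≠ 0) : ¬ pt j l = some v := fun h' => by
  have := M.pt_inj _ _ _ _ v h' hv
  omega

theorem src_prev_iff : φ.src (ed (str (i - 1))) = some v ↔ ¬ 0 < W.s (i - 1) := by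
  obtain ⟨h1, h2, h3⟩ := (M.pt_iff i 0).1 ⟨v, hv⟩
  rw [M.src_str (i - 1) (by omega), Nat.sub_add_cancel h1]
  have := M.pt_ne hv (j := i - 1) (l := 0) (Or.inl (by omega))
  split_ifs with h <;> simp [h, this, hv]

theorem tgt_prev_iff : φ.tgt (ed (str (i - 1))) = some v ↔ 0 < W.s (i - 1) := by
  obtain ⟨h1, h2, h3⟩ := (M.pt_iff i 0).1 ⟨v, hv⟩
  rw [M.tgt_str (i - 1) (by omega), Nat.sub_add_cancel h1]
  have := M.pt_ne hv (j := i - 1) (l := 0) (Or.inl (by omega))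
  split_ifs with h <;> simp [h, this, hv]

theorem src_next_iff : φ.src (ed (str i)) = some v ↔ 0 < W.s i := by
  rw [M.src_str i ((M.pt_iff i 0).1 ⟨v, hv⟩).2.1]
  have := M.pt_ne hv (j := i + 1) (l := 0) (Or.inl (by omega))
  split_ifs with h <;> simp [h, this, hv]

theorem tgt_next_iff : φ.tgt (ed (str i)) = some v ↔ ¬ 0 < W.s i := by
  rw [M.tgt_str i ((M.pt_iff i 0).1 ⟨v, hv⟩).2.1]
  have := M.pt_ne hv (j := i + 1) (l := 0) (Or.inl (by omega))
  split_ifs with h <;> simp [h, this, hv]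

theorem src_tail_iff : φ.src (ed (tl i 0 false)) = some v ↔ ¬ 0 < W.δ i := by
  obtain ⟨h1, h2, h3⟩ := (M.pt_iff i 0).1 ⟨v, hv⟩
  rw [M.src_tl i 0 false ⟨h1, h2, h3, by simp⟩]
  have := M.pt_ne hv (j := i) (l := 0 + 1) (Or.inr (by omega))
  split_ifs with h <;> simp [h, this, hv]

theorem tgt_tail_iff : φ.tgt (ed (tl i 0 false)) = some v ↔ 0 < W.δ i := by
  obtain ⟨h1, h2, h3⟩ := (M.pt_iff i 0).1 ⟨v, hv⟩
  rw [M.tgt_tl i 0 false ⟨h1, h2, h3, by simp⟩]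
  have := M.pt_ne hv (j := i) (l := 0 + 1) (Or.inr (by omega))
  split_ifs with h <;> simp [h, this, hv]

theorem bent_iff :
    φ.Bent {e | ∃ i ≤ W.n, ed (str i) = e} v ↔ ¬ (0 < W.s (i - 1) ↔ 0 < W.s i) := by
  obtain ⟨h1, h2, h3⟩ := (M.pt_iff i 0).1 ⟨v, hv⟩
  have hn1 : W.IsName (str (i - 1)) := by change i - 1 ≤ W.n; omega
  have hne : ed (str (i - 1)) ≠ ed (str i) := M.ed_ne hn1 h2 (by simp; omega)
  have k1 := M.src_prev_iff hv
  have k2 := M.tgt_prev_iff hv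
  have k3 := M.src_next_iff hv
  have k4 := M.tgt_next_iff hv
  constructor
  · rintro ⟨e, he, f, hf, hef, h⟩
    have ie : φ.Inc e v := h.elim (fun h => Or.inl h.1) fun h => Or.inr h.1
    have jf : φ.Inc f v := h.elim (fun h => Or.inl h.2) fun h => Or.inr h.2
    rcases M.edges_str hv he ie with rfl | rfl <;> rcases M.edges_str hv hf jf with rfl | rfl
    · exact absurd rfl hef
    · rw [k1, k2, k3, k4] at h; tauto
    · rw [k1, k2, k3, k4] at h; tauto
    · exact absurd rfl hef
  · intro h
    refine ⟨_, ⟨i - 1, hn1, rfl⟩, _, ⟨i, h2, rfl⟩, hne, ?_⟩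
    rw [k1, k2, k3, k4]
    tauto

end Ends

section Short

variable (hlen : ∀ i, 1 ≤ i → i ≤ W.n → W.len i = 0)
include hlen

theorem exists_str_vertex (v : Fin r) : ∃ i, 1 ≤ i ∧ i ≤ W.n ∧ pt i 0 = some v := by
  obtain ⟨i, j, hv⟩ := M.pt_surj v
  obtain ⟨h1, h2, h3⟩ := (M.pt_iff i j).1 ⟨v, hv⟩
  have := hlen i h1 h2
  have hj : j = 0 := by omega
  subst hj
  exact ⟨i, h1, h2, hv⟩

/-- The definition of tails speaks of arbitrary edge sets. With trivial lengths the third edge at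
the vertex is an end, so neither a fork nor a cycle can follow. -/
theorem tailAt {s : Side} {i : ℕ} {a : Fin r} (ha : pt i 0 = some a) {e : E} {T : Set E}
    (h : φ.IsTailAt {e | ∃ i ≤ W.n, ed (str i) = e} s a e T) :
    e = ed (tl i 0 false) ∧ T = {e} ∧ (s = if 0 < W.δ i then Side.left else Side.right) := by
  obtain ⟨h1, h2, h3⟩ := (M.pt_iff i 0).1 ⟨a, ha⟩
  have hn : W.IsName (tl i 0 false) := ⟨h1, h2, h3, by simp⟩
  have heT : e ∈ T := by cases h.isTail <;> simp
  have heS : e ∉ {e | ∃ i ≤ W.n, ed (str i) = e} := fun h' => Set.disjoint_left.1 h.disjoint heT h'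
  have hinc : φ.Inc e a := by
    have := h.attached
    cases s with
    | left => exact Or.inr this
    | right => exact Or.inl this
  have he : e = ed (tl i 0 false) := by
    rcases (M.inc_string_vertex ha e).1 hinc with rfl | rfl | rfl
    · exact absurd ⟨i - 1, by omega, rfl⟩ heS
    · exact absurd ⟨i, h2, rfl⟩ heS
    · rfl
  have hpn : pt i (0 + 1) = none := M.pt_none (by have := hlen i h1 h2; omega)
  have hs : s = if 0 < W.δ i then Side.left else Side.right := by
    have := h.attached
    rw [he] at this
    cases s with
    | left =>
      simp only [near] at this
      rw [M.tgt_tl _ _ _ hn] at this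
      split_ifs at this ⊢
      · rfl
      · rw [hpn] at this; cases this
    | right =>
      simp only [near] at this
      rw [M.src_tl _ _ _ hn] at this
      split_ifs at this ⊢
      · rw [hpn] at this; cases this
      · rfl
  have hfar : φ.far s e = none := by
    rw [hs, he]
    split_ifs with h4
    · simp only [far]; rw [M.src_tl _ _ _ hn, if_pos h4, hpn]
    · simp only [far]; rw [M.tgt_tl _ _ _ hn, if_neg h4, hpn]
  refine ⟨he, ?_, hs⟩
  have hT := h.isTail
  cases hT with
  | single => rfl
  | fork => rename_i h'; rw [hfar] at h'; cases h'
  | cycle => rename_i h'; rw [hfar] at h'; cases h'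

theorem tailVerts_eq (a : Fin r) :
    φ.tailVerts {e | ∃ i ≤ W.n, ed (str i) = e} a = {a} := by
  obtain ⟨i, h1, h2, ha⟩ := M.exists_str_vertex hlen a
  ext w
  refine ⟨?_, fun h => Or.inl h⟩
  rintro (rfl | ⟨s, e, T, hT, hw⟩)
  · rfl
  · obtain ⟨rfl, rfl, -⟩ := M.tailAt hlen ha hT
    obtain ⟨e, rfl, hw⟩ := hw
    obtain ⟨l, -, -, hl⟩ := M.exists_str_vertex hlen w
    obtain ⟨rfl, -⟩ := (M.inc_tl_iff (j' := 0) (i' := l) ⟨h1, h2, Nat.zero_le _, by simp⟩ hl).1 hw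
    exact Option.some_injective _ (hl.symm.trans ha)

/-- Passing an unbent vertex keeps the sign, hence the piece index. Conversely, edges of equal index
are joined through vertices at which the sign does not change. -/
theorem samePiece_iff {x y : ℕ} (hx : x ≤ W.n) (hy : y ≤ W.n) :
    φ.SamePiece {e | ∃ i ≤ W.n, ed (str i) = e} (ed (str x)) (ed (str y)) ↔
      W.piece x = W.piece y := by
  have unb : ∀ {l : ℕ} {v : Fin r}, pt l 0 = some v →
      ¬ φ.Bent {e | ∃ i ≤ W.n, ed (str i) = e} v → W.piece (l - 1) = W.piece l := by
    intro l v hv hb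
    have h1 := ((M.pt_iff l 0).1 ⟨v, hv⟩).1
    rw [M.bent_iff hv, not_not] at hb
    have := W.comp_of_unbent h1 hb
    exact this.1.trans this.2.symm
  constructor
  · intro h
    have key : ∀ f, φ.SamePiece {e | ∃ i ≤ W.n, ed (str i) = e} (ed (str x)) f →
        ∃ y ≤ W.n, f = ed (str y) ∧ W.piece x = W.piece y := by
      intro f hf
      induction hf with
      | refl => exact ⟨x, hx, rfl, rfl⟩
      | @tail b c _ hst ih =>
        obtain ⟨y, hy, rfl, hxy⟩ := ih
        obtain ⟨-, ⟨z, hz, rfl⟩, v, h1, h2, h3⟩ := hst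
        obtain ⟨l, -, -, hv⟩ := M.exists_str_vertex hlen v
        have h4 := ((M.inc_str_iff hy hv).1 h1).2
        have h5 := ((M.inc_str_iff hz hv).1 h2).2
        have h6 := unb hv h3
        refine ⟨z, hz, rfl, ?_⟩
        rcases h4 with rfl | rfl <;> rcases h5 with rfl | h5
        · exact hxy
        · have : z = y - 1 := by omega
          rw [this, h6, hxy]
        · rw [← h6, Nat.add_sub_cancel, hxy]
        · have : z = y := by omega
          rw [this, hxy]
    obtain ⟨z, hz, h1, h2⟩ := key _ h
    have := M.ed_inj (str y) (str z) hy hz h1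
    simp only [str.injEq] at this
    rw [this, h2]
  · have key : ∀ x y, x ≤ y → y ≤ W.n → W.piece x = W.piece y →
        φ.SamePiece {e | ∃ i ≤ W.n, ed (str i) = e} (ed (str x)) (ed (str y)) ∧
        φ.SamePiece {e | ∃ i ≤ W.n, ed (str i) = e} (ed (str y)) (ed (str x)) := by
      intro x y hxy
      induction y, hxy using Nat.le_induction with
      | base => exact fun _ _ => ⟨Relation.ReflTransGen.refl, Relation.ReflTransGen.refl⟩
      | succ y hxy ih =>
        intro hy h
        have h1 := W.pos_iff_of_piece_eq h y hxy (Nat.le_succ y)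
        have h2 := W.pos_iff_of_piece_eq h (y + 1)
          (Nat.le_succ_of_le hxy) le_rfl
        obtain ⟨i1, i2⟩ := ih (by omega) h1.1.symm
        obtain ⟨v, hv⟩ := M.pt_some (i := y + 1) (j := 0) (by omega) hy (Nat.zero_le _)
        have hb : ¬ φ.Bent {e | ∃ i ≤ W.n, ed (str i) = e} v := by
          rw [M.bent_iff hv, not_not, Nat.add_sub_cancel]
          exact h1.2.trans h2.2.symm
        have e1 : φ.Inc (ed (str y)) v := (M.inc_str (by omega) v).2 (Or.inr hv)
        have e2 : φ.Inc (ed (str (y + 1))) v := (M.inc_str hy v).2 (Or.inl hv)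
        exact ⟨i1.tail ⟨⟨y, by omega, rfl⟩, ⟨y + 1, hy, rfl⟩, v, e1, e2, hb⟩,
          Relation.ReflTransGen.head ⟨⟨y + 1, hy, rfl⟩, ⟨y, by omega, rfl⟩, v, e2, e1, hb⟩ i2⟩
    intro h
    rcases le_total x y with hxy | hxy
    · exact (key x y hxy hy h).1
    · exact (key y x hxy hx h.symm).2

/-- The in-pieces are those running from left to right. As all tails are single edges, the
conditions on cycles and forks are void and the intervals of the tails are points. The sides of
unbent tails follow from `natAbs_lt`, the bound on their number from `not_three`, and `ho` makes the
components occupy consecutive blocks of vertices, later ones to the left. -/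
theorem isUniversallyMonotoneAlong [Fintype E] (hW : W.Alternating)
    (ho : ∀ i j u v, pt i 0 = some u → pt j 0 = some v → u ≤ v → W.comp j ≤ W.comp i) :
    φ.IsUniversallyMonotoneAlong {e | ∃ i ≤ W.n, ed (str i) = e}
      {e | ∃ i ≤ W.n, 0 < W.s i ∧ ed (str i) = e} := by
  have memI : ∀ {i}, i ≤ W.n →
      (ed (str i) ∈ {e | ∃ i ≤ W.n, 0 < W.s i ∧ ed (str i) = e} ↔ 0 < W.s i) := by
    intro i hi
    constructor
    · rintro ⟨j, hj, h1, h2⟩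
      have := M.ed_inj (str j) (str i) hj hi h2
      simp only [str.injEq] at this
      rwa [← this]
    · exact fun h => ⟨i, hi, h, rfl⟩
  have subI : {e | ∃ i ≤ W.n, 0 < W.s i ∧ ed (str i) = e} ⊆ {e | ∃ i ≤ W.n, ed (str i) = e} := by
    rintro _ ⟨i, hi, -, rfl⟩
    exact ⟨i, hi, rfl⟩
  have compv : ∀ x ≤ W.n, ∀ w, w ∈ φ.compVerts {e | ∃ i ≤ W.n, ed (str i) = e}
      {e | ∃ i ≤ W.n, 0 < W.s i ∧ ed (str i) = e} (ed (str x)) →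
      ∃ i, pt i 0 = some w ∧ W.comp i = W.piece x := by
    rintro x hx w ⟨_, ⟨y, hy, rfl⟩, hxy, a, hya, hb, hw⟩
    rw [M.tailVerts_eq hlen, Set.mem_singleton_iff] at hw
    subst hw
    obtain ⟨i, h1, h2, hv⟩ := M.exists_str_vertex hlen w
    rw [M.samePiece_iff hlen hx hy] at hxy
    rw [M.bent_iff hv, memI hy] at hb
    refine ⟨i, hv, ?_⟩
    rw [hxy]
    have hyi := ((M.inc_str_iff hy hv).1 hya).2
    by_cases hbi : 0 < W.s (i - 1) ↔ 0 < W.s i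
    · have := W.comp_of_unbent h1 hbi
      rcases hyi with rfl | rfl
      · exact this.2.symm
      · rw [Nat.add_sub_cancel] at this; exact this.1.symm
    · have hpos := hb hbi
      unfold Walk.comp
      rcases hyi with rfl | rfl
      · rw [if_pos hpos]
      · rw [Nat.add_sub_cancel] at hbi ⊢
        have : ¬ 0 < W.s (y + 1) := by tauto
        rw [if_neg this, if_pos hpos]
  have hullc : ∀ x ≤ W.n, ∀ w, w ∈ hull (φ.compVerts {e | ∃ i ≤ W.n, ed (str i) = e}
      {e | ∃ i ≤ W.n, 0 < W.s i ∧ ed (str i) = e} (ed (str x))) →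
      ∃ i, pt i 0 = some w ∧ W.comp i = W.piece x := by
    rintro x hx w ⟨a, ha, b, hb, haw, hwb⟩
    obtain ⟨i, hi, hi'⟩ := compv x hx a ha
    obtain ⟨j, hj, hj'⟩ := compv x hx b hb
    obtain ⟨l, -, -, hl⟩ := M.exists_str_vertex hlen w
    have h1 := ho i l a w hi hl haw
    have h2 := ho l j w b hl hj hwb
    exact ⟨l, hl, by omega⟩
  refine ⟨⟨M.isTropical, M.isZigzagAlong, ⟨?_, subI, ?_⟩, ?_, ?_, ?_, ?_, ?_, ?_⟩, ?_⟩
  · refine ⟨ed (str 0), ⟨0, Nat.zero_le _, rfl⟩, Or.inl ?_⟩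
    rw [M.src_str 0 (Nat.zero_le _), if_pos M.valid.pos_zero]
    exact M.pt_none (by omega)
  · intro v e he f hf hef hev hfv
    obtain ⟨i, h1, h2, hv⟩ := M.exists_str_vertex hlen v
    rw [M.bent_iff hv, not_not]
    rcases M.edges_str hv he hev with rfl | rfl <;> rcases M.edges_str hv hf hfv with rfl | rfl
    · exact absurd rfl hef
    · rw [memI (i := i - 1) (by omega), memI h2]
    · rw [memI (i := i - 1) (by omega), memI h2]; exact Iff.comm
    · exact absurd rfl hef
  -- At an unbent vertex the absolute weight drops, so the tail has sign opposite to the string: an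
  -- out-tail on in-pieces, an in-tail on out-pieces.
  · intro s a e T hT hb f hf hfa
    obtain ⟨i, h1, h2, hv⟩ := M.exists_str_vertex hlen a
    obtain ⟨-, -, hs⟩ := M.tailAt hlen hv hT
    rw [M.bent_iff hv, not_not] at hb
    have h3 := hW.natAbs_lt (i - 1) (by omega)
    have h4 := M.valid.step (i - 1) (by omega)
    have h5 := M.valid.ne_zero i h1 h2
    have h6 := M.s_ne (i := i) h2
    have h7 := M.s_ne (i := i - 1) (by omega)
    rw [Nat.sub_add_cancel h1] at h3 h4
    have h8 := h3 hb
    have hfI : f ∈ {e | ∃ i ≤ W.n, 0 < W.s i ∧ ed (str i) = e} ↔ 0 < W.s i := by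
      rcases M.edges_str hv hf hfa with rfl | rfl
      · rw [memI (i := i - 1) (by omega), hb]
      · rw [memI h2]
    rw [hfI]
    constructor
    · intro h9
      rw [hs, if_neg (by have := hb.2 h9; omega)]
    · intro h9
      rw [hs, if_pos (by have := mt hb.1 h9; omega)]
  · rintro s a - e T hT - ⟨f, hf, f', hf', h⟩
    obtain ⟨i, h1, h2, hv⟩ := M.exists_str_vertex hlen a
    obtain ⟨-, rfl, -⟩ := M.tailAt hlen hv hT
    exact h.1 (hf.trans hf'.symm)
  · rintro a - e T hT - ⟨f, hf, f', hf', h⟩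
    obtain ⟨i, h1, h2, hv⟩ := M.exists_str_vertex hlen a
    obtain ⟨-, rfl, -⟩ := M.tailAt hlen hv hT
    exact h.1 (hf.trans hf'.symm)
  · rintro s a e T hT - ⟨f, hf, f', hf', h⟩
    obtain ⟨i, h1, h2, hv⟩ := M.exists_str_vertex hlen a
    obtain ⟨-, rfl, -⟩ := M.tailAt hlen hv hT
    exact absurd (hf.trans hf'.symm) (h.elim (fun h => h.1) fun h => h.1)
  · intro a _ b _ hab
    rw [M.tailVerts_eq hlen, M.tailVerts_eq hlen, Set.disjoint_left]
    rintro x ⟨_, rfl, _, rfl, h1, h2⟩ ⟨_, rfl, _, rfl, h3, h4⟩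
    exact hab (le_antisymm (h1.trans h4) (h3.trans h2))
  · rintro _ ⟨x, hx, rfl⟩ _ ⟨y, hy, rfl⟩ hxy
    rw [Set.disjoint_left]
    intro w hw hw'
    obtain ⟨i, hi, hi'⟩ := hullc x hx w hw
    obtain ⟨j, hj, hj'⟩ := hullc y hy w hw'
    obtain ⟨rfl, -⟩ := M.pt_inj _ _ _ _ w hi hj
    exact hxy ((M.samePiece_iff hlen hx hy).2 (hi'.symm.trans hj'))
  · rintro _ ⟨x, hx, hx', rfl⟩ _ ⟨y, hy, hy', rfl⟩ hxy a b hxa hyb hba hbb - - - - - -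
    rw [M.samePiece_iff hlen hx hy] at hxy
    obtain ⟨i, h1, h2, ha⟩ := M.exists_str_vertex hlen a
    obtain ⟨j, h3, h4, hb⟩ := M.exists_str_vertex hlen b
    rw [M.bent_iff ha, not_not] at hba
    rw [M.bent_iff hb, not_not] at hbb
    have k1 := W.comp_of_unbent h1 hba
    have k2 := W.comp_of_unbent h3 hbb
    have hxi := ((M.inc_str_iff hx ha).1 hxa).2
    have hyj := ((M.inc_str_iff hy hb).1 hyb).2
    have k3 : W.piece x = W.piece i ∧ 0 < W.s i := by
      rcases hxi with rfl | rfl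
      · exact ⟨rfl, hx'⟩
      · rw [Nat.add_sub_cancel] at k1 hba; exact ⟨k1.1.trans k1.2.symm, hba.1 hx'⟩
    have k4 : W.piece y = W.piece j ∧ 0 < W.s j := by
      rcases hyj with rfl | rfl
      · exact ⟨rfl, hy'⟩
      · rw [Nat.add_sub_cancel] at k2 hbb; exact ⟨k2.1.trans k2.2.symm, hbb.1 hy'⟩
    -- Two unbent vertices on one left-to-right piece would give three consecutive positive weights.
    have key : ∀ i j, 1 ≤ i → j ≤ W.n → (0 < W.s (i - 1) ↔ 0 < W.s i) → 0 < W.s i →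
        W.piece i = W.piece j → ¬ i < j := by
      intro i j h1 h2 h3 h4 h5 h6
      have h7 := (W.pos_iff_of_piece_eq h5 (i + 1) (by omega) h6).2
      have h8 := hW.not_three (i - 1) (by omega)
      have e1 : i - 1 + 1 = i := by omega
      have e2 : i - 1 + 2 = i + 1 := by omega
      rw [e1, e2] at h8
      exact h8 ⟨h3.2 h4, h4, h7.2 h4⟩
    have hij : W.piece i = W.piece j := by rw [← k3.1, ← k4.1, hxy]
    have e1 := key i j h1 h4 hba k3.2 hij
    have e2 := key j i h3 h2 hbb k4.2 hij.symm
    have e3 : i = j := by omega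
    subst e3
    exact Option.some_injective _ (ha.symm.trans hb)

end Short

section Mixed

variable {k : ℕ} (hk : 1 ≤ k) (hkn : k ≤ W.n) (hlen : ∀ i, 1 ≤ i → i ≤ k → W.len i = 0)
  (hcut : ∀ i j v, pt i j = some v → (v.val < k ↔ i ≤ k))
include hk hkn hlen hcut

/-- By `hcut` the first `k` vertices on the line are the first `k` vertices of the string, and their
tails have no further vertices. Hence the edges that meet them are named by `W.take k`. -/
theorem firstEdges_iff {x : Edg} (hx : W.IsName x) :
    ed x ∈ φ.firstEdges k ↔ (W.take k).IsName x := by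
  have hz : ∀ {i j v}, pt i j = some v → v.val < k → j = 0 := by
    intro i j v hv hvk
    have h1 := (hcut i j v hv).1 hvk
    have h2 := (M.pt_iff i j).1 ⟨v, hv⟩
    have := hlen i h2.1 h1
    omega
  cases x with
  | str i =>
    constructor
    · rintro ⟨v, hv, hinc⟩
      rcases (M.inc_str hx v).1 hinc with h | h
      · exact (hcut _ _ _ h).1 hv
      · have := (hcut _ _ _ h).1 hv
        change i ≤ k
        omega
    · intro hi
      have hi : i ≤ k := hi
      rcases Nat.eq_zero_or_pos i with rfl | h0
      · obtain ⟨v, hv⟩ := M.pt_some (i := 1) (j := 0) le_rfl (by omega) (Nat.zero_le _)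
        exact ⟨v, (hcut _ _ _ hv).2 hk, (M.inc_str hx v).2 (Or.inr hv)⟩
      · obtain ⟨v, hv⟩ := M.pt_some (i := i) (j := 0) h0 (by omega) (Nat.zero_le _)
        exact ⟨v, (hcut _ _ _ hv).2 hi, (M.inc_str hx v).2 (Or.inl hv)⟩
  | tl i j b =>
    constructor
    · rintro ⟨v, hv, hinc⟩
      rcases (M.inc_tl hx v).1 hinc with h | h
      · exact ⟨hx.1, (hcut _ _ _ h).1 hv, (hz h hv).le, hx.2.2.2⟩
      · have := hz h hv
        omega
    · rintro ⟨h1, h2, h3, h4⟩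
      have h3 : j = 0 := Nat.le_zero.1 h3
      subst h3
      obtain ⟨v, hv⟩ := M.pt_some (i := i) (j := 0) h1 hx.2.1 (Nat.zero_le _)
      exact ⟨v, (hcut _ _ _ hv).2 h2, (M.inc_tl hx v).2 (Or.inl hv)⟩

/-- Cutting after the `k`-th vertex turns the `k`-th edge of the string into an end. It must be an
out-end, and this is where `hpos` enters. -/
theorem exists_restrict (hpos : 0 < W.s k) :
    ∃ (pt' : ℕ → ℕ → Option (Fin k)) (ed' : Edg → φ.firstEdges k),
      IsModel (φ.restrict k) (W.take k) pt' ed' ∧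
      (∀ i j v, pt' i j = some v → ∃ u : Fin r, u.val = v.val ∧ pt i j = some u) ∧
      {e : φ.firstEdges k | e.1 ∈ {e | ∃ i ≤ W.n, ed (str i) = e}} =
        {e | ∃ i ≤ (W.take k).n, ed' (str i) = e} := by
  classical
  have hfe : ∀ {x}, (W.take k).IsName x → ed x ∈ φ.firstEdges k := fun {x} hx =>
    (M.firstEdges_iff hk hkn hlen hcut (Walk.isName_of_take hkn hx)).2 hx
  let ed' : Edg → φ.firstEdges k := fun x =>
    if h : (W.take k).IsName x then ⟨ed x, hfe h⟩ else ⟨ed (str 0), hfe (x := str 0) (Nat.zero_le _)⟩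
  have hed : ∀ {x}, (W.take k).IsName x → (ed' x).1 = ed x := by
    intro x hx
    simp only [ed', dif_pos hx]
  let pt' : ℕ → ℕ → Option (Fin k) := fun i j => (pt i j).bind (cut k)
  have hpt : ∀ i j (v : Fin k), pt' i j = some v ↔ ∃ u : Fin r, u.val = v.val ∧ pt i j = some u := by
    intro i j v
    simp only [pt', Option.bind_eq_some_iff]
    constructor
    · rintro ⟨u, hu, hc⟩
      unfold cut at hc
      split_ifs at hc with h
      exact ⟨u, by rw [← Option.some_injective _ hc], hu⟩
    · rintro ⟨u, huv, hu⟩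
      refine ⟨u, hu, ?_⟩
      unfold cut
      rw [dif_pos (by rw [huv]; exact v.2)]
      exact congrArg some (Fin.ext huv)
  have hbind : ∀ (p : Prop) [Decidable p] (a b : Option (Fin r)), (if p then a else b).bind (cut k) =
      if p then a.bind (cut k) else b.bind (cut k) := by
    intro p _ a b
    split_ifs <;> rfl
  have M' : IsModel (φ.restrict k) (W.take k) pt' ed' := by
    refine ⟨⟨?_, ?_, ?_, ?_, ?_, M.valid.pos_zero, hpos⟩, ?_, ?_, ?_, ?_, ?_, ?_, ?_, ?_, ?_, ?_, ?_, ?_⟩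
    · exact fun i hi => M.valid.step i (lt_of_lt_of_le hi hkn)
    · exact fun i hi => M.valid.odd i (le_trans hi hkn)
    · exact fun i h1 h2 => M.valid.even i h1 (le_trans h2 hkn)
    · exact fun i h1 h2 => M.valid.ne_zero i h1 (le_trans h2 hkn)
    · exact fun i h1 h2 h3 => absurd h3 (lt_irrefl 0)
    · intro i j
      constructor
      · rintro ⟨v, hv⟩
        obtain ⟨u, huv, hu⟩ := (hpt i j v).1 hv
        have h1 := (M.pt_iff i j).1 ⟨u, hu⟩
        have h2 := (hcut _ _ _ hu).1 (by rw [huv]; exact v.2)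
        have h3 := hlen i h1.1 h2
        exact ⟨h1.1, h2, by rw [h3] at h1; exact h1.2.2⟩
      · rintro ⟨h1, h2, h3⟩
        obtain ⟨u, hu⟩ := M.pt_some (j := j) h1 (le_trans h2 hkn)
          (le_trans (show j ≤ 0 from h3) (Nat.zero_le _))
        exact ⟨⟨u.val, (hcut _ _ _ hu).2 h2⟩, (hpt _ _ _).2 ⟨u, rfl, hu⟩⟩
    · intro i j i' j' v h h'
      obtain ⟨u, huv, hu⟩ := (hpt i j v).1 h
      obtain ⟨u', huv', hu'⟩ := (hpt i' j' v).1 h'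
      have : u = u' := Fin.ext (huv.trans huv'.symm)
      subst this
      exact M.pt_inj _ _ _ _ u hu hu'
    · intro v
      -- The first `k` vertices of the string are distinct elements of `Fin r`, whence `k ≤ r`.
      have hvr : v.val < r := by
        by_contra hvr
        have hinj : Function.Injective fun i : Fin k =>
            (M.pt_some (i := i.val + 1) (j := 0) (by omega) (by omega) (Nat.zero_le _)).choose := by
          intro a b hab
          have ha := (M.pt_some (i := a.val + 1) (j := 0) (by omega) (by omega)
            (Nat.zero_le _)).choose_spec
          have hb := (M.pt_some (i := b.val + 1) (j := 0) (by omega) (by omega)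
            (Nat.zero_le _)).choose_spec
          simp only at hab
          rw [hab] at ha
          have := (M.pt_inj _ _ _ _ _ ha hb).1
          exact Fin.ext (by omega)
        have := Fintype.card_le_of_injective _ hinj
        simp only [Fintype.card_fin] at this
        omega
      obtain ⟨i, j, h⟩ := M.pt_surj ⟨v.val, hvr⟩
      exact ⟨i, j, (hpt _ _ _).2 ⟨_, rfl, h⟩⟩
    · intro x y hx hy h
      refine M.ed_inj x y (Walk.isName_of_take hkn hx)
        (Walk.isName_of_take hkn hy) ?_
      rw [← hed hx, ← hed hy, h]
    · rintro ⟨e, he⟩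
      obtain ⟨x, hx, rfl⟩ := M.ed_surj e
      have hx' := (M.firstEdges_iff hk hkn hlen hcut hx).1 he
      exact ⟨x, hx', Subtype.ext (hed hx')⟩
    · intro i hi
      have hi' : i ≤ W.n := le_trans hi hkn
      change (φ.src (ed' (str i)).1).bind (cut k) = _
      rw [hed (x := str i) hi, M.src_str i hi', hbind]
      rfl
    · intro i hi
      have hi' : i ≤ W.n := le_trans hi hkn
      change (φ.tgt (ed' (str i)).1).bind (cut k) = _
      rw [hed (x := str i) hi, M.tgt_str i hi', hbind]
      rfl
    · intro i j b hn
      change (φ.src (ed' (tl i j b)).1).bind (cut k) = _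
      rw [hed hn, M.src_tl i j b (Walk.isName_of_take hkn hn), hbind]
      rfl
    · intro i j b hn
      change (φ.tgt (ed' (tl i j b)).1).bind (cut k) = _
      rw [hed hn, M.tgt_tl i j b (Walk.isName_of_take hkn hn), hbind]
      rfl
    · intro i hi
      simp only [restrict, hed (x := str i) hi]
      exact M.wt_str i (le_trans hi hkn)
    · intro i j b hn
      simp only [restrict, hed hn]
      exact M.wt_tl i j b (Walk.isName_of_take hkn hn)
    · have hcv : ∀ (o : Option (Fin r)) (u : Fin k), o.bind (cut k) = some u →
          ∃ w, o = some w ∧ w.val = u.val := by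
        intro o u h
        rw [Option.bind_eq_some_iff] at h
        obtain ⟨w, hw, hc⟩ := h
        unfold cut at hc
        split_ifs at hc with h
        exact ⟨w, hw, by rw [← Option.some_injective _ hc]⟩
      intro e u v hu hv
      obtain ⟨u', h1, h2⟩ := hcv _ _ hu
      obtain ⟨v', h3, h4⟩ := hcv _ _ hv
      have := M.lt e.1 u' v' h1 h3
      rw [Fin.lt_def] at this ⊢
      omega
  refine ⟨pt', ed', M', fun i j v h => (hpt i j v).1 h, ?_⟩
  ext ⟨e, he⟩
  constructor
  · rintro ⟨i, hi, h⟩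
    simp only at h
    subst h
    have hi' := (M.firstEdges_iff hk hkn hlen hcut (x := str i) hi).1 he
    exact ⟨i, hi', Subtype.ext (hed (x := str i) hi')⟩
  · rintro ⟨i, hi, h⟩
    have := congrArg Subtype.val h
    rw [hed (x := str i) hi] at this
    exact ⟨i, le_trans hi hkn, this⟩

/-- The only edge leading from the first `k` vertices to a later one is the `k`-th edge of the
string. This gives the separation condition, and the rest of the string is connected because it is a
final segment. -/
theorem isMixedAlong [Fintype E] (hpos : 0 < W.s k) (hW : (W.take k).Alternating)
    (ho : ∀ i j u v, i ≤ k → j ≤ k → pt i 0 = some u → pt j 0 = some v → u ≤ v →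
      W.comp j ≤ W.comp i) :
    φ.IsMixedAlong k {e | ∃ i ≤ W.n, ed (str i) = e} := by
  have hcomp : ∀ i, (W.take k).comp i = W.comp i := by
    have h1 : ∀ i, (W.take k).piece i = W.piece i := by
      intro i
      induction i with
      | zero => rfl
      | succ i ih => simp only [Walk.piece, ih]; rfl
    intro i
    unfold Walk.comp
    rw [h1, h1]
    rfl
  have hstr : ∀ {i}, i ≤ W.n → (ed (str i) ∈ φ.firstEdges k ↔ i ≤ k) := fun {i} hi =>
    M.firstEdges_iff hk hkn hlen hcut (x := str i) hi
  refine ⟨M.isZigzagAlong, ?_, ?_, ?_⟩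
  · have key : ∀ e ∈ φ.firstEdges k, ∀ v : Fin r, k ≤ v.val → φ.Inc e v → e = ed (str k) := by
      intro e he v hv hev
      obtain ⟨x, hx, rfl⟩ := M.ed_surj e
      have hx' := (M.firstEdges_iff hk hkn hlen hcut hx).1 he
      obtain ⟨i, j, hij⟩ := M.pt_surj v
      have hik : ¬ i ≤ k := fun h => absurd ((hcut i j v hij).2 h) (not_lt.2 hv)
      cases x with
      | str l =>
        have hl : l ≤ k := hx'
        have := ((M.inc_str_iff hx hij).1 hev).2
        have : l = k := by omega
        rw [this]
      | tl l m b =>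
        obtain ⟨rfl, -⟩ := (M.inc_tl_iff hx hij).1 hev
        exact absurd hx'.2.1 hik
    intro e he f hf v hv hev hfv
    rw [key e he v hv hev, key f hf v hv hfv]
  · obtain ⟨pt', ed', M', hpt', hS⟩ := M.exists_restrict hk hkn hlen hcut hpos
    rw [hS]
    classical
    refine ⟨_, M'.isUniversallyMonotoneAlong (fun _ _ _ => rfl) hW ?_⟩
    intro i j u v hu hv huv
    rw [hcomp, hcomp]
    obtain ⟨u', h1, h2⟩ := hpt' _ _ _ hu
    obtain ⟨v', h3, h4⟩ := hpt' _ _ _ hv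
    refine ho i j u' v' ((hcut _ _ _ h2).1 (by rw [h1]; exact u.2))
      ((hcut _ _ _ h4).1 (by rw [h3]; exact v.2)) h2 h4 ?_
    rw [Fin.le_def, h1, h3]
    exact huv
  · rintro - _ ⟨⟨x, hx, rfl⟩, hx'⟩ _ ⟨⟨y, hy, rfl⟩, hy'⟩
    rw [hstr hx] at hx'
    rw [hstr hy] at hy'
    have key : ∀ x y, k < x → x ≤ y → y ≤ W.n →
        φ.ConnIn ({e | ∃ i ≤ W.n, ed (str i) = e} \ φ.firstEdges k) (ed (str x)) (ed (str y)) := by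
      intro x y h1 h2 h3
      refine M.connIn_str h2 h3 fun i h4 h5 => ⟨⟨i, h5.trans h3, rfl⟩, ?_⟩
      rw [hstr (h5.trans h3)]
      omega
    rcases le_total x y with h | h
    · exact key x y (by omega) h hy
    · exact (key y x (by omega) h hx).symm

end Mixed

end IsModel


/-! ### Centres of the vertices and mixed factorizations -/

namespace Tuple

/-- A permutation commuting with `swap a b` preserves the pair of its moved points, and `b` cannot
go to `a`, which lies outside `B`. -/
theorem fixed_of_commute {D : ℕ} {μ τ : Perm (Fin D)} {a b : Fin D} {B : Finset (Fin D)}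
    (hτ : τ = swap a b) (hc : μ * τ = τ * μ) (ha : a ∉ B) (hb : b ∈ B) (hμ : μ b ∈ B) : μ b = b := by
  have h1 : μ a = τ (μ b) := by
    have := congrArg (fun f : Perm (Fin D) => f b) hc
    simpa [hτ] using this
  by_contra h2
  rw [hτ, swap_apply_of_ne_of_ne (fun h' => ha (by rw [← h']; exact hμ)) h2] at h1
  rw [μ.injective h1] at ha
  exact ha hb

theorem prod_succ {D r : ℕ} (F : Tuple D r) (v : Fin r) :
    F.prod (v.val + 1) = F.τ v * F.prod v.val := by
  simp [prod]

namespace Realizes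

open Cover

variable {D r : ℕ} {E : Type} {φ : Cover r E} {c : E → Colour} {ε : Fin r → ℤˣ} {F : Tuple D r}
  {B : E → Finset (Fin D)} (h : F.Realizes ε φ c B)
include h

theorem gammaAt_mul_self {i : ℕ} (hi : i ≤ r) : F.gammaAt ε i * F.gammaAt ε i = 1 := by
  induction i with
  | zero => exact h.involution
  | succ i ih =>
    simp only [gammaAt]
    split_ifs
    · exact ih (by omega)
    · rw [← mul_assoc, h.real i (by omega), inv_mul_cancel]

/-- If `γ` inverts `ρ`, then so does `γ * ρ`. Hence the involution after a vertex inverts the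
products on both sides of it. -/
theorem real_succ {i : ℕ} (hi : i ≤ r) :
    F.gammaAt ε (i + 1) * F.prod i * F.gammaAt ε (i + 1) = (F.prod i)⁻¹ := by
  have h1 := h.real i hi
  simp only [gammaAt]
  split_ifs
  · exact h1
  · have h5 : F.prod i * F.gammaAt ε i = F.gammaAt ε i * (F.prod i)⁻¹ := by
      rw [← h1, ← mul_assoc, ← mul_assoc, h.gammaAt_mul_self hi, one_mul]
    rw [mul_assoc (F.gammaAt ε i * F.prod i), ← mul_assoc (F.prod i), h5, inv_mul_cancel_right, h1]

theorem tau_inv (v : Fin r) : (F.τ v)⁻¹ = F.τ v := by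
  obtain ⟨a, b, -, hab⟩ := h.isSwap v
  rw [hab, swap_inv]

/-- With `γ` the involution after the vertex, `γ * ρ * γ = ρ⁻¹` and `γ * (τ * ρ) * γ = ρ⁻¹ * τ`.
Comparing the two gives `τ * ρ * γ = ρ * γ * τ`. -/
theorem commute_old (v : Fin r) : F.prod v.val * F.gammaAt ε (v.val + 1) * F.τ v =
    F.τ v * (F.prod v.val * F.gammaAt ε (v.val + 1)) := by
  have h1 := h.real_succ v.2.le
  have h2 := h.real (v.val + 1) v.2
  have h3 := h.gammaAt_mul_self (i := v.val + 1) v.2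
  have h4 := h.tau_inv v
  rw [F.prod_succ, mul_inv_rev, h4, ← h1] at h2
  have h5 : F.τ v * F.prod v.val * F.gammaAt ε (v.val + 1) =
      F.prod v.val * F.gammaAt ε (v.val + 1) * F.τ v := by
    have := congrArg (fun x => F.gammaAt ε (v.val + 1) * x) h2
    simp only [← mul_assoc, h3, one_mul] at this
    exact this
  rw [← h5, mul_assoc]

theorem commute_new (v : Fin r) : F.prod (v.val + 1) * F.gammaAt ε (v.val + 1) * F.τ v =
    F.τ v * (F.prod (v.val + 1) * F.gammaAt ε (v.val + 1)) := by
  rw [F.prod_succ, mul_assoc (F.τ v), mul_assoc (F.τ v), h.commute_old]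

/-- The centre of a vertex on a new edge. -/
theorem centre_new {v : Fin r} {a b : Fin D} (hτ : F.τ v = swap a b) {e : E}
    (he : φ.Alive (v.val + 1) e) (hc : c e ≠ Colour.dotted) (ha : a ∉ B e) (hb : b ∈ B e) :
    F.prod (v.val + 1) (F.gammaAt ε (v.val + 1) b) = b :=
  fixed_of_commute (μ := F.prod (v.val + 1) * F.gammaAt ε (v.val + 1)) hτ (h.commute_new v) ha hb
    ((h.cyc _ v.2 e he).apply_mem (h.pres _ v.2 e he hc b hb))

/-- The centre of a vertex on an old edge. -/
theorem centre_old {v : Fin r} {a b : Fin D} (hτ : F.τ v = swap a b) {e : E}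
    (he : φ.Alive v.val e) (hc : c e ≠ Colour.dotted) (ha : a ∉ B e) (hb : b ∈ B e) :
    F.prod v.val (F.gammaAt ε (v.val + 1) b) = b := by
  refine fixed_of_commute (μ := F.prod v.val * F.gammaAt ε (v.val + 1)) hτ (h.commute_old v) ha hb
    ((h.cyc _ v.2.le e he).apply_mem ?_)
  simp only [gammaAt]
  split_ifs
  · exact h.pres _ v.2.le e he hc b hb
  · exact h.pres _ v.2.le e he hc _ ((h.cyc _ v.2.le e he).apply_mem hb)

section Tropical

variable [Fintype E] (ht : φ.IsTropical)
include ht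

/-- Two edges on the same side of a vertex have disjoint sets and both meet the transposition, so
each contains exactly one of the two moved points. -/
theorem exists_centre {v : Fin r} {e e' : E} (hne : e ≠ e')
    (he : φ.src e = some v ∧ φ.src e' = some v ∨ φ.tgt e = some v ∧ φ.tgt e' = some v) :
    ∃ a b, a ≠ b ∧ F.τ v = swap a b ∧ a ∉ B e ∧ b ∈ B e := by
  have key : F.Meets v (B e) ∧ F.Meets v (B e') ∧ ∀ x ∈ B e, x ∉ B e' := by
    rcases he with ⟨h1, h2⟩ | ⟨h1, h2⟩
    · have a1 := ht.alive_succ_of_src h1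
      have a2 := ht.alive_succ_of_src h2
      exact ⟨(h.meets_new v e a1).2 h1, (h.meets_new v e' a2).2 h2,
        fun x hx hx' => hne (h.disj _ v.2 e e' x a1 a2 hx hx')⟩
    · have a1 := ht.alive_of_tgt h1
      have a2 := ht.alive_of_tgt h2
      exact ⟨(h.meets_old v e a1).2 h1, (h.meets_old v e' a2).2 h2,
        fun x hx hx' => hne (h.disj _ v.2.le e e' x a1 a2 hx hx')⟩
  obtain ⟨⟨b, hb, hb'⟩, ⟨a, ha, ha'⟩, hd⟩ := key
  have ha2 : a ∉ B e := fun h' => hd a h' ha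
  have hab : a ≠ b := fun h' => ha2 (h' ▸ hb)
  refine ⟨a, b, hab, ?_, ha2, hb⟩
  obtain ⟨x, y, hxy, hτ⟩ := h.isSwap v
  rw [hτ] at ha' hb' ⊢
  have h1 : a = x ∨ a = y := by
    by_contra hn
    push Not at hn
    exact ha' (swap_apply_of_ne_of_ne hn.1 hn.2)
  have h2 : b = x ∨ b = y := by
    by_contra hn
    push Not at hn
    exact hb' (swap_apply_of_ne_of_ne hn.1 hn.2)
  rcases h1 with rfl | rfl <;> rcases h2 with rfl | rfl
  · exact absurd rfl hab
  · rfl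
  · exact swap_comm _ _
  · exact absurd rfl hab

/-- Sheets outside the only incoming edge belong to edges that pass over `v` unchanged. -/
theorem subset_of_cut {v : Fin r} {e f : E} (hf : ∀ g, φ.tgt g = some v → g = f)
    (he : φ.src e = some v) : B e ⊆ B f := by
  intro x hx
  obtain ⟨g, hg, hxg⟩ := h.cover v.val v.2.le x
  by_cases hgv : φ.tgt g = some v
  · rwa [← hf g hgv]
  · have hgs : φ.src g ≠ some v := fun h' => by
      have := hg.1
      rw [h'] at this
      exact absurd this (by simp [birth])
    have hg' := ht.alive_succ_iff.2 (Or.inr ⟨hgs, hg, hgv⟩)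
    have := h.disj _ v.2 e g x (ht.alive_succ_of_src he) hg' hx hxg
    exact absurd (this ▸ he) hgs

end Tropical

end Realizes

end Tuple

namespace Walk

theorem pos_iff_of_piece_eq' (W : Walk) {i j : ℕ} (h : W.piece i = W.piece j) :
    0 < W.s i ↔ 0 < W.s j := by
  rcases le_total i j with hij | hij
  · exact (W.pos_iff_of_piece_eq h j hij le_rfl).2.symm
  · exact (W.pos_iff_of_piece_eq h.symm i hij le_rfl).2

theorem pos_of_piece_eq (W : Walk) {i j l : ℕ} (h : W.piece i = W.piece j) (hi : 0 < W.s i)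
    (h1 : i ≤ l) (h2 : l ≤ j) : 0 < W.s l :=
  (W.pos_iff_of_piece_eq h l h1 h2).2.2 hi

end Walk


namespace IsModel

open Edg Cover MixedZigzag.Tuple

variable {r : ℕ} {E : Type} {φ : Cover r E} {W : Walk} {pt : ℕ → ℕ → Option (Fin r)} {ed : Edg → E}
  (M : IsModel φ W pt ed)
include M

theorem lt_of_pos {i j : ℕ} (hij : i < j) (hpos : ∀ l, i ≤ l → l < j → 0 < W.s l) {u v : Fin r}
    (hu : pt i 0 = some u) (hv : pt j 0 = some v) : u < v := by
  induction j, hij using Nat.le_induction generalizing v with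
  | base =>
    exact M.lt (ed (str i)) u v ((M.src_next_iff hu).2 (hpos i le_rfl (Nat.lt_succ_self _)))
      ((M.tgt_prev_iff hv).2 (hpos i le_rfl (Nat.lt_succ_self _)))
  | succ j hij ih =>
    have hj : 0 < W.s j := hpos j (by omega) (Nat.lt_succ_self _)
    obtain ⟨w, hw⟩ := M.pt_some (i := j) (j := 0) (by omega)
      (by have := ((M.pt_iff _ _).1 ⟨v, hv⟩).2.1; omega) (Nat.zero_le _)
    exact (ih (fun l h1 h2 => hpos l h1 (by omega)) hw).trans
      (M.lt (ed (str j)) w v ((M.src_next_iff hw).2 hj) ((M.tgt_prev_iff hv).2 hj))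

section Centres

variable [Fintype E] {D k : ℕ} {F : Tuple D r} {ε : Fin r → ℤˣ} {c : E → Colour}
  {B : E → Finset (Fin D)} (h : F.Realizes ε φ c B) (hkn : k ≤ W.n)
include h hkn

/-- Where the string turns from leftward to rightward, both its edges start at the vertex, so they
arise by cutting the tail. -/
theorem subset_tail {i : ℕ} (hi : i + 1 ≤ k) (h1 : ¬ 0 < W.s i) (h2 : 0 < W.s (i + 1)) :
    B (ed (str (i + 1))) ⊆ B (ed (tl (i + 1) 0 false)) := by
  obtain ⟨v, hv⟩ := M.pt_some (i := i + 1) (j := 0) (by omega) (by omega) (Nat.zero_le _)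
  refine h.subset_of_cut M.isTropical (fun g hg => ?_) ((M.src_next_iff hv).2 h2)
  rcases (M.inc_string_vertex hv g).1 (Or.inr hg) with rfl | rfl | rfl
  · exact absurd ((M.tgt_prev_iff hv).1 hg) h1
  · exact absurd h2 ((M.tgt_next_iff hv).1 hg)
  · rfl

variable (hW : (W.take k).Alternating)
include hW

/-- Unbent tails on left-to-right pieces are out-tails, so the string only loses sheets along such a
piece. -/
theorem subset_prev {i : ℕ} (hi : i + 1 ≤ k) (h1 : 0 < W.s i) (h2 : 0 < W.s (i + 1)) :
    B (ed (str (i + 1))) ⊆ B (ed (str i)) := by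
  obtain ⟨v, hv⟩ := M.pt_some (i := i + 1) (j := 0) (by omega) (by omega) (Nat.zero_le _)
  have h3 := hW.natAbs_lt i hi (iff_of_true h1 h2)
  have h4 := M.valid.step i (by omega)
  change (W.s (i + 1)).natAbs < (W.s i).natAbs at h3
  refine h.subset_of_cut M.isTropical (fun g hg => ?_) ((M.src_next_iff hv).2 h2)
  rcases (M.inc_string_vertex hv g).1 (Or.inr hg) with rfl | rfl | rfl
  · rfl
  · exact absurd h2 ((M.tgt_next_iff hv).1 hg)
  · have := (M.tgt_tail_iff hv).1 hg
    omega

theorem subset_of_pos {i j : ℕ} (hij : i ≤ j) (hj : j ≤ k) (hpos : ∀ l, i ≤ l → l ≤ j → 0 < W.s l) :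
    B (ed (str j)) ⊆ B (ed (str i)) := by
  induction j, hij using Nat.le_induction with
  | base => exact Finset.Subset.refl _
  | succ j hij ih =>
    exact (M.subset_prev h hkn hW hj (hpos j hij (Nat.le_succ _))
      (hpos (j + 1) (by omega) le_rfl)).trans (ih (by omega) fun l h1 h2 => hpos l h1 (by omega))

/-- Every edge of the string that runs from left to right comes from an in-end joining the string in
the same component. -/
theorem exists_origin (hk : 1 ≤ k) (hlen : ∀ i, 1 ≤ i → i ≤ k → W.len i = 0) {x : ℕ} (hx : x ≤ k) (hpos : 0 < W.s x) :
    ∃ o y u, φ.src o = none ∧ B (ed (str x)) ⊆ B o ∧ φ.tgt o = some u ∧ pt y 0 = some u ∧ y ≤ k ∧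
      W.comp y = W.piece x := by
  induction x with
  | zero =>
    obtain ⟨v, hv⟩ := M.pt_some (i := 1) (j := 0) le_rfl (by omega) (Nat.zero_le _)
    refine ⟨ed (str 0), 1, v, ?_, Finset.Subset.refl _, (M.tgt_prev_iff hv).2 hpos, hv, hk, ?_⟩
    · rw [M.src_str 0 (Nat.zero_le _), if_pos hpos]
      exact M.pt_none (by omega)
    · unfold Walk.comp
      split_ifs with h1
      · exact (W.piece_succ_eq_iff 0).2 (iff_of_true hpos h1)
      · rfl
  | succ x ih =>
    by_cases h1 : 0 < W.s x
    · obtain ⟨o, y, u, h2, h3, h4, h5, h6, h7⟩ := ih (by omega) h1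
      exact ⟨o, y, u, h2, (M.subset_prev h hkn hW hx h1 hpos).trans h3, h4, h5, h6,
        h7.trans ((W.piece_succ_eq_iff x).2 (iff_of_true h1 hpos)).symm⟩
    · obtain ⟨v, hv⟩ := M.pt_some (i := x + 1) (j := 0) (by omega) (by omega) (Nat.zero_le _)
      have h4 := M.valid.step x (by omega)
      have hδ : 0 < W.δ (x + 1) := by omega
      refine ⟨ed (tl (x + 1) 0 false), x + 1, v, ?_, M.subset_tail h hkn hx h1 hpos,
        (M.tgt_tail_iff hv).2 hδ, hv, hx, ?_⟩
      · rw [M.src_tl _ _ _ ⟨by omega, by omega, Nat.zero_le _, by simp⟩, if_pos hδ]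
        exact M.pt_none (by rw [hlen (x + 1) (by omega) hx]; omega)
      · unfold Walk.comp
        rw [if_pos hpos]

/-- The centre of a vertex: a point moved by its transposition, on the piece running from left to
right at this vertex, or else on its tail. -/
theorem exists_centre (hlen : ∀ i, 1 ≤ i → i ≤ k → W.len i = 0) {i : ℕ} (hi : i ≤ k) {v : Fin r}
    (hv : pt i 0 = some v) : ∃ a b, a ≠ b ∧ F.τ v = swap a b ∧
      (0 < W.s i → a ∉ B (ed (str i)) ∧ b ∈ B (ed (str i))) ∧
      (¬ 0 < W.s i → 0 < W.s (i - 1) → a ∉ B (ed (str (i - 1))) ∧ b ∈ B (ed (str (i - 1)))) ∧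
      (¬ 0 < W.s i → ¬ 0 < W.s (i - 1) → b ∈ B (ed (tl i 0 false)) ∧
        φ.src (ed (tl i 0 false)) = none ∧ φ.tgt (ed (tl i 0 false)) = some v) := by
  obtain ⟨h1, -, h3⟩ := (M.pt_iff i 0).1 ⟨v, hv⟩
  have h2 : i ≤ W.n := hi.trans hkn
  have hn : W.IsName (tl i 0 false) := ⟨h1, h2, h3, by simp⟩
  have hn1 : W.IsName (str (i - 1)) := by change i - 1 ≤ W.n; omega
  have hn2 : W.IsName (str i) := h2
  have d1 : ed (str i) ≠ ed (str (i - 1)) := M.ed_ne hn2 hn1 (by simp; omega)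
  have d2 : ed (tl i 0 false) ≠ ed (str i) := M.ed_ne hn hn2 (by simp)
  have hst := M.valid.step (i - 1) (by omega)
  have hlt := hW.natAbs_lt (i - 1) (by change i - 1 < k; omega)
  change (0 < W.s (i - 1) ↔ 0 < W.s (i - 1 + 1)) →
    (W.s (i - 1 + 1)).natAbs < (W.s (i - 1)).natAbs at hlt
  rw [Nat.sub_add_cancel h1] at hst hlt
  by_cases p2 : 0 < W.s i <;> by_cases p1 : 0 < W.s (i - 1)
  · have := hlt (iff_of_true p1 p2)
    obtain ⟨a, b, hab, hτ, ha, hb⟩ := h.exists_centre M.isTropical d2.symm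
      (Or.inl ⟨(M.src_next_iff hv).2 p2, (M.src_tail_iff hv).2 (by omega)⟩)
    exact ⟨a, b, hab, hτ, fun _ => ⟨ha, hb⟩, fun h' => absurd p2 h', fun h' => absurd p2 h'⟩
  · obtain ⟨a, b, hab, hτ, ha, hb⟩ := h.exists_centre M.isTropical d1
      (Or.inl ⟨(M.src_next_iff hv).2 p2, (M.src_prev_iff hv).2 p1⟩)
    exact ⟨a, b, hab, hτ, fun _ => ⟨ha, hb⟩, fun h' => absurd p2 h', fun h' => absurd p2 h'⟩
  · obtain ⟨a, b, hab, hτ, ha, hb⟩ := h.exists_centre M.isTropical d1.symm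
      (Or.inr ⟨(M.tgt_prev_iff hv).2 p1, (M.tgt_next_iff hv).2 p2⟩)
    exact ⟨a, b, hab, hτ, fun h' => absurd h' p2, fun _ _ => ⟨ha, hb⟩, fun _ h' => absurd p1 h'⟩
  · have := hlt (iff_of_false p1 p2)
    have hδ : 0 < W.δ i := by omega
    obtain ⟨a, b, hab, hτ, ha, hb⟩ := h.exists_centre M.isTropical d2
      (Or.inr ⟨(M.tgt_tail_iff hv).2 hδ, (M.tgt_next_iff hv).2 p2⟩)
    refine ⟨a, b, hab, hτ, fun h' => absurd h' p2, fun _ h' => absurd h' p1,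
      fun _ _ => ⟨hb, ?_, (M.tgt_tail_iff hv).2 hδ⟩⟩
    rw [M.src_tl _ _ _ hn, if_pos hδ]
    exact M.pt_none (by rw [hlen i h1 hi]; omega)

/-- At three consecutive vertices of a piece, the centres of the first and the last one agree only if
that of the middle one does. -/
theorem centre_eq {i : ℕ} (hi : i + 2 ≤ k) (h1 : 0 < W.s i) (h2 : 0 < W.s (i + 1))
    (hc : ∀ i ≤ W.n, c (ed (str i)) ≠ Colour.dotted) {u v w : Fin r} (hu : pt i 0 = some u)
    (hv : pt (i + 1) 0 = some v) (hw : pt (i + 2) 0 = some w) (huv : v.val = u.val + 1)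
    (hvw : w.val = v.val + 1) {a b q a' : Fin D} (hτu : F.τ u = swap a q) (hτv : F.τ v = swap a' b)
    {a'' : Fin D} (hτw : F.τ w = swap a'' q) (ha : a ∉ B (ed (str i)))
    (ha' : a' ∉ B (ed (str (i + 1)))) (hb : b ∈ B (ed (str (i + 1))))
    (ha'' : a'' ∉ B (ed (str (i + 1)))) (hq : q ∈ B (ed (str (i + 1)))) : b = q := by
  have ht := M.isTropical
  have su := (M.src_next_iff hu).2 h1
  have sv := (M.src_next_iff hv).2 h2
  have tw : φ.tgt (ed (str (i + 1))) = some w := (M.tgt_prev_iff hw).2 h2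
  have au := ht.alive_succ_of_src su
  have av := ht.alive_succ_of_src sv
  have aw := ht.alive_of_tgt tw
  have hqi := M.subset_prev h hkn hW (by omega) h1 h2 hq
  have e1 := h.centre_new hτu au (hc i (by omega)) ha hqi
  have e2 := h.centre_new hτv av (hc (i + 1) (by omega)) ha' hb
  have e3 := h.centre_old hτw aw (hc (i + 1) (by omega)) ha'' hq
  rw [hvw, huv] at e3
  rw [huv] at e2 av
  have hvr : u.val + 2 ≤ r := by have := v.2; omega
  have r1 := h.real (u.val + 1) u.2
  have r2 := h.real (u.val + 1 + 1) hvr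
  have g1 := h.gammaAt_mul_self (i := u.val + 1) u.2
  have g2 := h.gammaAt_mul_self (i := u.val + 1 + 1) hvr
  have c1 := h.cyc _ u.2 _ au
  have c2 := h.cyc _ hvr _ av
  have w1 : (B (ed (str i))).card = (W.s i).natAbs := by rw [h.card, M.wt_str i (by omega)]
  have w2 : (B (ed (str (i + 1)))).card = (W.s (i + 1)).natAbs := by
    rw [h.card, M.wt_str (i + 1) (by omega)]
  have o1 : Odd (B (ed (str i))).card := by
    rw [w1, Int.natAbs_odd]; exact M.valid.odd i (by omega)
  have o2 : Odd (B (ed (str (i + 1)))).card := by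
    rw [w2, Int.natAbs_odd]; exact M.valid.odd (i + 1) (by omega)
  have hlt := hW.natAbs_lt i (by change i < k; omega) (iff_of_true h1 h2)
  change (W.s (i + 1)).natAbs < (W.s i).natAbs at hlt
  generalize hρ₁ : F.prod (u.val + 1) = ρ₁ at *
  generalize hρ₂ : F.prod (u.val + 1 + 1) = ρ₂ at *
  have step3 : F.gammaAt ε (u.val + 1 + 1 + 1) = F.gammaAt ε (u.val + 1 + 1) ∨
      F.gammaAt ε (u.val + 1 + 1 + 1) = F.gammaAt ε (u.val + 1 + 1) * ρ₂ := by
    rw [← hρ₂]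
    rw [gammaAt]
    split_ifs <;> simp
  have step2 : F.gammaAt ε (u.val + 1 + 1) = F.gammaAt ε (u.val + 1) ∨
      F.gammaAt ε (u.val + 1 + 1) = F.gammaAt ε (u.val + 1) * ρ₁ := by
    rw [← hρ₁]
    rw [gammaAt]
    split_ifs <;> simp
  generalize F.gammaAt ε (u.val + 1 + 1 + 1) = κ₃ at *
  generalize F.gammaAt ε (u.val + 1 + 1) = κ₂ at *
  generalize F.gammaAt ε (u.val + 1) = κ₁ at *
  -- The cycle has odd length and is longer than its successor on the string, so it has at least
  -- three elements.
  have notTwo : ¬ ∃ n : ℕ, (n = 1 ∨ n = 2) ∧ (ρ₁ ^ (n : ℤ)) q = q := by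
    rintro ⟨n, hn, hq'⟩
    rw [c1.zpow_apply_eq_self_iff hqi] at hq'
    have h5 : (B (ed (str i))).card ∣ n := by exact_mod_cast hq'
    have h6 := Nat.le_of_dvd (by omega) h5
    have h7 : (B (ed (str i))).card ≠ 2 := fun h' => by
      rw [h'] at o1
      exact absurd o1 (by decide)
    have h8 := h.card (ed (str (i + 1)))
    have h9 := ht.wt_pos (ed (str (i + 1)))
    omega
  rcases step3 with rfl | rfl
  -- No sign change at the last vertex: both centres are fixed by the same reflection of one odd
  -- cycle.
  · have m1 : (ρ₂ * κ₃) * ρ₂ * (ρ₂ * κ₃) = ρ₂⁻¹ := by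
      have : ρ₂ * κ₃ * ρ₂ * (ρ₂ * κ₃) = ρ₂ * (κ₃ * ρ₂ * κ₃) * (κ₃ * ρ₂ * κ₃) := by
        have h5 : κ₃ * (κ₃ * (ρ₂ * κ₃)) = ρ₂ * κ₃ := by rw [← mul_assoc, g2, one_mul]
        simp only [mul_assoc, h5]
      rw [this, r2]
      simp
    have m2 : (ρ₂ * κ₃) * (ρ₂ * κ₃) = 1 := by
      rw [mul_assoc, ← mul_assoc κ₃, r2, mul_inv_cancel]
    exact fixed_unique_of_odd c2 m1 m2 o2 hb hq e2 e3
  -- With a sign change at the last vertex the involution before it fixes `q`. Together with the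
  -- fixed point equation at the first vertex this makes `ρ₁` or its square fix `q`, according to
  -- whether the sign changes at the middle vertex.
  · exfalso
    have f1 : κ₂ q = q := by
      have h5 : ρ₂ * (κ₂ * ρ₂) = κ₂ := by
        have : κ₂ * ρ₂ = ρ₂⁻¹ * κ₂ := by rw [← r2, mul_assoc, mul_assoc, g2, mul_one]
        rw [this, mul_inv_cancel_left]
      have := e3
      rwa [← Perm.mul_apply, h5] at this
    rcases step2 with rfl | rfl
    · rw [f1] at e1
      exact notTwo ⟨1, Or.inl rfl, by simpa using e1⟩
    · refine notTwo ⟨2, Or.inr rfl, ?_⟩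
      have h5 : ρ₁ q = κ₁ q := by
        have := congrArg κ₁ f1
        rwa [← Perm.mul_apply, ← mul_assoc, g1, one_mul] at this
      have h6 : (ρ₁ ^ ((2 : ℕ) : ℤ)) q = ρ₁ (ρ₁ q) := by
        rw [zpow_natCast, pow_two, Perm.mul_apply]
      rw [h6, h5, e1]

/-- A factorization producing a model whose first vertices form a universally monotone cover is mixed
up to conjugation. -/
theorem exists_isMixed_conj (hk : 1 ≤ k) (hkr : k ≤ r) (hlen : ∀ i, 1 ≤ i → i ≤ k → W.len i = 0)
    (hcut : ∀ i j v, pt i j = some v → (v.val < k ↔ i ≤ k))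
    (ho : ∀ i j u v, i ≤ k → j ≤ k → pt i 0 = some u → pt j 0 = some v → u ≤ v →
      W.comp j ≤ W.comp i)
    (hc : ∀ i ≤ W.n, c (ed (str i)) ≠ Colour.dotted) :
    ∃ π : Perm (Fin D), (Tuple.conj π F).IsMixed k := by
  have hix : ∀ t : Fin k, ∃ i, i ≤ k ∧ pt i 0 = some (Fin.castLE hkr t) := by
    intro t
    obtain ⟨i, j, hij⟩ := M.pt_surj (Fin.castLE hkr t)
    have h1 := (hcut i j _ hij).1 t.2
    have h2 := (M.pt_iff i j).1 ⟨_, hij⟩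
    have h3 := hlen i h2.1 h1
    have hj : j = 0 := by omega
    subst hj
    exact ⟨i, h1, hij⟩
  choose ix hixk hpt using hix
  have hix1 : ∀ t, 1 ≤ ix t := fun t => ((M.pt_iff _ _).1 ⟨_, hpt t⟩).1
  have ixinj : ∀ {t t'}, ix t = ix t' → t = t' := by
    intro t t' h'
    have h1 := hpt t
    rw [h', hpt t'] at h1
    exact (Fin.castLE_injective hkr (Option.some_injective _ h1)).symm
  choose a b hab hτ hpos hprev hneg using fun t =>
    M.exists_centre h hkn hW hlen (hixk t) (hpt t)
  have hcomp : ∀ {t t' : Fin k}, t ≤ t' → W.comp (ix t') ≤ W.comp (ix t) := fun {t t'} htt =>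
    ho _ _ _ _ (hixk t) (hixk t') (hpt t) (hpt t') htt
  -- the edge of the string containing the centre
  have hedge : ∀ t, (0 < W.s (ix t) ∨ 0 < W.s (ix t - 1)) → ∃ x, x ≤ k ∧ 0 < W.s x ∧
      W.piece x = W.comp (ix t) ∧ (x = ix t ∨ x + 1 = ix t) ∧ b t ∈ B (ed (str x)) ∧
      (0 < W.s (ix t) → x = ix t) := by
    intro t ht
    have h1 := hix1 t
    have h2 := hixk t
    unfold Walk.comp
    by_cases hp : 0 < W.s (ix t)
    · exact ⟨ix t, hixk t, hp, by rw [if_pos hp], Or.inl rfl, (hpos t hp).2, fun _ => rfl⟩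
    · have hp' := ht.resolve_left hp
      exact ⟨ix t - 1, by omega, hp', by rw [if_neg hp, if_pos hp'], Or.inr (by omega),
        (hprev t hp hp').2, fun h' => absurd h' hp⟩
  -- Here the centre of `t'` lies on an in-end whose first vertex comes after `t`, so the
  -- transposition at `t` does not move it.
  have apart : ∀ t t' : Fin k, t < t' → (W.comp (ix t) ≠ W.comp (ix t') ∨
      ¬ (0 < W.s (ix t') ∨ 0 < W.s (ix t' - 1))) → b t' ≠ a t ∧ b t' ≠ b t := by
    intro t t' htt hd
    have origin : ∃ o u, φ.src o = none ∧ b t' ∈ B o ∧ φ.tgt o = some u ∧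
        Fin.castLE hkr t < u := by
      by_cases hp : 0 < W.s (ix t') ∨ 0 < W.s (ix t' - 1)
      · obtain ⟨x, hxk, hx, hpx, -, hbx, -⟩ := hedge t' hp
        obtain ⟨o, y, u, h1, h2, h3, h4, h5, h6⟩ := M.exists_origin h hkn hW hk hlen hxk hx
        refine ⟨o, u, h1, h2 hbx, h3, ?_⟩
        by_contra hut
        have h7 := ho _ _ _ _ h5 (hixk t) h4 (hpt t) (not_lt.1 hut)
        have h8 := hcomp htt.le
        rcases hd with hd | hd
        · omega
        · exact hd hp
      · push Not at hp
        obtain ⟨h1, h2, h3⟩ := hneg t' (not_lt.2 hp.1) (not_lt.2 hp.2)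
        exact ⟨_, _, h2, h1, h3, htt⟩
    obtain ⟨o, u, h1, h2, h3, h4⟩ := origin
    have hal : φ.Alive (Fin.castLE hkr t).val o := by
      refine ⟨by rw [h1]; exact Nat.zero_le _, fun j hj => ?_⟩
      rw [h3] at hj
      cases hj
      exact h4.le
    have hm : ¬ F.Meets (Fin.castLE hkr t) (B o) := by
      rw [h.meets_old _ _ hal, h3]
      intro h'
      cases h'
      exact lt_irrefl _ h4
    have hfix : F.τ (Fin.castLE hkr t) (b t') = b t' := by
      by_contra h'
      exact hm ⟨_, h2, h'⟩
    rw [hτ] at hfix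
    constructor
    · intro h'
      rw [h', swap_apply_left] at hfix
      exact hab t hfix.symm
    · intro h'
      rw [h', swap_apply_right] at hfix
      exact hab t hfix
  -- Within an in-component the order on the line agrees with the order along the string, and the
  -- whole stretch from `t` to the edge carrying the centre of `t'` runs to the right.
  have same : ∀ t t' : Fin k, t < t' → W.comp (ix t) = W.comp (ix t') →
      (0 < W.s (ix t') ∨ 0 < W.s (ix t' - 1)) → (0 < W.s (ix t) ∨ 0 < W.s (ix t - 1)) ∧
      ix t < ix t' ∧ ∃ x, x ≤ k ∧ ix t ≤ x ∧ (∀ l, ix t ≤ l → l ≤ x → 0 < W.s l) ∧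
      (x = ix t' ∨ x + 1 = ix t') ∧ b t' ∈ B (ed (str x)) ∧ (0 < W.s (ix t') → x = ix t') := by
    intro t t' htt hcc hp
    obtain ⟨x, hxk, hx, hpx, hxt, hbx, hx'⟩ := hedge t' hp
    have hpt' : 0 < W.s (ix t) ∨ 0 < W.s (ix t - 1) := by
      by_contra hn
      push Not at hn
      have h1 : W.comp (ix t) = W.piece (ix t) := by
        unfold Walk.comp
        rw [if_neg (not_lt.2 hn.1), if_neg (not_lt.2 hn.2)]
      have h2 : W.piece x = W.piece (ix t) := by rw [hpx, ← hcc, h1]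
      exact absurd ((W.pos_iff_of_piece_eq' h2).1 hx) (not_lt.2 hn.1)
    obtain ⟨y, hyk, hy, hpy, hyt, -, -⟩ := hedge t hpt'
    have hxy : W.piece x = W.piece y := by rw [hpx, hpy, hcc]
    have hlt : ix t < ix t' := by
      by_contra hn
      rcases (not_lt.1 hn).lt_or_eq with h1 | h1
      · have h2 := M.lt_of_pos h1 (fun l h3 h4 => W.pos_of_piece_eq hxy hx (by omega) (by omega))
          (hpt t') (hpt t)
        exact absurd h2 (not_lt.2 htt.le)
      · exact absurd (ixinj h1) htt.ne'
    have h1 : ix t ≤ x := by omega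
    have h2 : 0 < W.s (ix t) := W.pos_of_piece_eq hxy.symm hy (by omega) h1
    exact ⟨hpt', hlt, x, hxk, h1,
      fun l h3 h4 => W.pos_of_piece_eq hxy.symm hy (by omega) h4, hxt, hbx, hx'⟩
  -- Within an in-component the sets of the edges shrink along the string, so the centre of `t'`
  -- lies on the edge after `t`, which does not contain `a t`.
  have label₁ : ∀ t t', t ≤ t' → b t' ≠ a t := by
    intro t t' htt
    rcases htt.lt_or_eq with htt | rfl
    · by_cases hd : W.comp (ix t) ≠ W.comp (ix t') ∨ ¬ (0 < W.s (ix t') ∨ 0 < W.s (ix t' - 1))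
      · exact (apart t t' htt hd).1
      · push Not at hd
        obtain ⟨-, -, x, hxk, hx, hl, -, hbx, -⟩ := same t t' htt hd.1 hd.2
        have h3 := M.subset_of_pos h hkn hW hx hxk hl hbx
        intro h'
        rw [h'] at h3
        exact (hpos t (hl _ le_rfl hx)).1 h3
    · exact (hab t).symm
  have label₂ : ∀ i l j, i < l → l < j → b i = b j → b l = b i := by
    intro i l j hil hlj hbij
    by_cases hd : W.comp (ix i) ≠ W.comp (ix j) ∨ ¬ (0 < W.s (ix j) ∨ 0 < W.s (ix j - 1))
    · exact absurd hbij.symm (apart i j (hil.trans hlj) hd).2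
    push Not at hd
    obtain ⟨hdc, hdj⟩ := hd
    have between : ∀ t, i < t → t < j → ix i < ix t ∧ ix t < ix j ∧ 0 < W.s (ix t) ∧
        (0 < W.s (ix t) ∨ 0 < W.s (ix t - 1)) ∧ W.comp (ix i) = W.comp (ix t) := by
      intro t h1 h2
      have h3 := hcomp h1.le
      have h4 := hcomp h2.le
      have h5 : W.comp (ix i) = W.comp (ix t) := by omega
      have h6 : W.comp (ix t) = W.comp (ix j) := by omega
      obtain ⟨h7, h8, x, hxk, hx, hl, -⟩ := same t j h2 h6 hdj
      exact ⟨(same i t h1 h5 h7).2.1, h8, hl _ le_rfl hx, h7, h5⟩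
    obtain ⟨k1, k2, k3, k4, k5⟩ := between l hil hlj
    obtain ⟨-, k6, x, hxk, hx, hl, hxj, hbx, hx'⟩ := same i j (hil.trans hlj) hdc hdj
    -- Since three consecutive positive weights are excluded, the vertices `i`, `l`, `j` follow each
    -- other immediately, both on the string and on the line.
    have hx1 : x ≤ ix i + 1 := by
      by_contra hn
      exact hW.not_three (ix i) (by change ix i + 2 ≤ k; omega) ⟨hl _ le_rfl hx,
        hl _ (by omega) (by omega), hl _ (by omega) (by omega)⟩
    have hlx : ix l = ix i + 1 := by omega
    have hjx : ix j = ix i + 2 := by omega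
    have hxx : x = ix i + 1 := by omega
    have hli : l.val = i.val + 1 := by
      by_contra hn
      have hil' : i.val < l.val := hil
      have hi' : i < (⟨i.val + 1, by omega⟩ : Fin k) := by
        rw [Fin.lt_def]; exact Nat.lt_succ_self _
      have hl' : (⟨i.val + 1, by omega⟩ : Fin k) < l := by rw [Fin.lt_def]; simp only; omega
      obtain ⟨m1, -, -, m2, m3⟩ := between _ hi' (hl'.trans hlj)
      have := (same _ l hl' (m3.symm.trans k5) k4).2.1
      omega
    have hjl : j.val = l.val + 1 := by
      by_contra hn
      have hlj' : l.val < j.val := hlj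
      have hi' : l < (⟨l.val + 1, by omega⟩ : Fin k) := by
        rw [Fin.lt_def]; exact Nat.lt_succ_self _
      have hl' : (⟨l.val + 1, by omega⟩ : Fin k) < j := by rw [Fin.lt_def]; simp only; omega
      obtain ⟨m1, m0, -, m2, m3⟩ := between _ (hil.trans hi') hl'
      have := (same l _ hi' (k5.symm.trans m3) m2).2.1
      omega
    subst hxx
    have hpl := hpt l
    have hpj := hpt j
    have hpi := hl (ix i) le_rfl hx
    have hpi1 := hl (ix i + 1) (by omega) le_rfl
    have ca := (hpos i hpi).1
    have cl := hpos l (by rw [hlx]; exact hpi1)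
    have hnj : ¬ 0 < W.s (ix j) := fun h' => by have := hx' h'; omega
    have cj := hprev j hnj (by rw [hjx]; exact hpi1)
    rw [hlx] at hpl cl
    rw [hjx] at hpj cj
    have τi := hτ i
    rw [hbij] at τi ⊢
    exact M.centre_eq h hkn hW (by have := hixk j; omega) hpi hpi1 hc (hpt i) hpl hpj hli hjl τi
      (hτ l) (hτ j) ca cl.1 cl.2 cj.1 cj.2
  obtain ⟨π, h1, h2⟩ := exists_label a b label₁ label₂
  exact ⟨π, isMixed_conj hkr a b hτ h1 h2⟩

end Centres

end IsModel


/-! ### Factorizations producing one cover -/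

namespace IsModel

open Edg Cover MixedZigzag.Tuple

/-- Once one mixed factorization is found, the sheets over the in-ends in `O` can be permuted
arbitrarily, since the first `k` transpositions do not move them. The further in-end `f` supplies
the fixed sheet that makes the results distinct. -/
theorem factorial_le_mixedCount {d g k : ℕ} {lam mu : Nat.Partition d} {E : Type} [Fintype E]
    {φ : Cover (numBranch g lam mu) E} {W : Walk}
    {pt : ℕ → ℕ → Option (Fin (numBranch g lam mu))} {ed : Edg → E} (M : IsModel φ W pt ed)
    (htype : φ.HasType g lam.parts mu.parts) (hkn : k ≤ W.n) (hW : (W.take k).Alternating)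
    (hk : 1 ≤ k) (hkr : k ≤ numBranch g lam mu) (hlen : ∀ i, 1 ≤ i → i ≤ k → W.len i = 0)
    (hcut : ∀ i j v, pt i j = some v → (v.val < k ↔ i ≤ k))
    (ho : ∀ i j u v, i ≤ k → j ≤ k → pt i 0 = some u → pt j 0 = some v → u ≤ v →
      W.comp j ≤ W.comp i)
    (O : Finset E) (hO : ∀ e ∈ O, φ.src e = none ∧ ∀ u, φ.tgt e = some u → k ≤ u.val) {f : E}
    (hf : φ.src f = none) (hfO : f ∉ O) (ε : Fin (numBranch g lam mu) → ℤˣ) :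
    (∑ e ∈ O, φ.wt e).factorial ≤ mixedCount g k lam mu φ ε := by
  classical
  have ht := M.isTropical
  -- The value 1 off the vertices is arbitrary.
  let η : ℕ → ℕ → ℤˣ := fun i j => (pt i j).elim 1 ε
  obtain ⟨c, hc⟩ := M.exists_colour η
  have hcol := M.isColouring hc
  have hsign := M.hasSign (ε := ε) (fun i j v hv => by simp [η, hv]) hc
  have hstr : ∀ i ≤ W.n, c (ed (str i)) ≠ Colour.dotted := fun i hi => by
    rw [hc (str i) hi]; simp [Walk.colour]
  obtain ⟨F₀, B₀, h₀⟩ := exists_realizes (D := d) ht hcol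
    (by rw [htype.inProfile_eq, lam.parts_sum]) hsign M.exists_odd
  obtain ⟨π, hπ⟩ := M.exists_isMixed_conj h₀ hkn hW hk hkr hlen hcut ho hstr
  have h := h₀.conj π
  set F := Tuple.conj π F₀
  set B : E → Finset (Fin d) := fun e => (B₀ e).map π.toEmbedding
  have alive0 : ∀ e, φ.src e = none → φ.Alive 0 e := fun e he =>
    ⟨by rw [he]; exact le_rfl, fun _ _ => Nat.zero_le _⟩
  have hcard : (O.biUnion B).card = ∑ e ∈ O, φ.wt e := by
    rw [Finset.card_biUnion]
    · exact Finset.sum_congr rfl fun e _ => h.card e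
    · intro e he e' he' hne
      rw [Function.onFun, Finset.disjoint_left]
      intro x hx hx'
      exact hne (h.disj 0 (Nat.zero_le _) e e' x (alive0 e (hO e he).1) (alive0 e' (hO e' he').1)
        hx hx')
  obtain ⟨x, hx⟩ : (B f).Nonempty := by
    rw [← Finset.card_pos, h.card]
    exact ht.wt_pos f
  have hxO : x ∉ O.biUnion B := by
    intro hx'
    obtain ⟨e, he, hxe⟩ := Finset.mem_biUnion.1 hx'
    exact hfO (h.disj 0 (Nat.zero_le _) f e x (alive0 f hf) (alive0 e (hO e he).1) hx hxe ▸ he)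
  rw [← hcard]
  refine factorial_card_le_ncard _ _ (h.transitive ht) hxO fun σ hσ => ?_
  have hσF := h.conj σ
  refine ⟨⟨hσF.prod_eq, hσF.parts_first.trans htype.inProfile_eq,
    hσF.parts_last.trans htype.outProfile_eq, hσF.isSwap, hσF.transitive ht, hσF.involution,
    hσF.real⟩, hπ.conj fun i hi y hy => hσ y fun hyO => ?_, c, hcol, hsign,
    hσF.produces ht hcol⟩
  -- An end in `O` is alive from the start and meets no vertex of index below `k`, so no such
  -- transposition moves its sheets.
  obtain ⟨e, he, hye⟩ := Finset.mem_biUnion.1 hyO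
  obtain ⟨h1, h2⟩ := hO e he
  have hal : φ.Alive i.val e := ⟨by rw [h1]; exact Nat.zero_le _, fun u hu => by
    have := h2 u hu; omega⟩
  have := (h.meets_old i e hal).1 ⟨y, hye, hy⟩
  have := h2 i this
  omega

end IsModel


/-! Numberings of finite sets along a key. -/

/-- The numbering is by sorting, and elements with equal keys come in an arbitrary order. This
freedom produces the large number of covers. -/
theorem exists_equiv_of_key {V A : Type*} [Fintype V] [LinearOrder A] (key : V → A) {r : ℕ}
    (hr : Fintype.card V = r) : ∃ e : V ≃ Fin r, ∀ v w, key v < key w → e v < e w := by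
  let e₀ : V ≃ Fin r := Fintype.equivFinOfCardEq hr
  let σ := _root_.Tuple.sort (key ∘ e₀.symm)
  have hσ := _root_.Tuple.monotone_sort (key ∘ e₀.symm)
  refine ⟨e₀.trans σ.symm, fun v w hvw => ?_⟩
  by_contra hn
  have h1 := hσ (not_lt.1 hn)
  have h2 : ∀ v, ((key ∘ e₀.symm) ∘ σ) (e₀.trans σ.symm v) = key v := by
    intro v
    simp
  rw [h2, h2] at h1
  exact absurd hvw (not_lt.2 h1)

/-- The elements satisfying `p` form an initial segment of the numbering, so its length is their
number. -/
theorem val_lt_card_iff {V : Type*} [Fintype V] {r : ℕ} (e : V ≃ Fin r) (p : V → Prop)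
    [DecidablePred p] (h : ∀ v w, p v → ¬ p w → e v < e w) (v : V) :
    (e v).val < (Finset.univ.filter p).card ↔ p v := by
  have key : ∀ q : Fin r → Prop, ∀ [DecidablePred q],
      (Finset.univ.filter fun w => q (e w)).card = (Finset.univ.filter q).card := by
    intro q _
    refine Finset.card_bij (fun w _ => e w) ?_ ?_ ?_
    · intro w hw; simpa using hw
    · intro w _ w' _ hww; exact e.injective hww
    · intro x hx; exact ⟨e.symm x, by simpa using hx, by simp⟩
  constructor
  · intro hv
    by_contra hp
    have h1 : Finset.univ.filter p ⊆ Finset.univ.filter fun w => e w < e v := by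
      intro w hw
      simp only [Finset.mem_filter, Finset.mem_univ, true_and] at hw ⊢
      exact h w v hw hp
    have h2 := Finset.card_le_card h1
    rw [key fun x => x < e v] at h2
    have h3 : (Finset.univ.filter fun x => x < e v).card = (e v).val := by
      rw [← Fin.card_Iio]
      congr 1
      ext x
      simp
    omega
  · intro hp
    have h1 : (Finset.univ.filter fun w => e w ≤ e v) ⊆ Finset.univ.filter p := by
      intro w hw
      simp only [Finset.mem_filter, Finset.mem_univ, true_and] at hw ⊢
      by_contra hw'
      exact absurd (h v w hp hw') (not_lt.2 hw)
    have h2 := Finset.card_le_card h1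
    rw [key fun x => x ≤ e v] at h2
    have h3 : (Finset.univ.filter fun x => x ≤ e v).card = (e v).val + 1 := by
      rw [← Fin.card_Iic]
      congr 1
      ext x
      simp
    omega

/-! ### Covers given by numbered walks -/

namespace Walk

open Edg

/-- The vertices of a string with tails. -/
def verts (W : Walk) : Finset (Σ _ : ℕ, ℕ) :=
  (Finset.Icc 1 W.n).sigma fun i => Finset.range (W.len i + 1)

theorem mem_verts {W : Walk} {i j : ℕ} :
    (⟨i, j⟩ : Σ _ : ℕ, ℕ) ∈ W.verts ↔ 1 ≤ i ∧ i ≤ W.n ∧ j ≤ W.len i := by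
  simp [verts, and_assoc]

theorem card_verts (W : Walk) : W.verts.card = ∑ i ∈ Finset.Icc 1 W.n, (W.len i + 1) := by
  simp [verts]

/-- The vertex `(i, j)` under a numbering of the vertices. -/
def place (W : Walk) {r : ℕ} (e : W.verts ≃ Fin r) (i j : ℕ) : Option (Fin r) :=
  if h : (⟨i, j⟩ : Σ _ : ℕ, ℕ) ∈ W.verts then some (e ⟨_, h⟩) else none

theorem place_eq_some {W : Walk} {r : ℕ} {e : W.verts ≃ Fin r} {i j : ℕ} {v : Fin r} :
    W.place e i j = some v ↔ ∃ h : (⟨i, j⟩ : Σ _ : ℕ, ℕ) ∈ W.verts, e ⟨_, h⟩ = v := by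
  unfold place
  split_ifs with h
  · simp [h]
  · simp [h]

/-- Source, target and weight of an edge. -/
def triple (W : Walk) {r : ℕ} (pt : ℕ → ℕ → Option (Fin r)) :
    Edg → Option (Fin r) × Option (Fin r) × ℕ
  | str i => (if 0 < W.s i then pt i 0 else pt (i + 1) 0,
      if 0 < W.s i then pt (i + 1) 0 else pt i 0, (W.s i).natAbs)
  | tl i j _ => (if 0 < W.δ i then pt i (j + 1) else pt i j,
      if 0 < W.δ i then pt i j else pt i (j + 1),
      if Even j then (W.δ i).natAbs else (W.δ i).natAbs / 2)

/-- The isomorphism class of the cover given by a string with tails and a numbering of its vertices. -/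
noncomputable def coverClass (W : Walk) {r : ℕ} (e : W.verts ≃ Fin r) : CoverClass r :=
  W.names.val.map (W.triple (W.place e))

/-- The two edges of a double segment have the same triple, so an edge of the class is an occurrence
in a multiset. The names are matched with occurrences by the equivalence that comes with mapping a
multiset. -/
theorem exists_isModel {W : Walk} (hW : W.Valid) {r : ℕ} (e : W.verts ≃ Fin r)
    (hlt : ∀ x, W.IsName x → ∀ u v, (W.triple (W.place e) x).1 = some u →
      (W.triple (W.place e) x).2.1 = some v → u < v) :
    ∃ ed, IsModel (W.coverClass e).cover W (W.place e) ed := by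
  classical
  let f := W.triple (W.place e)
  have hcount : ∀ {x}, W.IsName x → 0 < W.names.val.count x := fun {x} hx =>
    Multiset.count_pos.2 (Finset.mem_def.1 (mem_names.2 hx))
  have h0 : W.IsName (str 0) := Nat.zero_le _
  let g : Multiset.ToType W.names.val ≃ Multiset.ToType (W.coverClass e) := W.names.val.mapEquiv f
  have hg : ∀ t, (g t).1 = f t.1 := Multiset.mapEquiv_apply W.names.val f
  let p : ∀ x, W.IsName x → Multiset.ToType W.names.val := fun x hx =>
    W.names.val.mkToType x ⟨0, hcount hx⟩
  let ed : Edg → Multiset.ToType (W.coverClass e) := fun x =>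
    if hx : W.IsName x then g (p x hx) else g (p (str 0) h0)
  have hed' : ∀ {x} (hx : W.IsName x), ed x = g (p x hx) := fun {x} hx => dif_pos hx
  have hed : ∀ {x}, W.IsName x → (ed x).1 = f x := fun {x} hx => by
    rw [hed' hx, hg]
  refine ⟨ed, hW, ?_, ?_, ?_, ?_, ?_, ?_, ?_, ?_, ?_, ?_, ?_, ?_⟩
  · intro i j
    rw [← mem_verts]
    constructor
    · rintro ⟨v, hv⟩
      exact (place_eq_some.1 hv).1
    · exact fun h => ⟨_, place_eq_some.2 ⟨h, rfl⟩⟩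
  · intro i j i' j' v h h'
    obtain ⟨h1, h2⟩ := place_eq_some.1 h
    obtain ⟨h3, h4⟩ := place_eq_some.1 h'
    have := congrArg Subtype.val (e.injective (h2.trans h4.symm))
    simp only [Sigma.mk.injEq, heq_eq_eq] at this
    exact this
  · intro v
    obtain ⟨⟨⟨i, j⟩, h⟩, rfl⟩ := e.surjective v
    exact ⟨i, j, place_eq_some.2 ⟨h, rfl⟩⟩
  · intro x y hx hy hxy
    rw [hed' hx, hed' hy] at hxy
    exact congrArg Sigma.fst (g.injective hxy)
  · intro t
    obtain ⟨⟨x, i⟩, rfl⟩ := g.surjective t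
    have hc := i.2
    have hx : W.IsName x := mem_names.1 (Finset.mem_def.2 (Multiset.count_pos.1
      (lt_of_le_of_lt (Nat.zero_le _) hc)))
    refine ⟨x, hx, ?_⟩
    rw [hed' hx]
    have h1 : W.names.val.count x = 1 := Multiset.count_eq_one_of_mem W.names.nodup
      (Finset.mem_def.1 (mem_names.2 hx))
    congr 1
    refine Sigma.ext rfl (heq_of_eq (Fin.ext ?_))
    exact (Nat.lt_one_iff.1 (lt_of_lt_of_eq hc h1)).symm
  · intro i hi
    change (ed (str i)).1.1 = _
    rw [hed (x := str i) hi]; rfl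
  · intro i hi
    change (ed (str i)).1.2.1 = _
    rw [hed (x := str i) hi]; rfl
  · intro i j b hn
    change (ed (tl i j b)).1.1 = _
    rw [hed hn]; rfl
  · intro i j b hn
    change (ed (tl i j b)).1.2.1 = _
    rw [hed hn]; rfl
  · intro i hi
    change (ed (str i)).1.2.2 = _
    rw [hed (x := str i) hi]; rfl
  · intro i j b hn
    change (ed (tl i j b)).1.2.2 = _
    rw [hed hn]; rfl
  · intro t u v hu hv
    have ht : t.1 ∈ W.coverClass e := Multiset.coe_mem
    obtain ⟨x, hx, hxt⟩ := Multiset.mem_map.1 ht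
    refine hlt x (mem_names.1 (Finset.mem_def.2 hx)) u v ?_ ?_
    · rw [hxt]; exact hu
    · rw [hxt]; exact hv

/-! The key that orders the vertices. -/

/-- The level of the `i`-th vertex of the string, which increases by one along every edge running from
left to right. -/
def level (W : Walk) : ℕ → ℤ
  | 0 => 0
  | i + 1 => W.level i + if 0 < W.s i then 1 else -1

/-- The level of the `j`-th vertex of the tail at the `i`-th vertex. -/
def height (W : Walk) (i j : ℕ) : ℤ := if 0 < W.δ i then W.level i - j else W.level i + j

/-- The first `k` vertices are ordered by components, the remaining ones by levels. -/
def key (W : Walk) (k : ℕ) (x : Σ _ : ℕ, ℕ) : ℤ ×ₗ ℤ :=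
  if x.1 ≤ k then toLex (-(W.comp x.1 : ℤ) - 1,
    if 0 < W.s x.1 ∨ 0 < W.s (x.1 - 1) then (x.1 : ℤ) else -(x.1 : ℤ))
  else toLex (0, W.height x.1 x.2)

theorem key_lt_of_le (W : Walk) {k i j i' j' : ℕ} (h : i ≤ k) (h' : ¬ i' ≤ k) :
    W.key k ⟨i, j⟩ < W.key k ⟨i', j'⟩ := by
  unfold key
  simp only [h, h', if_true, if_false]
  rw [Prod.Lex.toLex_lt_toLex]
  left
  simp only
  omega

theorem key_lt_of_comp_lt (W : Walk) {k i j i' j' : ℕ} (h : i ≤ k) (h' : i' ≤ k)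
    (hc : W.comp i' < W.comp i) : W.key k ⟨i, j⟩ < W.key k ⟨i', j'⟩ := by
  unfold key
  simp only [h, h', if_true]
  rw [Prod.Lex.toLex_lt_toLex]
  left
  simp only
  omega

theorem key_lt_succ (W : Walk) {k i : ℕ} (hs : 0 < W.s i) :
    W.key k ⟨i, 0⟩ < W.key k ⟨i + 1, 0⟩ := by
  by_cases h : i + 1 ≤ k
  · have hc : W.comp (i + 1) = W.comp i := by
      have h1 := (W.piece_succ_eq_iff i).2
      unfold comp
      rw [if_pos hs, Nat.add_sub_cancel, if_pos hs]
      split_ifs with h2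
      · exact h1 (iff_of_true hs h2)
      · rfl
    unfold key
    have h' : i ≤ k := by omega
    simp only [h, h', if_true, hs, true_or, Nat.add_sub_cancel, or_true]
    rw [Prod.Lex.toLex_lt_toLex, hc]
    right
    simp
  · by_cases h' : i ≤ k
    · exact W.key_lt_of_le h' h
    · unfold key
      simp only [h, h', if_false]
      rw [Prod.Lex.toLex_lt_toLex]
      right
      simp [height, level, hs]

/-- On a leftward edge, an endpoint where the string bends belongs to an adjacent in-component, and
later components come first. If both ends belong to the out-component, its vertices are ordered by
decreasing index. The hypothesis at `k` excludes an edge from the first `k` vertices to the others.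
-/
theorem key_succ_lt (W : Walk) {k i : ℕ} (h1 : 1 ≤ i) (hk : 0 < W.s k) (hs : ¬ 0 < W.s i) :
    W.key k ⟨i + 1, 0⟩ < W.key k ⟨i, 0⟩ := by
  by_cases h : i + 1 ≤ k
  · have h' : i ≤ k := by omega
    have hi : i - 1 + 1 = i := by omega
    have hp := (W.piece_succ_eq_iff i).not.2
    have hp' := (W.piece_succ_eq_iff (i - 1)).not.2
    have m1 := W.piece_mono (Nat.le_succ i)
    have m2 := W.piece_mono (Nat.le_succ (i - 1))
    change W.piece i ≤ W.piece (i + 1) at m1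
    change W.piece (i - 1) ≤ W.piece (i - 1 + 1) at m2
    rw [hi] at hp' m2
    by_cases hs1 : 0 < W.s (i + 1)
    · refine W.key_lt_of_comp_lt h h' ?_
      have h3 := hp fun h4 => hs (h4.2 hs1)
      unfold comp
      rw [if_pos hs1, if_neg hs]
      split_ifs <;> omega
    · by_cases hs0 : 0 < W.s (i - 1)
      · refine W.key_lt_of_comp_lt h h' ?_
        have h3 := hp' fun h4 => hs (h4.1 hs0)
        unfold comp
        rw [if_neg hs1, Nat.add_sub_cancel, if_neg hs, if_neg hs, if_pos hs0]
        omega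
      · have hc : W.comp (i + 1) = W.comp i := by
          unfold comp
          rw [if_neg hs1, Nat.add_sub_cancel, if_neg hs, if_neg hs, if_neg hs0]
          exact (W.piece_succ_eq_iff i).2 (iff_of_false hs hs1)
        unfold key
        simp only [h, h', if_true, hs, hs1, hs0, or_self, Nat.add_sub_cancel, if_false]
        rw [Prod.Lex.toLex_lt_toLex, hc]
        right
        simp
  · have h' : ¬ i ≤ k := fun h' => by
      have : i = k := by omega
      exact hs (this ▸ hk)
    unfold key
    simp only [h, h', if_false]
    rw [Prod.Lex.toLex_lt_toLex]
    right
    simp [height, level, hs]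

theorem key_tail (W : Walk) {k i j : ℕ} (h : ¬ i ≤ k) :
    if 0 < W.δ i then W.key k ⟨i, j + 1⟩ < W.key k ⟨i, j⟩
      else W.key k ⟨i, j⟩ < W.key k ⟨i, j + 1⟩ := by
  unfold key
  simp only [h, if_false]
  rw [Prod.Lex.toLex_lt_toLex, Prod.Lex.toLex_lt_toLex]
  split_ifs with hd <;> right <;> simp [height, hd]

/-- The two ends of an inner edge always have different keys in the right order, so any numbering
compatible with the key makes the edges run from left to right. -/
theorem triple_lt {W : Walk} {k : ℕ} (hpos : 0 < W.s k) (hlen : ∀ i, 1 ≤ i → i ≤ k → W.len i = 0)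
    {r : ℕ} {e : W.verts ≃ Fin r} (he : ∀ v w, W.key k v.1 < W.key k w.1 → e v < e w) (x : Edg)
    (u v : Fin r) (hu : (W.triple (W.place e) x).1 = some u)
    (hv : (W.triple (W.place e) x).2.1 = some v) : u < v := by
  have key : ∀ {i j i' j' : ℕ} {u v : Fin r}, W.place e i j = some u → W.place e i' j' = some v →
      W.key k ⟨i, j⟩ < W.key k ⟨i', j'⟩ → u < v := by
    intro i j i' j' u v hu hv hk
    obtain ⟨h1, rfl⟩ := place_eq_some.1 hu
    obtain ⟨h2, rfl⟩ := place_eq_some.1 hv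
    exact he _ _ hk
  have mem : ∀ {i j : ℕ} {u : Fin r}, W.place e i j = some u → 1 ≤ i ∧ i ≤ W.n ∧ j ≤ W.len i :=
    fun {i j u} h => mem_verts.1 (place_eq_some.1 h).1
  cases x with
  | str i =>
    simp only [triple] at hu hv
    split_ifs at hu hv with hs
    · exact key hu hv (W.key_lt_succ hs)
    · exact key hu hv (W.key_succ_lt (mem hv).1 hpos hs)
  | tl i j b =>
    simp only [triple] at hu hv
    have hik : ∀ {u : Fin r}, W.place e i (j + 1) = some u → ¬ i ≤ k := by
      intro u h h'
      have h1 := mem h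
      have h2 := hlen i h1.1 h'
      omega
    split_ifs at hu hv with hs
    · have := W.key_tail (k := k) (j := j) (hik hu)
      rw [if_pos hs] at this
      exact key hu hv this
    · have := W.key_tail (k := k) (j := j) (hik hv)
      rw [if_neg hs] at this
      exact key hu hv this

end Walk


/-! ### Recovering the numbering from the cover -/

namespace IsModel

open Edg Cover

section Unique

variable {r : ℕ} {E : Type} {φ : Cover r E} {W : Walk} {pt pt' : ℕ → ℕ → Option (Fin r)}
  {ed ed' : Edg → E} (M : IsModel φ W pt ed) (M' : IsModel φ W pt' ed')
include M M'

/-- The tail at a vertex of the string starts with an even edge, while the string is odd, so the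
string of one model cannot run into a tail of the other. -/
theorem str_of_inc {i l : ℕ} (hl : l ≤ W.n) {v : Fin r} (hv : pt i 0 = some v)
    (h : φ.Inc (ed' (str l)) v) : ed' (str l) = ed (str (i - 1)) ∨ ed' (str l) = ed (str i) := by
  obtain ⟨h1, h2, h3⟩ := (M.pt_iff i 0).1 ⟨v, hv⟩
  rcases (M.inc_string_vertex hv _).1 h with h | h | h
  · exact Or.inl h
  · exact Or.inr h
  · exfalso
    have hodd := M.wt_even_iff (x := tl i 0 false) ⟨h1, h2, h3, by simp⟩
    have hev := M'.wt_even_iff (x := str l) hl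
    rw [h] at hev
    obtain ⟨_, _, _, h4, -⟩ := hev.1 (hodd.2 ⟨_, _, _, rfl, Even.zero⟩)
    cases h4

/-- The first edge of the tail is the only even edge at the vertex, so both models give it the same
far endpoint. -/
theorem pt_one_eq {i : ℕ} {v : Fin r} (hv : pt i 0 = some v) (hv' : pt' i 0 = some v) :
    pt i 1 = pt' i 1 := by
  obtain ⟨h1, h2, h3⟩ := (M.pt_iff i 0).1 ⟨v, hv⟩
  have hn : W.IsName (tl i 0 false) := ⟨h1, h2, h3, by simp⟩
  have hev := (M'.wt_even_iff hn).2 ⟨_, _, _, rfl, Even.zero⟩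
  have key : ∀ {l}, l ≤ W.n → ed' (tl i 0 false) ≠ ed (str l) := by
    intro l hl h
    rw [h] at hev
    obtain ⟨_, _, _, h4, -⟩ := (M.wt_even_iff (x := str l) hl).1 hev
    cases h4
  have he : ed' (tl i 0 false) = ed (tl i 0 false) := by
    rcases (M.inc_string_vertex hv _).1 ((M'.inc_tl_iff hn hv').2 ⟨rfl, Or.inl rfl⟩) with h | h | h
    · exact absurd h (key (by omega))
    · exact absurd h (key h2)
    · exact h
  have e1 := M.src_tl _ _ _ hn
  have e2 := M'.src_tl _ _ _ hn
  have e3 := M.tgt_tl _ _ _ hn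
  have e4 := M'.tgt_tl _ _ _ hn
  rw [he] at e2 e4
  by_cases hd : 0 < W.δ i
  · rw [if_pos hd] at e1 e2
    exact e1.symm.trans e2
  · rw [if_neg hd] at e3 e4
    exact e3.symm.trans e4

theorem pt_succ_eq {i : ℕ} (hi : i ≤ W.n) (h : ed (str i) = ed' (str i)) :
    pt (i + 1) 0 = pt' (i + 1) 0 := by
  have e1 := M.src_str i hi
  have e2 := M'.src_str i hi
  have e3 := M.tgt_str i hi
  have e4 := M'.tgt_str i hi
  rw [← h] at e2 e4
  by_cases hd : 0 < W.s i
  · rw [if_pos hd] at e3 e4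
    exact e3.symm.trans e4
  · rw [if_neg hd] at e1 e2
    exact e1.symm.trans e2

/-- The vertices of the string and the first vertices of the tails are determined by the cover and the
first vertex of the string. -/
theorem pt_unique (h : pt 1 0 = pt' 1 0) : ∀ i, pt i 0 = pt' i 0 ∧ pt i 1 = pt' i 1 := by
  have key : ∀ i, i + 1 ≤ W.n → pt (i + 1) 0 = pt' (i + 1) 0 ∧ ed (str i) = ed' (str i) := by
    intro i
    induction i with
    | zero =>
      intro hi
      refine ⟨h, ?_⟩
      obtain ⟨v, hv⟩ := M.pt_some (i := 1) (j := 0) le_rfl hi (Nat.zero_le _)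
      have hv' : pt' 1 0 = some v := h ▸ hv
      have hinc : φ.Inc (ed' (str 0)) v :=
        (M'.inc_str_iff (Nat.zero_le _) hv').2 ⟨rfl, Or.inr rfl⟩
      rcases M.str_of_inc M' (Nat.zero_le _) hv hinc with h1 | h1
      · exact h1.symm
      · exfalso
        have hs := M'.src_str 0 (Nat.zero_le _)
        rw [if_pos M'.valid.pos_zero, M'.pt_none (i := 0) (by omega), h1, M.src_str 1 hi] at hs
        split_ifs at hs with h2
        · rw [hv] at hs; cases hs
        · rw [M.pt_eq_none_iff] at hs
          have h3 : W.n = 1 := by omega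
          have := M.valid.pos_last
          rw [h3] at this
          exact h2 this
    | succ i ih =>
      intro hi
      obtain ⟨h1, h2⟩ := ih (by omega)
      obtain ⟨v, hv⟩ := M.pt_some (i := i + 1) (j := 0) (by omega) (by omega) (Nat.zero_le _)
      have hv' : pt' (i + 1) 0 = some v := h1 ▸ hv
      have hinc : φ.Inc (ed' (str (i + 1))) v :=
        (M'.inc_str_iff (by omega) hv').2 ⟨rfl, Or.inl rfl⟩
      have h3 : ed (str (i + 1)) = ed' (str (i + 1)) := by
        rcases M.str_of_inc M' (by omega) hv hinc with h3 | h3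
        · rw [Nat.add_sub_cancel, h2] at h3
          have := M'.ed_inj (str (i + 1)) (str i) (by change i + 1 ≤ W.n; omega)
            (by change i ≤ W.n; omega) h3
          simp at this
        · exact h3.symm
      exact ⟨M.pt_succ_eq M' (by omega) h3, h3⟩
  intro i
  by_cases hi : 1 ≤ i ∧ i ≤ W.n
  · have h1 : pt i 0 = pt' i 0 := by
      have := (key (i - 1) (by omega)).1
      rwa [Nat.sub_add_cancel hi.1] at this
    obtain ⟨v, hv⟩ := M.pt_some (i := i) (j := 0) hi.1 hi.2 (Nat.zero_le _)
    exact ⟨h1, M.pt_one_eq M' hv (h1 ▸ hv)⟩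
  · constructor
    · rw [M.pt_none (by omega), M'.pt_none (by omega)]
    · rw [M.pt_none (by omega), M'.pt_none (by omega)]

end Unique

end IsModel

/-! ### Walks of a given type -/

namespace Walk

open Edg

/-- The conditions under which a walk gives mixed zigzag covers of type `(g, λ, μ)`. -/
structure Fits (W : Walk) (g k : ℕ) {d : ℕ} (lam mu : Nat.Partition d) : Prop where
  valid : W.Valid
  one_le : 1 ≤ k
  le : k ≤ W.n
  alternating : (W.take k).Alternating
  len_eq : ∀ i, 1 ≤ i → i ≤ k → W.len i = 0
  pos : 0 < W.s k
  left : {(W.s 0).natAbs} + W.inTails = lam.parts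
  right : {(W.s W.n).natAbs} + W.outTails = mu.parts
  genus : ∑ i ∈ Finset.Icc 1 W.n, W.len i / 2 = g

theorem comp_le {W : Walk} {k r : ℕ} {e : W.verts ≃ Fin r}
    (he : ∀ v w, W.key k v.1 < W.key k w.1 → e v < e w) (i j : ℕ) (u v : Fin r) (hi : i ≤ k)
    (hj : j ≤ k) (hu : W.place e i 0 = some u) (hv : W.place e j 0 = some v) (huv : u ≤ v) :
    W.comp j ≤ W.comp i := by
  by_contra hn
  obtain ⟨h1, rfl⟩ := place_eq_some.1 hu
  obtain ⟨h2, rfl⟩ := place_eq_some.1 hv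
  exact absurd (he _ _ (W.key_lt_of_comp_lt hj hi (not_le.1 hn))) (not_lt.2 huv)

variable {W : Walk} {g k d : ℕ} {lam mu : Nat.Partition d} (h : W.Fits g k lam mu)
include h

/-- An Euler characteristic count: a tail with `l` vertices off the string has `l + 1` vertices
altogether, `1 + l % 2` ends and `l / 2` cycles, and the two ends of the string account for the `-
2`. -/
theorem Fits.card_verts : W.verts.card = numBranch g lam mu := by
  have h1 : W.inTails.card + W.outTails.card = ∑ i ∈ Finset.Icc 1 W.n, (1 + W.len i % 2) := by
    rw [← Multiset.card_add]
    unfold inTails outTails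
    rw [← Finset.sum_add_distrib, Multiset.card_sum]
    refine Finset.sum_congr rfl fun i _ => ?_
    split_ifs <;> simp [card_tailEnds]
  have h2 : ∑ i ∈ Finset.Icc 1 W.n, (W.len i + 1) = ∑ i ∈ Finset.Icc 1 W.n, (1 + W.len i % 2) +
      (∑ i ∈ Finset.Icc 1 W.n, W.len i / 2 + ∑ i ∈ Finset.Icc 1 W.n, W.len i / 2) := by
    simp only [← Finset.sum_add_distrib]
    exact Finset.sum_congr rfl fun i _ => by omega
  rw [Walk.card_verts, h2, h.genus, ← h1]
  unfold numBranch
  rw [← h.left, ← h.right]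
  simp only [Multiset.card_add, Multiset.card_singleton]
  omega

section Numbered

variable {e : W.verts ≃ Fin (numBranch g lam mu)}
  (he : ∀ v w, W.key k v.1 < W.key k w.1 → e v < e w)
include he

theorem Fits.exists_isModel : ∃ ed, IsModel (W.coverClass e).cover W (W.place e) ed :=
  Walk.exists_isModel h.valid e fun x _ => triple_lt h.pos h.len_eq he x

/-- All keys of vertices with `i ≤ k` are below the other ones, and there are exactly `k` such
vertices, as the first tails have none of their own. -/
theorem Fits.place_lt_iff (i j : ℕ) (v : Fin (numBranch g lam mu)) (hv : W.place e i j = some v) :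
    v.val < k ↔ i ≤ k := by
  obtain ⟨h1, rfl⟩ := place_eq_some.1 hv
  have h2 := val_lt_card_iff e (fun x => x.1.1 ≤ k)
    (fun v w hv hw => he v w (W.key_lt_of_le hv hw)) ⟨⟨i, j⟩, h1⟩
  have h3 : (Finset.univ.filter fun x : W.verts => x.1.1 ≤ k).card = k := by
    have h4 : (Finset.univ.filter fun x : W.verts => x.1.1 ≤ k).card = (Finset.Icc 1 k).card := by
      refine Finset.card_bij (fun x _ => x.1.1) ?_ ?_ ?_
      · rintro ⟨⟨i, j⟩, hx⟩ hx'
        simp only [Finset.mem_filter, Finset.mem_univ, true_and] at hx'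
        exact Finset.mem_Icc.2 ⟨(mem_verts.1 hx).1, hx'⟩
      · rintro ⟨⟨i, j⟩, hx⟩ hx' ⟨⟨i', j'⟩, hy⟩ hy' hxy
        simp only [Finset.mem_filter, Finset.mem_univ, true_and] at hx' hy' hxy
        subst hxy
        have h5 := mem_verts.1 hx
        have h6 := mem_verts.1 hy
        have h7 := h.len_eq i h5.1 hx'
        have h8 : j = j' := by omega
        subst h8
        rfl
      · intro i hi
        obtain ⟨h5, h6⟩ := Finset.mem_Icc.1 hi
        exact ⟨⟨⟨i, 0⟩, mem_verts.2 ⟨h5, h6.trans h.le, Nat.zero_le _⟩⟩, by simpa using h6, rfl⟩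
    rw [h4, Nat.card_Icc]
    omega
  rw [h3] at h2
  exact h2

theorem Fits.hasType : (W.coverClass e).cover.HasType g lam.parts mu.parts := by
  obtain ⟨ed, M⟩ := h.exists_isModel he
  refine ⟨M.isTropical, ?_, M.inProfile_eq.trans h.left, M.outProfile_eq.trans h.right⟩
  rw [M.genus_eq (by rw [← h.card_verts, Walk.card_verts]), h.genus]

theorem Fits.coverClass_mem : W.coverClass e ∈ mixedZigzagCovers g k lam mu := by
  obtain ⟨ed, M⟩ := h.exists_isModel he
  exact ⟨h.hasType he, M.isZigzag, _, M.isMixedAlong h.one_le h.le h.len_eq (h.place_lt_iff he)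
    h.pos h.alternating (comp_le he)⟩

/-- An in-end of weight one on a tail is odd, hence part of a fork, and forks occur only after the
first `k` vertices. The in-end of the string is left out and provides the fixed sheet. -/
theorem Fits.factorial_le_mixedCount (ε : Fin (numBranch g lam mu) → ℤˣ) :
    (W.inTails.count 1).factorial ≤ mixedCount g k lam mu (W.coverClass e).cover ε := by
  classical
  obtain ⟨ed, M⟩ := h.exists_isModel he
  have ht := h.hasType he
  have s0 : (W.coverClass e).cover.src (ed (str 0)) = none := by
    rw [M.src_str 0 (Nat.zero_le _), if_pos h.valid.pos_zero]
    exact M.pt_none (by omega)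
  set φ := (W.coverClass e).cover
  let O := (Finset.univ.filter fun x => φ.src x = none ∧ φ.wt x = 1).erase (ed (str 0))
  have hsum : ∑ x ∈ O, φ.wt x = W.inTails.count 1 := by
    have h1 : ∑ x ∈ O, φ.wt x = O.card := by
      rw [Finset.card_eq_sum_ones]
      refine Finset.sum_congr rfl fun x hx => ?_
      simp only [O, Finset.mem_erase, Finset.mem_filter] at hx
      exact hx.2.2.2
    have h2 : (Finset.univ.filter fun x => φ.src x = none ∧ φ.wt x = 1).card =
        φ.inProfile.count 1 := by
      unfold Cover.inProfile
      rw [Multiset.count_map, ← Finset.filter_filter]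
      simp only [Finset.card_def, Finset.filter_val, eq_comm]
    have h3 : φ.wt (ed (str 0)) = (W.s 0).natAbs := M.wt_str 0 (Nat.zero_le _)
    rw [h1]
    rw [M.inProfile_eq, Multiset.count_add] at h2
    by_cases h4 : (W.s 0).natAbs = 1
    · rw [h4, Multiset.count_singleton_self] at h2
      have h5 : ed (str 0) ∈ Finset.univ.filter fun x => φ.src x = none ∧ φ.wt x = 1 := by
        simp [s0, h3, h4]
      rw [Finset.card_erase_of_mem h5]
      omega
    · rw [Multiset.count_singleton, if_neg (Ne.symm h4)] at h2
      have h5 : ed (str 0) ∉ Finset.univ.filter fun x => φ.src x = none ∧ φ.wt x = 1 := by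
        simp [s0, h3, h4]
      have h6 : O = _ := Finset.erase_eq_of_notMem h5
      rw [h6]
      omega
  rw [← hsum]
  refine M.factorial_le_mixedCount ht h.le h.alternating h.one_le ?_ h.len_eq (h.place_lt_iff he)
    (comp_le he) O ?_ s0 (Finset.notMem_erase _ _) ε
  · rw [← h.card_verts, Walk.card_verts]
    refine h.le.trans ?_
    calc W.n = ∑ i ∈ Finset.Icc 1 W.n, 1 := by simp
      _ ≤ _ := Finset.sum_le_sum fun i _ => by omega
  · intro x hx
    simp only [O, Finset.mem_erase, Finset.mem_filter, Finset.mem_univ, true_and] at hx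
    obtain ⟨h1, h2, h3⟩ := hx
    refine ⟨h2, fun u hu => ?_⟩
    obtain ⟨y, hy, rfl⟩ := M.ed_surj x
    cases y with
    | str i =>
      exfalso
      have hy : i ≤ W.n := hy
      have h4 := M.src_str i hy
      rw [h2] at h4
      split_ifs at h4 with h5
      · have := M.pt_eq_none_iff.1 h4.symm
        have : i = 0 := by omega
        rw [this] at h1
        exact h1 rfl
      · have := M.pt_eq_none_iff.1 h4.symm
        have : i = W.n := by omega
        rw [this] at h5
        exact h5 h.valid.pos_last
    | tl i j b =>
      have hj : ¬ Even j := fun hj => by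
        have := (M.wt_even_iff hy).2 ⟨i, j, b, rfl, hj⟩
        rw [h3] at this
        exact absurd this (by decide)
      have hi : ¬ i ≤ k := fun hi => by
        have h4 := h.len_eq i hy.1 hi
        have h5 := hy.2.2.1
        have : j = 0 := by omega
        rw [this] at hj
        exact hj Even.zero
      by_contra hn
      rcases (M.inc_tl hy u).1 (Or.inr hu) with h4 | h4
      · exact hi ((h.place_lt_iff he _ _ _ h4).1 (not_le.1 hn))
      · exact hi ((h.place_lt_iff he _ _ _ h4).1 (not_le.1 hn))

end Numbered

end Walk


/-! ### Permuting the vertices of the fork pairs -/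

namespace Walk

section Family

variable {W : Walk} {b N : ℕ}

/-- The vertex of type `c` in the `t`-th of the pairs of tails following the vertex `b`. -/
def pairVertex (b : ℕ) (c : Fin 4) (t : ℕ) : Σ _ : ℕ, ℕ := ⟨b + 2 * t + 1 + c.val % 2, c.val / 2⟩

theorem pairVertex_mem (hN : b + 2 * N ≤ W.n)
    (hlen : ∀ i, b < i → i ≤ b + 2 * N → 1 ≤ W.len i) (x : Fin 4 × Fin N) :
    pairVertex b x.1 x.2 ∈ W.verts := by
  obtain ⟨c, t⟩ := x
  have hc := c.isLt
  have ht := t.isLt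
  have := hlen (b + 2 * t.val + 1 + c.val % 2) (by omega) (by omega)
  have h2 : c.val / 2 ≤ W.len (b + 2 * t.val + 1 + c.val % 2) := by omega
  exact mem_verts.2 ⟨by dsimp only; omega, by dsimp only; omega, h2⟩

/-- The vertices of `N` consecutive pairs of tails with a symmetric fork. -/
def pairVertexEmb (hN : b + 2 * N ≤ W.n)
    (hlen : ∀ i, b < i → i ≤ b + 2 * N → 1 ≤ W.len i) : Fin 4 × Fin N ↪ W.verts where
  toFun x := ⟨pairVertex b x.1 x.2, pairVertex_mem hN hlen x⟩
  inj' := by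
    rintro ⟨c, t⟩ ⟨c', t'⟩ hxy
    have h := congrArg Subtype.val hxy
    simp only [pairVertex, Sigma.mk.injEq, heq_eq_eq] at h
    have hc := c.isLt
    have hc' := c'.isLt
    exact Prod.ext (Fin.ext (by dsimp only; omega)) (Fin.ext (by dsimp only; omega))

theorem level_add_two_mul (hs : ∀ t < N, 0 < W.s (b + 2 * t) ∧ ¬ 0 < W.s (b + 2 * t + 1)) :
    ∀ t ≤ N, W.level (b + 2 * t) = W.level b := by
  intro t
  induction t with
  | zero => simp
  | succ t ih =>
    intro ht
    obtain ⟨h1, h2⟩ := hs t (by omega)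
    have h3 : W.level (b + 2 * (t + 1)) = W.level (b + 2 * t + 1) + -1 := by
      change W.level (b + 2 * t + 1 + 1) = _
      rw [level, if_neg h2]
    rw [h3, level, if_pos h1, ih (by omega)]
    ring

/-- The string moves one step to the right and back in each pair, so the height depends on the type
`c` only. Parity of `c` selects the out-tail or the in-tail, and `c / 2` the attaching vertex or the
vertex of the fork. -/
theorem height_pairVertex (hs : ∀ t < N, 0 < W.s (b + 2 * t) ∧ ¬ 0 < W.s (b + 2 * t + 1))
    (hδ : ∀ t < N, ¬ 0 < W.δ (b + 2 * t + 1) ∧ 0 < W.δ (b + 2 * t + 2)) (c : Fin 4) (t : ℕ)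
    (ht : t < N) : W.height (pairVertex b c t).1 (pairVertex b c t).2 =
      if c.val % 2 = 0 then W.level b + 1 + (c.val / 2 : ℕ) else W.level b - (c.val / 2 : ℕ) := by
  have h0 := level_add_two_mul hs t ht.le
  obtain ⟨h1, h2⟩ := hs t ht
  obtain ⟨h3, h4⟩ := hδ t ht
  have h5 : W.level (b + 2 * t + 1) = W.level b + 1 := by rw [level, if_pos h1, h0]
  have h6 : W.level (b + 2 * t + 2) = W.level b := by
    rw [level, if_neg h2, h5]; ring
  unfold height pairVertex
  rcases Nat.mod_two_eq_zero_or_one c.val with hc | hc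
  · simp only [hc, if_true, add_zero]
    rw [if_neg h3, h5]
  · simp only [hc, one_ne_zero, if_false]
    rw [if_pos h4, h6]

/-- The permutation of the vertices exchanging the vertices of the same type. -/
noncomputable def shuffle (ι : Fin 4 × Fin N ↪ W.verts) (p : Fin 4 → Equiv.Perm (Fin N)) :
    Equiv.Perm W.verts :=
  Equiv.Perm.viaEmbedding (Equiv.prodShear (Equiv.refl _) p) ι

theorem shuffle_apply (ι : Fin 4 × Fin N ↪ W.verts) (p : Fin 4 → Equiv.Perm (Fin N)) (c : Fin 4)
    (t : Fin N) : shuffle ι p (ι (c, t)) = ι (c, p c t) :=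
  Equiv.Perm.viaEmbedding_apply _ _ _

/-- A walk with `N` consecutive pairs of tails with symmetric forks gives `(N!) ^ 4` covers. -/
theorem Fits.exists_family {g k d : ℕ} {lam mu : Nat.Partition d} (h : W.Fits g k lam mu)
    (hb : k ≤ b) (hN : b + 2 * N ≤ W.n) (hlen : ∀ i, b < i → i ≤ b + 2 * N → 1 ≤ W.len i)
    (hs : ∀ t < N, 0 < W.s (b + 2 * t) ∧ ¬ 0 < W.s (b + 2 * t + 1))
    (hδ : ∀ t < N, ¬ 0 < W.δ (b + 2 * t + 1) ∧ 0 < W.δ (b + 2 * t + 2)) :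
    ∃ f : (Fin 4 → Equiv.Perm (Fin N)) → CoverClass (numBranch g lam mu), Function.Injective f ∧
      ∀ p, f p ∈ mixedZigzagCovers g k lam mu ∧
        ∀ ε, (W.inTails.count 1).factorial ≤ mixedCount g k lam mu (f p).cover ε := by
  obtain ⟨e₀, he₀⟩ := exists_equiv_of_key (fun v : W.verts => W.key k v.1)
    (by rw [Fintype.card_coe, h.card_verts] : Fintype.card W.verts = numBranch g lam mu)
  let ι := pairVertexEmb hN hlen
  -- Shuffling within a type preserves keys, so every shuffled numbering is still admissible.
  have hkey : ∀ p v, W.key k (shuffle ι p v).1 = W.key k v.1 := by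
    intro p v
    by_cases hv : v ∈ Set.range ι
    · obtain ⟨⟨c, t⟩, rfl⟩ := hv
      rw [shuffle_apply]
      have h1 : ∀ t : Fin N, W.key k (ι (c, t)).1 = toLex (0,
          if c.val % 2 = 0 then W.level b + 1 + (c.val / 2 : ℕ)
          else W.level b - (c.val / 2 : ℕ)) := by
        intro t
        rw [← height_pairVertex hs hδ c t t.isLt]
        have h2 : ¬ (pairVertex b c t).1 ≤ k := by
          change ¬ b + 2 * t.val + 1 + c.val % 2 ≤ k
          omega
        exact if_neg h2
      rw [h1, h1]
    · rw [shuffle, Equiv.Perm.viaEmbedding_apply_of_notMem _ _ _ hv]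
  have he : ∀ p, ∀ v w, W.key k v.1 < W.key k w.1 →
      (shuffle ι p).trans e₀ v < (shuffle ι p).trans e₀ w := by
    intro p v w hvw
    refine he₀ _ _ ?_
    rw [hkey, hkey]
    exact hvw
  refine ⟨fun p => W.coverClass ((shuffle ι p).trans e₀), ?_, fun p =>
    ⟨h.coverClass_mem (he p), h.factorial_le_mixedCount (he p)⟩⟩
  intro p p' hpp
  dsimp only at hpp
  obtain ⟨ed, M⟩ := h.exists_isModel (he p)
  have M' := h.exists_isModel (he p')
  rw [← hpp] at M'
  obtain ⟨ed', M'⟩ := M'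
  have hk := h.one_le
  -- The shuffled vertices have string index at least `b + 1`, and `b ≥ k ≥ 1`. The first vertex
  -- keeps its place, and from it the cover determines all others.
  have h10 : ∀ p, W.place ((shuffle ι p).trans e₀) 1 0 = W.place e₀ 1 0 := by
    intro p
    unfold place
    split_ifs with hm
    · rw [Equiv.trans_apply, shuffle, Equiv.Perm.viaEmbedding_apply_of_notMem]
      rintro ⟨⟨c, t⟩, hct⟩
      have h2 := congrArg (fun v : W.verts => v.1.1) hct
      change b + 2 * t.val + 1 + c.val % 2 = 1 at h2
      omega
    · rfl
  have huniq := M.pt_unique M' ((h10 p).trans (h10 p').symm)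
  funext c
  refine Equiv.ext fun t => ?_
  have h3 : W.place ((shuffle ι p).trans e₀) (pairVertex b c t).1 (pairVertex b c t).2 =
      W.place ((shuffle ι p').trans e₀) (pairVertex b c t).1 (pairVertex b c t).2 := by
    have h4 : (pairVertex b c t).2 = 0 ∨ (pairVertex b c t).2 = 1 := by
      change c.val / 2 = 0 ∨ c.val / 2 = 1
      have := c.isLt
      omega
    rcases h4 with h4 | h4 <;> rw [h4]
    · exact (huniq _).1
    · exact (huniq _).2
  have h5 : ∀ p, W.place ((shuffle ι p).trans e₀) (pairVertex b c t).1 (pairVertex b c t).2 =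
      some (e₀ (ι (c, p c t))) := fun p => place_eq_some.2 ⟨pairVertex_mem hN hlen (c, t), by
        rw [← shuffle_apply]; rfl⟩
  rw [h5, h5] at h3
  have h6 := ι.injective (e₀.injective (Option.some.inj h3))
  exact congrArg Prod.snd h6

end Family

end Walk

/-! ### From families of covers to the mixed zigzag number -/

/-- Only finitely many covers are produced by factorizations. -/
theorem finite_mixedCount_ne_zero {d : ℕ} (g k : ℕ) (lam mu : Nat.Partition d) :
    {M : CoverClass (numBranch g lam mu) | ∃ ε, mixedCount g k lam mu M.cover ε ≠ 0}.Finite := by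
  classical
  let T (F : Tuple d (numBranch g lam mu)) : CoverClass (numBranch g lam mu) :=
    (Finset.univ : Finset {p // F.IsEdge p}).val.map fun p =>
      (F.cover.src p, F.cover.tgt p, F.cover.wt p)
  refine (Set.finite_range T).subset ?_
  rintro M ⟨ε, hε⟩
  obtain ⟨F, -, -, c, -, -, θ, hθ⟩ := Set.nonempty_of_ncard_ne_zero hε
  refine ⟨F, ?_⟩
  have h1 : M = (Finset.univ : Finset (Multiset.ToType M)).val.map fun e => e.1 :=
    (Multiset.map_univ_coe M).symm
  rw [h1]
  have h2 : (Finset.univ : Finset (Multiset.ToType M)).val =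
      (Finset.univ : Finset {p // F.IsEdge p}).val.map θ := by
    rw [← Finset.univ_map_equiv_to_embedding θ]
    rfl
  rw [h2, Multiset.map_map]
  refine Multiset.map_congr rfl fun p _ => ?_
  obtain ⟨a, b, c, -⟩ := hθ p
  exact Prod.ext a.symm (Prod.ext b.symm c.symm)

theorem card_mul_le_mixedZigzagNumber {d : ℕ} {g k : ℕ} {lam mu : Nat.Partition d} {ι : Type*}
    [Fintype ι] {f : ι → CoverClass (numBranch g lam mu)} (hf : Function.Injective f) (a : ℕ)
    (h : ∀ p, f p ∈ mixedZigzagCovers g k lam mu ∧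
      ∀ ε, a ≤ mixedCount g k lam mu (f p).cover ε) :
    Fintype.card ι * a ≤ mixedZigzagNumber g k lam mu := by
  classical
  let G (M : CoverClass (numBranch g lam mu)) : ℕ := ⨅ ε, mixedCount g k lam mu M.cover ε
  have hG : ∀ M, G M ≠ 0 → ∃ ε, mixedCount g k lam mu M.cover ε ≠ 0 := by
    intro M hM
    by_contra hn
    push Not at hn
    exact hM (by simp [G, hn])
  -- A `finsum` with infinite support would be zero, so a lower bound requires finiteness of the
  -- support. It holds because there are only finitely many tuples in the symmetric group.
  have hfin : (mixedZigzagCovers g k lam mu ∩ Function.support G).Finite :=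
    (finite_mixedCount_ne_zero g k lam mu).subset fun M hM => hG M hM.2
  have hsub : Finset.univ.image f ⊆ hfin.toFinset ∪ Finset.univ.image f :=
    Finset.subset_union_right
  have hsum : mixedZigzagNumber g k lam mu = ∑ M ∈ hfin.toFinset ∪ Finset.univ.image f, G M := by
    refine finsum_mem_eq_sum_of_inter_support_eq G ?_
    ext M
    simp only [Set.mem_inter_iff, Finset.coe_union, Set.Finite.coe_toFinset, Finset.coe_image,
      Finset.coe_univ, Set.image_univ, Set.mem_union, Set.mem_range]
    constructor
    · rintro ⟨h1, h2⟩
      exact ⟨Or.inl ⟨h1, h2⟩, h2⟩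
    · rintro ⟨h1 | ⟨p, rfl⟩, h2⟩
      · exact h1
      · exact ⟨(h p).1, h2⟩
  rw [hsum]
  refine le_trans ?_ (Finset.sum_le_sum_of_subset hsub)
  rw [Finset.sum_image hf.injOn, ← Finset.card_univ, ← smul_eq_mul]
  exact Finset.card_nsmul_le_sum _ _ _ fun p _ => le_ciInf (h p).2


/-! ### Walks from lists of steps -/

namespace Walk

/-- The in-ends of a tail. -/
def inEnds (x : ℤ × ℕ) : Multiset ℕ := if 0 < x.1 then tailEnds x.1 x.2 else 0

/-- The out-ends of a tail. -/
def outEnds (x : ℤ × ℕ) : Multiset ℕ := if 0 < x.1 then 0 else tailEnds x.1 x.2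

theorem sum_tailEnds {a : ℤ} (ha : Even a) (l : ℕ) : (tailEnds a l).sum = a.natAbs := by
  unfold tailEnds
  have := Int.natAbs_even.2 ha
  split_ifs
  · simp
  · simp only [Multiset.insert_eq_cons, Multiset.sum_cons, Multiset.sum_singleton]
    obtain ⟨c, hc⟩ := this
    omega

theorem sum_inEnds_sub_sum_outEnds {x : ℤ × ℕ} (hx : Even x.1) :
    ((inEnds x).sum : ℤ) - (outEnds x).sum = x.1 := by
  unfold inEnds outEnds
  split_ifs with h
  · rw [sum_tailEnds hx]
    simp only [Multiset.sum_zero]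
    omega
  · rw [sum_tailEnds hx]
    simp only [Multiset.sum_zero]
    omega

/-- The walk starting at `s₀` with given steps and lengths of tails. -/
def ofList (s₀ : ℤ) (L : List (ℤ × ℕ)) : Walk where
  n := L.length
  s i := s₀ + ((L.take i).map Prod.fst).sum
  δ i := (L.getD (i - 1) (0, 0)).1
  len i := (L.getD (i - 1) (0, 0)).2

theorem ofList_at (s₀ : ℤ) (X Y : List (ℤ × ℕ)) (x : ℤ × ℕ) :
    (ofList s₀ (X ++ x :: Y)).s X.length = s₀ + (X.map Prod.fst).sum ∧
    (ofList s₀ (X ++ x :: Y)).s (X.length + 1) = s₀ + (X.map Prod.fst).sum + x.1 ∧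
    (ofList s₀ (X ++ x :: Y)).δ (X.length + 1) = x.1 ∧
    (ofList s₀ (X ++ x :: Y)).len (X.length + 1) = x.2 := by
  refine ⟨?_, ?_, ?_, ?_⟩
  · simp [ofList]
  · simp [ofList, List.take_append, List.take_of_length_le, add_assoc]
  · simp [ofList]
  · simp [ofList]

theorem exists_append_of_lt {α : Type*} {L : List α} {i : ℕ} (h : i < L.length) :
    ∃ X x Y, L = X ++ x :: Y ∧ X.length = i :=
  ⟨L.take i, L[i], L.drop (i + 1), by simp, by simp [h.le]⟩

theorem ofList_mem {s₀ : ℤ} {L : List (ℤ × ℕ)} {i : ℕ} (h1 : 1 ≤ i) (h2 : i ≤ L.length) :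
    ((ofList s₀ L).δ i, (ofList s₀ L).len i) ∈ L := by
  obtain ⟨X, x, Y, hL, hX⟩ := exists_append_of_lt (L := L) (i := i - 1) (by omega)
  have h3 : i = X.length + 1 := by omega
  obtain ⟨-, -, h4, h5⟩ := ofList_at s₀ X Y x
  subst hL h3
  rw [h4, h5]
  simp

theorem sum_ofList {M : Type*} [AddCommMonoid M] (s₀ : ℤ) (L : List (ℤ × ℕ)) (f : ℤ × ℕ → M) :
    ∑ i ∈ Finset.Icc 1 (ofList s₀ L).n, f ((ofList s₀ L).δ i, (ofList s₀ L).len i) =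
      (L.map f).sum := by
  have h1 : ∀ i, ((ofList s₀ L).δ i, (ofList s₀ L).len i) = L.getD (i - 1) (0, 0) := fun i => rfl
  simp only [h1]
  change ∑ i ∈ Finset.Icc 1 L.length, _ = _
  have h2 : ∑ i ∈ Finset.Icc 1 L.length, f (L.getD (i - 1) (0, 0)) =
      ∑ i ∈ Finset.range L.length, f (L.getD i (0, 0)) := by
    refine Finset.sum_nbij' (· - 1) (· + 1) ?_ ?_ ?_ ?_ ?_
    · intro i hi
      simp only [Finset.mem_Icc, Finset.mem_range] at hi ⊢
      omega
    · intro i hi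
      simp only [Finset.mem_Icc, Finset.mem_range] at hi ⊢
      omega
    · intro i hi
      simp only [Finset.mem_Icc] at hi
      omega
    · intro i _
      exact Nat.add_sub_cancel i 1
    · exact fun _ _ => rfl
  rw [h2]
  clear h1 h2
  induction L with
  | nil => rfl
  | cons x L ih =>
    rw [List.length_cons, Finset.sum_range_succ', List.map_cons, List.sum_cons, ← ih, add_comm]
    rfl

/-- The conditions on the steps of a string from `s` on in the first part of a mixed cover; `p` tells
whether the previous weight was positive. -/
def Descends : Prop → ℤ → List ℤ → Prop
  | _, s, [] => 0 < s
  | p, s, x :: T => ((0 < s ↔ 0 < s + x) → (s + x).natAbs < s.natAbs) ∧ ¬ (p ∧ 0 < s ∧ 0 < s + x) ∧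
      Descends (0 < s) (s + x) T

/-- The third clause is only needed inside the induction: it remembers the weight before the start,
so that three consecutive positive weights across the first step are excluded. -/
theorem Descends.partial {p : Prop} {s : ℤ} {T : List ℤ} (h : Descends p s T) :
    (∀ i < T.length, (0 < s + (T.take i).sum ↔ 0 < s + (T.take (i + 1)).sum) →
      (s + (T.take (i + 1)).sum).natAbs < (s + (T.take i).sum).natAbs) ∧
    (∀ i, i + 2 ≤ T.length → ¬ (0 < s + (T.take i).sum ∧ 0 < s + (T.take (i + 1)).sum ∧
      0 < s + (T.take (i + 2)).sum)) ∧
    (1 ≤ T.length → ¬ (p ∧ 0 < s ∧ 0 < s + (T.take 1).sum)) ∧ 0 < s + T.sum := by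
  induction T generalizing p s with
  | nil => simpa [Descends] using h
  | cons x T ih =>
    obtain ⟨h1, h2, h3⟩ := h
    obtain ⟨i1, i2, i3, i4⟩ := ih h3
    simp only [List.length_cons, List.take_succ_cons, List.sum_cons, ← add_assoc]
    refine ⟨?_, ?_, ?_, i4⟩
    · rintro (_ | i) hi
      · simpa using h1
      · simpa [← add_assoc] using i1 i (by omega)
    · rintro (_ | i) hi
      · have := i3 (by omega)
        simpa using this
      · have := i2 i (by omega)
        simpa [← add_assoc] using this
    · intro _
      simpa using h2

/-- All conditions are read off from the list, irrespective of the order of the entries after the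
first `k`. In particular the final weight need not be controlled step by step. -/
theorem fits_ofList {g k d : ℕ} {lam mu : Nat.Partition d} {o o' : ℕ} {T : List ℤ}
    {L R : List (ℤ × ℕ)} (hTR : L = T.map (fun x => (x, 0)) ++ R) (ho : Odd o) (ho' : Odd o')
    (hL : ∀ x ∈ L, Even x.1 ∧ x.1 ≠ 0 ∧ (0 < x.2 → Odd (x.1.natAbs / 2)))
    (hT : Descends False o T) (hk : T.length = k) (hk1 : 1 ≤ k)
    (left : {o} + (L.map inEnds).sum = lam.parts) (right : {o'} + (L.map outEnds).sum = mu.parts)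
    (genus : (L.map fun x => x.2 / 2).sum = g) : (ofList o L).Fits g k lam mu := by
  have hkL : k ≤ L.length := by rw [hTR]; simp [hk]
  have step : ∀ i < L.length, (ofList o L).s (i + 1) = (ofList o L).s i + (ofList o L).δ (i + 1) := by
    intro i hi
    obtain ⟨X, x, Y, hXY, hX⟩ := exists_append_of_lt hi
    obtain ⟨h1, h2, h3, -⟩ := ofList_at o X Y x
    subst hXY hX
    rw [h1, h2, h3]
  have s0 : (ofList o L).s 0 = o := by simp [ofList]
  have sT : ∀ i ≤ k, (ofList o L).s i = o + (T.take i).sum := by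
    intro i hi
    have h1 : L.take i = (T.take i).map fun x => (x, 0) := by
      rw [hTR, List.take_append_of_le_length (by simpa [hk] using hi), List.map_take]
    simp only [ofList, h1, List.map_map]
    congr 2
    exact List.map_id' _
  have hsum : ((L.map Prod.fst).sum : ℤ) =
      ((L.map inEnds).sum.sum : ℤ) - (L.map outEnds).sum.sum := by
    clear hTR hkL step s0 sT left right genus
    induction L with
    | nil => simp
    | cons x L ih =>
      have h1 := sum_inEnds_sub_sum_outEnds (hL x (by simp)).1
      have h2 := ih fun y hy => hL y (by simp [hy])
      simp only [List.map_cons, List.sum_cons, Multiset.sum_add, Nat.cast_add]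
      rw [h2, ← h1]
      ring
  -- The total change of weight is the sum of the in-ends minus that of the out-ends of the tails.
  -- Both partitions have the same sum, so the string ends with weight `o'`.
  have sn : (ofList o L).s L.length = o' := by
    have h1 := congrArg Multiset.sum left
    have h2 := congrArg Multiset.sum right
    rw [lam.parts_sum, Multiset.sum_add, Multiset.sum_singleton] at h1
    rw [mu.parts_sum, Multiset.sum_add, Multiset.sum_singleton] at h2
    have h3 : (ofList o L).s L.length = o + (L.map Prod.fst).sum := by
      simp [ofList, List.take_of_length_le]
    rw [h3, hsum]
    omega
  obtain ⟨d1, d2, -, d4⟩ := hT.partial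
  refine ⟨⟨step, ?_, ?_, ?_, ?_, ?_, ?_⟩, hk1, hkL, ⟨?_, ?_⟩, ?_, ?_, ?_, ?_, ?_⟩
  · intro i
    induction i with
    | zero => intro _; rw [s0]; exact_mod_cast ho
    | succ i ih =>
      intro hi
      rw [step i hi]
      exact (ih (Nat.le_of_succ_le hi)).add_even
        (hL _ (ofList_mem (s₀ := o) (Nat.le_add_left 1 i) hi)).1
  · exact fun i h1 h2 => (hL _ (ofList_mem (s₀ := o) h1 h2)).1
  · exact fun i h1 h2 => (hL _ (ofList_mem (s₀ := o) h1 h2)).2.1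
  · exact fun i h1 h2 => (hL _ (ofList_mem (s₀ := o) h1 h2)).2.2
  · rw [s0]; exact_mod_cast ho.pos
  · change 0 < (ofList o L).s L.length
    rw [sn]; exact_mod_cast ho'.pos
  · intro i hi
    change i < k at hi
    change (0 < (ofList o L).s i ↔ 0 < (ofList o L).s (i + 1)) →
      ((ofList o L).s (i + 1)).natAbs < ((ofList o L).s i).natAbs
    rw [sT i hi.le, sT (i + 1) hi]
    exact d1 i (by omega)
  · intro i hi
    change i + 2 ≤ k at hi
    change ¬ (0 < (ofList o L).s i ∧ 0 < (ofList o L).s (i + 1) ∧ 0 < (ofList o L).s (i + 2))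
    rw [sT i (by omega), sT (i + 1) (by omega), sT (i + 2) hi]
    exact d2 i (by omega)
  · intro i h1 h2
    have h3 : L.getD (i - 1) (0, 0) = (T.map fun x => ((x : ℤ), 0)).getD (i - 1) (0, 0) := by
      rw [hTR, List.getD_append _ _ _ _ (by rw [List.length_map]; omega)]
    have h4 : (T.map fun x => ((x : ℤ), 0)).getD (i - 1) (0, 0) = (T.getD (i - 1) 0, 0) :=
      List.getD_map ..
    change (L.getD (i - 1) (0, 0)).2 = 0
    rw [h3, h4]
  · rw [sT k le_rfl, ← hk, List.take_length]
    exact d4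
  · rw [s0, Int.natAbs_natCast, ← left]
    exact congrArg _ (sum_ofList o L inEnds)
  · change {((ofList o L).s L.length).natAbs} + _ = _
    rw [sn, Int.natAbs_natCast, ← right]
    exact congrArg _ (sum_ofList o L outEnds)
  · rw [← genus]
    exact sum_ofList o L fun x => x.2 / 2

end Walk


/-! ### The steps of the first `k` vertices -/

namespace Walk

/-- Steps alternating between the entries of `A` and `b` upwards and the entries of `B` downwards. -/
theorem exists_descends (M b o : ℕ) (hbM : b ≤ M) (ho : 0 < o) (hob : o < b) :
    ∀ n (A B : Multiset ℕ) (p : Prop) (s : ℤ), A.card + B.card = n → (p → s ≤ 0) → s ≤ M →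
      (∀ x ∈ A, 0 < x ∧ x ≤ b) → (∀ x ∈ B, 0 < x) → (∀ x y, {x, y} ≤ B → M < x + y) →
      s + A.sum + b - B.sum = o →
      ∃ T : List ℤ, (T : Multiset ℤ) = (b ::ₘ A).map (fun x : ℕ => (x : ℤ)) +
        B.map (fun x : ℕ => -(x : ℤ)) ∧
        Descends p s T := by
  intro n
  induction n using Nat.strong_induction_on with
  | _ n ih =>
  intro A B p s hn hp hsM hA hB hBB hsum
  have up : ∀ x : ℕ, 0 < x → s ≤ 0 → (0 < s ↔ 0 < s + x) → (s + x).natAbs < s.natAbs := by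
    intro x h1 h2 h3; omega
  have down : ∀ (x : ℕ) (s : ℤ), 0 < x → 0 < s → (0 < s ↔ 0 < s + -(x : ℤ)) →
      (s + -(x : ℤ)).natAbs < s.natAbs := by
    intro x s h1 h2 h3; omega
  rcases le_or_gt s 0 with hs | hs
  -- As long as `A` is nonempty, one of its entries is used for the upward step. Otherwise `b` is
  -- used, and then at most one entry of `B` is left: two of them exceed `M`, hence also `s + b`,
  -- whereas the final weight is positive.
  · rcases Multiset.empty_or_exists_mem A with rfl | ⟨x, hx⟩
    · simp only [Multiset.sum_zero, Nat.cast_zero, add_zero] at hsum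
      rcases Multiset.empty_or_exists_mem B with rfl | ⟨u, hu⟩
      · refine ⟨[(b : ℤ)], by simp, up b (by omega) hs, by omega, ?_⟩
        simp only [Multiset.sum_zero] at hsum
        change 0 < s + b
        omega
      · obtain ⟨B', rfl⟩ := Multiset.exists_cons_of_mem hu
        rcases Multiset.empty_or_exists_mem B' with rfl | ⟨w, hw⟩
        · simp only [Multiset.sum_cons, Multiset.sum_zero, add_zero] at hsum
          have h1 := hB u (by simp)
          refine ⟨[(b : ℤ), -(u : ℤ)], rfl,
            up b (by omega) hs, by omega, down u _ h1 (by omega), by omega, ?_⟩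
          change 0 < s + b + -(u : ℤ)
          omega
        · obtain ⟨B'', rfl⟩ := Multiset.exists_cons_of_mem hw
          have h1 := hBB u w (Multiset.cons_le_cons _ (Multiset.cons_le_cons _ (Multiset.zero_le _)))
          simp only [Multiset.sum_cons, Nat.cast_add] at hsum
          omega
    · obtain ⟨A', rfl⟩ := Multiset.exists_cons_of_mem hx
      have hx' := hA x hx
      obtain ⟨T, hT, hT'⟩ := ih (A'.card + B.card) (by rw [← hn, Multiset.card_cons]; omega) A' B
        (0 < s) (s + x) rfl (fun h => by omega) (by omega)
        (fun y hy => hA y (Multiset.mem_cons_of_mem hy)) hB hBB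
        (by rw [Multiset.sum_cons, Nat.cast_add] at hsum; omega)
      refine ⟨x :: T, ?_, up x hx'.1 hs, by omega, hT'⟩
      rw [← Multiset.cons_coe, hT]
      simp only [Multiset.map_cons, Multiset.cons_add]
      exact Multiset.cons_swap _ _ _
  · have hpf : ¬ p := fun h => absurd (hp h) (not_le.2 hs)
    -- The entry `b` is still to be used and exceeds the final weight `o`. Hence the downward steps
    -- still to come add up to more than `s`, and `B` is not empty.
    have hBs : s < B.sum := by omega
    obtain ⟨u, hu⟩ : ∃ u, u ∈ B := by
      rcases Multiset.empty_or_exists_mem B with rfl | h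
      · simp only [Multiset.sum_zero, Nat.cast_zero] at hBs
        omega
      · exact h
    obtain ⟨B', rfl⟩ := Multiset.exists_cons_of_mem hu
    have hu' := hB u hu
    have hBB' : ∀ x y, {x, y} ≤ B' → M < x + y := fun x y h =>
      hBB x y (h.trans (Multiset.le_cons_self _ _))
    rw [Multiset.sum_cons, Nat.cast_add] at hBs hsum
    -- If `u` does not suffice to leave the positive range, a second entry does, as two entries
    -- exceed `M ≥ s`. This exhausts the single unbent tail allowed on the piece.
    rcases le_or_gt s u with hsu | hsu
    · obtain ⟨T, hT, hT'⟩ := ih (A.card + B'.card) (by rw [← hn, Multiset.card_cons]; omega) A B'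
        (0 < s) (s + -(u : ℤ)) rfl (fun h => by omega) (by omega) hA
        (fun y hy => hB y (Multiset.mem_cons_of_mem hy)) hBB' (by omega)
      refine ⟨-(u : ℤ) :: T, ?_, down u s hu' hs, fun h => hpf h.1, hT'⟩
      rw [← Multiset.cons_coe, hT]
      simp only [Multiset.map_cons, Multiset.add_cons]
    · obtain ⟨w, hw⟩ : ∃ w, w ∈ B' := by
        rcases Multiset.empty_or_exists_mem B' with rfl | h
        · simp only [Multiset.sum_zero, Nat.cast_zero] at hBs
          omega
        · exact h
      obtain ⟨B'', rfl⟩ := Multiset.exists_cons_of_mem hw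
      have huw := hBB u w (Multiset.cons_le_cons _ (Multiset.cons_le_cons _ (Multiset.zero_le _)))
      have hw' := hB w (Multiset.mem_cons_of_mem hw)
      rw [Multiset.sum_cons, Nat.cast_add] at hsum
      obtain ⟨T, hT, hT'⟩ := ih (A.card + B''.card) (by simp only [← hn, Multiset.card_cons]; omega)
        A B'' (0 < s + -(u : ℤ)) (s + -(u : ℤ) + -(w : ℤ)) rfl (fun h => by omega) (by omega) hA
        (fun y hy => hB y (Multiset.mem_cons_of_mem (Multiset.mem_cons_of_mem hy)))
        (fun x y h => hBB' x y (h.trans (Multiset.le_cons_self _ _))) (by omega)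
      refine ⟨-(u : ℤ) :: -(w : ℤ) :: T, ?_, down u s hu' hs, fun h => hpf h.1,
        down w _ hw' (by omega), by omega, hT'⟩
      rw [← Multiset.cons_coe, ← Multiset.cons_coe, hT]
      simp only [Multiset.map_cons, Multiset.add_cons]

end Walk

/-! ### The tail decomposition of a partition -/

theorem count_pairedOddParts (p : Multiset ℕ) (a : ℕ) :
    (pairedOddParts p).count a = if Odd a then p.count a / 2 else 0 := by
  classical
  unfold pairedOddParts
  rw [Multiset.count_sum']
  simp only [Multiset.count_replicate]
  rw [Finset.sum_ite_eq']
  simp only [Finset.mem_filter, Multiset.mem_toFinset]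
  by_cases ha : Odd a
  · by_cases hm : a ∈ p
    · simp [ha, hm]
    · simp [ha, hm]
  · simp [ha]

/-- The tail decomposition. -/
theorem tail_decomposition (p : Multiset ℕ) :
    evenParts p + singleOddParts p + (pairedOddParts p + pairedOddParts p) = p := by
  ext a
  simp only [Multiset.count_add, count_pairedOddParts]
  unfold evenParts singleOddParts
  rw [Multiset.count_filter, Multiset.count_filter, Multiset.count_dedup]
  rcases Nat.even_or_odd a with ha | ha
  · simp [ha, Nat.not_odd_iff_even.2 ha]
  · simp only [ha, Nat.not_even_iff_odd.2 ha, if_true, if_false, true_and, zero_add]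
    by_cases hc : Odd (p.count a)
    · have hm : a ∈ p := Multiset.count_pos.1 hc.pos
      simp only [hc, hm, if_true]
      obtain ⟨c, hc⟩ := hc
      omega
    · simp only [hc, if_false, zero_add]
      obtain ⟨c, hc⟩ := Nat.not_odd_iff_even.1 hc
      omega


/-! ### The walk of the construction -/

namespace Walk

theorem sum_map_singleton_of {P : Multiset ℕ} {f : ℕ → Multiset ℕ} (h : ∀ a ∈ P, f a = {a}) :
    (P.map f).sum = P := by
  rw [Multiset.map_congr rfl h, Multiset.sum_map_singleton]

theorem sum_map_pair_of {P : Multiset ℕ} {f : ℕ → Multiset ℕ} (h : ∀ a ∈ P, f a = {a, a}) :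
    (P.map f).sum = P + P := by
  have h' : ∀ a ∈ P, f a = {a} + {a} := h
  rw [Multiset.map_congr rfl h', Multiset.sum_map_add, Multiset.sum_map_singleton]

theorem sum_map_zero_of {M : Type*} [AddCommMonoid M] {P : Multiset ℕ} {f : ℕ → M}
    (h : ∀ a ∈ P, f a = 0) : (P.map f).sum = 0 := by
  rw [Multiset.map_congr rfl h, Multiset.map_const', Multiset.sum_replicate, nsmul_zero]

/-- `N` pairs of tails of weight two ending in forks, an out-tail and an in-tail each. -/
def pairs (N : ℕ) : List (ℤ × ℕ) := (List.replicate N [(-2, 1), (2, 1)]).flatten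

theorem pairs_split {N t : ℕ} (ht : t < N) :
    pairs N = pairs t ++ (-2, 1) :: (2, 1) :: pairs (N - t - 1) := by
  unfold pairs
  obtain ⟨q, rfl⟩ := Nat.exists_eq_add_of_lt ht
  have h1 : t + q + 1 - t - 1 = q := by omega
  rw [h1, add_assoc, List.replicate_add, List.flatten_append, List.replicate_succ,
    List.flatten_cons]
  rfl

theorem length_pairs (N : ℕ) : (pairs N).length = 2 * N := by
  simp [pairs, mul_comm]

theorem sum_pairs {M : Type*} [AddCommMonoid M] (f : ℤ × ℕ → M) (N : ℕ) :
    ((pairs N).map f).sum = N • (f (-2, 1) + f (2, 1)) := by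
  induction N with
  | zero => simp [pairs]
  | succ N ih =>
    have h1 : pairs (N + 1) = (-2, 1) :: (2, 1) :: pairs N := by
      simpa [pairs] using pairs_split (Nat.succ_pos N)
    rw [h1, List.map_cons, List.map_cons, List.sum_cons, List.sum_cons, ih, succ_nsmul',
      add_assoc]

/-- Tails of given even weights and tails of weight `2 a` with forks, in both directions. -/
noncomputable def remaining (E F P R : Multiset ℕ) : List (ℤ × ℕ) :=
  (E.map (fun a : ℕ => ((a : ℤ), 0)) + F.map (fun a : ℕ => (-(a : ℤ), 0)) +
    P.map (fun a : ℕ => (2 * (a : ℤ), 1)) + R.map (fun a : ℕ => (-(2 * (a : ℤ)), 1))).toList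

theorem sum_remaining {M : Type*} [AddCommMonoid M] (f : ℤ × ℕ → M) (E F P R : Multiset ℕ) :
    ((remaining E F P R).map f).sum = (E.map fun a : ℕ => f ((a : ℤ), 0)).sum +
      (F.map fun a : ℕ => f (-(a : ℤ), 0)).sum + (P.map fun a : ℕ => f (2 * (a : ℤ), 1)).sum +
      (R.map fun a : ℕ => f (-(2 * (a : ℤ)), 1)).sum := by
  rw [← Multiset.sum_coe, ← Multiset.map_coe, remaining, Multiset.coe_toList]
  simp only [Multiset.map_add, Multiset.sum_add, Multiset.map_map, Function.comp_def]

/-- The part of the walk after the first `k` vertices. -/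
noncomputable def secondPart (g h N : ℕ) (E F P R : Multiset ℕ) : List (ℤ × ℕ) :=
  ((2, 2 * g + 1) :: List.replicate h (-2, 1)) ++
    (pairs N ++ (List.replicate (h - 1) (2, 1) ++ remaining E F P R))

theorem sum_secondPart {M : Type*} [AddCommMonoid M] (f : ℤ × ℕ → M) (g h N : ℕ)
    (E F P R : Multiset ℕ) :
    ((secondPart g h N E F P R).map f).sum = f (2, 2 * g + 1) + h • f (-2, 1) +
      (N • (f (-2, 1) + f (2, 1)) + ((h - 1) • f (2, 1) + ((remaining E F P R).map f).sum)) := by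
  simp only [secondPart, List.map_append, List.sum_append, List.map_cons, List.sum_cons,
    List.map_replicate, List.sum_replicate, sum_pairs]

theorem mem_secondPart {g h N : ℕ} {E F P R : Multiset ℕ} {x : ℤ × ℕ}
    (hx : x ∈ secondPart g h N E F P R) : (x.1 = 2 ∨ x.1 = -2) ∨
      (x.2 = 0 ∧ ∃ a ∈ E + F, x.1.natAbs = a) ∨ ∃ a ∈ P + R, x.1.natAbs = 2 * a := by
  simp only [secondPart, pairs, remaining, List.mem_append, List.mem_cons, List.mem_replicate,
    List.mem_flatten, Multiset.mem_toList, Multiset.mem_add, Multiset.mem_map] at hx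
  rcases hx with (rfl | ⟨-, rfl⟩) | ⟨l, ⟨-, rfl⟩, hx⟩ | ⟨-, rfl⟩ |
    ((⟨a, ha, rfl⟩ | ⟨a, ha, rfl⟩) | ⟨a, ha, rfl⟩) | ⟨a, ha, rfl⟩
  · exact Or.inl (Or.inl rfl)
  · exact Or.inl (Or.inr rfl)
  · simp only [List.mem_cons, List.not_mem_nil, or_false] at hx
    rcases hx with rfl | rfl
    · exact Or.inl (Or.inr rfl)
    · exact Or.inl (Or.inl rfl)
  · exact Or.inl (Or.inl rfl)
  · exact Or.inr (Or.inl ⟨rfl, a, by simp [ha], by simp⟩)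
  · exact Or.inr (Or.inl ⟨rfl, a, by simp [ha], by simp⟩)
  · exact Or.inr (Or.inr ⟨a, by simp [ha], by dsimp only; omega⟩)
  · exact Or.inr (Or.inr ⟨a, by simp [ha], by dsimp only; omega⟩)

section Construction

variable {g k d m o o' c : ℕ} {lam mu : Nat.Partition d} {A B E F P R : Multiset ℕ} {T : List ℤ}
  (hlam : lam.parts = {o} + (A + E + (P + P))) (hmu : mu.parts = {o'} + (B + F + (R + R)))
include hlam hmu

/-- All added parts equal to 1 come from forks on tails of weight two, whose double edges have the
odd weight 1. The first of these tails has `2 * g + 1` vertices off the string, that is `g` cycles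
and a fork, so it carries the whole genus. -/
theorem fits_secondPart (ho : Odd o) (ho' : Odd o')
    (hAE : ∀ a ∈ A + E, Even a) (hBF : ∀ a ∈ B + F, Even a) (hP : ∀ a ∈ P + R, Odd a)
    (hT : (T : Multiset ℤ) = A.map (fun x : ℕ => (x : ℤ)) + B.map (fun x : ℕ => -(x : ℤ)))
    (hT' : Descends False o T) (hk : T.length = k) (hk1 : 1 ≤ k) {h N : ℕ} (hh : 1 ≤ h)
    (hm : m = h + N) :
    (ofList o (T.map (fun x => (x, 0)) ++ secondPart g h N E F P R)).Fits g k
      (addOnes lam m) (addOnes mu m) := by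
  have sumL : ∀ {M : Type} [AddCommMonoid M] (f : ℤ × ℕ → M),
      ((T.map (fun x => (x, 0)) ++ secondPart g h N E F P R).map f).sum =
        (A.map fun a : ℕ => f ((a : ℤ), 0)).sum + (B.map fun a : ℕ => f (-(a : ℤ), 0)).sum +
        (f (2, 2 * g + 1) + h • f (-2, 1) + (N • (f (-2, 1) + f (2, 1)) + ((h - 1) • f (2, 1) +
          ((E.map fun a : ℕ => f ((a : ℤ), 0)).sum + (F.map fun a : ℕ => f (-(a : ℤ), 0)).sum +
          (P.map fun a : ℕ => f (2 * (a : ℤ), 1)).sum +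
          (R.map fun a : ℕ => f (-(2 * (a : ℤ)), 1)).sum)))) := by
    intro M _ f
    rw [List.map_append, List.sum_append, sum_secondPart, sum_remaining, List.map_map,
      ← Multiset.sum_coe, ← Multiset.map_coe, hT, Multiset.map_add, Multiset.sum_add,
      Multiset.map_map, Multiset.map_map]
    rfl
  have posl : ∀ a ∈ A + E + (P + P), 0 < a := fun a ha => lam.parts_pos (by
    rw [hlam]; exact Multiset.mem_add.2 (Or.inr ha))
  have posm : ∀ a ∈ B + F + (R + R), 0 < a := fun a ha => mu.parts_pos (by
    rw [hmu]; exact Multiset.mem_add.2 (Or.inr ha))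
  simp only [Multiset.mem_add] at posl posm hAE hBF hP
  -- Over `-∞` the pairs of ones come from the tail with the genus, from the `N` in-tails of the
  -- pairs and from `h - 1` further in-tails. Over `+∞` they come from `h` out-tails and the `N`
  -- out-tails of the pairs. With `h + N = m` both give `2 * m` ones.
  have ones : Multiset.replicate (2 * m) 1 =
      ({1, 1} : Multiset ℕ) + N • ({1, 1} : Multiset ℕ) + (h - 1) • ({1, 1} : Multiset ℕ) := by
    have h1 : ({1, 1} : Multiset ℕ) = 2 • {1} := rfl
    rw [h1, ← mul_nsmul, ← mul_nsmul, ← add_nsmul, ← add_nsmul, Multiset.nsmul_singleton]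
    congr 1
    omega
  have ones' : Multiset.replicate (2 * m) 1 =
      h • ({1, 1} : Multiset ℕ) + N • ({1, 1} : Multiset ℕ) := by
    have h1 : ({1, 1} : Multiset ℕ) = 2 • {1} := rfl
    rw [h1, ← mul_nsmul, ← mul_nsmul, ← add_nsmul, Multiset.nsmul_singleton]
    congr 1
    omega
  have te : ∀ x : ℤ, tailEnds x 0 = {x.natAbs} := fun x => by simp [tailEnds]
  have te' : ∀ (x : ℤ) (l : ℕ), tailEnds x (2 * l + 1) = {x.natAbs / 2, x.natAbs / 2} := fun x l => by
    simp [tailEnds, Nat.not_even_iff_odd.2 (odd_two_mul_add_one l)]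
  have te1 : ∀ x : ℤ, tailEnds x 1 = {x.natAbs / 2, x.natAbs / 2} := fun x => te' x 0
  have half : ∀ a : ℕ, (2 * (a : ℤ)).natAbs / 2 = a := fun a => by omega
  have half' : ∀ a : ℕ, (-(2 * (a : ℤ))).natAbs / 2 = a := fun a => by omega
  refine fits_ofList rfl ho ho' ?_ hT' hk hk1 ?_ ?_ ?_
  · intro x hx
    rw [List.mem_append] at hx
    rcases hx with hx | hx
    · obtain ⟨y, hy, rfl⟩ := List.mem_map.1 hx
      rw [← Multiset.mem_coe, hT, Multiset.mem_add, Multiset.mem_map, Multiset.mem_map] at hy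
      rcases hy with ⟨a, ha, rfl⟩ | ⟨a, ha, rfl⟩
      · have h1 := hAE a (Or.inl ha)
        have h2 := posl a (Or.inl (Or.inl ha))
        exact ⟨(Int.even_coe_nat a).2 h1, by dsimp only; omega, fun h => absurd h (lt_irrefl _)⟩
      · have h1 := hBF a (Or.inl ha)
        have h2 := posm a (Or.inl (Or.inl ha))
        exact ⟨((Int.even_coe_nat a).2 h1).neg, by dsimp only; omega,
          fun h => absurd h (lt_irrefl _)⟩
    · rcases mem_secondPart hx with hx | ⟨h0, a, ha, hx⟩ | ⟨a, ha, hx⟩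
      · have h1 : x.1.natAbs = 2 := by omega
        refine ⟨?_, by omega, fun _ => by rw [h1]; decide⟩
        rw [← Int.natAbs_even, h1]
        decide
      · have h1 : Even a ∧ 0 < a := by
          rcases Multiset.mem_add.1 ha with ha | ha
          · exact ⟨hAE a (Or.inr ha), posl a (Or.inl (Or.inr ha))⟩
          · exact ⟨hBF a (Or.inr ha), posm a (Or.inl (Or.inr ha))⟩
        refine ⟨?_, by omega, fun h => by omega⟩
        rw [← Int.natAbs_even, hx]
        exact h1.1
      · have h1 := hP a (Multiset.mem_add.1 ha)
        have h2 := h1.pos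
        refine ⟨?_, by omega, fun _ => ?_⟩
        · rw [← Int.natAbs_even, hx]
          exact even_two_mul a
        · rw [hx, Nat.mul_div_cancel_left _ two_pos]
          exact h1
  · rw [sumL inEnds, sum_map_singleton_of (P := A), sum_map_singleton_of (P := E),
      sum_map_zero_of (P := B), sum_map_zero_of (P := F), sum_map_zero_of (P := R),
      sum_map_pair_of (P := P)]
    · change _ = lam.parts + Multiset.replicate (2 * m) 1
      rw [hlam, ones]
      have h1 : inEnds (2, 2 * g + 1) = {1, 1} := by simp [inEnds, te']
      have h2 : inEnds (2, 1) = {1, 1} := by simp [inEnds, te1]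
      have h3 : inEnds (-2, 1) = 0 := by simp [inEnds]
      rw [h1, h2, h3]
      simp only [nsmul_zero, add_zero, zero_add]
      abel
    · intro a ha
      have := posl a (Or.inr (Or.inl ha))
      simp [inEnds, te1, half, this]
    · intro a ha
      exact if_neg (by dsimp only; omega)
    · intro a ha
      exact if_neg (by dsimp only; omega)
    · intro a ha
      exact if_neg (by dsimp only; omega)
    · intro a ha
      have := posl a (Or.inl (Or.inr ha))
      simp [inEnds, te, this]
    · intro a ha
      have := posl a (Or.inl (Or.inl ha))
      simp [inEnds, te, this]
  · rw [sumL outEnds, sum_map_singleton_of (P := B), sum_map_singleton_of (P := F),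
      sum_map_zero_of (P := A), sum_map_zero_of (P := E), sum_map_zero_of (P := P),
      sum_map_pair_of (P := R)]
    · change _ = mu.parts + Multiset.replicate (2 * m) 1
      rw [hmu, ones']
      have h1 : outEnds (2, 2 * g + 1) = 0 := by simp [outEnds]
      have h2 : outEnds (2, 1) = 0 := by simp [outEnds]
      have h3 : outEnds (-2, 1) = {1, 1} := by simp [outEnds, te1]
      rw [h1, h2, h3]
      simp only [nsmul_zero, add_zero, zero_add]
      abel
    · intro a _
      have h1 : ¬ 0 < -(2 * (a : ℤ)) := by omega
      rw [outEnds, if_neg h1, te1, half']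
    · intro a ha
      have := posl a (Or.inr (Or.inl ha))
      exact if_pos (by dsimp only; omega)
    · intro a ha
      have := posl a (Or.inl (Or.inr ha))
      exact if_pos (by dsimp only; omega)
    · intro a ha
      have := posl a (Or.inl (Or.inl ha))
      exact if_pos (by dsimp only; omega)
    · intro a _
      have h1 : ¬ 0 < -(a : ℤ) := by omega
      rw [outEnds, if_neg h1, te, Int.natAbs_neg, Int.natAbs_natCast]
    · intro a _
      have h1 : ¬ 0 < -(a : ℤ) := by omega
      rw [outEnds, if_neg h1, te, Int.natAbs_neg, Int.natAbs_natCast]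
  · rw [sumL fun x => x.2 / 2]
    simp
    omega

/-- The number of choices for the walk with `N` pairs of forks. -/
theorem exists_family (ho : Odd o) (ho' : Odd o')
    (hAE : ∀ a ∈ A + E, Even a) (hBF : ∀ a ∈ B + F, Even a) (hP : ∀ a ∈ P + R, Odd a)
    (hT : (T : Multiset ℤ) = A.map (fun x : ℕ => (x : ℤ)) + B.map (fun x : ℕ => -(x : ℤ)))
    (hT' : Descends False o T) (hk : T.length = k) (hk1 : 1 ≤ k) (hc : Odd c)
    (hTc : (o : ℤ) + T.sum = c) (hm : 1 ≤ m) :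
    ∃ f : (Fin 4 → Equiv.Perm (Fin (m - (c + 1) / 2))) →
        CoverClass (numBranch g (addOnes lam m) (addOnes mu m)), Function.Injective f ∧
      ∀ p, f p ∈ mixedZigzagCovers g k (addOnes lam m) (addOnes mu m) ∧
        ∀ ε, (2 * m).factorial ≤ mixedCount g k (addOnes lam m) (addOnes mu m) (f p).cover ε := by
  obtain ⟨e, he⟩ := hc
  -- After the first `k` vertices and the tail with the genus the weight is `c + 2`, and `(c + 1) /
  -- 2` out-tails of weight two reduce it to 1. Only the remaining `N` of the `m` out-tails take
  -- part in pairs.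
  set N := m - (c + 1) / 2 with hN
  -- The minimum covers small `m`: then `N = 0`, and the weight before the empty row of pairs does
  -- not matter.
  set h := min m ((c + 1) / 2) with hh
  have W := fits_secondPart (g := g) hlam hmu ho ho' hAE hBF hP hT hT' hk hk1 (h := h) (N := N)
    (m := m) (by omega) (by omega)
  let X := T.map (fun x => ((x : ℤ), 0)) ++ ((2, 2 * g + 1) :: List.replicate h (-2, 1))
  let Y := List.replicate (h - 1) ((2 : ℤ), 1) ++ remaining E F P R
  have hL : T.map (fun x => (x, 0)) ++ secondPart g h N E F P R = X ++ (pairs N ++ Y) :=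
    (List.append_assoc _ _ _).symm
  have hX : X.length = k + 1 + h := by
    simp [X, hk]
    omega
  have hXs : N ≠ 0 → (o : ℤ) + (X.map Prod.fst).sum = 1 := by
    intro h0
    have h1 : ((T.map (fun x => ((x : ℤ), 0))).map Prod.fst).sum = T.sum := by
      rw [List.map_map]
      congr 1
      exact List.map_id' _
    have h2 : ((h : ℕ) : ℤ) = e + 1 := by omega
    simp only [X, List.map_append, List.sum_append, h1, List.map_cons, List.sum_cons,
      List.map_replicate, List.sum_replicate, nsmul_eq_mul, h2]
    rw [← add_assoc, hTc, he]
    push_cast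
    ring
  have hsplit : ∀ t < N, T.map (fun x => (x, 0)) ++ secondPart g h N E F P R =
      (X ++ pairs t) ++ (-2, 1) :: (((2, 1) :: pairs (N - t - 1)) ++ Y) := by
    intro t ht
    rw [hL, pairs_split ht]
    simp
  have hsplit' : ∀ t < N, T.map (fun x => (x, 0)) ++ secondPart g h N E F P R =
      (X ++ pairs t ++ [(-2, 1)]) ++ (2, 1) :: (pairs (N - t - 1) ++ Y) := by
    intro t ht
    rw [hL, pairs_split ht]
    simp
  have hlen : ∀ t, (X ++ pairs t).length = k + 1 + h + 2 * t := by
    intro t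
    rw [List.length_append, hX, length_pairs]
  have hlen' : ∀ t, (X ++ pairs t ++ [(-2, 1)]).length = k + 1 + h + 2 * t + 1 := by
    intro t
    rw [List.length_append, hlen]
    rfl
  have sumX : ∀ t, N ≠ 0 → (o : ℤ) + ((X ++ pairs t).map Prod.fst).sum = 1 := by
    intro t h0
    rw [List.map_append, List.sum_append, sum_pairs, ← add_assoc, hXs h0]
    simp
  have hat : ∀ t < N, _ := fun t ht => ofList_at o (X ++ pairs t)
    (((2, 1) :: pairs (N - t - 1)) ++ Y) (-2, 1)
  have hat' : ∀ t < N, _ := fun t ht => ofList_at o (X ++ pairs t ++ [(-2, 1)])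
    (pairs (N - t - 1) ++ Y) (2, 1)
  have key : ∀ t < N, _ := fun t ht => And.intro (hat t ht) (hat' t ht)
  simp only [hlen, hlen'] at key
  set L := T.map (fun x => (x, 0)) ++ secondPart g h N E F P R with hLdef
  have key' : ∀ t < N, 0 < (ofList o L).s (k + 1 + h + 2 * t) ∧
      ¬ 0 < (ofList o L).s (k + 1 + h + 2 * t + 1) ∧
      ¬ 0 < (ofList o L).δ (k + 1 + h + 2 * t + 1) ∧ 0 < (ofList o L).δ (k + 1 + h + 2 * t + 2) ∧
      1 ≤ (ofList o L).len (k + 1 + h + 2 * t + 1) ∧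
      1 ≤ (ofList o L).len (k + 1 + h + 2 * t + 2) := by
    intro t ht
    obtain ⟨⟨a1, a2, a3, a4⟩, -, -, b3, b4⟩ := key t ht
    rw [← hsplit t ht] at a1 a2 a3 a4
    rw [← hsplit' t ht] at b3 b4
    have h0 : N ≠ 0 := by omega
    rw [sumX t h0] at a1 a2
    exact ⟨by omega, by omega, by omega, by rw [b3]; decide, by omega, by rw [b4]⟩
  have hn : k + 1 + h + 2 * N ≤ L.length := by
    rw [hL, List.length_append, hX, List.length_append, length_pairs]
    omega
  obtain ⟨f, hf, hf'⟩ := W.exists_family (b := k + 1 + h) (N := N) (by omega) hn (by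
      intro i h1 h2
      obtain ⟨t, ht⟩ := Nat.even_or_odd' (i - (k + 1 + h) - 1)
      obtain ⟨-, -, -, -, a, b⟩ := key' t (by omega)
      rcases ht with ht | ht
      · rwa [show i = k + 1 + h + 2 * t + 1 by omega]
      · rwa [show i = k + 1 + h + 2 * t + 2 by omega])
    (fun t ht => ⟨(key' t ht).1, (key' t ht).2.1⟩)
    (fun t ht => ⟨(key' t ht).2.2.1, (key' t ht).2.2.2.1⟩)
  refine ⟨f, hf, fun p => ⟨(hf' p).1, fun ε => le_trans (Nat.factorial_le ?_) ((hf' p).2 ε)⟩⟩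
  -- The in-ends of the tails are all parts of the enlarged `λ` except `o`, so at least `2 * m` of
  -- them are equal to 1.
  have hleft := W.left
  have h0 : ((ofList o L).s 0).natAbs = o := by simp [ofList]
  have h1 : (addOnes lam m).parts = {o} + (A + E + (P + P) + Multiset.replicate (2 * m) 1) := by
    rw [← add_assoc, ← hlam]
    rfl
  rw [h0, h1] at hleft
  rw [add_left_cancel hleft, Multiset.count_add, Multiset.count_replicate_self]
  exact Nat.le_add_left _ _

end Construction

end Walk

/-! ### Assembly -/

theorem sup_mem {s : Multiset ℕ} (h : 0 < s.sup) : s.sup ∈ s := by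
  induction s using Multiset.induction with
  | empty => exact absurd h (lt_irrefl _)
  | cons a s ih =>
    rw [Multiset.sup_cons] at h ⊢
    rcases le_total a s.sup with h1 | h1
    · rw [sup_eq_right.2 h1] at h ⊢
      exact Multiset.mem_cons_of_mem (ih h)
    · rw [sup_eq_left.2 h1]
      exact Multiset.mem_cons_self _ _

theorem odd_of_mem_pairedOddParts {p : Multiset ℕ} {a : ℕ} (h : a ∈ pairedOddParts p) : Odd a := by
  by_contra hn
  have h1 := Multiset.count_pos.2 h
  rw [count_pairedOddParts, if_neg hn] at h1
  exact absurd h1 (lt_irrefl _)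

theorem odd_of_singleOddParts_eq {p : Multiset ℕ} {a : ℕ} (h : singleOddParts p = {a}) : Odd a := by
  have h1 : a ∈ singleOddParts p := by simp [h]
  exact (Multiset.mem_filter.1 h1).2.1

theorem parts_eq_of_singleOddParts {p q : Multiset ℕ} {o : ℕ} (h : singleOddParts p = {o})
    (hq : q ≤ evenParts p) : p = {o} + (q + (evenParts p - q) + (pairedOddParts p + pairedOddParts p)) := by
  conv_lhs => rw [← tail_decomposition p, h]
  rw [add_tsub_cancel_of_le hq]
  abel

end MixedZigzag

theorem mainTheorem5 (g k d d' : ℕ) (lam mu : Nat.Partition d) (lam' mu' : Nat.Partition d')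
    (hlam : (MixedZigzag.singleOddParts lam.parts).card = 1)
    (hmu : (MixedZigzag.singleOddParts mu.parts).card = 1)
    (hd : d' ≤ d)
    (hlam'_odd : MixedZigzag.singleOddParts lam'.parts = MixedZigzag.singleOddParts lam.parts)
    (hlam'_even : lam'.parts - MixedZigzag.singleOddParts lam'.parts
      ≤ MixedZigzag.evenParts lam.parts)
    (hmu'_even : mu'.parts - MixedZigzag.singleOddParts mu'.parts
      ≤ MixedZigzag.evenParts mu.parts)
    (hlam'_pairs : MixedZigzag.pairedOddParts lam'.parts = 0)
    (hmu'_pairs : MixedZigzag.pairedOddParts mu'.parts = 0)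
    (hlam' : (MixedZigzag.singleOddParts lam'.parts).card = 1)
    (hmu' : (MixedZigzag.singleOddParts mu'.parts).card = 1)
    (hk : lam'.parts.card + mu'.parts.card = k + 2)
    (hpairs : ∀ a b : ℕ, ({a, b} : Multiset ℕ) ≤ MixedZigzag.evenParts mu'.parts →
      ∀ o ∈ MixedZigzag.singleOddParts lam.parts,
        max o (MixedZigzag.evenParts lam'.parts).sup < a + b)
    (hmax : ∀ o ∈ MixedZigzag.singleOddParts mu'.parts,
      o < (MixedZigzag.evenParts lam'.parts).sup) :
    (∀ m : ℕ, 1 ≤ m →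
      (MixedZigzag.mixedZigzagCovers g k (MixedZigzag.addOnes lam m)
        (MixedZigzag.addOnes mu m)).Nonempty) ∧
    ∃ m₀ : ℕ, ∀ m : ℕ, m₀ ≤ m →
      Nat.factorial (m - m₀) ^ 4 * Nat.factorial (2 * m) ≤
        MixedZigzag.mixedZigzagNumber g k (MixedZigzag.addOnes lam m)
          (MixedZigzag.addOnes mu m) := by
  obtain ⟨o, ho⟩ := Multiset.card_eq_one.1 hlam
  obtain ⟨o', ho'⟩ := Multiset.card_eq_one.1 hmu
  obtain ⟨c, hc⟩ := Multiset.card_eq_one.1 hmu'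
  rw [ho] at hlam'_odd hpairs
  rw [hc] at hmax hmu'_even
  rw [hlam'_odd] at hlam'_even
  have dl := MixedZigzag.tail_decomposition lam'.parts
  have dm := MixedZigzag.tail_decomposition mu'.parts
  rw [hlam'_pairs, hlam'_odd, add_zero, add_zero] at dl
  rw [hmu'_pairs, hc, add_zero, add_zero] at dm
  rw [← dl, add_tsub_cancel_right] at hlam'_even
  rw [← dm, add_tsub_cancel_right] at hmu'_even
  set A := MixedZigzag.evenParts lam'.parts with hA
  set B := MixedZigzag.evenParts mu'.parts with hB
  have hcb := hmax c (Multiset.mem_singleton_self c)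
  have hbA : A.sup ∈ A := MixedZigzag.sup_mem (by omega)
  have hAcons := Multiset.cons_erase hbA
  have oddc := MixedZigzag.odd_of_singleOddParts_eq hc
  have sl := congrArg Multiset.sum dl
  have sm := congrArg Multiset.sum dm
  rw [lam'.parts_sum, Multiset.sum_add, Multiset.sum_singleton] at sl
  rw [mu'.parts_sum, Multiset.sum_add, Multiset.sum_singleton] at sm
  have sA := congrArg Multiset.sum hAcons
  rw [Multiset.sum_cons] at sA
  have posA : ∀ x ∈ A, 0 < x := fun x hx => lam'.parts_pos (Multiset.mem_of_mem_filter hx)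
  have posB : ∀ x ∈ B, 0 < x := fun x hx => mu'.parts_pos (Multiset.mem_of_mem_filter hx)
  -- The largest even part of `λ'` is removed from `A` and reserved for the last upward step. It
  -- exceeds the target weight `c`, the odd part of `μ'`. The total change of weight is correct
  -- because `λ'` and `μ'` have equal sums.
  obtain ⟨T, hT, hT'⟩ := MixedZigzag.Walk.exists_descends (max o A.sup) A.sup c (le_max_right _ _)
    oddc.pos hcb _ (A.erase A.sup) B False o rfl False.elim (by exact_mod_cast le_max_left _ _)
    (fun x hx => ⟨posA x (Multiset.mem_of_mem_erase hx),
      Multiset.le_sup (Multiset.mem_of_mem_erase hx)⟩) posB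
    (fun x y h => hpairs x y h o (Multiset.mem_singleton_self o)) (by omega)
  rw [hAcons] at hT
  have cl := congrArg Multiset.card dl
  have cm := congrArg Multiset.card dm
  have cT := congrArg Multiset.card hT
  have cA := congrArg Multiset.card hAcons
  simp only [Multiset.card_add, Multiset.card_singleton, Multiset.coe_card, Multiset.card_map,
    Multiset.card_cons] at cl cm cT cA
  have sT := congrArg Multiset.sum hT
  rw [Multiset.sum_coe, Multiset.sum_add, Multiset.sum_map_neg, ← Nat.cast_multiset_sum,
    ← Nat.cast_multiset_sum] at sT
  have main := fun (m : ℕ) (hm : 1 ≤ m) => MixedZigzag.Walk.exists_family (g := g) (k := k) (m := m)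
    (MixedZigzag.parts_eq_of_singleOddParts ho hlam'_even)
    (MixedZigzag.parts_eq_of_singleOddParts ho' hmu'_even)
    (MixedZigzag.odd_of_singleOddParts_eq ho) (MixedZigzag.odd_of_singleOddParts_eq ho')
    (by
      rw [add_tsub_cancel_of_le hlam'_even]
      exact fun a ha => Multiset.of_mem_filter ha)
    (by
      rw [add_tsub_cancel_of_le hmu'_even]
      exact fun a ha => Multiset.of_mem_filter ha)
    (fun a ha => (Multiset.mem_add.1 ha).elim MixedZigzag.odd_of_mem_pairedOddParts
      MixedZigzag.odd_of_mem_pairedOddParts)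
    hT hT' (by omega) (by omega) oddc (by omega) hm
  constructor
  · intro m hm
    obtain ⟨f, -, hf⟩ := main m hm
    exact ⟨f 1, (hf 1).1⟩
  -- This many out-tails with forks are spent on lowering the string to weight one. As `c` is
  -- positive, the bound is at least 1, so `m ≥ 1` as well.
  · refine ⟨(c + 1) / 2, fun m hm => ?_⟩
    have := oddc.pos
    obtain ⟨f, hf, hf'⟩ := main m (by omega)
    have h1 := MixedZigzag.card_mul_le_mixedZigzagNumber hf _ hf'
    simpa [Fintype.card_perm] using h1
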